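/- Let $\Omega\subset\mathbb R^2$ be a nonempty bounded open convex set with $C^5$ boundary, $n_x$ its outer unit normal at $x\in\partial\Omega$, $v^*=v-2(n_x\cdot v)n_x$, and $\hat v=v/\sqrt{1+|v|^2}$. Let $T>0$ and $\mu\in(0,1)$. Let $E:[0,T]\times\bar\Omega\to\mathbb R^2$ belong to $C^{0;1,\mu}_{t;x}([0,T]\times\bar\Omega)$, that is, $E$ is bounded and continuous, differentiable in $x$ up to the boundary, and $\sup_{t}\sup_{x\ne x'}|\nabla_xE(t,x)-\nabla_xE(t,x')|/|x-x'|^{\mu}<\infty$. Suppose $E(t,x)\cdot n_x=h(x)>0$ for all $t\in[0,T]$, $x\in\partial\Omega$, with $h$ independent of $t$. Let $f_0\ge 0$ on $\bar\Omega\times\mathbb R^2$ belong to $C^{1,\mu}_0(\bar\Omega\times\mathbb R^2)$, that is, $f_0$ has compact support in $\bar\Omega\times\mathbb R^2$, is bounded and differentiable up to the boundary, and $|\nabla f_0(x,v)-\nabla f_0(x',v')|\le C(|x-x'|^\mu+|v-v'|^\mu)$, where $\nabla=(\nabla_x,\nabla_v)$. Suppose also that (i) (compatibility) for all $x\in\partial\Omega$,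 $v\in\mathbb R^2$: $f_0(x,v)=f_0(x,v^*)$, and the function $\hat v\cdot\nabla_xf_0(x,v)+E(0,x)\cdot\nabla_vf_0(x,v)$ takes the same value at $(x,v)$ and at $(x,v^*)$; (ii) (flatness near the singular set) for some $\delta_0>0$, $f_0$ is constant on the set of points of $\bar\Omega\times\mathbb R^2$ at distance at most $\delta_0$ from $\Gamma=\{(x,v):x\in\partial\Omega,\ n_x\cdot v=0\}$. For $\lambda\in(0,1)$ let $C^{1;1,\lambda}_{t;(x,v)}$ be the space of functions $f$ on $[0,T]\times\bar\Omega\times\mathbb R^2$ such that $f$ and $\partial_tf$ exist and are bounded and continuous there, $f(t,\cdot,\cdot)$ is differentiable up to the boundary, and $|\nabla f(t,x,v)-\nabla f(t,x',v')|\le C(|x-x'|^\lambda+|v-v'|^\lambda)$ with $C$ independent of $t$. Then for some $\lambda\in(0,\mu)$ there is a function $f\in C^{1;1,\lambda}_{t;(x,v)}$ with $$\partial_tf+\hat v\cdot\nabla_xf+E\cdot\nabla_vf=0\quad (0<t\le T,\ x\in\Omega,\ v\in\mathbb R^2),$$ $$f(t,x,v)=f(t,x,v^*)\quad(0<t\le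 T,\ x\in\partial\Omega,\ v\in\mathbb R^2),\qquad f(0,x,v)=f_0(x,v)\quad(x\in\Omega,\ v\in\mathbb R^2).$$ This solution is unique: any solution of this problem in $C^{1;1,\lambda'}_{t;(x,v)}$ for some $\lambda'\in(0,\mu)$ equals $f$ on $[0,T]\times\bar\Omega\times\mathbb R^2$. Moreover $f\ge0$, and for every $t\in[0,T]$ the function $f(t,\cdot,\cdot)$ is integrable on $\Omega\times\mathbb R^2$ with $$\int_{\Omega\times\mathbb R^2} f(t,x,v)\,dx\,dv=\int_{\Omega\times\mathbb R^2} f_0(x,v)\,dx\,dv .$$ -/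

import Mathlib

open Set Filter Topology MeasureTheory
open scoped RealInnerProductSpace

/-- The Euclidean plane `ℝ²`. -/
abbrev Plane := EuclideanSpace ℝ (Fin 2)

namespace VlasovLinear

/-- On the open neighbourhood `U` of `x`, the set `Ω` is `{ψ < 0}` for a function `ψ` of
class `C⁵` whose gradient does not vanish at `x`. -/
structure IsLocalDefiningFunction (Ω : Set Plane) (x : Plane) (U : Set Plane)
    (ψ : Plane → ℝ) : Prop where
  isOpen : IsOpen U
  mem : x ∈ U
  contDiffOn : ContDiffOn ℝ 5 ψ U
  gradient_ne : gradient ψ x ≠ 0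
  inter_eq : Ω ∩ U = {y | y ∈ U ∧ ψ y < 0}

/-- A nonempty bounded convex planar domain with boundary of class `C⁵`. -/
structure IsC5ConvexDomain (Ω : Set Plane) : Prop where
  isOpen : IsOpen Ω
  nonempty : Ω.Nonempty
  isBounded : Bornology.IsBounded Ω
  convex : Convex ℝ Ω
  boundary : ∀ x ∈ frontier Ω, ∃ U ψ, IsLocalDefiningFunction Ω x U ψ

/-- `ν` is the outer unit normal of `Ω` at `x`: the normalized gradient of a local defining
function. -/
def IsOuterUnitNormal (Ω : Set Plane) (x ν : Plane) : Prop :=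
  ‖ν‖ = 1 ∧ ∃ (U : Set Plane) (ψ : Plane → ℝ) (c : ℝ),
    IsLocalDefiningFunction Ω x U ψ ∧ 0 < c ∧ gradient ψ x = c • ν

/-- The outer unit normal `n_x` at a boundary point `x` (existence and uniqueness are proved
below). -/
noncomputable def outerNormal (Ω : Set Plane) (x : Plane) : Plane :=
  Classical.epsilon (IsOuterUnitNormal Ω x)

theorem isOuterUnitNormal_outerNormal {Ω : Set Plane} (hΩ : IsC5ConvexDomain Ω) {x : Plane}
    (hx : x ∈ frontier Ω) : IsOuterUnitNormal Ω x (outerNormal Ω x) := by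
  apply Classical.epsilon_spec (p := IsOuterUnitNormal Ω x)
  obtain ⟨U, ψ, h⟩ := hΩ.boundary x hx
  have h0 : ‖gradient ψ x‖ ≠ 0 := norm_ne_zero_iff.2 h.gradient_ne
  refine ⟨‖gradient ψ x‖⁻¹ • gradient ψ x, ?_, U, ψ, ‖gradient ψ x‖, h, by positivity, ?_⟩
  · rw [norm_smul, norm_inv, norm_norm, inv_mul_cancel₀ h0]
  · rw [smul_smul, mul_inv_cancel₀ h0, one_smul]

theorem IsOuterUnitNormal.unique {Ω : Set Plane} (hΩ : IsOpen Ω) {x ν ν' : Plane}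
    (hx : x ∈ frontier Ω) (h : IsOuterUnitNormal Ω x ν) (h' : IsOuterUnitNormal Ω x ν') :
    ν = ν' := by
  obtain ⟨n1, U, ψ, c, hψ, hc, hg⟩ := h
  obtain ⟨n1', U', ψ', c', hψ', hc', hg'⟩ := h'
  have key : ∀ (V : Set Plane) (φ : Plane → ℝ), IsLocalDefiningFunction Ω x V φ → φ x = 0 := by
    intro V φ hφ
    have hcont : ContinuousAt φ x :=
      hφ.contDiffOn.continuousOn.continuousAt (hφ.isOpen.mem_nhds hφ.mem)
    apply le_antisymm
    · by_contra hpos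
      have hpos : 0 < φ x := not_le.1 hpos
      have hev : ∀ᶠ y in 𝓝 x, 0 < φ y ∧ y ∈ V :=
        (hcont.eventually (lt_mem_nhds hpos)).and (hφ.isOpen.mem_nhds hφ.mem)
      obtain ⟨y, hyΩ, hy, hyV⟩ :=
        ((mem_closure_iff_frequently.1 (frontier_subset_closure hx)).and_eventually hev).exists
      have hm : y ∈ Ω ∩ V := ⟨hyΩ, hyV⟩
      rw [hφ.inter_eq] at hm
      exact absurd hm.2 (not_lt.2 hy.le)
    · by_contra hneg
      have hm : x ∈ Ω ∩ V := by
        rw [hφ.inter_eq]; exact ⟨hφ.mem, not_le.1 hneg⟩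
      rw [hΩ.frontier_eq] at hx
      exact hx.2 hm.1
  have dline : ∀ (V : Set Plane) (φ : Plane → ℝ) (w : Plane), IsLocalDefiningFunction Ω x V φ →
      HasDerivAt (fun s : ℝ => φ (x + s • w)) ⟪gradient φ x, w⟫ 0 := by
    intro V φ w hφ
    have hd : DifferentiableAt ℝ φ x :=
      (hφ.contDiffOn.contDiffAt (hφ.isOpen.mem_nhds hφ.mem)).differentiableAt (by norm_num)
    have h1 : HasDerivAt (fun s : ℝ => x + s • w) w 0 := by
      simpa using ((hasDerivAt_id (0 : ℝ)).smul_const w).const_add x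
    have h2 : HasFDerivAt φ (InnerProductSpace.toDual ℝ Plane (gradient φ x)) (x + (0 : ℝ) • w) := by
      simpa using hd.hasGradientAt.hasFDerivAt
    have h3 := h2.comp_hasDerivAt (0 : ℝ) h1
    rw [InnerProductSpace.toDual_apply_apply] at h3
    exact h3
  by_contra hne
  have hlt : ⟪ν, ν'⟫ < 1 := (inner_lt_one_iff_real_of_norm_eq_one n1 n1').2 hne
  have hνν : ⟪ν, ν⟫ = (1 : ℝ) := by rw [real_inner_self_eq_norm_sq, n1]; norm_num
  have hνν' : ⟪ν', ν'⟫ = (1 : ℝ) := by rw [real_inner_self_eq_norm_sq, n1']; norm_num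
  have d1 := dline U ψ (ν' - ν) hψ
  have d2 := dline U' ψ' (ν' - ν) hψ'
  have e1 : ⟪gradient ψ x, ν' - ν⟫ < 0 := by
    rw [hg, real_inner_smul_left, inner_sub_right, hνν]; nlinarith
  have e2 : 0 < ⟪gradient ψ' x, ν' - ν⟫ := by
    rw [hg', real_inner_smul_left, inner_sub_right, hνν', real_inner_comm]; nlinarith
  have hle : 𝓝[>] (0 : ℝ) ≤ 𝓝[≠] 0 := nhdsWithin_mono _ fun y hy => ne_of_gt hy
  have s1 := ((hasDerivAt_iff_tendsto_slope.1 d1).mono_left hle).eventually (gt_mem_nhds e1)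
  have s2 := ((hasDerivAt_iff_tendsto_slope.1 d2).mono_left hle).eventually (lt_mem_nhds e2)
  have hcl : Tendsto (fun s : ℝ => x + s • (ν' - ν)) (𝓝[>] 0) (𝓝 x) := by
    have : Continuous fun s : ℝ => x + s • (ν' - ν) := by fun_prop
    simpa using (this.tendsto 0).mono_left nhdsWithin_le_nhds
  have u1 := hcl.eventually_mem (hψ.isOpen.mem_nhds hψ.mem)
  have u2 := hcl.eventually_mem (hψ'.isOpen.mem_nhds hψ'.mem)
  obtain ⟨s, hs1, hs2, hU, hU', hs⟩ := (s1.and (s2.and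
    (u1.and (u2.and self_mem_nhdsWithin)))).exists
  have hs : 0 < s := hs
  simp only [slope_def_field, zero_smul, add_zero, sub_zero, key U ψ hψ, key U' ψ' hψ'] at hs1 hs2
  have p1 : ψ (x + s • (ν' - ν)) < 0 := by
    by_contra hh; exact absurd hs1 (not_lt.2 (div_nonneg (not_lt.1 hh) hs.le))
  have p2 : 0 < ψ' (x + s • (ν' - ν)) := by
    by_contra hh; exact absurd hs2 (not_lt.2 (div_nonpos_of_nonpos_of_nonneg (not_lt.1 hh) hs.le))
  have m1 : x + s • (ν' - ν) ∈ Ω ∩ U := by rw [hψ.inter_eq]; exact ⟨hU, p1⟩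
  have m2 : x + s • (ν' - ν) ∈ Ω ∩ U' := ⟨m1.1, hU'⟩
  rw [hψ'.inter_eq] at m2
  exact absurd m2.2 (not_lt.2 p2.le)

/-- Specular reflection `v* = v - 2 (n_x · v) n_x` at the boundary point `x`. -/
noncomputable def reflect (Ω : Set Plane) (x v : Plane) : Plane :=
  v - (2 * ⟪outerNormal Ω x, v⟫) • outerNormal Ω x

/-- The relativistic velocity `v / √(1 + |v|²)` of a particle with momentum `v`. -/
noncomputable def relVelocity (v : Plane) : Plane :=
  (Real.sqrt (1 + ‖v‖ ^ 2))⁻¹ • v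

/-- The closed phase space `Ω̄ × ℝ²`, with points `(x, v)`. -/
def phaseSpace (Ω : Set Plane) : Set (Plane × Plane) :=
  closure Ω ×ˢ univ

/-- The singular (grazing) set: boundary points with tangential momenta. -/
def singularSet (Ω : Set Plane) : Set (Plane × Plane) :=
  {p | p.1 ∈ frontier Ω ∧ ⟪outerNormal Ω p.1, p.2⟫ = 0}

/-- `g` is a bounded continuous function on `[0,T] × S`. -/
def IsBddCont {X G : Type*} [TopologicalSpace X] [NormedAddCommGroup G] (T : ℝ) (S : Set X)
    (g : ℝ → X → G) : Prop :=
  ContinuousOn (fun z : ℝ × X => g z.1 z.2) (Icc 0 T ×ˢ S) ∧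
    ∃ C : ℝ, ∀ t ∈ Icc 0 T, ∀ p ∈ S, ‖g t p‖ ≤ C

/-- `E ∈ C^{0;1,μ}_{t;x}([0,T] × Ω̄)`: bounded and continuous in `(t,x)`, and continuously
differentiable in `x` up to the boundary with `∇ₓE` being `μ`-Hölder in `x`, uniformly in `t`. -/
structure MemC01Holder (T : ℝ) (Ω : Set Plane) (μ : ℝ) (E : ℝ → Plane → Plane) : Prop where
  bddCont : IsBddCont T (closure Ω) E
  differentiableOn : ∀ t ∈ Icc 0 T, DifferentiableOn ℝ (E t) (closure Ω)
  holder : ∃ C : ℝ, ∀ t ∈ Icc 0 T, ∀ x ∈ closure Ω, ∀ y ∈ closure Ω,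
    ‖fderivWithin ℝ (E t) (closure Ω) x - fderivWithin ℝ (E t) (closure Ω) y‖ ≤ C * ‖x - y‖ ^ μ

/-- `f₀ ∈ C₀^{1,μ}(Ω̄ × ℝ²)`: bounded and continuously differentiable up to the boundary,
with `μ`-Hölder gradient and compact support in `Ω̄ × ℝ²`. -/
structure MemC1Holder0 (Ω : Set Plane) (μ : ℝ) (f₀ : Plane × Plane → ℝ) : Prop where
  differentiableOn : DifferentiableOn ℝ f₀ (phaseSpace Ω)
  bounded : ∃ C : ℝ, ∀ p ∈ phaseSpace Ω, |f₀ p| ≤ C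
  holder : ∃ C : ℝ, ∀ p ∈ phaseSpace Ω, ∀ q ∈ phaseSpace Ω,
    ‖fderivWithin ℝ f₀ (phaseSpace Ω) p - fderivWithin ℝ f₀ (phaseSpace Ω) q‖
      ≤ C * (‖p.1 - q.1‖ ^ μ + ‖p.2 - q.2‖ ^ μ)
  compactSupport : ∃ K : Set (Plane × Plane), IsCompact K ∧ ∀ p ∈ phaseSpace Ω, p ∉ K → f₀ p = 0

/-- `f ∈ C^{1;1,λ}_{t;(x,v)}([0,T] × Ω̄ × ℝ²)`: `f` and `∂ₜf` are bounded and continuous on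
`[0,T] × Ω̄ × ℝ²` (one-sided time derivatives at `0` and `T`), and `f(t,·)` is differentiable up
to the boundary with `∇ₓf, ∇ᵥf` being `λ`-Hölder in `(x,v)`, uniformly in `t`. -/
structure MemC11Holder (T : ℝ) (Ω : Set Plane) (lam : ℝ) (f : ℝ → Plane × Plane → ℝ) :
    Prop where
  bddCont : IsBddCont T (phaseSpace Ω) f
  timeDifferentiableOn : ∀ p ∈ phaseSpace Ω, DifferentiableOn ℝ (fun s => f s p) (Icc 0 T)
  timeDeriv : IsBddCont T (phaseSpace Ω) fun t p => derivWithin (fun s => f s p) (Icc 0 T) t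
  differentiableOn : ∀ t ∈ Icc 0 T, DifferentiableOn ℝ (f t) (phaseSpace Ω)
  holder : ∃ C : ℝ, ∀ t ∈ Icc 0 T, ∀ p ∈ phaseSpace Ω, ∀ q ∈ phaseSpace Ω,
    ‖fderivWithin ℝ (f t) (phaseSpace Ω) p - fderivWithin ℝ (f t) (phaseSpace Ω) q‖
      ≤ C * (‖p.1 - q.1‖ ^ lam + ‖p.2 - q.2‖ ^ lam)

/-- Compatibility conditions on the initial datum at `∂Ω × ℝ²`: invariance of `f₀`, and of
the initial transport derivative `v̂ · ∇ₓf₀ + E(0,x) · ∇ᵥf₀`, under `v ↦ v*`. -/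
structure IsCompatible (Ω : Set Plane) (E : ℝ → Plane → Plane) (f₀ : Plane × Plane → ℝ) :
    Prop where
  zeroth : ∀ x ∈ frontier Ω, ∀ v : Plane, f₀ (x, v) = f₀ (x, reflect Ω x v)
  first : ∀ x ∈ frontier Ω, ∀ v : Plane,
    fderivWithin ℝ f₀ (phaseSpace Ω) (x, v) (relVelocity v, E 0 x) =
      fderivWithin ℝ f₀ (phaseSpace Ω) (x, reflect Ω x v) (relVelocity (reflect Ω x v), E 0 x)

/-- `f₀` is constant on the points of `Ω̄ × ℝ²` close to the singular set. -/
def IsFlat (Ω : Set Plane) (f₀ : Plane × Plane → ℝ) : Prop :=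
  ∃ δ > 0, ∃ c : ℝ, ∀ p ∈ phaseSpace Ω, Metric.infDist p (singularSet Ω) ≤ δ → f₀ p = c

/-- `f` solves `∂ₜf + v̂ · ∇ₓf + E · ∇ᵥf = 0` in `Ω × ℝ²` with specular reflection on `∂Ω` and
initial datum `f₀`; `v̂ · ∇ₓf + E · ∇ᵥf` is the derivative of `f(t,·)` in the direction
`(v̂, E(t,x))`. -/
structure IsSolution (T : ℝ) (Ω : Set Plane) (E : ℝ → Plane → Plane) (f₀ : Plane × Plane → ℝ)
    (f : ℝ → Plane × Plane → ℝ) : Prop where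
  transport : ∀ t ∈ Ioc 0 T, ∀ x ∈ Ω, ∀ v : Plane,
    derivWithin (fun s => f s (x, v)) (Icc 0 T) t
      + fderiv ℝ (f t) (x, v) (relVelocity v, E t x) = 0
  specular : ∀ t ∈ Ioc 0 T, ∀ x ∈ frontier Ω, ∀ v : Plane,
    f t (x, v) = f t (x, reflect Ω x v)
  initial : ∀ x ∈ Ω, ∀ v : Plane, f 0 (x, v) = f₀ (x, v)

end VlasovLinear

/-!
The transport equation is solved by characteristics. With the reversed momentum `u = -v` the
backward characteristics are the trajectories of `x' = u / √(1 + |u|²)`, `u' = E (t - s, x)`,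
reflected at the boundary, and `f (t, x, -u)` is the initial datum evaluated at the end of the
trajectory of `(x, u)`. Free trajectories depend smoothly on the initial state, and a reflected
trajectory does so as long as it meets the boundary transversally, so that everything rests on
staying away from the grazing set.

*The velocity lemma.* Let `ψ` be a normalized defining function of `Ω` and `n` its gradient. The
quantity `energy = ⟪n, u⟫² / 2 - ψ * bend + K * ψ²`, in which `bend` collects the curvature of the
boundary and the normal force, is invariant under the reflection, dominates `|ψ|` by convexity and
since the force points outwards, and has a derivative along trajectories that is bounded by a
multiple of `|ψ|`, since the normal force on the boundary does not depend on time
(`exists_energy_bounds`). It therefore changes at most by a factor `exp (C * T)`. As the datum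
vanishes near the grazing set, so does the solution on the whole time interval, and on the rest of
phase space the trajectories meet the boundary with a normal velocity that is bounded below
(`exists_speed`); in a short time they bounce at most once.

*Regularity across the bounce.* The first time at which a trajectory hits the boundary is not
differentiable up to the states on the boundary, and nearby trajectories may have bounced or not.
The time-independence of the normal force makes the linearization `A` of the bounce a function of
the boundary state alone, and the two compatibility conditions on `f₀` say exactly that the
derivative of the datum at `z` and at the reflected state are related by `A`
(`isReflecting_of_compat`). With this the difference of the datum at the ends of two neighbouring
trajectories has a first-order expansion with a Hölder remainder in all cases
(`IsScale.exists_path_taylor`). Instead of Hölder estimates for derivatives such expansions,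
`IsTaylor`, are propagated: on a fat convex set they imply the Hölder continuity of the derivative
(`IsTaylor.holder`). The class `IsAdmissible` of reflecting `C^{1,lam}` functions that vanish near
the grazing set and for large momenta is preserved by a short time step, and finitely many steps
give the solution on `[0, T]` (`exists_evolution`).

*Uniqueness and mass.* The difference of two solutions obeys a maximum principle
(`IsSolution.le`): at a boundary maximum the reflection allows the momentum to be taken outgoing,
so that the backward characteristic points into the domain. For the mass, the field is divergence
free, and the flux through the level sets of `ψ` is `O(ψ)`, since on the boundary it is odd under
the reflection (`exists_flux_le`).
-/

namespace VlasovLinear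

/-! ### First-order Taylor expansions with Hölder remainder on convex sets -/

section Jets

variable {X F : Type*} [NormedAddCommGroup X] [NormedSpace ℝ X] [NormedAddCommGroup F]
  [NormedSpace ℝ F] {S : Set X} {r D lam C : ℝ}

/-- `S` is convex and contains, within distance `D` of each of its points, a ball of radius `r`.
On such a set a linear map is controlled by its values on small increments that stay in `S`. -/
structure IsFat (S : Set X) (r D : ℝ) : Prop where
  convex : Convex ℝ S
  r_pos : 0 < r
  one_le : 1 ≤ D
  exists_ball : ∀ x ∈ S, ∃ c, ‖c - x‖ ≤ D ∧ Metric.closedBall c r ⊆ S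

/-- `f` has on `S` the first-order expansion with derivative `f'` and a remainder of order
`1 + lam` at unit distance and below, and `f'` is bounded; one constant `C` serves for both. -/
structure IsTaylor (S : Set X) (lam C : ℝ) (f : X → F) (f' : X → X →L[ℝ] F) : Prop where
  nonneg : 0 ≤ C
  taylor : ∀ x ∈ S, ∀ y ∈ S, ‖y - x‖ ≤ 1 → ‖f y - f x - f' x (y - x)‖ ≤ C * ‖y - x‖ ^ (1 + lam)
  bound : ∀ x ∈ S, ‖f' x‖ ≤ C

/-- Near each of its points a fat set contains two points whose difference is a prescribed small
vector: shrink the ball of the definition towards the point. -/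
theorem IsFat.exists_sub_eq_smul (hS : IsFat S r D) {x : X} (hx : x ∈ S) {e : X} (he : ‖e‖ ≤ 1)
    {ρ : ℝ} (hρ : 0 < ρ) (hρ1 : ρ ≤ 1) :
    ∃ y₀ ∈ S, ∃ y₁ ∈ S, ‖y₀ - x‖ ≤ ρ ∧ ‖y₁ - x‖ ≤ ρ ∧ y₁ - y₀ = (ρ * r / (D + r)) • e := by
  obtain ⟨c, hc, hb⟩ := hS.exists_ball x hx
  have hr := hS.r_pos
  have hD := hS.one_le
  have hDr : 0 < D + r := by linarith
  set s := ρ / (D + r) with hs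
  have hs0 : 0 < s := by positivity
  have hs1 : s ∈ Icc (0 : ℝ) 1 := ⟨hs0.le, by rw [hs, div_le_one hDr]; linarith⟩
  have hsD : s * (D + r) = ρ := by rw [hs]; field_simp
  have h0 : c ∈ S := hb (Metric.mem_closedBall_self hr.le)
  have hre : ‖r • e‖ ≤ r := by
    rw [norm_smul, Real.norm_of_nonneg hr.le]; nlinarith
  have h1 : c + r • e ∈ S := hb (by simpa [Metric.mem_closedBall, dist_eq_norm] using hre)
  refine ⟨x + s • (c - x), hS.convex.add_smul_sub_mem hx h0 hs1, x + s • (c + r • e - x),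
    hS.convex.add_smul_sub_mem hx h1 hs1, ?_, ?_, ?_⟩
  · rw [add_sub_cancel_left, norm_smul, Real.norm_of_nonneg hs0.le]
    nlinarith [mul_nonneg hs0.le hr.le, mul_le_mul_of_nonneg_left hc hs0.le]
  · rw [add_sub_cancel_left, norm_smul, Real.norm_of_nonneg hs0.le, ← hsD]
    gcongr
    calc ‖c + r • e - x‖ = ‖(c - x) + r • e‖ := by congr 1; abel
      _ ≤ D + r := (norm_add_le _ _).trans (add_le_add hc hre)
  · have : x + s • (c + r • e - x) - (x + s • (c - x)) = (s * r) • e := by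
      rw [mul_smul]; module
    rw [this, hs]; congr 1; ring

/-- A linear map is bounded by its values on the increments of size at most `ρ` that stay in the
set. -/
theorem IsFat.opNorm_le (hS : IsFat S r D) {x : X} (hx : x ∈ S) {l : X →L[ℝ] F} {ρ M : ℝ}
    (hρ : 0 < ρ) (hρ1 : ρ ≤ 1) (h : ∀ y ∈ S, ‖y - x‖ ≤ ρ → ‖l (y - x)‖ ≤ M) :
    ‖l‖ ≤ 2 * (D + r) / r * (M / ρ) := by
  have hr := hS.r_pos
  have hD := hS.one_le
  have hDr : 0 < D + r := by linarith
  have hM : 0 ≤ M := (norm_nonneg _).trans (h x hx (by simpa using hρ.le))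
  refine ContinuousLinearMap.opNorm_le_of_unit_norm (by positivity) fun e he => ?_
  obtain ⟨y₀, h0, y₁, h1, n0, n1, hy⟩ := hS.exists_sub_eq_smul hx he.le hρ hρ1
  have e1 : l (y₁ - x) - l (y₀ - x) = (ρ * r / (D + r)) • l e := by
    rw [← map_sub, ← map_smul, ← hy]; congr 1; abel
  have e2 : ‖(ρ * r / (D + r)) • l e‖ ≤ 2 * M := by
    rw [← e1]
    calc _ ≤ ‖l (y₁ - x)‖ + ‖l (y₀ - x)‖ := norm_sub_le _ _
      _ ≤ 2 * M := by linarith [h y₁ h1 n1, h y₀ h0 n0]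
  rw [norm_smul, Real.norm_of_nonneg (by positivity)] at e2
  have : 2 * (D + r) / r * (M / ρ) = (2 * M) / (ρ * r / (D + r)) := by field_simp
  rw [this, le_div_iff₀ (by positivity)]
  linarith

theorem IsFat.uniqueDiffOn (hS : IsFat S r D) : UniqueDiffOn ℝ S := by
  intro x hx
  obtain ⟨c, -, hc⟩ := hS.exists_ball x hx
  exact uniqueDiffWithinAt_convex hS.convex
    ⟨c, mem_interior_iff_mem_nhds.2 (mem_of_superset (Metric.closedBall_mem_nhds c hS.r_pos) hc)⟩
    (subset_closure hx)

/-- The derivative is bounded in terms of the function and of the remainder. -/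
theorem IsFat.norm_deriv_le (hS : IsFat S r D) {f : X → F} {f' : X → X →L[ℝ] F} {B : ℝ}
    (hlam : 0 < lam) (hC : 0 ≤ C) (hB : ∀ x ∈ S, ‖f x‖ ≤ B)
    (h : ∀ x ∈ S, ∀ y ∈ S, ‖y - x‖ ≤ 1 → ‖f y - f x - f' x (y - x)‖ ≤ C * ‖y - x‖ ^ (1 + lam))
    {x : X} (hx : x ∈ S) : ‖f' x‖ ≤ 2 * (D + r) / r * (2 * B + C) := by
  have := hS.opNorm_le hx (l := f' x) (M := 2 * B + C) one_pos le_rfl fun y hy hyx => by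
    have h1 := h x hx y hy hyx
    have h2 : ‖y - x‖ ^ (1 + lam) ≤ 1 := Real.rpow_le_one (norm_nonneg _) hyx (by linarith)
    have h3 : f' x (y - x) = (f y - f x) - (f y - f x - f' x (y - x)) := by abel
    rw [h3]
    refine (norm_sub_le _ _).trans ?_
    have := norm_sub_le (f y) (f x)
    nlinarith [hB x hx, hB y hy]
  simpa using this

theorem IsTaylor.mono {f : X → F} {f' : X → X →L[ℝ] F} (h : IsTaylor S lam C f f') {C' : ℝ}
    (hC : C ≤ C') : IsTaylor S lam C' f f' :=
  ⟨h.nonneg.trans hC, fun x hx y hy hxy => (h.taylor x hx y hy hxy).trans (by gcongr),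
    fun x hx => (h.bound x hx).trans hC⟩

theorem IsTaylor.hasFDerivWithinAt {f : X → F} {f' : X → X →L[ℝ] F} (h : IsTaylor S lam C f f')
    (hlam : 0 < lam) {x : X} (hx : x ∈ S) : HasFDerivWithinAt f (f' x) S x := by
  refine HasFDerivWithinAt.of_isLittleO (Asymptotics.isLittleO_iff.2 fun c hc => ?_)
  have h1 : Tendsto (fun y => C * ‖y - x‖ ^ lam) (𝓝[S] x) (𝓝 0) := by
    have : ContinuousAt (fun y => C * ‖y - x‖ ^ lam) x := by
      refine continuousAt_const.mul (ContinuousAt.rpow_const (by fun_prop) (Or.inr hlam.le))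
    have h2 := this.tendsto
    simp only [sub_self, norm_zero, Real.zero_rpow hlam.ne', mul_zero] at h2
    exact h2.mono_left nhdsWithin_le_nhds
  have h3 : Tendsto (fun y => ‖y - x‖) (𝓝[S] x) (𝓝 0) := by
    have : ContinuousAt (fun y => ‖y - x‖) x := by fun_prop
    have h2 := this.tendsto
    simp only [sub_self, norm_zero] at h2
    exact h2.mono_left nhdsWithin_le_nhds
  filter_upwards [h1.eventually (gt_mem_nhds hc), h3.eventually (gt_mem_nhds one_pos),
    self_mem_nhdsWithin] with y h4 h5 hy
  refine (h.taylor x hx y hy h5.le).trans ?_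
  rcases (norm_nonneg (y - x)).eq_or_lt with h0 | h0
  · rw [← h0, Real.zero_rpow (by linarith)]; simp
  · rw [Real.rpow_add h0, Real.rpow_one]
    nlinarith

theorem IsTaylor.lipschitz {f : X → F} {f' : X → X →L[ℝ] F} (h : IsTaylor S lam C f f')
    (hlam : 0 < lam) (hS : Convex ℝ S) {x y : X} (hx : x ∈ S) (hy : y ∈ S) :
    ‖f y - f x‖ ≤ C * ‖y - x‖ :=
  hS.norm_image_sub_le_of_norm_hasFDerivWithin_le (fun _ hz => h.hasFDerivWithinAt hlam hz)
    h.bound hx hy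

/-- On a fat set the derivative in a Taylor expansion is automatically Hölder continuous. -/
theorem IsTaylor.holder {f : X → F} {f' : X → X →L[ℝ] F} (h : IsTaylor S lam C f f')
    (hlam : 0 < lam) (hlam1 : lam < 1) (hS : IsFat S r D) {x y : X} (hx : x ∈ S) (hy : y ∈ S) :
    ‖f' x - f' y‖ ≤ (12 * (D + r) / r + 4) * C * ‖x - y‖ ^ lam := by
  have hr := hS.r_pos
  have hD := hS.one_le
  have hC := h.nonneg
  have hDr : 0 < D + r := by linarith
  set ρ := ‖x - y‖ with hρ
  rcases le_or_gt ρ (1 / 2) with hle | hgt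
  · rcases (norm_nonneg (x - y)).eq_or_lt with h0 | h0
    · have : x = y := sub_eq_zero.1 (norm_eq_zero.1 h0.symm)
      subst this
      simp only [sub_self, norm_zero]
      positivity
    · have hρ0 : 0 < ρ := h0
      have key := hS.opNorm_le hx (l := f' x - f' y) (ρ := ρ) (M := 6 * C * ρ ^ (1 + lam)) h0
        (by linarith) fun z hz hzx => by
          have hzy : ‖z - y‖ ≤ 2 * ρ := by
            calc ‖z - y‖ = ‖(z - x) + (x - y)‖ := by congr 1; abel
              _ ≤ _ := (norm_add_le _ _).trans (by linarith)
          have t1 := h.taylor x hx z hz (by linarith)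
          have t2 := h.taylor y hy z hz (by linarith)
          have t3 := h.taylor y hy x hx (by linarith)
          have r1 : ‖z - x‖ ^ (1 + lam) ≤ ρ ^ (1 + lam) :=
            Real.rpow_le_rpow (norm_nonneg _) hzx (by linarith)
          have r2 : ‖z - y‖ ^ (1 + lam) ≤ 4 * ρ ^ (1 + lam) := by
            calc ‖z - y‖ ^ (1 + lam) ≤ (2 * ρ) ^ (1 + lam) :=
                  Real.rpow_le_rpow (norm_nonneg _) hzy (by linarith)
              _ = 2 ^ (1 + lam) * ρ ^ (1 + lam) := Real.mul_rpow (by norm_num) hρ0.le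
              _ ≤ 2 ^ (2 : ℝ) * ρ ^ (1 + lam) := by
                  gcongr
                  · norm_num
                  · linarith
              _ = _ := by norm_num
          have e : (f' x - f' y) (z - x) = (f z - f y - f' y (z - y))
              - (f x - f y - f' y (x - y)) - (f z - f x - f' x (z - x)) := by
            have : z - x = (z - y) - (x - y) := by abel
            rw [sub_apply]
            conv_lhs => rw [this, map_sub (f' y), ← this]
            abel
          rw [e]
          refine (norm_sub_le _ _).trans ?_
          have := norm_sub_le (f z - f y - f' y (z - y)) (f x - f y - f' y (x - y))
          have r1' := mul_le_mul_of_nonneg_left r1 hC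
          have r2' := mul_le_mul_of_nonneg_left r2 hC
          rw [← hρ] at t3
          linarith
      refine key.trans ?_
      rw [Real.rpow_add hρ0, Real.rpow_one]
      have hp : 0 ≤ ρ ^ lam := Real.rpow_nonneg hρ0.le _
      have : 2 * (D + r) / r * (6 * C * (ρ * ρ ^ lam) / ρ) = 12 * (D + r) / r * C * ρ ^ lam := by
        field_simp; ring
      rw [this]
      nlinarith [mul_nonneg hC hp]
  · have h1 : (1 / 2 : ℝ) ≤ ρ ^ lam := by
      calc (1 / 2 : ℝ) = (1 / 2 : ℝ) ^ (1 : ℝ) := by norm_num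
        _ ≤ (1 / 2 : ℝ) ^ lam :=
          Real.rpow_le_rpow_of_exponent_ge (by norm_num) (by norm_num) hlam1.le
        _ ≤ ρ ^ lam := Real.rpow_le_rpow (by norm_num) hgt.le hlam.le
    have h2 : ‖f' x - f' y‖ ≤ 2 * C :=
      (norm_sub_le _ _).trans (by linarith [h.bound x hx, h.bound y hy])
    have h3 : 0 ≤ 12 * (D + r) / r := by positivity
    nlinarith [mul_nonneg (mul_nonneg h3 hC) (by linarith : (0 : ℝ) ≤ ρ ^ lam)]

theorem norm_sub_sub_le_of_holder {f : X → F} {f' : X → X →L[ℝ] F} (hS : Convex ℝ S)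
    (hlam : 0 < lam) (hC : 0 ≤ C) (hd : ∀ x ∈ S, HasFDerivWithinAt f (f' x) S x)
    (h : ∀ x ∈ S, ∀ y ∈ S, ‖y - x‖ ≤ 1 → ‖f' x - f' y‖ ≤ C * ‖x - y‖ ^ lam) {x y : X} (hx : x ∈ S)
    (hy : y ∈ S) (hxy : ‖y - x‖ ≤ 1) : ‖f y - f x - f' x (y - x)‖ ≤ C * ‖y - x‖ ^ (1 + lam) := by
  have hseg : segment ℝ x y ⊆ S := hS.segment_subset hx hy
  have := (convex_segment x y).norm_image_sub_le_of_norm_hasFDerivWithin_le' (𝕜 := ℝ)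
    (f := f) (f' := f') (φ := f' x) (C := C * ‖y - x‖ ^ lam)
    (fun z hz => (hd z (hseg hz)).mono hseg) (fun z hz => ?_) (left_mem_segment ℝ x y)
    (right_mem_segment ℝ x y)
  · refine this.trans (le_of_eq ?_)
    rcases (norm_nonneg (y - x)).eq_or_lt with h0 | h0
    · rw [← h0, Real.zero_rpow hlam.ne', Real.zero_rpow (by positivity)]; ring
    · rw [Real.rpow_add h0, Real.rpow_one]; ring
  · have hzx : ‖z - x‖ ≤ ‖y - x‖ := by
      obtain ⟨t, ht, rfl⟩ := (segment_eq_image' ℝ x y ▸ hz : z ∈ _)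
      simp only [add_sub_cancel_left, norm_smul, Real.norm_of_nonneg ht.1]
      nlinarith [norm_nonneg (y - x), ht.2]
    rw [norm_sub_rev]
    refine (h x hx z (hseg hz) (hzx.trans hxy)).trans ?_
    rw [norm_sub_rev]
    gcongr

/-- A bounded function with Hölder continuous derivative has first-order expansions; the constant
depends on the set, the bound and the Hölder constant only. -/
theorem IsFat.isTaylor_of_holder (hS : IsFat S r D) {f : X → F} {f' : X → X →L[ℝ] F} {B : ℝ}
    (hlam : 0 < lam) (hC : 0 ≤ C) (hB : ∀ x ∈ S, ‖f x‖ ≤ B)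
    (hd : ∀ x ∈ S, HasFDerivWithinAt f (f' x) S x)
    (h : ∀ x ∈ S, ∀ y ∈ S, ‖y - x‖ ≤ 1 → ‖f' x - f' y‖ ≤ C * ‖x - y‖ ^ lam) :
    IsTaylor S lam (C + 2 * (D + r) / r * (2 * |B| + C)) f f' := by
  have hr := hS.r_pos
  have hD := hS.one_le
  have h0 : 0 ≤ 2 * (D + r) / r * (2 * |B| + C) := by positivity
  have ht : ∀ x ∈ S, ∀ y ∈ S, ‖y - x‖ ≤ 1 →
      ‖f y - f x - f' x (y - x)‖ ≤ C * ‖y - x‖ ^ (1 + lam) := fun x hx y hy hxy =>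
    norm_sub_sub_le_of_holder hS.convex hlam hC hd h hx hy hxy
  refine ⟨by positivity, fun x hx y hy hxy => (ht x hx y hy hxy).trans ?_, fun x hx => ?_⟩
  · gcongr
    linarith
  · have := hS.norm_deriv_le hlam hC (fun x hx => (hB x hx).trans (le_abs_self B)) ht hx
    linarith

/-- It is enough to know the expansion at small distances, if `f` is bounded. -/
theorem IsTaylor.of_local {f : X → F} {f' : X → X →L[ℝ] F} {ρ : ℝ} (hρ : 0 < ρ) (hρ1 : ρ ≤ 1)
    (hlam : 0 < lam) (hlam1 : lam < 1) (hC : 0 ≤ C) (hf : ∀ x ∈ S, ‖f x‖ ≤ C)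
    (hb : ∀ x ∈ S, ‖f' x‖ ≤ C)
    (h : ∀ x ∈ S, ∀ y ∈ S, ‖y - x‖ ≤ ρ → ‖f y - f x - f' x (y - x)‖ ≤ C * ‖y - x‖ ^ (1 + lam)) :
    IsTaylor S lam (3 * C / ρ ^ 2) f f' := by
  have h1 : C ≤ 3 * C / ρ ^ 2 := by
    rw [le_div_iff₀ (by positivity)]
    have : ρ ^ 2 ≤ 1 := by nlinarith
    nlinarith
  refine ⟨by positivity, fun x hx y hy hxy => ?_, fun x hx => (hb x hx).trans h1⟩
  rcases le_or_gt ‖y - x‖ ρ with hle | hgt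
  · exact (h x hx y hy hle).trans (by gcongr)
  · have h2 : ρ ^ 2 ≤ ‖y - x‖ ^ (1 + lam) := by
      calc ρ ^ 2 = ρ ^ (2 : ℝ) := by norm_num
        _ ≤ ρ ^ (1 + lam) := Real.rpow_le_rpow_of_exponent_ge hρ hρ1 (by linarith)
        _ ≤ _ := Real.rpow_le_rpow hρ.le hgt.le (by linarith)
    have h3 : ‖f y - f x - f' x (y - x)‖ ≤ 3 * C := by
      refine (norm_sub_le _ _).trans ?_
      have := norm_sub_le (f y) (f x)
      have h4 : ‖f' x (y - x)‖ ≤ C * 1 :=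
        (f' x).le_of_opNorm_le_of_le (hb x hx) hxy
      linarith [hf x hx, hf y hy]
    refine h3.trans ?_
    rw [div_mul_eq_mul_div, le_div_iff₀ (by positivity)]
    exact mul_le_mul_of_nonneg_left h2 (by positivity)

/-- If a family with uniform Taylor expansions depends continuously on a parameter, so do its
derivatives. -/
theorem IsFat.continuousOn_deriv [FiniteDimensional ℝ X] {P : Type*} [TopologicalSpace P]
    {A : Set P} (hS : IsFat S r D) (hlam : 0 < lam) {f : P → X → F} {f' : P → X → X →L[ℝ] F}
    (h : ∀ t ∈ A, IsTaylor S lam C (f t) (f' t)) (hf : ∀ x ∈ S, ContinuousOn (fun t => f t x) A)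
    {x : X} (hx : x ∈ S) : ContinuousOn (fun t => f' t x) A := by
  rw [continuousOn_clm_apply]
  have hr := hS.r_pos
  have hD := hS.one_le
  have hDr : 0 < D + r := by linarith
  suffices H : ∀ e : X, ‖e‖ ≤ 1 → ContinuousOn (fun t => f' t x e) A by
    intro e
    have h1 := H ((‖e‖ + 1)⁻¹ • e) (by
      rw [norm_smul, norm_inv, Real.norm_of_nonneg (by positivity), inv_mul_le_iff₀ (by positivity)]
      linarith)
    refine (h1.const_smul (‖e‖ + 1)).congr fun t _ => ?_
    change f' t x e = (‖e‖ + 1) • f' t x ((‖e‖ + 1)⁻¹ • e)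
    rw [map_smul, smul_smul, mul_inv_cancel₀ (by positivity), one_smul]
  intro e he t₀ ht₀
  have hC := (h t₀ ht₀).nonneg
  rw [ContinuousWithinAt, tendsto_iff_norm_sub_tendsto_zero]
  rw [Metric.tendsto_nhds]
  intro ε hε
  obtain ⟨ρ, hρ, hρ1, hρε⟩ : ∃ ρ : ℝ, 0 < ρ ∧ ρ ≤ 1 ∧ 4 * C * (D + r) / r * ρ ^ lam < ε / 2 := by
    have : Tendsto (fun ρ : ℝ => 4 * C * (D + r) / r * ρ ^ lam) (𝓝[>] 0) (𝓝 0) := by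
      have : ContinuousAt (fun ρ : ℝ => 4 * C * (D + r) / r * ρ ^ lam) 0 :=
        continuousAt_const.mul (ContinuousAt.rpow_const continuousAt_id (Or.inr hlam.le))
      have h2 := this.tendsto
      simp only [Real.zero_rpow hlam.ne', mul_zero] at h2
      exact h2.mono_left nhdsWithin_le_nhds
    obtain ⟨ρ, h1, h2, h3⟩ := ((this.eventually (gt_mem_nhds (half_pos hε))).and
      ((Ioc_mem_nhdsGT one_pos))).exists
    exact ⟨ρ, h2, h3, h1⟩
  obtain ⟨y₀, h0, y₁, h1, n0, n1, hy⟩ := hS.exists_sub_eq_smul hx he hρ hρ1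
  set s := ρ * r / (D + r) with hs
  have hs0 : 0 < s := by positivity
  have hcont : Tendsto (fun t => ‖(f t y₁ - f t y₀) - (f t₀ y₁ - f t₀ y₀)‖) (𝓝[A] t₀) (𝓝 0) :=
    tendsto_iff_norm_sub_tendsto_zero.1 ((hf y₁ h1 t₀ ht₀).sub (hf y₀ h0 t₀ ht₀))
  filter_upwards [hcont.eventually (gt_mem_nhds (by positivity : 0 < s * (ε / 2))),
    self_mem_nhdsWithin] with t h3 ht
  have est : ∀ t ∈ A, ‖s • f' t x e - (f t y₁ - f t y₀)‖ ≤ 2 * (C * ρ ^ (1 + lam)) := by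
    intro t ht
    have e1 : s • f' t x e = f' t x (y₁ - x) - f' t x (y₀ - x) := by
      rw [← map_sub, ← map_smul, ← hy]; congr 1; abel
    have e2 : s • f' t x e - (f t y₁ - f t y₀) =
        (f t y₀ - f t x - f' t x (y₀ - x)) - (f t y₁ - f t x - f' t x (y₁ - x)) := by
      rw [e1]; abel
    rw [e2]
    refine (norm_sub_le _ _).trans ?_
    have a0 := (h t ht).taylor x hx y₀ h0 (n0.trans hρ1)
    have a1 := (h t ht).taylor x hx y₁ h1 (n1.trans hρ1)
    have b0 : ‖y₀ - x‖ ^ (1 + lam) ≤ ρ ^ (1 + lam) :=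
      Real.rpow_le_rpow (norm_nonneg _) n0 (by linarith)
    have b1 : ‖y₁ - x‖ ^ (1 + lam) ≤ ρ ^ (1 + lam) :=
      Real.rpow_le_rpow (norm_nonneg _) n1 (by linarith)
    have c0 := mul_le_mul_of_nonneg_left b0 hC
    have c1 := mul_le_mul_of_nonneg_left b1 hC
    linarith
  have e3 : s * ‖f' t x e - f' t₀ x e‖ ≤ 4 * (C * ρ ^ (1 + lam)) +
      ‖(f t y₁ - f t y₀) - (f t₀ y₁ - f t₀ y₀)‖ := by
    have : s * ‖f' t x e - f' t₀ x e‖ = ‖s • (f' t x e - f' t₀ x e)‖ := by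
      rw [norm_smul, Real.norm_of_nonneg hs0.le]
    rw [this]
    have e4 : s • (f' t x e - f' t₀ x e) = (s • f' t x e - (f t y₁ - f t y₀))
        - (s • f' t₀ x e - (f t₀ y₁ - f t₀ y₀))
        + ((f t y₁ - f t y₀) - (f t₀ y₁ - f t₀ y₀)) := by
      rw [smul_sub]; abel
    rw [e4]
    refine (norm_add_le _ _).trans ?_
    have := norm_sub_le (s • f' t x e - (f t y₁ - f t y₀))
      (s • f' t₀ x e - (f t₀ y₁ - f t₀ y₀))
    linarith [est t ht, est t₀ ht₀]
  have e5 : 4 * (C * ρ ^ (1 + lam)) < s * (ε / 2) := by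
    rw [Real.rpow_add hρ, Real.rpow_one]
    have : 4 * (C * (ρ * ρ ^ lam)) = s * (4 * C * (D + r) / r * ρ ^ lam) := by
      rw [hs]; field_simp
    rw [this]
    exact mul_lt_mul_of_pos_left hρε hs0
  have e6 : s * ‖f' t x e - f' t₀ x e‖ < s * ε := by linarith
  rw [dist_zero_right, norm_norm]
  exact lt_of_mul_lt_mul_left e6 hs0.le

end Jets

/-- Joint continuity from continuity in the parameter and a uniform Hölder bound. -/
theorem continuousOn_prod_of_holder {P X F : Type*} [TopologicalSpace P] [NormedAddCommGroup X]
    [NormedAddCommGroup F] {A : Set P} {S : Set X} {lam C : ℝ} {g : P → X → F}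
    (hlam : 0 < lam) (h : ∀ t ∈ A, ∀ x ∈ S, ∀ y ∈ S, ‖g t x - g t y‖ ≤ C * ‖x - y‖ ^ lam)
    (hg : ∀ x ∈ S, ContinuousOn (fun t => g t x) A) :
    ContinuousOn (fun z : P × X => g z.1 z.2) (A ×ˢ S) := by
  rintro ⟨t₀, x₀⟩ ⟨ht₀, hx₀⟩
  rw [ContinuousWithinAt, tendsto_iff_norm_sub_tendsto_zero]
  have h1 : Tendsto (fun z : P × X => C * ‖z.2 - x₀‖ ^ lam) (𝓝[A ×ˢ S] (t₀, x₀)) (𝓝 0) := by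
    have : ContinuousAt (fun z : P × X => C * ‖z.2 - x₀‖ ^ lam) (t₀, x₀) :=
      continuousAt_const.mul (ContinuousAt.rpow_const (by fun_prop) (Or.inr hlam.le))
    have h2 := this.tendsto
    simp only [sub_self, norm_zero, Real.zero_rpow hlam.ne', mul_zero] at h2
    exact h2.mono_left nhdsWithin_le_nhds
  have h2 : Tendsto (fun z : P × X => ‖g z.1 x₀ - g t₀ x₀‖) (𝓝[A ×ˢ S] (t₀, x₀)) (𝓝 0) := by
    have h3 := tendsto_iff_norm_sub_tendsto_zero.1 (hg x₀ hx₀ t₀ ht₀)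
    refine h3.comp ?_
    rw [nhdsWithin_prod_eq]
    exact tendsto_fst
  refine squeeze_zero' (Eventually.of_forall fun _ => norm_nonneg _) ?_
    (by simpa using h1.add h2)
  filter_upwards [self_mem_nhdsWithin] with z hz
  have e : g z.1 z.2 - g t₀ x₀ = (g z.1 z.2 - g z.1 x₀) + (g z.1 x₀ - g t₀ x₀) := by abel
  rw [e]
  exact (norm_add_le _ _).trans (add_le_add (h _ hz.1 _ hz.2 _ hx₀) le_rfl)

/-! ### Lipschitz bounds on compact sets and Grönwall estimates -/

section Lip

variable {X F G H : Type*} [NormedAddCommGroup X] [NormedAddCommGroup F] [NormedAddCommGroup G]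
  [NormedAddCommGroup H] {K : Set X}

/-- `f` is bounded and Lipschitz on `K`. -/
def IsBddLip (K : Set X) (f : X → F) : Prop :=
  ∃ C, 0 ≤ C ∧ (∀ x ∈ K, ‖f x‖ ≤ C) ∧ ∀ x ∈ K, ∀ y ∈ K, ‖f y - f x‖ ≤ C * ‖y - x‖

theorem IsBddLip.mono {K' : Set X} {f : X → F} (h : IsBddLip K f) (hK : K' ⊆ K) :
    IsBddLip K' f := by
  obtain ⟨C, h0, h1, h2⟩ := h
  exact ⟨C, h0, fun x hx => h1 x (hK hx), fun x hx y hy => h2 x (hK hx) y (hK hy)⟩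

theorem IsBddLip.add {f g : X → F} (hf : IsBddLip K f) (hg : IsBddLip K g) :
    IsBddLip K fun x => f x + g x := by
  obtain ⟨C, h0, h1, h2⟩ := hf
  obtain ⟨C', h0', h1', h2'⟩ := hg
  refine ⟨C + C', by positivity, fun x hx => (norm_add_le _ _).trans
    (add_le_add (h1 x hx) (h1' x hx)), fun x hx y hy => ?_⟩
  have e : f y + g y - (f x + g x) = (f y - f x) + (g y - g x) := by abel
  rw [e, add_mul]
  exact (norm_add_le _ _).trans (add_le_add (h2 x hx y hy) (h2' x hx y hy))

theorem IsBddLip.comp {K' : Set F} {g : F → G} {f : X → F} (hg : IsBddLip K' g)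
    (hf : IsBddLip K f) (hm : MapsTo f K K') : IsBddLip K fun x => g (f x) := by
  obtain ⟨C, h0, h1, h2⟩ := hf
  obtain ⟨C', h0', h1', h2'⟩ := hg
  refine ⟨C' + C' * C, by positivity, fun x hx => (h1' _ (hm hx)).trans
    (by nlinarith [mul_nonneg h0' h0]), fun x hx y hy => (h2' _ (hm hx) _ (hm hy)).trans ?_⟩
  calc C' * ‖f y - f x‖ ≤ C' * (C * ‖y - x‖) := by gcongr; exact h2 x hx y hy
    _ ≤ _ := by nlinarith [mul_nonneg h0' (norm_nonneg (y - x))]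

theorem IsBddLip.inv {f : X → ℝ} (hf : IsBddLip K f) {c : ℝ} (hc : 0 < c)
    (h : ∀ x ∈ K, c ≤ f x) : IsBddLip K fun x => (f x)⁻¹ := by
  obtain ⟨C, h0, h1, h2⟩ := hf
  refine ⟨c⁻¹ + C * (c⁻¹ * c⁻¹), by positivity, fun x hx => ?_, fun x hx y hy => ?_⟩
  · rw [norm_inv, Real.norm_of_nonneg (hc.le.trans (h x hx))]
    have : (f x)⁻¹ ≤ c⁻¹ := by gcongr; exact h x hx
    have : 0 ≤ C * (c⁻¹ * c⁻¹) := by positivity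
    linarith
  · have hx' : 0 < f x := hc.trans_le (h x hx)
    have hy' : 0 < f y := hc.trans_le (h y hy)
    have e : (f y)⁻¹ - (f x)⁻¹ = -(f y - f x) * ((f y)⁻¹ * (f x)⁻¹) := by field_simp; ring
    rw [e, norm_mul, norm_neg, norm_mul, norm_inv, norm_inv, Real.norm_of_nonneg hx'.le,
      Real.norm_of_nonneg hy'.le]
    have i1 : (f x)⁻¹ ≤ c⁻¹ := by gcongr; exact h x hx
    have i2 : (f y)⁻¹ ≤ c⁻¹ := by gcongr; exact h y hy
    calc ‖f y - f x‖ * ((f y)⁻¹ * (f x)⁻¹) ≤ (C * ‖y - x‖) * (c⁻¹ * c⁻¹) := by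
          gcongr
          exact h2 x hx y hy
      _ ≤ _ := by
          have : 0 ≤ c⁻¹ * ‖y - x‖ := by positivity
          nlinarith

variable [NormedSpace ℝ F] [NormedSpace ℝ G] [NormedSpace ℝ H]

theorem IsBddLip.bilin (B : F →L[ℝ] G →L[ℝ] H) {f : X → F} {g : X → G} (hf : IsBddLip K f)
    (hg : IsBddLip K g) : IsBddLip K fun x => B (f x) (g x) := by
  obtain ⟨C, h0, h1, h2⟩ := hf
  obtain ⟨C', h0', h1', h2'⟩ := hg
  refine ⟨2 * (‖B‖ * C * C'), by positivity, fun x hx => ?_, fun x hx y hy => ?_⟩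
  · refine (B.le_opNorm₂ _ _).trans ?_
    have : ‖B‖ * ‖f x‖ * ‖g x‖ ≤ ‖B‖ * C * C' := by
      gcongr
      · exact h1 x hx
      · exact h1' x hx
    have : 0 ≤ ‖B‖ * C * C' := by positivity
    linarith
  · have e : B (f y) (g y) - B (f x) (g x) = B (f y - f x) (g y) + B (f x) (g y - g x) := by
      simp only [map_sub, sub_apply]; abel
    rw [e]
    refine (norm_add_le _ _).trans ?_
    have a1 : ‖B (f y - f x) (g y)‖ ≤ ‖B‖ * (C * ‖y - x‖) * C' := by
      refine (B.le_opNorm₂ _ _).trans ?_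
      gcongr
      · exact h2 x hx y hy
      · exact h1' y hy
    have a2 : ‖B (f x) (g y - g x)‖ ≤ ‖B‖ * C * (C' * ‖y - x‖) := by
      refine (B.le_opNorm₂ _ _).trans ?_
      gcongr
      · exact h1 x hx
      · exact h2' x hx y hy
    linarith

theorem IsBddLip.clm (L : F →L[ℝ] G) {f : X → F} (hf : IsBddLip K f) :
    IsBddLip K fun x => L (f x) := by
  obtain ⟨C, h0, h1, h2⟩ := hf
  refine ⟨‖L‖ * C, by positivity, fun x hx => L.le_opNorm_of_le (h1 x hx), fun x hx y hy => ?_⟩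
  rw [← map_sub, mul_assoc]
  exact L.le_opNorm_of_le (h2 x hx y hy)

variable [NormedSpace ℝ X]

theorem isBddLip_of_contDiff {f : X → F} (hf : ContDiff ℝ 1 f) (hK : IsCompact K)
    (hc : Convex ℝ K) : IsBddLip K f := by
  obtain ⟨C, hC⟩ := hK.exists_bound_of_continuousOn hf.continuous.continuousOn
  obtain ⟨C', hC'⟩ := hK.exists_bound_of_continuousOn
    (hf.continuous_fderiv one_ne_zero).continuousOn
  refine ⟨max 0 (max C C'), le_max_left _ _, fun x hx => (hC x hx).trans (by simp),
    fun x hx y hy => ?_⟩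
  refine (hc.norm_image_sub_le_of_norm_fderiv_le (𝕜 := ℝ) (f := f) (C := C')
    (fun z _ => hf.differentiable one_ne_zero z) hC' hx hy).trans ?_
  gcongr
  simp

theorem exists_taylor_of_contDiff {f : X → F} (hf : ContDiff ℝ 2 f) (hK : IsCompact K)
    (hc : Convex ℝ K) :
    ∃ C, 0 ≤ C ∧ ∀ x ∈ K, ∀ y ∈ K, ‖f y - f x - fderiv ℝ f x (y - x)‖ ≤ C * ‖y - x‖ ^ 2 := by
  obtain ⟨C, h0, -, h2⟩ := isBddLip_of_contDiff (f := fderiv ℝ f)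
    (hf.fderiv_right (m := 1) (by norm_num)) hK hc
  refine ⟨C, h0, fun x hx y hy => ?_⟩
  have hseg : segment ℝ x y ⊆ K := hc.segment_subset hx hy
  have := (convex_segment x y).norm_image_sub_le_of_norm_hasFDerivWithin_le' (𝕜 := ℝ)
    (f := f) (f' := fderiv ℝ f) (φ := fderiv ℝ f x) (C := C * ‖y - x‖)
    (fun z hz => ((hf.differentiable two_ne_zero z).hasFDerivAt).hasFDerivWithinAt)
    (fun z hz => ?_) (left_mem_segment ℝ x y) (right_mem_segment ℝ x y)
  · exact this.trans (le_of_eq (by ring))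
  · refine (h2 x hx z (hseg hz)).trans ?_
    gcongr
    obtain ⟨t, ht, rfl⟩ := (segment_eq_image' ℝ x y ▸ hz : z ∈ _)
    simp only [add_sub_cancel_left, norm_smul, Real.norm_of_nonneg ht.1]
    nlinarith [norm_nonneg (y - x), ht.2]

theorem exists_pos_le_max {Y : Type*} [TopologicalSpace Y] {K : Set Y} (hK : IsCompact K)
    {f g : Y → ℝ} (hf : ContinuousOn f K) (hg : ContinuousOn g K)
    (h : ∀ x ∈ K, f x ≤ 0 → 0 < g x) : ∃ ε > 0, ∀ x ∈ K, ε ≤ max (f x) (g x) := by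
  rcases K.eq_empty_or_nonempty with rfl | hne
  · exact ⟨1, one_pos, by simp⟩
  · obtain ⟨x₀, hx₀, hmin⟩ := hK.exists_isMinOn hne (f := fun x => max (f x) (g x)) (by fun_prop)
    refine ⟨max (f x₀) (g x₀), ?_, fun x hx => hmin hx⟩
    rcases le_or_gt (f x₀) 0 with h1 | h1
    · exact lt_max_of_lt_right (h x₀ hx₀ h1)
    · exact lt_max_of_lt_left h1

/-- Grönwall's inequality on an interval on which the exponential factor is at most `2`. -/
theorem norm_le_of_norm_deriv_le {g g' : ℝ → F} {k δ ε b : ℝ} (hk : 0 < k) (hkb : k * b ≤ 1 / 2)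
    (hδ : 0 ≤ δ) (hε : 0 ≤ ε) (hg : ∀ s ∈ Icc 0 b, HasDerivWithinAt g (g' s) (Icc 0 b) s)
    (h0 : ‖g 0‖ ≤ δ) (h : ∀ s ∈ Ico 0 b, ‖g' s‖ ≤ k * ‖g s‖ + ε) {s : ℝ} (hs : s ∈ Icc 0 b) :
    ‖g s‖ ≤ 2 * δ + 2 * ε * s := by
  have h1 := norm_le_gronwallBound_of_norm_deriv_right_le
    (fun s hs => (hg s hs).continuousWithinAt)
    (fun s hs => (hg s (Ico_subset_Icc_self hs)).mono_of_mem_nhdsWithin (Icc_mem_nhdsGE_of_mem hs))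
    h0 h s hs
  refine h1.trans ?_
  rw [gronwallBound_of_K_ne_0 hk.ne', sub_zero]
  have hks : k * s ≤ 1 / 2 := (mul_le_mul_of_nonneg_left hs.2 hk.le).trans hkb
  have hks0 : 0 ≤ k * s := mul_nonneg hk.le hs.1
  have h2 := abs_le.1 (Real.abs_exp_sub_one_le (x := k * s) (by rw [abs_of_nonneg hks0]; linarith))
  rw [abs_of_nonneg hks0] at h2
  have h3 : ε / k * (Real.exp (k * s) - 1) ≤ ε / k * (2 * (k * s)) := by
    gcongr
    exact h2.2
  have h4 : ε / k * (2 * (k * s)) = 2 * ε * s := by field_simp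
  nlinarith [h2.2]

/-- Two-sided Grönwall estimate. No sign of `g` is assumed: the hypothesis forces `0 ≤ k * g`. -/
theorem exp_le_of_abs_deriv_le {g g' : ℝ → ℝ} {k a b : ℝ} (hab : a ≤ b)
    (hg : ∀ s ∈ Icc a b, HasDerivWithinAt g (g' s) (Icc a b) s)
    (h : ∀ s ∈ Icc a b, |g' s| ≤ k * g s) :
    Real.exp (-(k * (b - a))) * g a ≤ g b ∧ g b ≤ Real.exp (k * (b - a)) * g a := by
  have key : ∀ c : ℝ, (∀ s ∈ Icc a b, 0 ≤ c * g s + g' s) →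
      Real.exp (c * a) * g a ≤ Real.exp (c * b) * g b := by
    intro c hc
    have hd : ∀ s ∈ Icc a b, HasDerivWithinAt (fun s => Real.exp (c * s) * g s)
        (Real.exp (c * s) * (c * g s + g' s)) (Icc a b) s := by
      intro s hs
      have h1 : HasDerivWithinAt (fun s => Real.exp (c * s)) (Real.exp (c * s) * c)
          (Icc a b) s := by
        have := ((hasDerivAt_id s).const_mul c).exp
        simpa using this.hasDerivWithinAt
      exact (h1.mul (hg s hs)).congr_deriv (by ring)
    have hm : MonotoneOn (fun s => Real.exp (c * s) * g s) (Icc a b) := by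
      refine monotoneOn_of_hasDerivWithinAt_nonneg (convex_Icc a b)
        (fun s hs => (hd s hs).continuousWithinAt)
        (fun s hs => (hd s (interior_subset hs)).mono interior_subset) fun s hs => ?_
      exact mul_nonneg (Real.exp_pos _).le (hc s (interior_subset hs))
    exact hm (left_mem_Icc.2 hab) (right_mem_Icc.2 hab) hab
  constructor
  · have := key k fun s hs => by linarith [(abs_le.1 (h s hs)).1]
    have e : Real.exp (-(k * (b - a))) = Real.exp (k * a) * (Real.exp (k * b))⁻¹ := by
      rw [← Real.exp_neg, ← Real.exp_add]; congr 1; ring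
    rw [e]
    have hp := Real.exp_pos (k * b)
    calc _ = (Real.exp (k * b))⁻¹ * (Real.exp (k * a) * g a) := by ring
      _ ≤ (Real.exp (k * b))⁻¹ * (Real.exp (k * b) * g b) := by gcongr
      _ = g b := by field_simp
  · by_contra hlt
    have hd : ∀ s ∈ Icc a b, HasDerivWithinAt (fun s => - g s) (- g' s) (Icc a b) s :=
      fun s hs => (hg s hs).neg
    have hm : AntitoneOn (fun s => Real.exp (-(k * s)) * g s) (Icc a b) := by
      have hd : ∀ s ∈ Icc a b, HasDerivWithinAt (fun s => Real.exp (-(k * s)) * g s)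
          (Real.exp (-(k * s)) * (g' s - k * g s)) (Icc a b) s := by
        intro s hs
        have h1 : HasDerivWithinAt (fun s => Real.exp (-(k * s))) (Real.exp (-(k * s)) * (-k))
            (Icc a b) s := by
          have := ((hasDerivAt_id s).const_mul k).neg.exp
          simpa using this.hasDerivWithinAt
        exact (h1.mul (hg s hs)).congr_deriv (by ring)
      refine antitoneOn_of_hasDerivWithinAt_nonpos (convex_Icc a b)
        (fun s hs => (hd s hs).continuousWithinAt)
        (fun s hs => (hd s (interior_subset hs)).mono interior_subset) fun s hs => ?_
      exact mul_nonpos_of_nonneg_of_nonpos (Real.exp_pos _).le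
        (by linarith [(abs_le.1 (h s (interior_subset hs))).2])
    have := hm (left_mem_Icc.2 hab) (right_mem_Icc.2 hab) hab
    apply hlt
    have e : Real.exp (k * (b - a)) = Real.exp (-(k * a)) * (Real.exp (-(k * b)))⁻¹ := by
      rw [← Real.exp_neg, ← Real.exp_add]; congr 1; ring
    rw [e]
    have hp := Real.exp_pos (-(k * b))
    calc g b = (Real.exp (-(k * b)))⁻¹ * (Real.exp (-(k * b)) * g b) := by field_simp
      _ ≤ (Real.exp (-(k * b)))⁻¹ * (Real.exp (-(k * a)) * g a) := by gcongr
      _ = _ := by ring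

end Lip

/-! ### A global normalized defining function -/

section Geometry

variable {Ω : Set Plane}

theorem contDiff_gradient {ψ : Plane → ℝ} {m k : WithTop ℕ∞} (h : ContDiff ℝ m ψ)
    (hk : k + 1 ≤ m) : ContDiff ℝ k (gradient ψ) :=
  (InnerProductSpace.toDual ℝ Plane).symm.toContinuousLinearEquiv.contDiff.comp
    (h.fderiv_right hk)

theorem hasFDerivAt_gradient {ψ : Plane → ℝ} {x : Plane} (h : DifferentiableAt ℝ ψ x) :
    HasFDerivAt ψ (innerSL ℝ (gradient ψ x)) x := by
  have := h.hasGradientAt.hasFDerivAt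
  exact this

theorem hasDerivAt_line {ψ : Plane → ℝ} {n x w : Plane} {s : ℝ}
    (h : HasFDerivAt ψ (innerSL ℝ n) (x + s • w)) :
    HasDerivAt (fun s : ℝ => ψ (x + s • w)) ⟪n, w⟫ s := by
  have h1 : HasDerivAt (fun s : ℝ => x + s • w) w s := by
    simpa using ((hasDerivAt_id s).smul_const w).const_add x
  have := h.comp_hasDerivAt s h1
  rw [innerSL_apply_apply] at this
  exact this

theorem IsC5ConvexDomain.frontier_eq (hΩ : IsC5ConvexDomain Ω) :
    frontier Ω = closure Ω \ Ω := hΩ.isOpen.frontier_eq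

/-- Near a boundary point, a multiple of a local defining function has the sign pattern of a
signed distance and dominates the distance to the complement inside `Ω`. -/
theorem IsLocalDefiningFunction.exists_local (hΩ : IsC5ConvexDomain Ω) {x : Plane}
    (hx : x ∈ frontier Ω) {U : Set Plane} {ψ : Plane → ℝ} (h : IsLocalDefiningFunction Ω x U ψ) :
    ∃ V ∈ 𝓝 x, ∃ g : Plane → ℝ, ContDiffOn ℝ 5 g V ∧ ∀ y ∈ V,
      (y ∈ Ω → g y ≤ -Metric.infDist y Ωᶜ) ∧ (y ∈ frontier Ω → g y = 0) ∧
        (y ∉ closure Ω → 0 < g y) := by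
  set g := gradient ψ x with hg
  have ha : 0 < ‖g‖ := norm_pos_iff.2 h.gradient_ne
  have hU : U ∈ 𝓝 x := h.isOpen.mem_nhds h.mem
  have hdiff : ∀ y ∈ U, DifferentiableAt ℝ ψ y := fun y hy =>
    (h.contDiffOn.contDiffAt (h.isOpen.mem_nhds hy)).differentiableAt (by norm_num)
  have hcontU : ContinuousOn ψ U := h.contDiffOn.continuousOn
  have hneg : ∀ y ∈ U, (y ∈ Ω ↔ ψ y < 0) := by
    intro y hy
    have : y ∈ Ω ∩ U ↔ y ∈ U ∧ ψ y < 0 := by rw [h.inter_eq]; rfl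
    constructor
    · exact fun h1 => (this.1 ⟨h1, hy⟩).2
    · exact fun h1 => (this.2 ⟨hy, h1⟩).1
  have hbd : ∀ y ∈ U, y ∈ frontier Ω → ψ y = 0 := by
    intro y hy hyf
    rw [hΩ.frontier_eq] at hyf
    refine le_antisymm ?_ (not_lt.1 fun hlt => hyf.2 ((hneg y hy).2 hlt))
    by_contra hpos
    have hpos := not_le.1 hpos
    have hev : ∀ᶠ z in 𝓝 y, 0 < ψ z ∧ z ∈ U :=
      ((hcontU.continuousAt (h.isOpen.mem_nhds hy)).eventually (lt_mem_nhds hpos)).and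
        (h.isOpen.mem_nhds hy)
    obtain ⟨z, hzΩ, hz, hzU⟩ := ((mem_closure_iff_frequently.1 hyf.1).and_eventually hev).exists
    exact absurd ((hneg z hzU).1 hzΩ) (not_lt.2 hz.le)
  have hgc : ContinuousAt (fun y => fderiv ℝ ψ y g) x := by
    have h1 : ContinuousAt (fderiv ℝ ψ) x :=
      ((h.contDiffOn.contDiffAt hU).fderiv_right (m := 0) (by norm_num)).continuousAt
    exact h1.clm_apply continuousAt_const
  have hgx : fderiv ℝ ψ x g = ‖g‖ ^ 2 := by
    rw [(hasFDerivAt_gradient (hdiff x h.mem)).fderiv, innerSL_apply_apply, ← hg,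
      real_inner_self_eq_norm_sq]
  obtain ⟨ε, hε, hball⟩ : ∃ ε > 0, ∀ y ∈ Metric.ball x ε, ‖g‖ ^ 2 / 2 < fderiv ℝ ψ y g ∧ y ∈ U := by
    have h1 : ∀ᶠ y in 𝓝 x, ‖g‖ ^ 2 / 2 < fderiv ℝ ψ y g ∧ y ∈ U :=
      (hgc.eventually (lt_mem_nhds (by beta_reduce; rw [hgx]; nlinarith))).and hU
    exact Metric.eventually_nhds_iff_ball.1 h1
  -- growth of `ψ` along the direction `g`
  have hgrow : ∀ y s, 0 ≤ s → y ∈ Metric.ball x ε → y + s • g ∈ Metric.ball x ε →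
      ψ y + ‖g‖ ^ 2 / 2 * s ≤ ψ (y + s • g) := by
    intro y s hs hy hys
    have hseg : ∀ r ∈ Icc 0 s, y + r • g ∈ Metric.ball x ε := by
      intro r hr
      rcases hs.eq_or_lt with h0 | h0
      · have : r = 0 := le_antisymm (hr.2.trans h0.symm.le) hr.1
        simpa [this] using hy
      · have := (convex_ball x ε).add_smul_sub_mem hy hys
          (t := r / s) ⟨div_nonneg hr.1 hs, (div_le_one h0).2 hr.2⟩
        rw [add_sub_cancel_left, smul_smul, div_mul_cancel₀ _ h0.ne'] at this
        exact this
    have hd : ∀ r ∈ Icc 0 s, HasDerivAt (fun r : ℝ => ψ (y + r • g) - ‖g‖ ^ 2 / 2 * r)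
        (fderiv ℝ ψ (y + r • g) g - ‖g‖ ^ 2 / 2) r := by
      intro r hr
      have h1 : HasDerivAt (fun r : ℝ => y + r • g) g r := by
        simpa using ((hasDerivAt_id r).smul_const g).const_add y
      have h2 := (hdiff _ (hball _ (hseg r hr)).2).hasFDerivAt.comp_hasDerivAt r h1
      have h3 := (hasDerivAt_id r).const_mul (‖g‖ ^ 2 / 2)
      simp only [mul_one, id] at h3
      exact h2.sub h3
    have hm : MonotoneOn (fun r : ℝ => ψ (y + r • g) - ‖g‖ ^ 2 / 2 * r) (Icc 0 s) := by
      refine monotoneOn_of_hasDerivWithinAt_nonneg (convex_Icc 0 s)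
        (fun r hr => (hd r hr).continuousAt.continuousWithinAt)
        (fun r hr => (hd r (interior_subset hr)).hasDerivWithinAt) fun r hr => ?_
      linarith [(hball _ (hseg r (interior_subset hr))).1]
    have := hm (left_mem_Icc.2 hs) (right_mem_Icc.2 hs) hs
    simp only [zero_smul, add_zero, mul_zero, sub_zero] at this
    linarith
  have hψx : ψ x = 0 := hbd x h.mem hx
  obtain ⟨V, hV, hVsub⟩ : ∃ V ∈ 𝓝 x, ∀ y ∈ V, y ∈ Metric.ball x (ε / 2) ∧
      2 * |ψ y| / ‖g‖ < ε / 2 := by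
    have h1 : ContinuousAt (fun y => 2 * |ψ y| / ‖g‖) x := by
      have : ContinuousAt ψ x := hcontU.continuousAt hU
      fun_prop
    have h2 : ∀ᶠ y in 𝓝 x, 2 * |ψ y| / ‖g‖ < ε / 2 :=
      h1.eventually (gt_mem_nhds (by simp [hψx, hε]))
    have h3 : ∀ᶠ y in 𝓝 x, y ∈ Metric.ball x (ε / 2) := Metric.ball_mem_nhds x (half_pos hε)
    exact ⟨_, h3.and h2, fun y hy => hy⟩
  have hV' : ∀ y ∈ V, y ∈ Metric.ball x ε := fun y hy =>
    Metric.ball_subset_ball (by linarith) (hVsub y hy).1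
  refine ⟨V, hV, fun y => 2 / ‖g‖ * ψ y, contDiffOn_const.mul
    (h.contDiffOn.mono fun y hy => (hball y (hV' y hy)).2), fun y hy => ⟨?_, ?_, ?_⟩⟩
  · intro hyΩ
    have hyneg : ψ y < 0 := (hneg y (hball y (hV' y hy)).2).1 hyΩ
    set s := 2 * |ψ y| / ‖g‖ ^ 2 with hs
    have hs0 : 0 ≤ s := by positivity
    have hsg : s * ‖g‖ = 2 * |ψ y| / ‖g‖ := by rw [hs]; field_simp
    have hys : y + s • g ∈ Metric.ball x ε := by
      rw [Metric.mem_ball]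
      calc dist (y + s • g) x ≤ dist (y + s • g) y + dist y x := dist_triangle _ _ _
        _ < ε / 2 + ε / 2 := by
          refine add_lt_add ?_ (hVsub y hy).1
          rw [dist_eq_norm, add_sub_cancel_left, norm_smul, Real.norm_of_nonneg hs0, hsg]
          exact (hVsub y hy).2
        _ = ε := by ring
    have h1 := hgrow y s hs0 (hV' y hy) hys
    have h2 : ‖g‖ ^ 2 / 2 * s = |ψ y| := by rw [hs]; field_simp
    rw [h2, abs_of_neg hyneg] at h1
    have h3 : y + s • g ∈ Ωᶜ := fun hc => by
      have := (hneg _ (hball _ hys).2).1 hc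
      linarith
    have h4 := Metric.infDist_le_dist_of_mem (x := y) h3
    rw [dist_eq_norm, sub_add_cancel_left, norm_neg, norm_smul, Real.norm_of_nonneg hs0, hsg,
      abs_of_neg hyneg] at h4
    have h5 : 2 / ‖g‖ * ψ y = -(2 * -ψ y / ‖g‖) := by ring
    beta_reduce
    rw [h5]
    linarith
  · intro hyf
    simp [hbd y (hball y (hV' y hy)).2 hyf]
  · intro hyc
    have h0 : 0 ≤ ψ y := not_lt.1 fun hlt =>
      hyc (subset_closure ((hneg y (hball y (hV' y hy)).2).2 hlt))
    refine mul_pos (by positivity) (lt_of_le_of_ne h0 fun h0 => ?_)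
    -- if `ψ y = 0`, points slightly behind `y` would belong to `Ω`
    have hc : Tendsto (fun s : ℝ => y - s • g) (𝓝[>] 0) (𝓝 y) := by
      have : Continuous fun s : ℝ => y - s • g := by fun_prop
      simpa using (this.tendsto 0).mono_left nhdsWithin_le_nhds
    have e1 := hc.eventually_mem (Metric.isOpen_ball.mem_nhds (hV' y hy))
    have e2 := hc.eventually_mem (isClosed_closure.isOpen_compl.mem_nhds hyc)
    obtain ⟨s, hs1, hs2, hs3⟩ := (e1.and (e2.and self_mem_nhdsWithin)).exists
    have hs3 : 0 < s := hs3
    have := hgrow (y - s • g) s hs3.le hs1 (by simpa using hV' y hy)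
    rw [sub_add_cancel, ← h0] at this
    have hlt : ψ (y - s • g) < 0 := by
      have : 0 < ‖g‖ ^ 2 / 2 * s := by positivity
      linarith
    exact hs2 (subset_closure ((hneg _ (hball _ hs1).2).2 hlt))

theorem IsC5ConvexDomain.compl_nonempty (hΩ : IsC5ConvexDomain Ω) : (Ωᶜ).Nonempty := by
  rw [nonempty_compl]
  rintro rfl
  exact NormedSpace.unbounded_univ ℝ Plane hΩ.isBounded

/-- A global function of class `C⁵` with the sign pattern of a signed distance. The admissible
values at each point form a convex set, so local defining functions, suitably scaled, can be glued
by a partition of unity. The quantitative bound inside keeps the gradient on the boundary nonzero.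
-/
theorem IsC5ConvexDomain.exists_contDiff_signed (hΩ : IsC5ConvexDomain Ω) :
    ∃ ψ : Plane → ℝ, ContDiff ℝ 5 ψ ∧ ∀ y, (y ∈ Ω → ψ y ≤ -Metric.infDist y Ωᶜ) ∧
      (y ∈ frontier Ω → ψ y = 0) ∧ (y ∉ closure Ω → 0 < ψ y) := by
  let t : Plane → Set ℝ := fun y => {r | (y ∈ Ω → r ≤ -Metric.infDist y Ωᶜ) ∧
      (y ∈ frontier Ω → r = 0) ∧ (y ∉ closure Ω → 0 < r)}
  have ht : ∀ y, Convex ℝ (t y) := by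
    intro y a ha b hb p q hp hq hpq
    refine ⟨fun hy => ?_, fun hy => ?_, fun hy => ?_⟩
    · have h1 := ha.1 hy
      have h2 := hb.1 hy
      simp only [smul_eq_mul]
      calc p * a + q * b ≤ p * -Metric.infDist y Ωᶜ + q * -Metric.infDist y Ωᶜ := by gcongr
        _ = _ := by rw [← add_mul, hpq, one_mul]
    · simp [ha.2.1 hy, hb.2.1 hy]
    · have h1 := ha.2.2 hy
      have h2 := hb.2.2 hy
      simp only [smul_eq_mul]
      rcases hp.eq_or_lt with h0 | h0
      · have : q = 1 := by linarith
        subst this; rw [← h0]; linarith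
      · have := mul_pos h0 h1
        have := mul_nonneg hq h2.le
        linarith
  obtain ⟨g, hg⟩ := exists_contMDiffMap_forall_mem_convex_of_local (n := 5)
    (modelWithCornersSelf ℝ Plane) (F := ℝ) ht (fun x => by
    by_cases hx : x ∈ Ω
    · refine ⟨Ω ∩ Metric.ball x 1, inter_mem (hΩ.isOpen.mem_nhds hx)
        (Metric.ball_mem_nhds x one_pos), fun _ => -(Metric.infDist x Ωᶜ + 1),
        contMDiffOn_const, fun y hy => ⟨fun _ => ?_, fun hyf => ?_, fun hyc => ?_⟩⟩
      · have h1 := Metric.infDist_le_infDist_add_dist (s := Ωᶜ) (x := y) (y := x)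
        have h2 : dist y x < 1 := hy.2
        linarith
      · rw [hΩ.frontier_eq] at hyf
        exact absurd hy.1 hyf.2
      · exact absurd (subset_closure hy.1) hyc
    · by_cases hxc : x ∈ closure Ω
      · have hxf : x ∈ frontier Ω := by rw [hΩ.frontier_eq]; exact ⟨hxc, hx⟩
        obtain ⟨U, ψ, hψ⟩ := hΩ.boundary x hxf
        obtain ⟨V, hV, g, hg, hgV⟩ := hψ.exists_local hΩ hxf
        exact ⟨V, hV, g, hg.contMDiffOn, hgV⟩
      · refine ⟨(closure Ω)ᶜ, isClosed_closure.isOpen_compl.mem_nhds hxc, fun _ => 1,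
          contMDiffOn_const, fun y hy => ⟨fun h => ?_, fun h => ?_, fun _ => one_pos⟩⟩
        · exact absurd (subset_closure h) hy
        · exact absurd (frontier_subset_closure h) hy)
  exact ⟨g, g.contMDiff.contDiff, hg⟩

theorem IsC5ConvexDomain.exists_closedBall_subset (hΩ : IsC5ConvexDomain Ω) :
    ∃ c, ∃ r > 0, Metric.closedBall c r ⊆ Ω := by
  obtain ⟨c, hc⟩ := hΩ.nonempty
  obtain ⟨r, hr, h⟩ := Metric.isOpen_iff.1 hΩ.isOpen c hc
  exact ⟨c, r / 2, half_pos hr, (Metric.closedBall_subset_ball (half_lt_self hr)).trans h⟩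

/-- A global defining function of class `C⁴` whose gradient `n` is the outer unit normal on the
boundary; the last clause is the convexity of `Ω` expressed by second derivatives. -/
theorem IsC5ConvexDomain.exists_definingFunction (hΩ : IsC5ConvexDomain Ω) :
    ∃ (ψ : Plane → ℝ) (n : Plane → Plane), ContDiff ℝ 3 n ∧
      (∀ x, HasFDerivAt ψ (innerSL ℝ (n x)) x) ∧ (∀ x, x ∈ Ω ↔ ψ x < 0) ∧
      (∀ x, x ∈ frontier Ω ↔ ψ x = 0) ∧
      ∀ x ∈ frontier Ω, n x = outerNormal Ω x ∧ ‖n x‖ = 1 ∧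
        ∀ w, ⟪n x, w⟫ = 0 → 0 ≤ ⟪fderiv ℝ n x w, w⟫ := by
  obtain ⟨φ, hφ, hsign⟩ := hΩ.exists_contDiff_signed
  obtain ⟨c, r, hr, hball⟩ := hΩ.exists_closedBall_subset
  have hint : interior Ω = Ω := hΩ.isOpen.interior_eq
  have hneg : ∀ x ∈ Ω, φ x < 0 := by
    intro x hx
    have h1 : 0 < Metric.infDist x Ωᶜ :=
      (hΩ.isOpen.isClosed_compl.notMem_iff_infDist_pos hΩ.compl_nonempty).1 (by simpa using hx)
    linarith [(hsign x).1 hx]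
  have hφd : ∀ x, HasFDerivAt φ (innerSL ℝ (gradient φ x)) x := fun x =>
    hasFDerivAt_gradient (hφ.differentiable (by norm_num) x)
  -- a right derivative of a function that is below a line through the origin
  have hslope : ∀ (q : ℝ → ℝ) (q' a : ℝ), HasDerivAt q q' 0 → q 0 = 0 →
      (∀ s ∈ Ioc (0 : ℝ) 1, q s ≤ -(s * a)) → q' ≤ -a := by
    intro q q' a hq h0 hle
    have h1 := (hasDerivAt_iff_tendsto_slope.1 hq).mono_left
      (nhdsWithin_mono (0 : ℝ) fun y (hy : y ∈ Ioi (0 : ℝ)) => ne_of_gt hy)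
    refine le_of_tendsto h1 ?_
    filter_upwards [Ioc_mem_nhdsGT (one_pos : (0 : ℝ) < 1)] with s hs
    rw [slope_def_field, h0, sub_zero, sub_zero, div_le_iff₀ hs.1]
    linarith [hle s hs]
  have hgrad : ∀ x ∈ frontier Ω, gradient φ x ≠ 0 := by
    intro x hx h0
    have hxc := frontier_subset_closure hx
    have h1 : HasDerivAt (fun s : ℝ => φ (x + s • (c - x))) ⟪gradient φ x, c - x⟫ 0 :=
      hasDerivAt_line (by simpa using hφd x)
    have h2 := hslope _ _ r h1 (by simpa using (hsign x).2.1 hx) (fun s hs => by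
      have hmem : ∀ w ∈ Metric.closedBall c r, x + s • (w - x) ∈ Ω := by
        intro w hw
        have := hΩ.convex.add_smul_sub_mem_interior' hxc (hint.symm ▸ hball hw) hs
        rwa [hint] at this
      have h3 : s * r ≤ Metric.infDist (x + s • (c - x)) Ωᶜ := by
        rw [Metric.le_infDist hΩ.compl_nonempty]
        intro y hy
        by_contra hlt
        have hlt := not_le.1 hlt
        apply hy
        have := hmem (c + s⁻¹ • (y - (x + s • (c - x)))) (by
          rw [Metric.mem_closedBall, dist_eq_norm, add_sub_cancel_left, norm_smul, norm_inv,
            Real.norm_of_nonneg hs.1.le, inv_mul_le_iff₀ hs.1, ← dist_eq_norm, dist_comm]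
          exact hlt.le)
        convert this using 1
        have hs0 : s ≠ 0 := hs.1.ne'
        rw [add_sub_right_comm, smul_add, smul_smul, mul_inv_cancel₀ hs0, one_smul]
        abel
      linarith [(hsign _).1 (hmem c (Metric.mem_closedBall_self hr.le))])
    rw [h0, inner_zero_left] at h2
    linarith
  set q : Plane → ℝ := fun x => ‖gradient φ x‖ ^ 2 + φ x ^ 2 with hq
  have hqpos : ∀ x, 0 < q x := by
    intro x
    by_cases hx : x ∈ Ω
    · have := hneg x hx
      have : 0 < φ x ^ 2 := by nlinarith
      simp only [hq]; positivity
    · by_cases hxc : x ∈ closure Ω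
      · have hxf : x ∈ frontier Ω := by rw [hΩ.frontier_eq]; exact ⟨hxc, hx⟩
        have : 0 < ‖gradient φ x‖ := norm_pos_iff.2 (hgrad x hxf)
        simp only [hq]; positivity
      · have := (hsign x).2.2 hxc
        simp only [hq]; positivity
  have hgc : ContDiff ℝ 4 (gradient φ) := contDiff_gradient hφ (by norm_num)
  have hφ4 : ContDiff ℝ 4 φ := hφ.of_le (by norm_num)
  have hqc : ContDiff ℝ 4 q := (hgc.norm_sq ℝ).add (hφ4.pow 2)
  set m : Plane → ℝ := fun x => (Real.sqrt (q x))⁻¹ with hm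
  have hmpos : ∀ x, 0 < m x := fun x => inv_pos.2 (Real.sqrt_pos.2 (hqpos x))
  have hmc : ContDiff ℝ 4 m := (hqc.sqrt fun x => (hqpos x).ne').inv fun x =>
    (Real.sqrt_pos.2 (hqpos x)).ne'
  set ψ : Plane → ℝ := fun x => m x * φ x with hψ
  have hψc : ContDiff ℝ 4 ψ := hmc.mul hφ4
  have hψd : ∀ x, HasFDerivAt ψ (innerSL ℝ (gradient ψ x)) x := fun x =>
    hasFDerivAt_gradient (hψc.differentiable (by norm_num) x)
  have hΩiff : ∀ x, x ∈ Ω ↔ ψ x < 0 := by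
    intro x
    constructor
    · exact fun hx => mul_neg_of_pos_of_neg (hmpos x) (hneg x hx)
    · intro hlt
      by_contra hx
      have h0 : 0 ≤ φ x := by
        by_cases hxc : x ∈ closure Ω
        · exact ((hsign x).2.1 (by rw [hΩ.frontier_eq]; exact ⟨hxc, hx⟩)).ge
        · exact ((hsign x).2.2 hxc).le
      exact absurd hlt (not_lt.2 (mul_nonneg (hmpos x).le h0))
  have hfr : ∀ x, x ∈ frontier Ω ↔ ψ x = 0 := by
    intro x
    constructor
    · intro hx
      simp only [hψ, (hsign x).2.1 hx, mul_zero]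
    · intro h0
      have h0 : φ x = 0 := by
        rcases mul_eq_zero.1 h0 with h | h
        · exact absurd h (hmpos x).ne'
        · exact h
      rw [hΩ.frontier_eq]
      refine ⟨by_contra fun hxc => ((hsign x).2.2 hxc).ne' h0, fun hx => (hneg x hx).ne h0⟩
  have hnx : ∀ x ∈ frontier Ω, gradient ψ x = ‖gradient φ x‖⁻¹ • gradient φ x := by
    intro x hx
    have h0 : φ x = 0 := (hsign x).2.1 hx
    have h1 := ((hmc.differentiable (by norm_num) x).hasFDerivAt).mul (hφd x)
    have h2 := h1.unique (hψd x)
    rw [h0, zero_smul, add_zero] at h2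
    have h3 : m x = ‖gradient φ x‖⁻¹ := by
      simp only [hm, hq, h0]
      rw [zero_pow two_ne_zero, add_zero, Real.sqrt_sq (norm_nonneg _)]
    rw [h3] at h2
    refine ext_inner_right ℝ fun w => ?_
    have := congrArg (fun L => L w) h2
    simp only [smul_apply, innerSL_apply_apply, smul_eq_mul] at this
    rw [← this, real_inner_smul_left]
  have hnorm : ∀ x ∈ frontier Ω, ‖gradient ψ x‖ = 1 := by
    intro x hx
    rw [hnx x hx, norm_smul, norm_inv, norm_norm, inv_mul_cancel₀ (norm_ne_zero_iff.2 (hgrad x hx))]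
  refine ⟨ψ, gradient ψ, contDiff_gradient hψc (by norm_num), hψd, hΩiff, hfr, fun x hx =>
    ⟨?_, hnorm x hx, fun w hw => ?_⟩⟩
  · refine IsOuterUnitNormal.unique hΩ.isOpen hx ⟨hnorm x hx, univ, φ, ‖gradient φ x‖, ?_,
      norm_pos_iff.2 (hgrad x hx), ?_⟩ (isOuterUnitNormal_outerNormal hΩ hx)
    · refine ⟨isOpen_univ, mem_univ x, hφ.contDiffOn, hgrad x hx, ?_⟩
      ext y
      rw [inter_univ, hΩiff y]
      simp only [mem_univ, true_and, mem_ofPred_eq, hψ]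
      constructor
      · intro h; by_contra h'
        exact absurd h (not_lt.2 (mul_nonneg (hmpos y).le (not_lt.1 h')))
      · exact fun h => mul_neg_of_pos_of_neg (hmpos y) h
    · rw [hnx x hx, smul_smul, mul_inv_cancel₀ (norm_ne_zero_iff.2 (hgrad x hx)), one_smul]
  · -- the tangent line at `x` does not meet `Ω`, so `ψ ≥ 0` along it
    have hψx : ψ x = 0 := (hfr x).1 hx
    have hxc := frontier_subset_closure hx
    have hout : ∀ ε : ℝ, 0 ≤ ψ (x + ε • w) := by
      intro ε
      by_contra hlt
      have hy : x + ε • w ∈ Ω := (hΩiff _).2 (not_le.1 hlt)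
      obtain ⟨δ, hδ, hb⟩ := Metric.isOpen_iff.1 hΩ.isOpen _ hy
      set y := x + ε • w + (δ / 2) • gradient ψ x with hyd
      have hyΩ : y ∈ Ω := hb (by
        rw [Metric.mem_ball, dist_eq_norm, hyd, add_sub_cancel_left, norm_smul, hnorm x hx,
          Real.norm_of_nonneg (by positivity)]
        linarith)
      have h1 : HasDerivAt (fun s : ℝ => ψ (x + s • (y - x))) ⟪gradient ψ x, y - x⟫ 0 :=
        hasDerivAt_line (by simpa using hψd x)
      have h2 := hslope _ _ 0 h1 (by simpa using hψx) (fun s hs => by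
        have := hΩ.convex.add_smul_sub_mem_interior' hxc (hint.symm ▸ hyΩ) hs
        rw [hint, hΩiff] at this
        simpa using this.le)
      have h3 : ⟪gradient ψ x, y - x⟫ = δ / 2 := by
        have : y - x = ε • w + (δ / 2) • gradient ψ x := by rw [hyd]; abel
        rw [this, inner_add_right, real_inner_smul_right, real_inner_smul_right, hw,
          real_inner_self_eq_norm_sq, hnorm x hx]
        ring
      linarith
    by_contra hlt
    have hlt := not_le.1 hlt
    have hd1 : ∀ s : ℝ, HasDerivAt (fun s : ℝ => ψ (x + s • w)) ⟪gradient ψ (x + s • w), w⟫ s :=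
      fun s => hasDerivAt_line (hψd _)
    have hd2 : HasDerivAt (fun s : ℝ => ⟪gradient ψ (x + s • w), w⟫)
        ⟪fderiv ℝ (gradient ψ) x w, w⟫ 0 := by
      have h1 : HasDerivAt (fun s : ℝ => x + s • w) w 0 := by
        simpa using ((hasDerivAt_id (0 : ℝ)).smul_const w).const_add x
      have h2 : HasFDerivAt (gradient ψ) (fderiv ℝ (gradient ψ) x) (x + (0 : ℝ) • w) := by
        rw [zero_smul, add_zero]
        exact ((contDiff_gradient hψc (k := 3) (by norm_num)).differentiable
          (by norm_num) x).hasFDerivAt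
      have h3 := (h2.comp_hasDerivAt (0 : ℝ) h1).inner ℝ (hasDerivAt_const (0 : ℝ) w)
      simpa using h3
    have h1 := (hasDerivAt_iff_tendsto_slope.1 hd2).mono_left
      (nhdsWithin_mono (0 : ℝ) fun y (hy : y ∈ Ioi (0 : ℝ)) => ne_of_gt hy)
    obtain ⟨ε, hε, hεs⟩ : ∃ ε > (0 : ℝ), ∀ s ∈ Ioo 0 ε, ⟪gradient ψ (x + s • w), w⟫ < 0 := by
      have h2 := h1.eventually (gt_mem_nhds hlt)
      obtain ⟨ε, hε, h3⟩ := mem_nhdsGT_iff_exists_Ioo_subset.1 h2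
      refine ⟨ε, hε, fun s hs => ?_⟩
      have h4 : slope (fun s : ℝ => ⟪gradient ψ (x + s • w), w⟫) 0 s < 0 := h3 hs
      rw [slope_def_field, zero_smul, add_zero, hw, sub_zero, sub_zero] at h4
      by_contra h5
      exact absurd h4 (not_lt.2 (div_nonneg (not_lt.1 h5) hs.1.le))
    obtain ⟨s, hs, hs'⟩ := exists_hasDerivAt_eq_slope (fun s : ℝ => ψ (x + s • w)) _
      (half_pos hε) (fun s _ => (hd1 s).continuousAt.continuousWithinAt) (fun s _ => hd1 s)
    have h5 := hεs s ⟨hs.1, hs.2.trans (half_lt_self hε)⟩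
    rw [hs', zero_smul, add_zero, hψx] at h5
    have h6 := hout (ε / 2)
    have : 0 ≤ (ψ (x + (ε / 2) • w) - 0) / (ε / 2 - 0) := by
      apply div_nonneg <;> linarith
    linarith

end Geometry

/-! ### The relativistic velocity -/

section Velocity

/-- The Lorentz factor `√(1 + |u|²)`. -/
noncomputable def lorentz (u : Plane) : ℝ := Real.sqrt (1 + ‖u‖ ^ 2)

theorem lorentz_sq (u : Plane) : lorentz u ^ 2 = 1 + ‖u‖ ^ 2 := Real.sq_sqrt (by positivity)

theorem one_le_lorentz (u : Plane) : 1 ≤ lorentz u :=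
  Real.one_le_sqrt.2 (by nlinarith [sq_nonneg ‖u‖])

theorem lorentz_pos (u : Plane) : 0 < lorentz u := one_pos.trans_le (one_le_lorentz u)

theorem norm_le_lorentz (u : Plane) : ‖u‖ ≤ lorentz u :=
  Real.le_sqrt_of_sq_le (by linarith)

theorem relVelocity_eq (u : Plane) : relVelocity u = (lorentz u)⁻¹ • u := rfl

theorem lorentz_smul_relVelocity (u : Plane) : lorentz u • relVelocity u = u := by
  rw [relVelocity_eq, smul_smul, mul_inv_cancel₀ (lorentz_pos u).ne', one_smul]

theorem contDiff_lorentz {k : WithTop ℕ∞} : ContDiff ℝ k lorentz :=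
  (contDiff_const.add (contDiff_norm_sq ℝ)).sqrt fun u => by positivity

theorem contDiff_relVelocity {k : WithTop ℕ∞} : ContDiff ℝ k relVelocity :=
  (contDiff_lorentz.inv fun u => (lorentz_pos u).ne').smul contDiff_id

theorem norm_relVelocity_le (u : Plane) : ‖relVelocity u‖ ≤ 1 := by
  rw [relVelocity_eq, norm_smul, norm_inv, Real.norm_of_nonneg (lorentz_pos u).le,
    inv_mul_le_iff₀ (lorentz_pos u), mul_one]
  exact norm_le_lorentz u

theorem abs_lorentz_sub_le (u w : Plane) : |lorentz w - lorentz u| ≤ ‖u - w‖ := by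
  have h1 : (lorentz w - lorentz u) * (lorentz w + lorentz u) = (‖w‖ - ‖u‖) * (‖w‖ + ‖u‖) := by
    nlinarith [lorentz_sq u, lorentz_sq w]
  have h2 : 0 < lorentz w + lorentz u := add_pos (lorentz_pos w) (lorentz_pos u)
  have h3 : |lorentz w - lorentz u| * (lorentz w + lorentz u) ≤
      ‖u - w‖ * (lorentz w + lorentz u) := by
    rw [← abs_of_pos h2, ← abs_mul, h1, abs_mul, abs_of_pos h2,
      abs_of_nonneg (by positivity : 0 ≤ ‖w‖ + ‖u‖)]
    gcongr
    · rw [norm_sub_rev]; exact abs_norm_sub_norm_le w u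
    · exact norm_le_lorentz w
    · exact norm_le_lorentz u
  exact le_of_mul_le_mul_right h3 h2

theorem norm_relVelocity_sub_le (u w : Plane) : ‖relVelocity u - relVelocity w‖ ≤ 2 * ‖u - w‖ := by
  have hu := lorentz_pos u
  have hw := lorentz_pos w
  have e : relVelocity u - relVelocity w =
      (lorentz u)⁻¹ • (u - w) + ((lorentz w - lorentz u) * (lorentz u)⁻¹) • relVelocity w := by
    have : (lorentz w - lorentz u) * (lorentz u)⁻¹ * (lorentz w)⁻¹ =
        (lorentz u)⁻¹ - (lorentz w)⁻¹ := by field_simp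
    rw [relVelocity_eq, relVelocity_eq, smul_smul, this]
    module
  rw [e]
  have h1 : (lorentz u)⁻¹ ≤ 1 := inv_le_one_of_one_le₀ (one_le_lorentz u)
  have h0 : 0 ≤ (lorentz u)⁻¹ := (inv_pos.2 hu).le
  refine (norm_add_le _ _).trans ?_
  rw [norm_smul, norm_smul, norm_mul, Real.norm_of_nonneg h0, Real.norm_eq_abs]
  have h2 : (lorentz u)⁻¹ * ‖u - w‖ ≤ 1 * ‖u - w‖ := by gcongr
  have h3 : |lorentz w - lorentz u| * (lorentz u)⁻¹ * ‖relVelocity w‖ ≤ ‖u - w‖ * 1 * 1 := by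
    gcongr
    · exact abs_lorentz_sub_le u w
    · exact norm_relVelocity_le w
  linarith

theorem norm_fderiv_relVelocity_le (u : Plane) : ‖fderiv ℝ relVelocity u‖ ≤ 2 := by
  have : LipschitzWith 2 relVelocity := LipschitzWith.of_dist_le_mul fun x y => by
    simpa [dist_eq_norm] using norm_relVelocity_sub_le x y
  simpa using norm_fderiv_le_of_lipschitz ℝ this (x₀ := u)

theorem lorentz_eq_of_norm_eq {u w : Plane} (h : ‖u‖ = ‖w‖) : lorentz u = lorentz w := by
  rw [lorentz, lorentz, h]

theorem relVelocity_neg (u : Plane) : relVelocity (-u) = -relVelocity u := by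
  rw [relVelocity_eq, relVelocity_eq, lorentz_eq_of_norm_eq (norm_neg u), smul_neg]

end Velocity

/-! ### Billiard systems and their free flow -/

/-- Points `(x, u)` of phase space. -/
abbrev Phase := Plane × Plane

/-- The data of the bouncing problem in a form that is convenient for estimates: a convex domain
`Ω = {ψ < 0}` with a normalized defining function, and a bounded Lipschitz force field that is
defined for all times and positions and is `C^{1,lam}` on `closure Ω`, with derivative `E'`. One
constant `M` bounds the field and all its moduli of continuity. Convexity enters through `hess`, the
second fundamental form of the boundary, and the force through `E_normal` and `E_normal_pos`: on the
boundary its normal component is time-independent and points outwards. -/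
structure BilliardSystem where
  Ω : Set Plane
  ψ : Plane → ℝ
  n : Plane → Plane
  E : ℝ → Plane → Plane
  E' : ℝ → Plane → Plane →L[ℝ] Plane
  lam : ℝ
  M : ℝ
  lam_pos : 0 < lam
  lam_lt_one : lam < 1
  one_le_M : 1 ≤ M
  nonempty : Ω.Nonempty
  convex : Convex ℝ Ω
  bounded : Bornology.IsBounded Ω
  hasFDerivAt_ψ : ∀ x, HasFDerivAt ψ (innerSL ℝ (n x)) x
  n_contDiff : ContDiff ℝ 3 n
  mem_iff : ∀ x, x ∈ Ω ↔ ψ x < 0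
  mem_closure_iff : ∀ x, x ∈ closure Ω ↔ ψ x ≤ 0
  norm_n : ∀ x, ψ x = 0 → ‖n x‖ = 1
  hess : ∀ x, ψ x = 0 → ∀ w, ⟪n x, w⟫ = 0 → 0 ≤ ⟪fderiv ℝ n x w, w⟫
  E_cont : Continuous fun p : ℝ × Plane => E p.1 p.2
  E_bdd : ∀ t x, ‖E t x‖ ≤ M
  E_lip : ∀ t x y, ‖E t y - E t x‖ ≤ M * ‖y - x‖
  E'_cont : Continuous fun p : ℝ × Plane => E' p.1 p.2
  E'_bdd : ∀ t x, ‖E' t x‖ ≤ M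
  E_taylor : ∀ t, ∀ x ∈ closure Ω, ∀ y ∈ closure Ω,
    ‖E t y - E t x - E' t x (y - x)‖ ≤ M * ‖y - x‖ ^ (1 + lam)
  E_normal : ∀ t x, ψ x = 0 → ⟪E t x, n x⟫ = ⟪E 0 x, n x⟫
  E_normal_pos : ∀ x, ψ x = 0 → 0 < ⟪E 0 x, n x⟫

namespace BilliardSystem

variable (S : BilliardSystem)

theorem M_pos : 0 < S.M := one_pos.trans_le S.one_le_M

/-- The vector field of the backward characteristics in the variables `(x, u)`, `u = -v`. -/
noncomputable def W (t : ℝ) (z : Phase) : Phase := (relVelocity z.2, S.E t z.1)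

/-- The derivative of the vector field `W t`. -/
noncomputable def DW (t : ℝ) (z : Phase) : Phase →L[ℝ] Phase :=
  ((fderiv ℝ relVelocity z.2).comp (ContinuousLinearMap.snd ℝ Plane Plane)).prod
    ((S.E' t z.1).comp (ContinuousLinearMap.fst ℝ Plane Plane))

theorem DW_apply (t : ℝ) (z ξ : Phase) :
    S.DW t z ξ = (fderiv ℝ relVelocity z.2 ξ.2, S.E' t z.1 ξ.1) := rfl

/-- A Lipschitz constant of the vector field. -/
noncomputable def L : ℝ := S.M + 2

/-- The length of time for which the free flow is considered. -/
noncomputable def b : ℝ := 1 / (2 * S.L)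

theorem L_pos : 0 < S.L := by have := S.M_pos; unfold L; linarith

theorem b_pos : 0 < S.b := by have := S.L_pos; unfold b; positivity

theorem L_mul_b : S.L * S.b = 1 / 2 := by have := S.L_pos; unfold b; field_simp

theorem b_le_one : S.b ≤ 1 := by
  have h1 := S.L_mul_b
  have h2 : 2 < S.L := by have := S.M_pos; unfold L; linarith
  nlinarith [S.b_pos]

theorem norm_W_le (t : ℝ) (z : Phase) : ‖S.W t z‖ ≤ S.M :=
  (Prod.norm_def _).trans_le
    (max_le ((norm_relVelocity_le _).trans S.one_le_M) (S.E_bdd _ _))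

theorem norm_W_sub_le (t : ℝ) (z z' : Phase) : ‖S.W t z' - S.W t z‖ ≤ S.L * ‖z' - z‖ := by
  have hM := S.M_pos
  refine (Prod.norm_def _).trans_le (max_le ?_ ?_)
  · refine (norm_relVelocity_sub_le _ _).trans ?_
    have := norm_snd_le (z' - z)
    unfold L
    have h0 : 0 ≤ ‖z' - z‖ := norm_nonneg _
    have : ‖z'.2 - z.2‖ ≤ ‖z' - z‖ := this
    nlinarith
  · refine (S.E_lip _ _ _).trans ?_
    have := norm_fst_le (z' - z)
    unfold L
    have h0 : 0 ≤ ‖z' - z‖ := norm_nonneg _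
    have : ‖z'.1 - z.1‖ ≤ ‖z' - z‖ := this
    nlinarith

theorem norm_DW_le (t : ℝ) (z : Phase) : ‖S.DW t z‖ ≤ S.L := by
  refine ContinuousLinearMap.opNorm_le_bound _ S.L_pos.le fun ξ => ?_
  have hM := S.M_pos
  have h0 : 0 ≤ ‖ξ‖ := norm_nonneg _
  rw [DW_apply]
  refine (Prod.norm_def _).trans_le (max_le ?_ ?_)
  · refine ((fderiv ℝ relVelocity z.2).le_of_opNorm_le_of_le (norm_fderiv_relVelocity_le _)
      (norm_snd_le ξ)).trans ?_
    unfold L; nlinarith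
  · refine ((S.E' t z.1).le_of_opNorm_le_of_le (S.E'_bdd _ _) (norm_fst_le ξ)).trans ?_
    unfold L; nlinarith

theorem continuous_W : Continuous fun p : ℝ × Phase => S.W p.1 p.2 := by
  have h1 : Continuous fun p : ℝ × Phase => relVelocity p.2.2 :=
    (contDiff_relVelocity (k := 1)).continuous.comp (by fun_prop)
  have h2 : Continuous fun p : ℝ × Phase => S.E p.1 p.2.1 :=
    S.E_cont.comp (by fun_prop : Continuous fun p : ℝ × Phase => (p.1, p.2.1))
  exact h1.prodMk h2

theorem continuous_DW : Continuous fun p : ℝ × Phase => S.DW p.1 p.2 := by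
  have h1 : Continuous fun p : ℝ × Phase => fderiv ℝ relVelocity p.2.2 :=
    ((contDiff_relVelocity (k := 1)).continuous_fderiv one_ne_zero).comp (by fun_prop)
  have h2 : Continuous fun p : ℝ × Phase => S.E' p.1 p.2.1 :=
    S.E'_cont.comp (by fun_prop : Continuous fun p : ℝ × Phase => (p.1, p.2.1))
  have h3 : Continuous fun p : ℝ × Phase =>
      (((fderiv ℝ relVelocity p.2.2).comp (ContinuousLinearMap.snd ℝ Plane Plane),
        (S.E' p.1 p.2.1).comp (ContinuousLinearMap.fst ℝ Plane Plane)) :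
        (Phase →L[ℝ] Plane) × (Phase →L[ℝ] Plane)) :=
    (h1.clm_comp continuous_const).prodMk (h2.clm_comp continuous_const)
  let e : ((Phase →L[ℝ] Plane) × (Phase →L[ℝ] Plane)) ≃ₗᵢ[ℝ] (Phase →L[ℝ] Phase) :=
    ContinuousLinearMap.prodₗᵢ ℝ
  exact e.continuous.comp h3

/-- `Z` is a free characteristic on `[0, c]` that starts at time `t` and runs backwards. -/
def IsTraj (t c : ℝ) (Z : ℝ → Phase) : Prop :=
  ∀ s ∈ Icc 0 c, HasDerivWithinAt Z (S.W (t - s) (Z s)) (Icc 0 c) s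

variable {S}

theorem IsTraj.shift {t c : ℝ} {Z : ℝ → Phase} (h : S.IsTraj t c Z) {δ : ℝ} (hδ : 0 ≤ δ) :
    S.IsTraj (t - δ) (c - δ) fun s => Z (δ + s) := by
  intro s hs
  have h1 : HasDerivWithinAt (fun s => δ + s) 1 (Icc 0 (c - δ)) s :=
    ((hasDerivAt_id s).const_add δ).hasDerivWithinAt
  have h2 := (h (δ + s) ⟨by linarith [hs.1], by linarith [hs.2]⟩).scomp s h1
    (fun r hr => ⟨by linarith [hr.1], by linarith [hr.2]⟩)
  rw [one_smul, ← sub_sub] at *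
  exact h2

theorem IsTraj.mono {t c c' : ℝ} {Z : ℝ → Phase} (h : S.IsTraj t c Z) (hc : c' ≤ c) :
    S.IsTraj t c' Z := fun s hs =>
  (h s ⟨hs.1, hs.2.trans hc⟩).mono (Icc_subset_Icc_right hc)

theorem IsTraj.norm_sub_le {t c : ℝ} {Z Z' : ℝ → Phase} (h : S.IsTraj t c Z)
    (h' : S.IsTraj t c Z') (hc : c ≤ S.b) {s : ℝ} (hs : s ∈ Icc 0 c) :
    ‖Z' s - Z s‖ ≤ 2 * ‖Z' 0 - Z 0‖ := by
  have := norm_le_of_norm_deriv_le (g := fun s => Z' s - Z s) S.L_pos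
    (by nlinarith [S.L_mul_b, S.L_pos] : S.L * c ≤ 1 / 2) (norm_nonneg _) le_rfl
    (fun s hs => (h' s hs).sub (h s hs)) le_rfl
    (fun s hs => by simpa using S.norm_W_sub_le (t - s) (Z s) (Z' s)) hs
  simpa using this

theorem IsTraj.fst {t c : ℝ} {Z : ℝ → Phase} (h : S.IsTraj t c Z) {s : ℝ} (hs : s ∈ Icc 0 c) :
    HasDerivWithinAt (fun s => (Z s).1) (relVelocity (Z s).2) (Icc 0 c) s :=
  (ContinuousLinearMap.fst ℝ Plane Plane).hasFDerivAt.comp_hasDerivWithinAt s (h s hs)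

theorem IsTraj.snd {t c : ℝ} {Z : ℝ → Phase} (h : S.IsTraj t c Z) {s : ℝ} (hs : s ∈ Icc 0 c) :
    HasDerivWithinAt (fun s => (Z s).2) (S.E (t - s) (Z s).1) (Icc 0 c) s :=
  (ContinuousLinearMap.snd ℝ Plane Plane).hasFDerivAt.comp_hasDerivWithinAt s (h s hs)

theorem IsTraj.norm_sub_zero_le {t c : ℝ} {Z : ℝ → Phase} (h : S.IsTraj t c Z) {s : ℝ}
    (hs : s ∈ Icc 0 c) : ‖Z s - Z 0‖ ≤ S.M * s := by
  have := norm_image_sub_le_of_norm_deriv_le_segment' h (fun s _ => S.norm_W_le _ _) s hs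
  simpa using this

variable (S)

theorem exists_traj (t : ℝ) (z : Phase) : ∃ Z : ℝ → Phase, Z 0 = z ∧ S.IsTraj t S.b Z := by
  have hb := S.b_pos.le
  have hM := S.M_pos.le
  have hp : IsPicardLindelof (fun s z => S.W (t - s) z) (⟨0, le_rfl, hb⟩ : Icc 0 S.b) z
      ⟨S.M * S.b, by positivity⟩ 0 ⟨S.M, hM⟩ ⟨S.L, S.L_pos.le⟩ := by
    refine ⟨fun s _ => ?_, fun x _ => ?_, fun s _ x _ => S.norm_W_le _ _, ?_⟩
    · refine (LipschitzWith.of_dist_le_mul fun x y => ?_).lipschitzOnWith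
      rw [dist_eq_norm, dist_eq_norm]
      exact S.norm_W_sub_le _ _ _
    · exact (S.continuous_W.comp
        (by fun_prop : Continuous fun s : ℝ => (t - s, x))).continuousOn
    · simp only [sub_zero, sub_self, max_eq_left hb, NNReal.coe_zero]
      exact le_refl (S.M * S.b)
  exact hp.exists_eq_forall_mem_Icc_hasDerivWithinAt₀

/-- The free backward flow: the state reached from `z` at time `t` after the duration `s`. -/
noncomputable def Φ (t s : ℝ) (z : Phase) : Phase := Classical.choose (S.exists_traj t z) s

theorem Φ_zero (t : ℝ) (z : Phase) : S.Φ t 0 z = z :=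
  (Classical.choose_spec (S.exists_traj t z)).1

theorem isTraj_Φ (t : ℝ) (z : Phase) : S.IsTraj t S.b fun s => S.Φ t s z :=
  (Classical.choose_spec (S.exists_traj t z)).2

theorem continuousOn_Φ (t : ℝ) (z : Phase) : ContinuousOn (fun s => S.Φ t s z) (Icc 0 S.b) :=
  fun s hs => (S.isTraj_Φ t z s hs).continuousWithinAt

theorem norm_Φ_sub_le (t : ℝ) (z z' : Phase) {s : ℝ} (hs : s ∈ Icc 0 S.b) :
    ‖S.Φ t s z' - S.Φ t s z‖ ≤ 2 * ‖z' - z‖ := by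
  simpa only [Φ_zero] using (S.isTraj_Φ t z).norm_sub_le (S.isTraj_Φ t z') le_rfl hs

theorem norm_Φ_sub_self_le (t : ℝ) (z : Phase) {s : ℝ} (hs : s ∈ Icc 0 S.b) :
    ‖S.Φ t s z - z‖ ≤ S.M * s := by
  simpa only [Φ_zero] using (S.isTraj_Φ t z).norm_sub_zero_le hs

theorem norm_Φ_le {t : ℝ} {z : Phase} {ρ : ℝ} (hz : ‖z‖ ≤ ρ) {s : ℝ} (hs : s ∈ Icc 0 S.b) :
    ‖S.Φ t s z‖ ≤ ρ + S.M := by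
  have h1 := S.norm_Φ_sub_self_le t z hs
  have h2 : ‖S.Φ t s z‖ ≤ ‖S.Φ t s z - z‖ + ‖z‖ := norm_le_norm_sub_add _ _
  have := S.M_pos
  nlinarith [hs.2, S.b_le_one]

theorem Φ_add (t : ℝ) (z : Phase) {s δ : ℝ} (hδ : 0 ≤ δ) (hs : 0 ≤ s) (hb : δ + s ≤ S.b) :
    S.Φ t (δ + s) z = S.Φ (t - δ) s (S.Φ t δ z) := by
  have h1 := (S.isTraj_Φ t z).shift hδ
  have h2 := (S.isTraj_Φ (t - δ) (S.Φ t δ z)).mono (c' := S.b - δ) (by linarith)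
  have h3 := h2.norm_sub_le h1 (by linarith) (s := s) ⟨hs, by linarith⟩
  simp only [add_zero, Φ_zero, sub_self, norm_zero, mul_zero] at h3
  exact sub_eq_zero.1 (norm_le_zero_iff.1 h3)

/-! ### The linearized flow -/

theorem continuousOn_DW_Φ (t : ℝ) (z : Phase) :
    ContinuousOn (fun s => S.DW (t - s) (S.Φ t s z)) (Icc 0 S.b) :=
  S.continuous_DW.comp_continuousOn
    ((continuous_const.sub continuous_id).continuousOn.prodMk (S.continuousOn_Φ t z))

theorem exists_linearization (t : ℝ) (z : Phase) : ∃ J : ℝ → Phase →L[ℝ] Phase,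
    J 0 = ContinuousLinearMap.id ℝ Phase ∧ ∀ s ∈ Icc 0 S.b,
      HasDerivWithinAt J ((S.DW (t - s) (S.Φ t s z)).comp (J s)) (Icc 0 S.b) s := by
  have hb := S.b_pos.le
  have hL := S.L_pos.le
  have hid : ‖ContinuousLinearMap.id ℝ Phase‖ ≤ 1 := ContinuousLinearMap.norm_id_le
  have hp : IsPicardLindelof (fun s (J : Phase →L[ℝ] Phase) => (S.DW (t - s) (S.Φ t s z)).comp J)
      (⟨0, le_rfl, hb⟩ : Icc 0 S.b) (ContinuousLinearMap.id ℝ Phase)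
      1 0 ⟨S.L * 2, by positivity⟩ ⟨S.L, hL⟩ := by
    refine ⟨fun s _ => ?_, fun J _ => ?_, fun s _ J hJ => ?_, ?_⟩
    · refine (LipschitzWith.of_dist_le_mul fun x y => ?_).lipschitzOnWith
      rw [dist_eq_norm, dist_eq_norm, ← ContinuousLinearMap.comp_sub]
      exact (ContinuousLinearMap.opNorm_comp_le _ _).trans
        (mul_le_mul_of_nonneg_right (S.norm_DW_le _ _) (norm_nonneg _))
    · exact (S.continuousOn_DW_Φ t z).clm_comp continuousOn_const
    · refine (ContinuousLinearMap.opNorm_comp_le _ _).trans ?_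
      have h1 : ‖J‖ ≤ 2 := by
        rw [Metric.mem_closedBall, dist_eq_norm] at hJ
        have h2 : ‖J‖ ≤ ‖J - ContinuousLinearMap.id ℝ Phase‖ + ‖ContinuousLinearMap.id ℝ Phase‖ :=
          norm_le_norm_sub_add _ _
        have h3 : ‖J - ContinuousLinearMap.id ℝ Phase‖ ≤ 1 := hJ
        linarith
      exact mul_le_mul (S.norm_DW_le _ _) h1 (norm_nonneg _) hL
    · have h := S.L_mul_b
      simp only [sub_zero, NNReal.coe_one, NNReal.coe_zero, sub_self, max_eq_left hb]
      change S.L * 2 * S.b ≤ 1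
      linarith
  exact hp.exists_eq_forall_mem_Icc_hasDerivWithinAt₀

/-- The solution of the variational equation along the free backward flow. -/
noncomputable def J (t : ℝ) (z : Phase) (s : ℝ) : Phase →L[ℝ] Phase :=
  Classical.choose (S.exists_linearization t z) s

theorem J_zero (t : ℝ) (z : Phase) : S.J t z 0 = ContinuousLinearMap.id ℝ Phase :=
  (Classical.choose_spec (S.exists_linearization t z)).1

theorem hasDerivWithinAt_J (t : ℝ) (z : Phase) {s : ℝ} (hs : s ∈ Icc 0 S.b) :
    HasDerivWithinAt (S.J t z) ((S.DW (t - s) (S.Φ t s z)).comp (S.J t z s)) (Icc 0 S.b) s :=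
  (Classical.choose_spec (S.exists_linearization t z)).2 s hs

theorem norm_J_le (t : ℝ) (z : Phase) {s : ℝ} (hs : s ∈ Icc 0 S.b) : ‖S.J t z s‖ ≤ 2 := by
  have := norm_le_of_norm_deriv_le (g := S.J t z) S.L_pos S.L_mul_b.le (zero_le_one)
    le_rfl (fun s hs => S.hasDerivWithinAt_J t z hs)
    (by rw [J_zero]; exact ContinuousLinearMap.norm_id_le)
    (fun s hs => by
      rw [add_zero]
      exact (ContinuousLinearMap.opNorm_comp_le _ _).trans
        (mul_le_mul_of_nonneg_right (S.norm_DW_le _ _) (norm_nonneg _))) hs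
  simpa using this

theorem norm_J_sub_le (t : ℝ) (z : Phase) {s s' : ℝ} (hs : s ∈ Icc 0 S.b) (hs' : s' ∈ Icc 0 S.b) :
    ‖S.J t z s' - S.J t z s‖ ≤ 2 * S.L * |s' - s| := by
  have := (convex_Icc 0 S.b).norm_image_sub_le_of_norm_hasDerivWithin_le (f := S.J t z)
    (C := 2 * S.L) (fun s hs => S.hasDerivWithinAt_J t z hs) (fun s hs => by
      refine (ContinuousLinearMap.opNorm_comp_le _ _).trans ?_
      rw [mul_comm 2]
      exact mul_le_mul (S.norm_DW_le _ _) (S.norm_J_le t z hs) (norm_nonneg _) S.L_pos.le) hs hs'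
  simpa using this

theorem norm_J_sub_id_le (t : ℝ) (z : Phase) {s : ℝ} (hs : s ∈ Icc 0 S.b) :
    ‖S.J t z s - ContinuousLinearMap.id ℝ Phase‖ ≤ 2 * S.L * s := by
  have := S.norm_J_sub_le t z (left_mem_Icc.2 S.b_pos.le) hs
  rwa [J_zero, sub_zero, abs_of_nonneg hs.1] at this

/-- Starting the linearized flow a time `δ` later changes it by `O(δ)`. -/
theorem norm_J_add_sub_le (t : ℝ) (z : Phase) {s δ : ℝ} (hδ : 0 ≤ δ) (hs : 0 ≤ s)
    (hb : δ + s ≤ S.b) :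
    ‖S.J t z (δ + s) - S.J (t - δ) (S.Φ t δ z) s‖ ≤ 4 * S.L * δ := by
  have hsub : ∀ r ∈ Icc 0 (S.b - δ), δ + r ∈ Icc 0 S.b := fun r hr =>
    ⟨by linarith [hr.1], by linarith [hr.2]⟩
  have hL := S.L_pos
  have hLb := S.L_mul_b
  have hd1 : ∀ r ∈ Icc 0 (S.b - δ), HasDerivWithinAt (fun r => S.J t z (δ + r))
      ((S.DW (t - (δ + r)) (S.Φ t (δ + r) z)).comp (S.J t z (δ + r))) (Icc 0 (S.b - δ)) r := by
    intro r hr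
    have h1 : HasDerivWithinAt (fun s => δ + s) 1 (Icc 0 (S.b - δ)) r :=
      ((hasDerivAt_id r).const_add δ).hasDerivWithinAt
    have h2 := (S.hasDerivWithinAt_J t z (hsub r hr)).scomp r h1 hsub
    rw [one_smul] at h2
    exact h2
  have hd2 : ∀ r ∈ Icc 0 (S.b - δ), HasDerivWithinAt (S.J (t - δ) (S.Φ t δ z))
      ((S.DW (t - (δ + r)) (S.Φ t (δ + r) z)).comp (S.J (t - δ) (S.Φ t δ z) r))
      (Icc 0 (S.b - δ)) r := by
    intro r hr
    rw [S.Φ_add t z hδ hr.1 (hsub r hr).2, ← sub_sub]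
    exact (S.hasDerivWithinAt_J (t - δ) (S.Φ t δ z) ⟨hr.1, by linarith [hr.2]⟩).mono
      (Icc_subset_Icc_right (by linarith))
  have := norm_le_of_norm_deriv_le (b := S.b - δ)
    (g := fun r => S.J t z (δ + r) - S.J (t - δ) (S.Φ t δ z) r) S.L_pos
    (by nlinarith) (δ := 2 * S.L * δ) (by positivity) le_rfl
    (fun r hr => (hd1 r hr).sub (hd2 r hr))
    (by simpa [J_zero] using S.norm_J_sub_id_le t z ⟨hδ, by linarith⟩)
    (fun r hr => by
      rw [add_zero, ← ContinuousLinearMap.comp_sub]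
      exact (ContinuousLinearMap.opNorm_comp_le _ _).trans
        (mul_le_mul_of_nonneg_right (S.norm_DW_le _ _) (norm_nonneg _))) (s := s)
    ⟨hs, by linarith⟩
  refine this.trans (le_of_eq ?_)
  ring

theorem exists_relVelocity_taylor (ρ : ℝ) : ∃ C, 0 ≤ C ∧ ∀ u w : Plane, ‖u‖ ≤ ρ → ‖w‖ ≤ ρ →
    ‖relVelocity w - relVelocity u - fderiv ℝ relVelocity u (w - u)‖ ≤ C * ‖w - u‖ ^ 2 := by
  obtain ⟨C, h0, h⟩ := exists_taylor_of_contDiff (contDiff_relVelocity (k := 2))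
    (isCompact_closedBall (0 : Plane) ρ) (convex_closedBall 0 ρ)
  exact ⟨C, h0, fun u w hu hw => h u (by simpa using hu) w (by simpa using hw)⟩

theorem sq_le_two_mul_rpow {x : ℝ} (h0 : 0 ≤ x) (h2 : x ≤ 2) : x ^ 2 ≤ 2 * x ^ (1 + S.lam) := by
  have hl := S.lam_pos
  have hl1 := S.lam_lt_one
  rcases h0.eq_or_lt with rfl | h0
  · rw [Real.zero_rpow (by positivity)]; simp
  · have e : x ^ 2 = x ^ (1 - S.lam) * x ^ (1 + S.lam) := by
      rw [← Real.rpow_add h0, ← Real.rpow_natCast]; norm_num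
    rw [e]
    gcongr
    calc x ^ (1 - S.lam) ≤ 2 ^ (1 - S.lam) := Real.rpow_le_rpow h0.le h2 (by linarith)
      _ ≤ 2 ^ (1 : ℝ) := Real.rpow_le_rpow_of_exponent_le (by norm_num) (by linarith)
      _ = 2 := by norm_num

theorem two_mul_rpow_le {x : ℝ} (h0 : 0 ≤ x) : (2 * x) ^ (1 + S.lam) ≤ 4 * x ^ (1 + S.lam) := by
  have hl := S.lam_pos
  have hl1 := S.lam_lt_one
  rw [Real.mul_rpow (by norm_num) h0]
  gcongr
  calc (2 : ℝ) ^ (1 + S.lam) ≤ 2 ^ (2 : ℝ) :=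
        Real.rpow_le_rpow_of_exponent_le (by norm_num) (by linarith)
    _ = 4 := by norm_num

/-- First-order expansion of the free flow for pairs of trajectories that stay in `closure Ω`. -/
theorem exists_Φ_taylor (ρ : ℝ) : ∃ C, 0 ≤ C ∧ ∀ t z z' s, s ∈ Icc 0 S.b → ‖z‖ ≤ ρ → ‖z'‖ ≤ ρ →
    ‖z' - z‖ ≤ 1 → (∀ r ∈ Icc 0 s, (S.Φ t r z).1 ∈ closure S.Ω) →
    (∀ r ∈ Icc 0 s, (S.Φ t r z').1 ∈ closure S.Ω) →
    ‖S.Φ t s z' - S.Φ t s z - S.J t z s (z' - z)‖ ≤ C * ‖z' - z‖ ^ (1 + S.lam) := by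
  obtain ⟨C, hC, hT⟩ := exists_relVelocity_taylor (ρ + S.M)
  have hl := S.lam_pos
  have hM := S.M_pos
  have hL := S.L_pos
  refine ⟨2 * ((8 * C + 4 * S.M)), by positivity, fun t z z' s hs hz hz' hzz hin hin' => ?_⟩
  set Δ := ‖z' - z‖ with hΔ
  have hsb : Icc 0 s ⊆ Icc 0 S.b := Icc_subset_Icc_right hs.2
  set g : ℝ → Phase := fun r => S.Φ t r z' - S.Φ t r z - S.J t z r (z' - z) with hg
  have hd : ∀ r ∈ Icc 0 s, HasDerivWithinAt g (S.W (t - r) (S.Φ t r z') - S.W (t - r) (S.Φ t r z)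
      - S.DW (t - r) (S.Φ t r z) (S.J t z r (z' - z))) (Icc 0 s) r := by
    intro r hr
    have h1 := ((S.isTraj_Φ t z' r (hsb hr)).sub (S.isTraj_Φ t z r (hsb hr))).sub
      ((S.hasDerivWithinAt_J t z (hsb hr)).clm_apply
        (hasDerivWithinAt_const r (Icc 0 S.b) (z' - z)))
    rw [map_zero, add_zero] at h1
    exact h1.mono hsb
  have hW : ∀ r ∈ Icc 0 s, ‖S.W (t - r) (S.Φ t r z') - S.W (t - r) (S.Φ t r z)
      - S.DW (t - r) (S.Φ t r z) (S.Φ t r z' - S.Φ t r z)‖ ≤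
      (8 * C + 4 * S.M) * Δ ^ (1 + S.lam) := by
    intro r hr
    have hd2 := S.norm_Φ_sub_le t z z' (hsb hr)
    set a := S.Φ t r z
    set a' := S.Φ t r z'
    have hpow : ‖a' - a‖ ^ (1 + S.lam) ≤ 4 * Δ ^ (1 + S.lam) :=
      (Real.rpow_le_rpow (norm_nonneg _) hd2 (by linarith)).trans
        (S.two_mul_rpow_le (norm_nonneg _))
    have hx : ‖a'.1 - a.1‖ ≤ ‖a' - a‖ := norm_fst_le (a' - a)
    have hu : ‖a'.2 - a.2‖ ≤ ‖a' - a‖ := norm_snd_le (a' - a)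
    refine (Prod.norm_def _).trans_le (max_le ?_ ?_)
    · refine (hT a.2 a'.2 ((norm_snd_le a).trans (S.norm_Φ_le hz (hsb hr)))
        ((norm_snd_le a').trans (S.norm_Φ_le hz' (hsb hr)))).trans ?_
      have h1 : ‖a'.2 - a.2‖ ^ 2 ≤ ‖a' - a‖ ^ 2 := by gcongr
      have h2 := S.sq_le_two_mul_rpow (norm_nonneg (a' - a)) (by linarith)
      have h3 : 0 ≤ 4 * S.M * Δ ^ (1 + S.lam) := by positivity
      have h4 : C * ‖a'.2 - a.2‖ ^ 2 ≤ C * (2 * (4 * Δ ^ (1 + S.lam))) := by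
        gcongr; linarith
      linarith
    · refine (S.E_taylor (t - r) a.1 (hin r hr) a'.1 (hin' r hr)).trans ?_
      have h1 : ‖a'.1 - a.1‖ ^ (1 + S.lam) ≤ ‖a' - a‖ ^ (1 + S.lam) :=
        Real.rpow_le_rpow (norm_nonneg _) hx (by linarith)
      have h3 : 0 ≤ 8 * C * Δ ^ (1 + S.lam) := by positivity
      have h4 : S.M * ‖a'.1 - a.1‖ ^ (1 + S.lam) ≤ S.M * (4 * Δ ^ (1 + S.lam)) := by
        gcongr; linarith
      linarith
  have := norm_le_of_norm_deriv_le (g := g) (b := s) (δ := 0)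
    (ε := (8 * C + 4 * S.M) * Δ ^ (1 + S.lam)) S.L_pos
    (by nlinarith [S.L_mul_b, hs.2]) le_rfl (by positivity) hd (by simp [hg, Φ_zero, J_zero])
    (fun r hr => by
      have hr' : r ∈ Icc 0 s := Ico_subset_Icc_self hr
      have e : S.W (t - r) (S.Φ t r z') - S.W (t - r) (S.Φ t r z)
          - S.DW (t - r) (S.Φ t r z) (S.J t z r (z' - z)) = S.DW (t - r) (S.Φ t r z) (g r) +
          (S.W (t - r) (S.Φ t r z') - S.W (t - r) (S.Φ t r z)
            - S.DW (t - r) (S.Φ t r z) (S.Φ t r z' - S.Φ t r z)) := by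
        simp only [hg, map_sub]; abel
      rw [e]
      exact (norm_add_le _ _).trans (add_le_add
        ((S.DW (t - r) (S.Φ t r z)).le_of_opNorm_le (S.norm_DW_le _ _) _) (hW r hr')))
    (right_mem_Icc.2 hs.1)
  refine this.trans ?_
  have h5 : 0 ≤ (8 * C + 4 * S.M) * Δ ^ (1 + S.lam) := by positivity
  have h6 : s ≤ 1 := hs.2.trans S.b_le_one
  nlinarith [hs.1]

end BilliardSystem

namespace BilliardSystem

variable (S : BilliardSystem)

/-! ### Geometry of the domain -/

theorem continuous_ψ : Continuous S.ψ :=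
  continuous_iff_continuousAt.2 fun x => (S.hasFDerivAt_ψ x).continuousAt

theorem contDiff_ψ : ContDiff ℝ 2 S.ψ := by
  have h : ContDiff ℝ 1 S.n := S.n_contDiff.of_le (by norm_num)
  have := (contDiff_succ_iff_hasFDerivAt (𝕜 := ℝ) (n := 1) (f := S.ψ)).2
    ⟨fun x => innerSL ℝ (S.n x), (innerSL ℝ).contDiff.comp h, S.hasFDerivAt_ψ⟩
  simpa [one_add_one_eq_two] using this

theorem fderiv_ψ (x : Plane) : fderiv ℝ S.ψ x = innerSL ℝ (S.n x) := (S.hasFDerivAt_ψ x).fderiv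

theorem hasFDerivAt_n (x : Plane) : HasFDerivAt S.n (fderiv ℝ S.n x) x :=
  (S.n_contDiff.differentiable (by norm_num) x).hasFDerivAt

theorem isCompact_closure : IsCompact (closure S.Ω) := S.bounded.isCompact_closure

theorem exists_norm_le : ∃ ρ₀, 0 < ρ₀ ∧ ∀ x ∈ closure S.Ω, ‖x‖ ≤ ρ₀ := by
  obtain ⟨C, hC⟩ := S.isCompact_closure.exists_bound_of_continuousOn continuousOn_id
  exact ⟨max C 1, by positivity, fun x hx => (hC x hx).trans (le_max_left _ _)⟩

theorem exists_ψ_eq_zero : ∃ y, S.ψ y = 0 := by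
  obtain ⟨x, hx⟩ := S.nonempty
  have : ∃ y, y ∉ S.Ω := by
    by_contra h
    push Not at h
    exact NormedSpace.unbounded_univ ℝ Plane (S.bounded.subset fun y _ => h y)
  obtain ⟨y, hy⟩ := this
  rw [S.mem_iff] at hx hy
  have := mem_range_of_exists_le_of_exists_ge S.continuous_ψ ⟨x, hx.le⟩ ⟨y, not_lt.1 hy⟩
  exact this

/-- The distance to the boundary is controlled by the defining function. -/
theorem exists_dist_le : ∃ C, 0 ≤ C ∧ ∀ x ∈ closure S.Ω,
    ∃ y, S.ψ y = 0 ∧ ‖x - y‖ ≤ C * |S.ψ x| := by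
  obtain ⟨ρ₀, hρ₀, hb⟩ := S.exists_norm_le
  obtain ⟨y₀, hy₀⟩ := S.exists_ψ_eq_zero
  obtain ⟨N, hN⟩ := S.isCompact_closure.exists_bound_of_continuousOn
    S.n_contDiff.continuous.continuousOn
  have hN0 : 0 ≤ N := (norm_nonneg _).trans (hN _ ((S.mem_closure_iff y₀).2 hy₀.le))
  obtain ⟨C, hC, hT⟩ := exists_taylor_of_contDiff S.contDiff_ψ
    (isCompact_closedBall (0 : Plane) (ρ₀ + N)) (convex_closedBall 0 (ρ₀ + N))
  obtain ⟨ε, hε, hmax⟩ := exists_pos_le_max S.isCompact_closure (f := fun x => |S.ψ x|)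
    (g := fun x => ‖S.n x‖ - 1 / 2) S.continuous_ψ.abs.continuousOn
    (S.n_contDiff.continuous.norm.sub continuous_const).continuousOn
    (fun x _ h => by
      have : S.ψ x = 0 := abs_nonpos_iff.1 h
      rw [S.norm_n x this]; norm_num)
  set ε' := min ε (1 / (8 * (2 * C + 1))) with hε'
  have hε'0 : 0 < ε' := by positivity
  refine ⟨8 * N + (ρ₀ + ‖y₀‖) / ε', by positivity, fun x hx => ?_⟩
  have hψx : S.ψ x ≤ 0 := (S.mem_closure_iff x).1 hx
  have hsplit : ∀ a : ℝ, 0 ≤ a → 8 * N * a ≤ (8 * N + (ρ₀ + ‖y₀‖) / ε') * a ∧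
      (ρ₀ + ‖y₀‖) / ε' * a ≤ (8 * N + (ρ₀ + ‖y₀‖) / ε') * a := by
    intro a ha
    have h1 : 0 ≤ (ρ₀ + ‖y₀‖) / ε' * a := by positivity
    have h2 : 0 ≤ 8 * N * a := by positivity
    constructor <;> nlinarith
  rcases lt_or_ge |S.ψ x| ε' with hlt | hge
  · have hn : 1 / 2 ≤ ‖S.n x‖ := by
      rcases le_max_iff.1 (hmax x hx) with h | h
      · exact absurd (hlt.trans_le (min_le_left _ _)) (not_lt.2 h)
      · linarith
    set s := 8 * |S.ψ x| with hs
    have hs0 : 0 ≤ s := by positivity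
    have hs1 : s * (2 * C + 1) ≤ 1 := by
      have h1 := hlt.le.trans (min_le_right ε (1 / (8 * (2 * C + 1))))
      rw [le_div_iff₀ (by positivity)] at h1
      nlinarith
    have hs2 : s ≤ 1 := by nlinarith
    have hmem : x + s • S.n x ∈ Metric.closedBall (0 : Plane) (ρ₀ + N) := by
      rw [mem_closedBall_zero_iff]
      refine (norm_add_le _ _).trans (add_le_add (hb x hx) ?_)
      rw [norm_smul, Real.norm_of_nonneg hs0]
      nlinarith [hN x hx, norm_nonneg (S.n x)]
    have h1 := hT x (by rw [mem_closedBall_zero_iff]; linarith [hb x hx]) _ hmem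
    rw [add_sub_cancel_left, fderiv_ψ, innerSL_apply_apply, real_inner_smul_right,
      real_inner_self_eq_norm_sq, norm_smul, Real.norm_of_nonneg hs0] at h1
    have h2 : 0 ≤ S.ψ (x + s • S.n x) := by
      have h3 := (abs_le.1 h1).1
      have h4 : (1 : ℝ) / 4 ≤ ‖S.n x‖ ^ 2 := by nlinarith
      have h5 : 1 / 2 ≤ 1 - C * s := by nlinarith
      have h6 : s * (1 / 4) * (1 / 2) ≤ s * ‖S.n x‖ ^ 2 * (1 - C * s) := by gcongr
      have h7 : S.ψ x = -|S.ψ x| := by rw [abs_of_nonpos hψx]; ring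
      nlinarith
    have hcont : ContinuousOn (fun r : ℝ => S.ψ (x + r • S.n x)) (Icc 0 s) :=
      (S.continuous_ψ.comp (by fun_prop)).continuousOn
    obtain ⟨r, hr, hr0⟩ := intermediate_value_Icc hs0 hcont
      (show (0 : ℝ) ∈ Icc _ _ from ⟨by simpa using hψx, h2⟩)
    refine ⟨x + r • S.n x, hr0, ?_⟩
    rw [sub_add_cancel_left, norm_neg, norm_smul, Real.norm_of_nonneg hr.1]
    refine le_trans ?_ (hsplit _ (abs_nonneg _)).1
    calc r * ‖S.n x‖ ≤ s * N := mul_le_mul hr.2 (hN x hx) (norm_nonneg _) hs0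
      _ = _ := by rw [hs]; ring
  · refine ⟨y₀, hy₀, ?_⟩
    refine le_trans ?_ (hsplit _ (abs_nonneg _)).2
    calc ‖x - y₀‖ ≤ ρ₀ + ‖y₀‖ := (norm_sub_le _ _).trans (by linarith [hb x hx])
      _ = (ρ₀ + ‖y₀‖) / ε' * ε' := by field_simp
      _ ≤ _ := by gcongr

/-- The closed phase space of the system. -/
def D : Set Phase := closure S.Ω ×ˢ univ

variable {S} in
theorem mem_D {z : Phase} : z ∈ S.D ↔ S.ψ z.1 ≤ 0 := by
  rw [D, mem_prod, S.mem_closure_iff]; simp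

theorem isClosed_D : IsClosed S.D := isClosed_closure.prod isClosed_univ

theorem convex_D : Convex ℝ S.D := S.convex.closure.prod convex_univ

theorem isCompact_D_inter (ρ : ℝ) : IsCompact (S.D ∩ Metric.closedBall 0 ρ) :=
  (isCompact_closedBall 0 ρ).inter_left S.isClosed_D

theorem isTaylor_E (t : ℝ) : IsTaylor (closure S.Ω) S.lam S.M (S.E t) (S.E' t) :=
  ⟨S.M_pos.le, fun x hx y hy _ => S.E_taylor t x hx y hy, fun x _ => S.E'_bdd t x⟩

/-! ### Specular reflection and its linearization across a bounce -/

/-- Specular reflection of phase space, extended off the boundary by the field `n`. -/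
noncomputable def R (z : Phase) : Phase := (z.1, z.2 - (2 * ⟪S.n z.1, z.2⟫) • S.n z.1)

/-- The normal component of the velocity. -/
noncomputable def p (z : Phase) : ℝ := ⟪S.n z.1, relVelocity z.2⟫

theorem R_fst (z : Phase) : (S.R z).1 = z.1 := rfl

theorem p_eq (z : Phase) : S.p z = (lorentz z.2)⁻¹ * ⟪S.n z.1, z.2⟫ := by
  rw [p, relVelocity_eq, real_inner_smul_right]

variable {S} in
theorem inner_R {z : Phase} (hz : S.ψ z.1 = 0) : ⟪S.n z.1, (S.R z).2⟫ = -⟪S.n z.1, z.2⟫ := by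
  rw [R, inner_sub_right, real_inner_smul_right, real_inner_self_eq_norm_sq, S.norm_n _ hz]
  ring

variable {S} in
theorem norm_R {z : Phase} (hz : S.ψ z.1 = 0) : ‖(S.R z).2‖ = ‖z.2‖ := by
  have h : ‖(S.R z).2‖ ^ 2 = ‖z.2‖ ^ 2 := by
    rw [R, norm_sub_sq_real, real_inner_smul_right, norm_smul, S.norm_n _ hz, Real.norm_eq_abs,
      mul_one, sq_abs, real_inner_comm]
    ring
  exact (pow_left_inj₀ (norm_nonneg _) (norm_nonneg _) two_ne_zero).1 h

variable {S} in
theorem R_R {z : Phase} (hz : S.ψ z.1 = 0) : S.R (S.R z) = z := by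
  have h := inner_R hz
  refine Prod.ext rfl ?_
  change (S.R z).2 - (2 * ⟪S.n z.1, (S.R z).2⟫) • S.n z.1 = z.2
  rw [h, R]
  module

variable {S} in
theorem p_R {z : Phase} (hz : S.ψ z.1 = 0) : S.p (S.R z) = -S.p z := by
  rw [p_eq, p_eq, lorentz_eq_of_norm_eq (norm_R hz), R_fst, inner_R hz]
  ring

variable {S} in
theorem R_mem_D {z : Phase} (hz : z ∈ S.D) : S.R z ∈ S.D := mem_D.2 (mem_D.1 hz)

theorem contDiff_n_fst : ContDiff ℝ 3 fun z : Phase => S.n z.1 := S.n_contDiff.comp contDiff_fst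

theorem contDiff_R : ContDiff ℝ 3 S.R :=
  contDiff_fst.prodMk (contDiff_snd.sub
    ((contDiff_const.mul (S.contDiff_n_fst.inner ℝ contDiff_snd)).smul S.contDiff_n_fst))

theorem contDiff_p : ContDiff ℝ 3 S.p :=
  S.contDiff_n_fst.inner ℝ (contDiff_relVelocity.comp contDiff_snd)

theorem hasFDerivAt_R (z : Phase) : HasFDerivAt S.R (fderiv ℝ S.R z) z :=
  (S.contDiff_R.differentiable (by norm_num) z).hasFDerivAt

theorem fderiv_R_snd (z : Phase) (η : Plane) :
    fderiv ℝ S.R z (0, η) = (0, η - (2 * ⟪S.n z.1, η⟫) • S.n z.1) := by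
  have h0 : HasDerivAt (fun s : ℝ => z + s • ((0, η) : Phase)) (0, η) 0 := by
    simpa using ((hasDerivAt_id (0 : ℝ)).smul_const ((0, η) : Phase)).const_add z
  have h1 : HasDerivAt (fun s : ℝ => S.R (z + s • ((0, η) : Phase))) (fderiv ℝ S.R z (0, η)) 0 :=
    HasFDerivAt.comp_hasDerivAt (x := (0 : ℝ)) (l := S.R) (l' := fderiv ℝ S.R z)
      (f := fun s : ℝ => z + s • ((0, η) : Phase)) (f' := (0, η))
      (by simpa using S.hasFDerivAt_R z) h0
  have h2 : HasDerivAt (fun s : ℝ => S.R z +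
      s • ((0, η - (2 * ⟪S.n z.1, η⟫) • S.n z.1) : Phase))
      (0, η - (2 * ⟪S.n z.1, η⟫) • S.n z.1) 0 := by
    simpa using ((hasDerivAt_id (0 : ℝ)).smul_const
      ((0, η - (2 * ⟪S.n z.1, η⟫) • S.n z.1) : Phase)).const_add (S.R z)
  have e : (fun s : ℝ => S.R (z + s • ((0, η) : Phase))) = fun s : ℝ => S.R z +
      s • ((0, η - (2 * ⟪S.n z.1, η⟫) • S.n z.1) : Phase) := by
    funext s
    refine Prod.ext ?_ ?_
    · simp [R]
    · simp only [R, Prod.fst_add, Prod.snd_add, Prod.smul_fst, Prod.smul_snd, smul_zero, add_zero,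
        inner_add_right, real_inner_smul_right]
      module
  rw [e] at h1
  exact h1.unique h2

/-- The jump of the vector field across the boundary, in coordinates that follow the reflection.
By the boundary condition on `E` it does not depend on time. -/
noncomputable def k (z : Phase) : Phase := S.W 0 (S.R z) - fderiv ℝ S.R z (S.W 0 z)

/-- The derivative of the bounce: `A z` maps a displacement just before the bounce at `z` to the
displacement just after it. Two trajectories hit the boundary at times that differ to first
order by `-⟪n, ξ.1⟫ / p z`, which accounts for the multiple of `k z`. -/
noncomputable def A (z : Phase) : Phase →L[ℝ] Phase :=
  fderiv ℝ S.R z + (S.p z)⁻¹ •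
    ((innerSL ℝ (S.n z.1)).comp (ContinuousLinearMap.fst ℝ Plane Plane)).smulRight (S.k z)

theorem A_apply (z ξ : Phase) :
    S.A z ξ = fderiv ℝ S.R z ξ + ((S.p z)⁻¹ * ⟪S.n z.1, ξ.1⟫) • S.k z := by
  simp [A, mul_smul]

variable {S} in
/-- A particle that bounces a time `δ` later and has received the impulse `I` meanwhile: to first
order the state after the bounce differs from the reflected one only through the normal part of
`I - δ • E`. -/
theorem norm_fderiv_R_add_le {z : Phase} (hz : S.ψ z.1 = 0) (δ : ℝ) (I : Plane) :
    ‖fderiv ℝ S.R z (δ • relVelocity z.2, I) + δ • S.k z - (δ • relVelocity (S.R z).2, I)‖ ≤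
      2 * |⟪S.n z.1, I⟫ - δ * ⟪S.n z.1, S.E 0 z.1⟫| := by
  have e : fderiv ℝ S.R z (δ • relVelocity z.2, I) + δ • S.k z - (δ • relVelocity (S.R z).2, I)
      = (0, -(2 * (⟪S.n z.1, I⟫ - δ * ⟪S.n z.1, S.E 0 z.1⟫)) • S.n z.1) := by
    have h1 : ((δ • relVelocity z.2, I) : Phase) =
        δ • S.W 0 z + (0, I - δ • S.E 0 z.1) := by
      refine Prod.ext ?_ ?_ <;> simp [W]
    rw [h1, map_add, map_smul, fderiv_R_snd, k, smul_sub]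
    refine Prod.ext ?_ ?_
    · simp [W]
    · simp only [W, R_fst, Prod.snd_sub, Prod.snd_add, Prod.smul_snd, inner_sub_right,
        real_inner_smul_right]
      module
  rw [e, Prod.norm_def]
  simp only [norm_zero, norm_neg, norm_smul, norm_mul, neg_smul, S.norm_n _ hz, mul_one,
    Real.norm_eq_abs, abs_two]
  exact max_le (by positivity) le_rfl

variable {S} in
theorem A_W {z : Phase} (hz : S.ψ z.1 = 0) (hp : S.p z ≠ 0) (t : ℝ) :
    S.A z (S.W t z) = S.W t (S.R z) := by
  have h := norm_fderiv_R_add_le hz 1 (S.E t z.1)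
  rw [one_smul, one_smul, one_smul, one_mul, real_inner_comm, S.E_normal t _ hz,
    real_inner_comm (S.n z.1) (S.E 0 z.1), sub_self, abs_zero, mul_zero] at h
  have h2 := sub_eq_zero.1 (norm_le_zero_iff.1 h)
  rw [A_apply]
  have h3 : (S.p z)⁻¹ * ⟪S.n z.1, (S.W t z).1⟫ = 1 := inv_mul_cancel₀ hp
  rw [h3, one_smul]
  exact h2

theorem isBddLip_W (t : ℝ) : IsBddLip univ (S.W t) :=
  ⟨S.L, S.L_pos.le, fun z _ => (S.norm_W_le t z).trans (by unfold L; linarith),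
    fun z _ z' _ => S.norm_W_sub_le t z z'⟩

theorem isBddLip_closedBall {F : Type*} [NormedAddCommGroup F] [NormedSpace ℝ F] {f : Phase → F}
    (hf : ContDiff ℝ 1 f) (ρ : ℝ) : IsBddLip (Metric.closedBall (0 : Phase) ρ) f :=
  isBddLip_of_contDiff hf (isCompact_closedBall 0 ρ) (convex_closedBall 0 ρ)

theorem isBddLip_k (ρ : ℝ) : IsBddLip (Metric.closedBall (0 : Phase) ρ) S.k := by
  have hR := isBddLip_closedBall (S.contDiff_R.of_le (by norm_num : (1 : WithTop ℕ∞) ≤ 3)) ρ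
  have hDR := isBddLip_closedBall (S.contDiff_R.fderiv_right (m := 1) (by norm_num)) ρ
  have h1 := (S.isBddLip_W 0).comp hR (fun _ _ => mem_univ _)
  have h2 := hDR.bilin (ContinuousLinearMap.id ℝ (Phase →L[ℝ] Phase))
    ((S.isBddLip_W 0).mono (subset_univ _))
  have h3 := h1.add (h2.clm (-ContinuousLinearMap.id ℝ Phase))
  have e : S.k = fun z => S.W 0 (S.R z) + -(fderiv ℝ S.R z (S.W 0 z)) := by
    funext z
    rw [k, sub_eq_add_neg]
  rw [e]
  simpa using h3

/-- The set of boundary states with outgoing normal velocity at least `c`. -/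
def outgoing (ρ c : ℝ) : Set Phase := {z | ‖z‖ ≤ ρ ∧ S.ψ z.1 = 0 ∧ c ≤ S.p z}

theorem isBddLip_A (ρ : ℝ) {c : ℝ} (hc : 0 < c) : IsBddLip (S.outgoing ρ c) S.A := by
  have hsub : S.outgoing ρ c ⊆ Metric.closedBall 0 ρ := fun z hz => by
    rw [mem_closedBall_zero_iff]; exact hz.1
  have hDR := (isBddLip_closedBall (S.contDiff_R.fderiv_right (m := 1) (by norm_num)) ρ).mono hsub
  have hp := ((isBddLip_closedBall (S.contDiff_p.of_le (by norm_num : (1 : WithTop ℕ∞) ≤ 3)) ρ).mono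
    hsub).inv hc (fun z hz => hz.2.2)
  have hn : ContDiff ℝ 1 fun z : Phase =>
      (innerSL ℝ (S.n z.1)).comp (ContinuousLinearMap.fst ℝ Plane Plane) :=
    ((innerSL ℝ).contDiff.comp (S.contDiff_n_fst.of_le (by norm_num))).clm_comp contDiff_const
  have hn' := (isBddLip_closedBall hn ρ).mono hsub
  have h1 := hn'.bilin (ContinuousLinearMap.smulRightL ℝ Phase Phase) ((S.isBddLip_k ρ).mono hsub)
  have h2 := hp.bilin (ContinuousLinearMap.lsmul ℝ ℝ (E := Phase →L[ℝ] Phase)) h1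
  exact hDR.add h2

/-! ### The kinetic distance to the grazing set -/

/-- The convexity and force term of the kinetic distance: on grazing boundary states it is
the Lorentz factor squared times the outward acceleration. -/
noncomputable def bend (z : Phase) : ℝ :=
  ⟪fderiv ℝ S.n z.1 z.2, z.2⟫ + lorentz z.2 * ⟪S.n z.1, S.E 0 z.1⟫

/-- The kinetic distance to the grazing set. -/
noncomputable def energy (K : ℝ) (z : Phase) : ℝ :=
  ⟪S.n z.1, z.2⟫ ^ 2 / 2 - S.ψ z.1 * S.bend z + K * S.ψ z.1 ^ 2

variable {S} in
theorem energy_eq {K : ℝ} {z : Phase} (hz : S.ψ z.1 = 0) :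
    S.energy K z = ⟪S.n z.1, z.2⟫ ^ 2 / 2 := by
  rw [energy, hz]; ring

variable {S} in
theorem energy_R {K : ℝ} {z : Phase} (hz : S.ψ z.1 = 0) : S.energy K (S.R z) = S.energy K z := by
  rw [energy_eq hz, energy_eq (z := S.R z) hz, R_fst, inner_R hz, neg_sq]

theorem continuous_inner_n : Continuous fun z : Phase => ⟪S.n z.1, z.2⟫ :=
  (S.contDiff_n_fst.continuous).inner continuous_snd

theorem continuous_E_zero : Continuous (S.E 0) :=
  S.E_cont.comp (by fun_prop : Continuous fun x : Plane => ((0 : ℝ), x))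

theorem contDiff_hess : ContDiff ℝ 1 fun z : Phase => ⟪fderiv ℝ S.n z.1 z.2, z.2⟫ := by
  have h1 : ContDiff ℝ 1 fun z : Phase => fderiv ℝ S.n z.1 :=
    (S.n_contDiff.fderiv_right (m := 1) (by norm_num)).comp contDiff_fst
  exact (h1.clm_apply contDiff_snd).inner ℝ contDiff_snd

theorem continuous_bend : Continuous S.bend :=
  S.contDiff_hess.continuous.add
    (((contDiff_lorentz (k := 1)).continuous.comp continuous_snd).mul
      (S.contDiff_n_fst.continuous.inner (S.continuous_E_zero.comp continuous_fst)))

theorem continuous_energy (K : ℝ) : Continuous (S.energy K) := by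
  have h1 := S.continuous_inner_n
  have h2 := S.continuous_bend
  have h3 : Continuous fun z : Phase => S.ψ z.1 := S.continuous_ψ.comp continuous_fst
  unfold energy
  fun_prop

/-- On bounded sets and for large `K` the kinetic distance dominates the distance to the boundary:
the function `bend` is positive near the grazing set, by convexity and since `E` points outwards. -/
theorem exists_energy_coercive (ρ : ℝ) : ∃ K c, 0 < c ∧ ∀ z ∈ S.D, ‖z‖ ≤ ρ →
    c * |S.ψ z.1| ≤ S.energy K z := by
  have hcomp := S.isCompact_D_inter ρ
  obtain ⟨β, hβ⟩ := hcomp.exists_bound_of_continuousOn S.continuous_bend.continuousOn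
  have hψ : Continuous fun z : Phase => S.ψ z.1 := S.continuous_ψ.comp continuous_fst
  obtain ⟨ε, hε, hmax⟩ := exists_pos_le_max hcomp
    (f := fun z => |S.ψ z.1| + ⟪S.n z.1, z.2⟫ ^ 2) (g := S.bend)
    (hψ.abs.add (S.continuous_inner_n.pow 2)).continuousOn S.continuous_bend.continuousOn
    (fun z _ h => by
      have h1 : S.ψ z.1 = 0 := abs_nonpos_iff.1 (by nlinarith [sq_nonneg ⟪S.n z.1, z.2⟫])
      have h2 : ⟪S.n z.1, z.2⟫ = 0 := by
        have : ⟪S.n z.1, z.2⟫ ^ 2 ≤ 0 := by nlinarith [abs_nonneg (S.ψ z.1)]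
        exact pow_eq_zero_iff two_ne_zero |>.1 (le_antisymm this (sq_nonneg _))
      have h3 := S.hess _ h1 _ h2
      have h4 := mul_pos (lorentz_pos z.2) (S.E_normal_pos _ h1)
      rw [real_inner_comm] at h4
      exact add_pos_of_nonneg_of_pos h3 h4)
  set β' := max β 0 + 1 with hβ'
  have hβ'0 : 0 < β' := by positivity
  refine ⟨β' ^ 2 / ε + 2 * β' / ε, min ε 1, by positivity, fun z hz hzρ => ?_⟩
  have hzm : z ∈ S.D ∩ Metric.closedBall 0 ρ := ⟨hz, by rwa [mem_closedBall_zero_iff]⟩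
  have hψz : S.ψ z.1 = -|S.ψ z.1| := by rw [abs_of_nonpos (mem_D.1 hz)]; ring
  have hB : -β' + 1 ≤ S.bend z := by
    have h1 := (abs_le.1 (hβ z hzm)).1
    have h2 := le_max_left β 0
    linarith
  set a := |S.ψ z.1| with ha
  have ha0 : 0 ≤ a := abs_nonneg _
  set P := ⟪S.n z.1, z.2⟫ with hP
  set K := β' ^ 2 / ε + 2 * β' / ε with hK
  have hK0 : 0 ≤ K := by positivity
  have hen : S.energy K z = P ^ 2 / 2 + a * S.bend z + K * a ^ 2 := by
    rw [energy, hψz]; ring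
  rw [hen]
  have hmin1 : min ε 1 * a ≤ ε * a := by gcongr; exact min_le_left _ _
  have hmin2 : min ε 1 * a ≤ 1 * a := by gcongr; exact min_le_right _ _
  rcases le_max_iff.1 (hmax z hzm) with h | h
  · have h : ε ≤ a + P ^ 2 := h
    have h1 : a * (-β' + 1) ≤ a * S.bend z := by gcongr
    suffices β' * a ≤ P ^ 2 / 2 + K * a ^ 2 by nlinarith
    rcases le_or_gt (ε / 2) a with h2 | h2
    · have h3 : β' * a ≤ 2 * β' / ε * a ^ 2 := by
        have : β' * a * (ε / 2) ≤ β' * a * a := by gcongr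
        rw [div_mul_eq_mul_div, le_div_iff₀ hε]
        nlinarith
      have h4 : 0 ≤ β' ^ 2 / ε * a ^ 2 := by positivity
      rw [hK, add_mul]
      nlinarith [sq_nonneg P]
    · have h3 : β' * a ≤ β' ^ 2 / ε * a ^ 2 + ε / 4 := by
        have : β' ^ 2 / ε * a ^ 2 + ε / 4 - β' * a = (β' * a - ε / 2) ^ 2 / ε := by
          field_simp; ring
        have h5 : 0 ≤ (β' * a - ε / 2) ^ 2 / ε := by positivity
        linarith
      have h4 : 0 ≤ 2 * β' / ε * a ^ 2 := by positivity
      rw [hK, add_mul]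
      nlinarith
  · have h1 : a * ε ≤ a * S.bend z := by gcongr
    have h2 : 0 ≤ K * a ^ 2 := by positivity
    nlinarith [sq_nonneg P]

/-- The normal component of the field is time-independent on the boundary, hence time-independent up
to `O(ψ)` inside. -/
theorem exists_inner_E_sub_le : ∃ C, 0 ≤ C ∧ ∀ t, ∀ x ∈ closure S.Ω,
    |⟪S.n x, S.E t x⟫ - ⟪S.n x, S.E 0 x⟫| ≤ C * |S.ψ x| := by
  obtain ⟨ρ₀, hρ₀, hb⟩ := S.exists_norm_le
  obtain ⟨C, hC, hd⟩ := S.exists_dist_le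
  obtain ⟨N, hN0, hN, hNl⟩ := isBddLip_of_contDiff
    (S.n_contDiff.of_le (by norm_num : (1 : WithTop ℕ∞) ≤ 3))
    (isCompact_closedBall (0 : Plane) ρ₀) (convex_closedBall 0 ρ₀)
  have hM := S.M_pos
  refine ⟨4 * N * S.M * C, by positivity, fun t x hx => ?_⟩
  obtain ⟨y, hy, hxy⟩ := hd x hx
  have hyc : y ∈ closure S.Ω := (S.mem_closure_iff y).2 hy.le
  have hx' : x ∈ Metric.closedBall (0 : Plane) ρ₀ := by simpa using hb x hx
  have hy' : y ∈ Metric.closedBall (0 : Plane) ρ₀ := by simpa using hb y hyc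
  have e0 : ⟪S.n y, S.E t y⟫ - ⟪S.n y, S.E 0 y⟫ = 0 := by
    rw [real_inner_comm, S.E_normal t y hy, real_inner_comm, sub_self]
  have e : ⟪S.n x, S.E t x⟫ - ⟪S.n x, S.E 0 x⟫ =
      ⟪S.n x - S.n y, S.E t x - S.E 0 x⟫ + ⟪S.n y, (S.E t x - S.E t y) - (S.E 0 x - S.E 0 y)⟫ := by
    simp only [inner_sub_left, inner_sub_right] at *
    linarith
  rw [e]
  have h1 : |⟪S.n x - S.n y, S.E t x - S.E 0 x⟫| ≤ N * ‖x - y‖ * (2 * S.M) := by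
    refine (abs_real_inner_le_norm _ _).trans ?_
    gcongr
    · exact hNl y hy' x hx'
    · exact (norm_sub_le _ _).trans (by linarith [S.E_bdd t x, S.E_bdd 0 x])
  have h2 : |⟪S.n y, (S.E t x - S.E t y) - (S.E 0 x - S.E 0 y)⟫| ≤ N * (2 * S.M * ‖x - y‖) := by
    refine (abs_real_inner_le_norm _ _).trans ?_
    gcongr
    · exact hN y hy'
    · exact (norm_sub_le _ _).trans (by linarith [S.E_lip t y x, S.E_lip 0 y x])
  refine (abs_add_le _ _).trans ?_
  have h3 : 4 * N * S.M * ‖x - y‖ ≤ 4 * N * S.M * (C * |S.ψ x|) := by gcongr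
  linarith

/-- The velocity lemma: the kinetic distance to the grazing set changes at most exponentially
along free characteristics in `closure Ω`. -/
theorem exists_energy_bounds (ρ : ℝ) : ∃ K c C, 0 < c ∧ 0 ≤ C ∧
    (∀ z ∈ S.D, ‖z‖ ≤ ρ → c * |S.ψ z.1| ≤ S.energy K z) ∧
    ∀ t T Z, 0 ≤ T → S.IsTraj t T Z → (∀ s ∈ Icc 0 T, Z s ∈ S.D ∧ ‖Z s‖ ≤ ρ) →
      Real.exp (-(C * T)) * S.energy K (Z 0) ≤ S.energy K (Z T) ∧
      S.energy K (Z T) ≤ Real.exp (C * T) * S.energy K (Z 0) := by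
  obtain ⟨K, c, hc, hcoer⟩ := S.exists_energy_coercive ρ
  obtain ⟨C₁, hC₁, hE⟩ := S.exists_inner_E_sub_le
  have hcomp := isCompact_closedBall (0 : Phase) ρ
  obtain ⟨N, hN⟩ := hcomp.exists_bound_of_continuousOn S.contDiff_n_fst.continuous.continuousOn
  obtain ⟨N', hN'⟩ := hcomp.exists_bound_of_continuousOn (f := fun z : Phase => fderiv ℝ S.n z.1)
    ((S.n_contDiff.continuous_fderiv (by norm_num)).comp continuous_fst).continuousOn
  obtain ⟨H, hH⟩ := hcomp.exists_bound_of_continuousOn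
    (S.contDiff_hess.continuous_fderiv one_ne_zero).continuousOn
  obtain ⟨Λ, hΛ⟩ := hcomp.exists_bound_of_continuousOn (f := fun z : Phase => fderiv ℝ lorentz z.2)
    (((contDiff_lorentz (k := 1)).continuous_fderiv one_ne_zero).comp continuous_snd).continuousOn
  obtain ⟨G, hG⟩ := hcomp.exists_bound_of_continuousOn (f := fun z : Phase => lorentz z.2)
    ((contDiff_lorentz (k := 1)).continuous.comp continuous_snd).continuousOn
  have hM := S.M_pos
  set C₃ := |N| * |ρ| * C₁ + (|H| * S.M + |Λ| * S.M * (|N| * S.M) +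
    |G| * (|N'| * S.M + |N| * S.M)) + 2 * |K| * |N| with hC₃
  have hC₃0 : 0 ≤ C₃ := by positivity
  refine ⟨K, c, C₃ / c, hc, by positivity, hcoer, fun t T Z hT hZ hin => ?_⟩
  -- the derivative of the kinetic distance
  let e' : ℝ → ℝ := fun s =>
    let x := (Z s).1; let u := (Z s).2
    ⟪S.n x, u⟫ * (⟪S.n x, S.E (t - s) x⟫ - ⟪S.n x, S.E 0 x⟫) -
    S.ψ x * (fderiv ℝ (fun z : Phase => ⟪fderiv ℝ S.n z.1 z.2, z.2⟫) (Z s) (S.W (t - s) (Z s)) +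
      (fderiv ℝ lorentz u (S.E (t - s) x) * ⟪S.n x, S.E 0 x⟫ +
        lorentz u * (⟪S.n x, S.E' 0 x (relVelocity u)⟫ +
          ⟪fderiv ℝ S.n x (relVelocity u), S.E 0 x⟫))) +
    2 * K * S.ψ x * ⟪S.n x, relVelocity u⟫
  have hd : ∀ s ∈ Icc 0 T, HasDerivWithinAt (fun s => S.energy K (Z s)) (e' s) (Icc 0 T) s := by
    intro s hs
    have dx := hZ.fst hs
    have du := hZ.snd hs
    set x := (Z s).1 with hx
    set u := (Z s).2 with hu
    have dn : HasDerivWithinAt (fun s => S.n (Z s).1) (fderiv ℝ S.n x (relVelocity u))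
        (Icc 0 T) s :=
      (S.hasFDerivAt_n x).comp_hasDerivWithinAt s dx
    have dψ : HasDerivWithinAt (fun s => S.ψ (Z s).1) ⟪S.n x, relVelocity u⟫ (Icc 0 T) s := by
      have := (S.hasFDerivAt_ψ x).comp_hasDerivWithinAt s dx
      rw [innerSL_apply_apply] at this
      exact this
    have dP : HasDerivWithinAt (fun s => ⟪S.n (Z s).1, (Z s).2⟫)
        (⟪S.n x, S.E (t - s) x⟫ + ⟪fderiv ℝ S.n x (relVelocity u), u⟫) (Icc 0 T) s :=
      dn.inner ℝ du
    have dE : HasDerivWithinAt (fun s => S.E 0 (Z s).1) (S.E' 0 x (relVelocity u)) (Icc 0 T) s :=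
      ((S.isTaylor_E 0).hasFDerivWithinAt S.lam_pos
        (hin s hs).1.1).comp_hasDerivWithinAt s dx (fun r hr => (hin r hr).1.1)
    have dh :=
      ((S.contDiff_hess.differentiable one_ne_zero (Z s)).hasFDerivAt).comp_hasDerivWithinAt
      s (hZ s hs)
    have dl : HasDerivWithinAt (fun s => lorentz (Z s).2) (fderiv ℝ lorentz u (S.E (t - s) x))
        (Icc 0 T) s :=
      HasFDerivAt.comp_hasDerivWithinAt (l := lorentz) (l' := fderiv ℝ lorentz u)
        (f := fun s => (Z s).2) s
        ((contDiff_lorentz (k := 1)).differentiable one_ne_zero u).hasFDerivAt du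
    have dB := dh.add (dl.mul (dn.inner ℝ dE))
    have := (((dP.pow 2).div_const 2).sub (dψ.mul dB)).add ((dψ.pow 2).const_mul K)
    refine this.congr_deriv ?_
    have hu' : ⟪fderiv ℝ S.n x u, u⟫ = lorentz u * ⟪fderiv ℝ S.n x (relVelocity u), u⟫ := by
      conv_lhs => rw [← lorentz_smul_relVelocity u, map_smul, lorentz_smul_relVelocity,
        real_inner_smul_left]
    have hp' : ⟪S.n x, u⟫ = lorentz u * ⟪S.n x, relVelocity u⟫ := by
      conv_lhs => rw [← lorentz_smul_relVelocity u, real_inner_smul_right]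
    simp only [e', Function.comp, Pi.add_apply, Pi.mul_apply, ← hx, ← hu]
    rw [hu', hp']
    push_cast
    ring
  have hbound : ∀ s ∈ Icc 0 T, |e' s| ≤ C₃ / c * S.energy K (Z s) := by
    intro s hs
    obtain ⟨hD, hρ⟩ := hin s hs
    have hzm : Z s ∈ Metric.closedBall (0 : Phase) ρ := by rwa [mem_closedBall_zero_iff]
    have b1 := (hN _ hzm).trans (le_abs_self N)
    have b2 := (hN' _ hzm).trans (le_abs_self N')
    have b3 := (hH _ hzm).trans (le_abs_self H)
    have b4 := (hΛ _ hzm).trans (le_abs_self Λ)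
    have b5 := (hG _ hzm).trans (le_abs_self G)
    have b6 : ‖(Z s).2‖ ≤ |ρ| := (norm_snd_le _).trans (hρ.trans (le_abs_self ρ))
    have b7 := hE (t - s) _ hD.1
    have b8 := norm_relVelocity_le (Z s).2
    have hen := hcoer _ hD hρ
    simp only [e']
    set x := (Z s).1
    set u := (Z s).2
    have i1 : |⟪S.n x, u⟫ * (⟪S.n x, S.E (t - s) x⟫ - ⟪S.n x, S.E 0 x⟫)| ≤
        |N| * |ρ| * (C₁ * |S.ψ x|) := by
      rw [abs_mul]
      gcongr
      exact (abs_real_inner_le_norm _ _).trans (by gcongr)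
    have i2 : |fderiv ℝ (fun z : Phase => ⟪fderiv ℝ S.n z.1 z.2, z.2⟫) (Z s) (S.W (t - s) (Z s))| ≤
        |H| * S.M :=
      (ContinuousLinearMap.le_of_opNorm_le_of_le _ b3 (S.norm_W_le _ _))
    have i3 : |fderiv ℝ lorentz u (S.E (t - s) x) * ⟪S.n x, S.E 0 x⟫| ≤
        |Λ| * S.M * (|N| * S.M) := by
      rw [abs_mul]
      gcongr
      · exact ContinuousLinearMap.le_of_opNorm_le_of_le _ b4 (S.E_bdd _ _)
      · refine (abs_real_inner_le_norm _ _).trans ?_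
        gcongr
        exact S.E_bdd _ _
    have i4 : |lorentz u * (⟪S.n x, S.E' 0 x (relVelocity u)⟫ +
          ⟪fderiv ℝ S.n x (relVelocity u), S.E 0 x⟫)| ≤ |G| * (|N'| * S.M + |N| * S.M) := by
      rw [abs_mul, add_comm (|N'| * S.M)]
      refine mul_le_mul b5 ?_ (abs_nonneg _) (abs_nonneg _)
      · refine (abs_add_le _ _).trans (add_le_add ?_ ?_)
        · refine (abs_real_inner_le_norm _ _).trans ?_
          gcongr
          simpa using ContinuousLinearMap.le_of_opNorm_le_of_le _ (S.E'_bdd 0 x) b8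
        · refine (abs_real_inner_le_norm _ _).trans ?_
          gcongr
          · simpa using ContinuousLinearMap.le_of_opNorm_le_of_le _ b2 b8
          · exact S.E_bdd _ _
    have i5 : |2 * K * S.ψ x * ⟪S.n x, relVelocity u⟫| ≤ 2 * |K| * |N| * |S.ψ x| := by
      rw [abs_mul, abs_mul, abs_mul, abs_two]
      have : |⟪S.n x, relVelocity u⟫| ≤ |N| * 1 := (abs_real_inner_le_norm _ _).trans (by gcongr)
      have h0 : 0 ≤ 2 * |K| * |S.ψ x| := by positivity
      nlinarith
    have i6 : ∀ a b c d e : ℝ, |a - b * (c + (d + e))| ≤ |a| + |b| * (|c| + |d| + |e|) := by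
      intro a b c d e
      refine (abs_sub _ _).trans ?_
      rw [abs_mul]
      gcongr
      rw [← add_assoc]
      exact abs_add_three _ _ _
    refine (abs_add_le _ _).trans ?_
    refine (add_le_add (i6 _ _ _ _ _) i5).trans ?_
    have i7 : |S.ψ x| * (|fderiv ℝ (fun z : Phase => ⟪fderiv ℝ S.n z.1 z.2, z.2⟫) (Z s)
        (S.W (t - s) (Z s))| + |fderiv ℝ lorentz u (S.E (t - s) x) * ⟪S.n x, S.E 0 x⟫| +
        |lorentz u * (⟪S.n x, S.E' 0 x (relVelocity u)⟫ +
          ⟪fderiv ℝ S.n x (relVelocity u), S.E 0 x⟫)|) ≤ |S.ψ x| * (|H| * S.M +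
          |Λ| * S.M * (|N| * S.M) + |G| * (|N'| * S.M + |N| * S.M)) := by gcongr
    have i8 : C₃ * |S.ψ x| ≤ C₃ / c * S.energy K (Z s) := by
      rw [div_mul_eq_mul_div, le_div_iff₀ hc, mul_assoc, mul_comm |S.ψ x|]
      gcongr
    refine le_trans ?_ i8
    rw [hC₃]
    linarith
  have := exp_le_of_abs_deriv_le hT hd hbound
  simpa using this

end BilliardSystem

namespace BilliardSystem

variable (S : BilliardSystem)

/-! ### Short times near the boundary -/

/-- Over a short time the flow moves neighbouring states by almost the same amount. -/
theorem norm_Φ_sub_sub_le (t : ℝ) (z z' : Phase) {δ : ℝ} (hδ : δ ∈ Icc 0 S.b) :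
    ‖(S.Φ t δ z' - z') - (S.Φ t δ z - z)‖ ≤ 2 * S.L * ‖z' - z‖ * δ := by
  have hd : ∀ s ∈ Icc 0 S.b, HasDerivWithinAt
      (fun s => (S.Φ t s z' - z') - (S.Φ t s z - z))
      (S.W (t - s) (S.Φ t s z') - S.W (t - s) (S.Φ t s z)) (Icc 0 S.b) s := fun s hs =>
    ((S.isTraj_Φ t z' s hs).sub_const z').sub ((S.isTraj_Φ t z s hs).sub_const z)
  have := norm_image_sub_le_of_norm_deriv_le_segment' hd (C := 2 * S.L * ‖z' - z‖)
    (fun s hs => (S.norm_W_sub_le _ _ _).trans (by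
      have h := S.norm_Φ_sub_le t z z' (Ico_subset_Icc_self hs)
      have := S.L_pos
      nlinarith)) δ hδ
  simpa [Φ_zero] using this

/-- Displacements along the incoming and along the reflected trajectory share their momentum part
`I` up to second order, and the normal part of `I` is determined by the force at time `0`. -/
theorem exists_short_time (t : ℝ) {z : Phase} (hz : S.ψ z.1 = 0) {δ : ℝ} (hδ : δ ∈ Icc 0 S.b) :
    ∃ I : Plane, ‖S.Φ t δ z - z - (δ • relVelocity z.2, I)‖ ≤ 2 * S.M ^ 2 * δ ^ 2 ∧
      ‖S.Φ t δ (S.R z) - S.R z - (δ • relVelocity (S.R z).2, I)‖ ≤ 2 * S.M ^ 2 * δ ^ 2 ∧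
      |⟪S.n z.1, I⟫ - δ * ⟪S.n z.1, S.E 0 z.1⟫| ≤ 2 * S.M ^ 2 * δ ^ 2 := by
  have hM := S.one_le_M
  have hsub : Icc 0 δ ⊆ Icc 0 S.b := Icc_subset_Icc_right hδ.2
  have hv : ∀ y : Phase, ‖(S.Φ t δ y).1 - y.1 - δ • relVelocity y.2‖ ≤ 2 * S.M ^ 2 * δ ^ 2 := by
    intro y
    have hd : ∀ s ∈ Icc 0 δ, HasDerivWithinAt
        (fun s => (S.Φ t s y).1 - y.1 - s • relVelocity y.2)
        (relVelocity (S.Φ t s y).2 - (1 : ℝ) • relVelocity y.2) (Icc 0 δ) s := fun s hs =>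
      ((((S.isTraj_Φ t y).fst (hsub hs)).mono hsub).sub_const y.1).sub
        ((hasDerivAt_id s).smul_const (relVelocity y.2)).hasDerivWithinAt
    have := norm_image_sub_le_of_norm_deriv_le_segment' hd (C := 2 * S.M * δ)
      (fun s hs => by
        have hs' := Ico_subset_Icc_self hs
        rw [one_smul]
        refine (norm_relVelocity_sub_le _ _).trans ?_
        have h1 : ‖(S.Φ t s y).2 - y.2‖ ≤ S.M * s :=
          (norm_snd_le (S.Φ t s y - y)).trans (S.norm_Φ_sub_self_le t y (hsub hs'))
        nlinarith [hs.2]) δ (right_mem_Icc.2 hδ.1)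
    simp only [Φ_zero, sub_self, zero_smul, sub_zero] at this
    refine this.trans ?_
    have h1 : S.M * δ ^ 2 ≤ S.M ^ 2 * δ ^ 2 := by gcongr; nlinarith
    nlinarith
  have hI2 : ‖(S.Φ t δ (S.R z)).2 - (S.R z).2 - ((S.Φ t δ z).2 - z.2)‖ ≤ 2 * S.M ^ 2 * δ ^ 2 := by
    have hd : ∀ s ∈ Icc 0 δ, HasDerivWithinAt
        (fun s => (S.Φ t s (S.R z)).2 - (S.R z).2 - ((S.Φ t s z).2 - z.2))
        (S.E (t - s) (S.Φ t s (S.R z)).1 - S.E (t - s) (S.Φ t s z).1) (Icc 0 δ) s := fun s hs =>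
      ((((S.isTraj_Φ t (S.R z)).snd (hsub hs)).mono hsub).sub_const _).sub
        ((((S.isTraj_Φ t z).snd (hsub hs)).mono hsub).sub_const _)
    have := norm_image_sub_le_of_norm_deriv_le_segment' hd (C := S.M * (2 * S.M * δ))
      (fun s hs => by
        have hs' := Ico_subset_Icc_self hs
        refine (S.E_lip _ _ _).trans ?_
        have h1 : ‖(S.Φ t s z).1 - z.1‖ ≤ S.M * s :=
          (norm_fst_le (S.Φ t s z - z)).trans (S.norm_Φ_sub_self_le t z (hsub hs'))
        have h2 : ‖(S.Φ t s (S.R z)).1 - z.1‖ ≤ S.M * s :=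
          (norm_fst_le (S.Φ t s (S.R z) - S.R z)).trans (S.norm_Φ_sub_self_le t _ (hsub hs'))
        have h3 : ‖(S.Φ t s (S.R z)).1 - (S.Φ t s z).1‖ ≤ 2 * S.M * δ := by
          have : (S.Φ t s (S.R z)).1 - (S.Φ t s z).1 =
              ((S.Φ t s (S.R z)).1 - z.1) - ((S.Φ t s z).1 - z.1) := by abel
          rw [this]
          refine (norm_sub_le _ _).trans ?_
          nlinarith [hs.2]
        gcongr) δ (right_mem_Icc.2 hδ.1)
    simp only [Φ_zero, sub_self, sub_zero] at this
    refine this.trans (le_of_eq ?_)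
    ring
  refine ⟨(S.Φ t δ z).2 - z.2, ?_, ?_, ?_⟩
  · refine (Prod.norm_def _).trans_le (max_le (hv z) ?_)
    simp only [Prod.snd_sub, sub_self, norm_zero]
    positivity
  · exact (Prod.norm_def _).trans_le (max_le (hv (S.R z)) hI2)
  · have hd : ∀ s ∈ Icc 0 δ, HasDerivWithinAt
        (fun s => ⟪S.n z.1, (S.Φ t s z).2 - z.2⟫ - s * ⟪S.n z.1, S.E 0 z.1⟫)
        (⟪S.n z.1, S.E (t - s) (S.Φ t s z).1⟫ - 1 * ⟪S.n z.1, S.E 0 z.1⟫) (Icc 0 δ) s := by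
      intro s hs
      have h1 := (((S.isTraj_Φ t z).snd (hsub hs)).mono hsub).sub_const z.2
      have h2 := (innerSL ℝ (S.n z.1)).hasFDerivAt.comp_hasDerivWithinAt s h1
      exact h2.sub ((hasDerivAt_id s).mul_const _).hasDerivWithinAt
    have := norm_image_sub_le_of_norm_deriv_le_segment' hd (C := S.M * (S.M * δ))
      (fun s hs => by
        have hs' := Ico_subset_Icc_self hs
        have e : ⟪S.n z.1, S.E 0 z.1⟫ = ⟪S.n z.1, S.E (t - s) z.1⟫ := by
          rw [real_inner_comm, ← S.E_normal (t - s) _ hz, real_inner_comm]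
        rw [one_mul, e, ← inner_sub_right, Real.norm_eq_abs]
        refine (abs_real_inner_le_norm _ _).trans ?_
        rw [S.norm_n _ hz, one_mul]
        refine (S.E_lip _ _ _).trans ?_
        have h1 : ‖(S.Φ t s z).1 - z.1‖ ≤ S.M * s :=
          (norm_fst_le (S.Φ t s z - z)).trans (S.norm_Φ_sub_self_le t z (hsub hs'))
        have : S.M * s ≤ S.M * δ := by gcongr; exact hs.2.le
        gcongr
        exact h1.trans this) δ (right_mem_Icc.2 hδ.1)
    simp only [Φ_zero, sub_self, inner_zero_right, zero_mul, sub_zero, Real.norm_eq_abs] at this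
    refine this.trans ?_
    nlinarith [mul_nonneg (sq_nonneg S.M) (sq_nonneg δ)]

/-- `τ` is so short that a trajectory of size `ρ` leaving a boundary state with normal velocity at
least `c` in modulus moves away from the boundary during the whole time `τ`. -/
structure IsScale (ρ c τ : ℝ) : Prop where
  ρ_nonneg : 0 ≤ ρ
  c_pos : 0 < c
  τ_pos : 0 < τ
  τ_le : τ ≤ S.b
  outward : ∀ t z, ‖z‖ ≤ ρ → S.ψ z.1 = 0 → c ≤ S.p z → ∀ s ∈ Icc 0 τ,
    c / 2 * s ≤ S.ψ (S.Φ t s z).1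
  inward : ∀ t z, ‖z‖ ≤ ρ → S.ψ z.1 = 0 → S.p z ≤ -c → ∀ s ∈ Icc 0 τ,
    S.ψ (S.Φ t s z).1 ≤ -(c / 2 * s)

theorem hasDerivWithinAt_ψ {t T : ℝ} {Z : ℝ → Phase} (hZ : S.IsTraj t T Z) {s : ℝ}
    (hs : s ∈ Icc 0 T) : HasDerivWithinAt (fun s => S.ψ (Z s).1) (S.p (Z s)) (Icc 0 T) s := by
  have := (S.hasFDerivAt_ψ (Z s).1).comp_hasDerivWithinAt s (hZ.fst hs)
  rw [innerSL_apply_apply] at this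
  exact this

theorem exists_isScale {ρ c : ℝ} (hρ : 0 ≤ ρ) (hc : 0 < c) : ∃ τ, S.IsScale ρ c τ := by
  obtain ⟨N, hN0, -, hN⟩ := isBddLip_closedBall
    (S.contDiff_p.of_le (by norm_num : (1 : WithTop ℕ∞) ≤ 3)) (ρ + S.M)
  have hM := S.M_pos
  have hb := S.b_pos
  set τ := min S.b (c / (2 * (N * S.M + 1))) with hτ
  have hτ0 : 0 < τ := by positivity
  have hτb : τ ≤ S.b := min_le_left _ _
  have hτc : N * S.M * τ ≤ c / 2 := by
    have h := min_le_right S.b (c / (2 * (N * S.M + 1)))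
    rw [← hτ, le_div_iff₀ (by positivity)] at h
    nlinarith
  have hsub : Icc 0 τ ⊆ Icc 0 S.b := Icc_subset_Icc_right hτb
  have key : ∀ t z, ‖z‖ ≤ ρ → ∀ s ∈ Icc 0 τ, |S.p (S.Φ t s z) - S.p z| ≤ c / 2 := by
    intro t z hz s hs
    have h1 := S.norm_Φ_sub_self_le t z (hsub hs)
    have h2 := hN z (by rw [mem_closedBall_zero_iff]; linarith) (S.Φ t s z)
      (by rw [mem_closedBall_zero_iff]; exact S.norm_Φ_le hz (hsub hs))
    rw [Real.norm_eq_abs] at h2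
    calc _ ≤ N * ‖S.Φ t s z - z‖ := h2
      _ ≤ N * (S.M * τ) := by gcongr; exact h1.trans (by gcongr; exact hs.2)
      _ ≤ c / 2 := by linarith
  have hmono : ∀ t z (q : ℝ), (∀ s ∈ Icc 0 τ, q ≤ S.p (S.Φ t s z)) → S.ψ z.1 = 0 →
      ∀ s ∈ Icc 0 τ, q * s ≤ S.ψ (S.Φ t s z).1 := by
    intro t z q hq h0 s hs
    have hd := fun r hr => S.hasDerivWithinAt_ψ ((S.isTraj_Φ t z).mono hτb) (s := r) hr
    have hd' : ∀ r ∈ Icc 0 τ, HasDerivWithinAt (fun r => S.ψ (S.Φ t r z).1 - q * r)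
        (S.p (S.Φ t r z) - q) (Icc 0 τ) r := fun r hr =>
      (hd r hr).sub (by simpa using ((hasDerivAt_id r).const_mul q).hasDerivWithinAt)
    have hm : MonotoneOn (fun r => S.ψ (S.Φ t r z).1 - q * r) (Icc 0 τ) := by
      refine monotoneOn_of_hasDerivWithinAt_nonneg (convex_Icc 0 τ)
        (f' := fun r => S.p (S.Φ t r z) - q)
        (fun r hr => (hd' r hr).continuousWithinAt)
        (fun r hr => (hd' r (interior_subset hr)).mono interior_subset) (fun r hr => ?_)
      have := hq r (interior_subset hr)
      linarith
    have := hm (left_mem_Icc.2 hτ0.le) hs hs.1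
    simp only [Φ_zero, h0, mul_zero] at this
    linarith
  have hmono' : ∀ t z (q : ℝ), (∀ s ∈ Icc 0 τ, S.p (S.Φ t s z) ≤ q) → S.ψ z.1 = 0 →
      ∀ s ∈ Icc 0 τ, S.ψ (S.Φ t s z).1 ≤ q * s := by
    intro t z q hq h0 s hs
    have hd := fun r hr => S.hasDerivWithinAt_ψ ((S.isTraj_Φ t z).mono hτb) (s := r) hr
    have hd' : ∀ r ∈ Icc 0 τ, HasDerivWithinAt (fun r => q * r - S.ψ (S.Φ t r z).1)
        (q - S.p (S.Φ t r z)) (Icc 0 τ) r := fun r hr =>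
      HasDerivWithinAt.sub
        (by simpa using ((hasDerivAt_id r).const_mul q).hasDerivWithinAt) (hd r hr)
    have hm : MonotoneOn (fun r => q * r - S.ψ (S.Φ t r z).1) (Icc 0 τ) := by
      refine monotoneOn_of_hasDerivWithinAt_nonneg (convex_Icc 0 τ)
        (f' := fun r => q - S.p (S.Φ t r z))
        (fun r hr => (hd' r hr).continuousWithinAt)
        (fun r hr => (hd' r (interior_subset hr)).mono interior_subset) (fun r hr => ?_)
      have := hq r (interior_subset hr)
      linarith
    have := hm (left_mem_Icc.2 hτ0.le) hs hs.1
    simp only [Φ_zero, h0, mul_zero] at this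
    linarith
  refine ⟨τ, hρ, hc, hτ0, hτb, fun t z hz h0 hp s hs => ?_, fun t z hz h0 hp s hs => ?_⟩
  · exact hmono t z _ (fun r hr => by have := (abs_le.1 (key t z hz r hr)).1; linarith) h0 s hs
  · rw [← neg_mul]
    exact hmono' t z _ (fun r hr => by have := (abs_le.1 (key t z hz r hr)).2; linarith) h0 s hs

variable {S}

theorem norm_R_le {z : Phase} (hz : S.ψ z.1 = 0) : ‖S.R z‖ = ‖z‖ := by
  rw [Prod.norm_def, Prod.norm_def, norm_R hz, R_fst]

/-- If a trajectory issued from `y` stays in `closure Ω` for the time `δ`, while `y` is close to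
the outgoing boundary state `z`, then `δ` is small. -/
theorem IsScale.exists_time_le {ρ c τ : ℝ} (h : S.IsScale ρ c τ) : ∃ C, 0 ≤ C ∧ ∀ t z y δ,
    δ ∈ Icc 0 τ → ‖z‖ ≤ ρ → ‖y‖ ≤ ρ → S.ψ z.1 = 0 → c ≤ S.p z → S.Φ t δ y ∈ S.D →
    δ ≤ C * ‖y - z‖ := by
  obtain ⟨N, hN0, -, hN⟩ := isBddLip_closedBall (S.contDiff_ψ.of_le
    (by norm_num : (1 : WithTop ℕ∞) ≤ 2) |>.comp (contDiff_fst (E := Plane) (F := Plane)))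
    (ρ + S.M)
  have hc := h.c_pos
  refine ⟨4 * N / c, by positivity, fun t z y δ hδ hz hy h0 hp hD => ?_⟩
  have hδb : δ ∈ Icc 0 S.b := ⟨hδ.1, hδ.2.trans h.τ_le⟩
  have h1 := h.outward t z hz h0 hp δ hδ
  have h2 := mem_D.1 hD
  have h3 := hN (S.Φ t δ y) (by rw [mem_closedBall_zero_iff]; exact S.norm_Φ_le hy hδb)
    (S.Φ t δ z) (by rw [mem_closedBall_zero_iff]; exact S.norm_Φ_le hz hδb)
  have h4 := S.norm_Φ_sub_le t y z hδb
  rw [norm_sub_rev z y] at h4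
  rw [Real.norm_eq_abs] at h3
  have h5 := (le_abs_self _).trans h3
  simp only [Function.comp] at h5
  have h6 : N * ‖S.Φ t δ z - S.Φ t δ y‖ ≤ N * (2 * ‖y - z‖) := by gcongr
  rw [div_mul_eq_mul_div, le_div_iff₀ hc]
  linarith

/-- On an outgoing boundary state the map `A` intertwines the two displacements. -/
theorem IsScale.exists_A_displacement {ρ c τ : ℝ} (h : S.IsScale ρ c τ) : ∃ C, 0 ≤ C ∧
    ∀ t z δ, δ ∈ Icc 0 τ → ‖z‖ ≤ ρ → S.ψ z.1 = 0 → c ≤ S.p z →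
    ‖S.A z (S.Φ t δ z - z) - (S.Φ t δ (S.R z) - S.R z)‖ ≤ C * δ ^ 2 := by
  obtain ⟨N, hN0, hN, -⟩ := S.isBddLip_A ρ h.c_pos
  have hM := S.M_pos
  refine ⟨2 * S.M ^ 2 * (N + 3), by positivity, fun t z δ hδ hz h0 hp => ?_⟩
  have hp0 : S.p z ≠ 0 := (h.c_pos.trans_le hp).ne'
  obtain ⟨I, h1, h2, h3⟩ := S.exists_short_time t h0 ⟨hδ.1, hδ.2.trans h.τ_le⟩
  set Q := S.Φ t δ z - z
  set Q' := S.Φ t δ (S.R z) - S.R z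
  have h4 := norm_fderiv_R_add_le h0 δ I
  have e1 : S.A z (δ • relVelocity z.2, I) =
      fderiv ℝ S.R z (δ • relVelocity z.2, I) + δ • S.k z := by
    have e : (S.p z)⁻¹ * ⟪S.n z.1, δ • relVelocity z.2⟫ = δ := by
      rw [real_inner_smul_right, mul_comm δ]
      exact inv_mul_cancel_left₀ hp0 δ
    rw [A_apply, e]
  rw [← e1] at h4
  have e2 : S.A z Q - Q' = S.A z (Q - (δ • relVelocity z.2, I)) +
      (S.A z (δ • relVelocity z.2, I) - (δ • relVelocity (S.R z).2, I)) -
      (Q' - (δ • relVelocity (S.R z).2, I)) := by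
    rw [map_sub (S.A z) Q]; abel
  rw [e2]
  have h5 := (S.A z).le_of_opNorm_le_of_le (hN z ⟨hz, h0, hp⟩) h1
  refine (norm_sub_le _ _).trans ((add_le_add (norm_add_le _ _) le_rfl).trans ?_)
  linarith

/-- The bounce is differentiable: for `y` near the outgoing boundary state `z`, whose
trajectory bounces after the time `δ`, the reflected states at that moment differ by
`A z (y - z)` up to second order. -/
theorem IsScale.exists_bounce {ρ c τ : ℝ} (h : S.IsScale ρ c τ) : ∃ C, 0 ≤ C ∧ ∀ t z y δ,
    δ ∈ Icc 0 τ → ‖z‖ ≤ ρ → ‖y‖ ≤ ρ → S.ψ z.1 = 0 → c ≤ S.p z → S.ψ (S.Φ t δ y).1 = 0 →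
    ‖S.R (S.Φ t δ y) - S.Φ t δ (S.R z) - S.A z (y - z)‖ ≤ C * ‖y - z‖ ^ 2 := by
  obtain ⟨C₁, hC₁, htime⟩ := h.exists_time_le
  obtain ⟨C₂, hC₂, hR⟩ := exists_taylor_of_contDiff
    (S.contDiff_R.of_le (by norm_num : (2 : WithTop ℕ∞) ≤ 3))
    (isCompact_closedBall (0 : Phase) (ρ + S.M)) (convex_closedBall 0 (ρ + S.M))
  obtain ⟨C₃, hC₃, hψ⟩ := exists_taylor_of_contDiff
    (S.contDiff_ψ.comp (contDiff_fst (E := Plane) (F := Plane)))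
    (isCompact_closedBall (0 : Phase) (ρ + S.M)) (convex_closedBall 0 (ρ + S.M))
  obtain ⟨N₁, hN₁0, hN₁, -⟩ := isBddLip_closedBall
    (S.contDiff_R.fderiv_right (m := 1) (by norm_num)) ρ
  obtain ⟨N₂, hN₂0, hN₂, -⟩ := S.isBddLip_k ρ
  have hM := S.M_pos
  have hL := S.L_pos
  have hc := h.c_pos
  -- bounds for the position error, the displacement and the time error
  set a := 2 * S.L * C₁ + 2 * S.M ^ 2 * C₁ ^ 2 with ha
  set d := 3 + S.M * C₁ with hd
  set q := C₃ * d ^ 2 + a with hq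
  refine ⟨C₂ * d ^ 2 + N₁ * a + 4 * S.M ^ 2 * C₁ ^ 2 + 2 * S.M ^ 2 * C₁ ^ 2 + q / c * N₂,
    by positivity, fun t z y δ hδ hz hy h0 hp hψ0 => ?_⟩
  have hδb : δ ∈ Icc 0 S.b := ⟨hδ.1, hδ.2.trans h.τ_le⟩
  have hδ1 := htime t z y δ hδ hz hy h0 hp (mem_D.2 hψ0.le)
  have hpz : 0 < S.p z := hc.trans_le hp
  obtain ⟨I, h1, h2, h3⟩ := S.exists_short_time t h0 hδb
  have h4 := norm_fderiv_R_add_le h0 δ I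
  have h5 := S.norm_Φ_sub_sub_le t z y hδb
  set r := ‖y - z‖ with hr
  have hr0 : 0 ≤ r := norm_nonneg _
  set Y := S.Φ t δ y
  set Q : Phase := (δ • relVelocity z.2, I) with hQ
  have hδ2 : δ ^ 2 ≤ C₁ ^ 2 * r ^ 2 := by
    rw [← mul_pow]; exact pow_le_pow_left₀ hδ.1 hδ1 2
  have hzm : z ∈ Metric.closedBall (0 : Phase) (ρ + S.M) := by
    rw [mem_closedBall_zero_iff]; linarith
  have hzm' : z ∈ Metric.closedBall (0 : Phase) ρ := by rwa [mem_closedBall_zero_iff]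
  have hYm : Y ∈ Metric.closedBall (0 : Phase) (ρ + S.M) := by
    rw [mem_closedBall_zero_iff]; exact S.norm_Φ_le hy hδb
  -- the displacement of the state
  have e1 : ‖Y - z - (y - z) - Q‖ ≤ a * r ^ 2 := by
    have e : Y - z - (y - z) - Q = ((Y - y) - (S.Φ t δ z - z)) + (S.Φ t δ z - z - Q) := by abel
    rw [e, ha]
    refine (norm_add_le _ _).trans ((add_le_add h5 h1).trans ?_)
    have i1 : 2 * S.L * r * δ ≤ 2 * S.L * r * (C₁ * r) := by gcongr
    have i2 : 2 * S.M ^ 2 * δ ^ 2 ≤ 2 * S.M ^ 2 * (C₁ ^ 2 * r ^ 2) := by gcongr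
    linarith
  have e2 : ‖Y - z‖ ≤ d * r := by
    have e : Y - z = (Y - S.Φ t δ z) + (S.Φ t δ z - z) := by abel
    rw [e, hd]
    refine (norm_add_le _ _).trans ((add_le_add (S.norm_Φ_sub_le t z y hδb)
      (S.norm_Φ_sub_self_le t z hδb)).trans ?_)
    have : S.M * δ ≤ S.M * (C₁ * r) := by gcongr
    nlinarith
  have e3 : ‖Y - z‖ ^ 2 ≤ d ^ 2 * r ^ 2 := by
    rw [← mul_pow]; exact pow_le_pow_left₀ (norm_nonneg _) e2 2
  -- the bounce time to first order
  have e4 : |⟪S.n z.1, (y - z).1⟫ + δ * S.p z| ≤ q * r ^ 2 := by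
    have i1 := hψ z hzm Y hYm
    have hf : fderiv ℝ (S.ψ ∘ Prod.fst) z = (innerSL ℝ (S.n z.1)).comp
        (ContinuousLinearMap.fst ℝ Plane Plane) :=
      ((S.hasFDerivAt_ψ z.1).comp z (ContinuousLinearMap.fst ℝ Plane Plane).hasFDerivAt).fderiv
    rw [hf] at i1
    simp only [Function.comp, hψ0, h0, sub_zero, zero_sub, norm_neg,
      ContinuousLinearMap.comp_apply, ContinuousLinearMap.coe_fst', innerSL_apply_apply,
      Real.norm_eq_abs] at i1
    have i2 : |⟪S.n z.1, (Y - z - (y - z) - Q).1⟫| ≤ a * r ^ 2 := by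
      refine (abs_real_inner_le_norm _ _).trans ?_
      rw [S.norm_n _ h0, one_mul]
      exact (norm_fst_le _).trans e1
    have i3 : ⟪S.n z.1, (y - z).1⟫ + δ * S.p z =
        ⟪S.n z.1, (Y - z).1⟫ - ⟪S.n z.1, (Y - z - (y - z) - Q).1⟫ := by
      rw [p, ← real_inner_smul_right, ← inner_add_right, ← inner_sub_right]
      congr 1
      simp only [hQ, Prod.fst_sub]
      abel
    rw [i3, hq]
    refine (abs_sub _ _).trans ((add_le_add i1 i2).trans ?_)
    have : C₃ * ‖Y - z‖ ^ 2 ≤ C₃ * (d ^ 2 * r ^ 2) := by gcongr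
    linarith
  have e5 : S.R Y - S.Φ t δ (S.R z) - S.A z (y - z) =
      (S.R Y - S.R z - fderiv ℝ S.R z (Y - z)) + fderiv ℝ S.R z (Y - z - (y - z) - Q) +
      (fderiv ℝ S.R z Q + δ • S.k z - (δ • relVelocity (S.R z).2, I)) -
      (S.Φ t δ (S.R z) - S.R z - (δ • relVelocity (S.R z).2, I)) -
      ((S.p z)⁻¹ * (⟪S.n z.1, (y - z).1⟫ + δ * S.p z)) • S.k z := by
    have e : (S.p z)⁻¹ * (⟪S.n z.1, (y - z).1⟫ + δ * S.p z) =
        (S.p z)⁻¹ * ⟪S.n z.1, (y - z).1⟫ + δ := by field_simp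
    rw [A_apply, e, add_smul]
    simp only [map_sub]
    abel
  rw [e5]
  have j1 := (hR z hzm Y hYm).trans (mul_le_mul_of_nonneg_left e3 hC₂)
  have j2 := (fderiv ℝ S.R z).le_of_opNorm_le_of_le (hN₁ z hzm') e1
  have j3 : 2 * |⟪S.n z.1, I⟫ - δ * ⟪S.n z.1, S.E 0 z.1⟫| ≤
      2 * (2 * S.M ^ 2 * (C₁ ^ 2 * r ^ 2)) := by
    refine mul_le_mul_of_nonneg_left (h3.trans ?_) zero_le_two
    gcongr
  have j4 : 2 * S.M ^ 2 * δ ^ 2 ≤ 2 * S.M ^ 2 * (C₁ ^ 2 * r ^ 2) := by gcongr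
  have j5 : ‖((S.p z)⁻¹ * (⟪S.n z.1, (y - z).1⟫ + δ * S.p z)) • S.k z‖ ≤
      c⁻¹ * (q * r ^ 2) * N₂ := by
    rw [norm_smul, norm_mul, norm_inv, Real.norm_of_nonneg hpz.le, Real.norm_eq_abs]
    gcongr
    exact hN₂ z hzm'
  refine (norm_sub_le _ _).trans (((add_le_add ((norm_sub_le _ _).trans
    (add_le_add ((norm_add_le _ _).trans (add_le_add (norm_add_le _ _) le_rfl)) le_rfl))
    le_rfl)).trans ?_)
  have := h4.trans j3
  have j6 := h2.trans j4
  refine (add_le_add (add_le_add (add_le_add (add_le_add j1 j2) this) j6) j5).trans (le_of_eq ?_)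
  ring

end BilliardSystem

namespace BilliardSystem

variable (S : BilliardSystem)

/-! ### Trajectories with at most one bounce -/

/-- The closed phase space is fat, being a convex set with interior points, bounded in the
positions. -/
theorem exists_isFat_D : ∃ r d, IsFat S.D r d := by
  obtain ⟨x₀, hx₀⟩ := S.nonempty
  have hopen : IsOpen S.Ω := by
    have : S.Ω = {x | S.ψ x < 0} := by ext x; exact S.mem_iff x
    rw [this]
    exact isOpen_lt S.continuous_ψ continuous_const
  obtain ⟨r, hr, hball⟩ := Metric.nhds_basis_closedBall.mem_iff.1 (hopen.mem_nhds hx₀)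
  obtain ⟨ρ₀, hρ₀, hb⟩ := S.exists_norm_le
  refine ⟨r, 2 * ρ₀ + 1, S.convex_D, hr, by linarith, fun z hz => ⟨(x₀, z.2), ?_, fun y hy => ?_⟩⟩
  · refine (Prod.norm_def _).trans_le (max_le ?_ ?_)
    · refine (norm_sub_le _ _).trans ?_
      linarith [hb x₀ (subset_closure hx₀), hb z.1 hz.1]
    · simp only [Prod.snd_sub, sub_self, norm_zero]; linarith
  · refine ⟨subset_closure (hball ?_), mem_univ _⟩
    rw [Metric.mem_closedBall] at hy ⊢
    exact (le_max_left _ _).trans hy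

theorem mul_rpow_le {k x : ℝ} (hk : 1 ≤ k) (hx : 0 ≤ x) :
    (k * x) ^ (1 + S.lam) ≤ k ^ 2 * x ^ (1 + S.lam) := by
  rw [Real.mul_rpow (by linarith) hx]
  gcongr
  rw [← Real.rpow_natCast]
  exact Real.rpow_le_rpow_of_exponent_le hk (by push_cast; linarith [S.lam_lt_one])

theorem mul_rpow_lam_le {k x : ℝ} (hk : 1 ≤ k) (hx : 0 ≤ x) :
    (k * x) ^ S.lam ≤ k * x ^ S.lam := by
  rw [Real.mul_rpow (by linarith) hx]
  gcongr
  conv_rhs => rw [← Real.rpow_one k]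
  exact Real.rpow_le_rpow_of_exponent_le hk S.lam_lt_one.le

theorem rpow_le_self {x : ℝ} (hx : 0 ≤ x) (hx1 : x ≤ 1) : x ^ (1 + S.lam) ≤ x := by
  have := Real.rpow_le_rpow_of_exponent_ge_of_imp hx hx1 (by linarith [S.lam_pos] :
    (1 : ℝ) ≤ 1 + S.lam) (fun _ h => absurd h (by linarith [S.lam_pos]))
  rwa [Real.rpow_one] at this

theorem rpow_mul_self {x : ℝ} (hx : 0 ≤ x) : x ^ S.lam * x = x ^ (1 + S.lam) := by
  rcases hx.eq_or_lt with rfl | hx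
  · rw [mul_zero, Real.zero_rpow (by linarith [S.lam_pos])]
  · rw [Real.rpow_add hx, Real.rpow_one, mul_comm]

variable {S}

theorem IsScale.reflected_mem_D {ρ c τ : ℝ} (h : S.IsScale ρ c τ) {t : ℝ} {z : Phase}
    (hz : ‖z‖ ≤ ρ) (h0 : S.ψ z.1 = 0) (hp : c ≤ S.p z) {s : ℝ} (hs : s ∈ Icc 0 τ) :
    S.Φ t s (S.R z) ∈ S.D := by
  refine mem_D.2 ((h.inward t (S.R z) ((norm_R_le h0).trans_le hz) h0 ?_ s hs).trans ?_)
  · rw [p_R h0]; linarith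
  · have := mul_nonneg h.c_pos.le hs.1
    linarith

/-- First-order expansion across a bounce, based at the boundary state `z` and at the neighbouring
state `y`, which bounces a little later. -/
theorem IsScale.exists_bounce_taylor {ρ c τ : ℝ} (h : S.IsScale ρ c τ) : ∃ C r, 0 ≤ C ∧ 0 < r ∧
    ∀ t σ z y δ, σ ∈ Icc 0 τ → δ ∈ Icc 0 σ → ‖z‖ ≤ ρ → ‖y‖ ≤ ρ → ‖y - z‖ ≤ r → S.ψ z.1 = 0 →
    c ≤ S.p z → ‖S.Φ t δ y‖ ≤ ρ → S.ψ (S.Φ t δ y).1 = 0 → c ≤ S.p (S.Φ t δ y) →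
    ‖S.Φ (t - δ) (σ - δ) (S.R (S.Φ t δ y)) - S.Φ t σ (S.R z) -
        S.J t (S.R z) σ (S.A z (y - z))‖ ≤ C * ‖y - z‖ ^ (1 + S.lam) ∧
    ‖S.Φ t σ (S.R z) - S.Φ (t - δ) (σ - δ) (S.R (S.Φ t δ y)) -
        S.J (t - δ) (S.R (S.Φ t δ y)) (σ - δ) (S.A (S.Φ t δ y) (z - y))‖ ≤
      C * ‖y - z‖ ^ (1 + S.lam) := by
  obtain ⟨Cb, hCb, hbounce⟩ := h.exists_bounce
  obtain ⟨C₁, hC₁, htime⟩ := h.exists_time_le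
  obtain ⟨N, hN0, hN, hNl⟩ := S.isBddLip_A ρ h.c_pos
  obtain ⟨Cf, hCf, hflow⟩ := S.exists_Φ_taylor (ρ + S.M)
  have hM := S.M_pos
  have hL := S.L_pos
  set k := N + Cb + 1 with hk
  have hk1 : 1 ≤ k := by linarith
  refine ⟨Cf * k ^ 2 + 8 * S.L * C₁ * k + 4 * Cb + 4 * N * (2 + S.M * C₁), 1 / k, by positivity,
    by positivity, fun t σ z y δ hσ hδ hz hy hr h0 hp hY hY0 hYp => ?_⟩
  have hδτ : δ ∈ Icc 0 τ := ⟨hδ.1, hδ.2.trans hσ.2⟩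
  have hδb : δ ∈ Icc 0 S.b := ⟨hδ.1, hδτ.2.trans h.τ_le⟩
  have hσδ : σ - δ ∈ Icc 0 S.b := ⟨by linarith [hδ.2], by linarith [hδ.1, hσ.2, h.τ_le]⟩
  have hσb : σ ∈ Icc 0 S.b := ⟨hσ.1, hσ.2.trans h.τ_le⟩
  set Y := S.Φ t δ y with hYdef
  set U := S.Φ t δ (S.R z) with hU
  set Δ := ‖y - z‖ with hΔ
  have hΔ0 : 0 ≤ Δ := norm_nonneg _
  have hkΔ : k * Δ ≤ 1 := by rw [le_div_iff₀ (by positivity)] at hr; linarith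
  have hΔ1 : Δ ≤ 1 := by nlinarith
  have hΔ2 := S.sq_le_two_mul_rpow hΔ0 (by linarith)
  have hpow0 : 0 ≤ Δ ^ (1 + S.lam) := Real.rpow_nonneg hΔ0 _
  have hb1 := hbounce t z y δ hδτ hz hy h0 hp hY0
  have hδ1 := htime t z y δ hδτ hz hy h0 hp (mem_D.2 hY0.le)
  have hAz := hN z ⟨hz, h0, hp⟩
  have hVU : ‖S.R Y - U‖ ≤ k * Δ := by
    have e : S.R Y - U = (S.R Y - U - S.A z (y - z)) + S.A z (y - z) := by abel
    rw [e]
    refine (norm_add_le _ _).trans ((add_le_add hb1 ((S.A z).le_of_opNorm_le hAz _)).trans ?_)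
    nlinarith
  have hwU : S.Φ t σ (S.R z) = S.Φ (t - δ) (σ - δ) U := by
    have := S.Φ_add t (S.R z) hδ.1 hσδ.1 (by rw [add_sub_cancel]; exact hσb.2)
    rwa [add_sub_cancel] at this
  have hUin : ∀ s ∈ Icc 0 (σ - δ), (S.Φ (t - δ) s U).1 ∈ closure S.Ω := fun s hs => by
    rw [hU, ← S.Φ_add t (S.R z) hδ.1 hs.1 (by linarith [hs.2, hσb.2])]
    exact (h.reflected_mem_D hz h0 hp ⟨by linarith [hs.1, hδ.1], by linarith [hs.2, hσ.2]⟩).1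
  have hVin : ∀ s ∈ Icc 0 (σ - δ), (S.Φ (t - δ) s (S.R Y)).1 ∈ closure S.Ω := fun s hs =>
    (h.reflected_mem_D hY hY0 hYp ⟨hs.1, by linarith [hs.2, hδ.1, hσ.2]⟩).1
  have hRY : ‖S.R Y‖ ≤ ρ + S.M := by rw [norm_R_le hY0]; linarith
  have hUn : ‖U‖ ≤ ρ + S.M := S.norm_Φ_le ((norm_R_le h0).trans_le hz) hδb
  have hf1 := hflow (t - δ) U (S.R Y) (σ - δ) hσδ hUn hRY (hVU.trans hkΔ) hUin hVin
  have hf2 := hflow (t - δ) (S.R Y) U (σ - δ) hσδ hRY hUn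
    (by rw [norm_sub_rev]; exact hVU.trans hkΔ) hVin hUin
  rw [norm_sub_rev U] at hf2
  have hpow : ‖S.R Y - U‖ ^ (1 + S.lam) ≤ k ^ 2 * Δ ^ (1 + S.lam) :=
    (Real.rpow_le_rpow (norm_nonneg _) hVU (by linarith [S.lam_pos])).trans (S.mul_rpow_le hk1 hΔ0)
  have hpow' : Cf * ‖S.R Y - U‖ ^ (1 + S.lam) ≤ Cf * (k ^ 2 * Δ ^ (1 + S.lam)) := by gcongr
  have hJd := S.norm_J_add_sub_le t (S.R z) hδ.1 hσδ.1 (by rw [add_sub_cancel]; exact hσb.2)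
  rw [add_sub_cancel] at hJd
  rw [hwU]
  have hX : ∀ x : ℝ, x ≤ Cf * (k ^ 2 * Δ ^ (1 + S.lam)) + 4 * S.L * (C₁ * Δ) * (k * Δ) +
      2 * (Cb * Δ ^ 2) + 2 * (N * ((2 + S.M * C₁) * Δ) * Δ) →
      x ≤ (Cf * k ^ 2 + 8 * S.L * C₁ * k + 4 * Cb + 4 * N * (2 + S.M * C₁)) *
        Δ ^ (1 + S.lam) := by
    intro x hx
    have i1 : (4 * S.L * C₁ * k + 2 * Cb + 2 * N * (2 + S.M * C₁)) * Δ ^ 2 ≤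
        (4 * S.L * C₁ * k + 2 * Cb + 2 * N * (2 + S.M * C₁)) * (2 * Δ ^ (1 + S.lam)) := by
      gcongr
    linarith
  constructor
  · apply hX
    have e : S.Φ (t - δ) (σ - δ) (S.R Y) - S.Φ (t - δ) (σ - δ) U - S.J t (S.R z) σ (S.A z (y - z))
        = (S.Φ (t - δ) (σ - δ) (S.R Y) - S.Φ (t - δ) (σ - δ) U -
          S.J (t - δ) U (σ - δ) (S.R Y - U)) -
          (S.J t (S.R z) σ - S.J (t - δ) U (σ - δ)) (S.R Y - U) +
          S.J t (S.R z) σ (S.R Y - U - S.A z (y - z)) := by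
      rw [_root_.sub_apply, map_sub (S.J t (S.R z) σ) (S.R Y - U)]; abel
    rw [e]
    refine (norm_add_le _ _).trans ((add_le_add (norm_sub_le _ _) le_rfl).trans ?_)
    have i1 := (S.J t (S.R z) σ - S.J (t - δ) U (σ - δ)).le_of_opNorm_le_of_le hJd hVU
    have i2 := (S.J t (S.R z) σ).le_of_opNorm_le_of_le (S.norm_J_le _ _ hσb) hb1
    have i3 : 4 * S.L * δ * (k * Δ) ≤ 4 * S.L * (C₁ * Δ) * (k * Δ) := by gcongr
    have i4 : 0 ≤ 2 * (N * ((2 + S.M * C₁) * Δ) * Δ) := by positivity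
    linarith
  · apply hX
    have e : S.Φ (t - δ) (σ - δ) U - S.Φ (t - δ) (σ - δ) (S.R Y) -
        S.J (t - δ) (S.R Y) (σ - δ) (S.A Y (z - y)) =
        (S.Φ (t - δ) (σ - δ) U - S.Φ (t - δ) (σ - δ) (S.R Y) -
          S.J (t - δ) (S.R Y) (σ - δ) (U - S.R Y)) +
          S.J (t - δ) (S.R Y) (σ - δ) ((S.A Y - S.A z) (y - z) -
            (S.R Y - U - S.A z (y - z))) := by
      rw [← sub_eq_zero, _root_.sub_apply]
      simp only [map_sub]
      abel
    rw [e]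
    have hYz : ‖Y - z‖ ≤ (2 + S.M * C₁) * Δ := by
      have e : Y - z = (Y - S.Φ t δ z) + (S.Φ t δ z - z) := by abel
      rw [e]
      refine (norm_add_le _ _).trans ((add_le_add (S.norm_Φ_sub_le t z y hδb)
        (S.norm_Φ_sub_self_le t z hδb)).trans ?_)
      have : S.M * δ ≤ S.M * (C₁ * Δ) := by gcongr
      linarith
    have hAA : ‖(S.A Y - S.A z) (y - z)‖ ≤ N * ((2 + S.M * C₁) * Δ) * Δ := by
      refine (S.A Y - S.A z).le_of_opNorm_le ((hNl z ⟨hz, h0, hp⟩ Y ⟨hY, hY0, hYp⟩).trans ?_) _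
      gcongr
    refine (norm_add_le _ _).trans ?_
    have i2 := (S.J (t - δ) (S.R Y) (σ - δ)).le_of_opNorm_le_of_le (S.norm_J_le _ _ hσδ)
      ((norm_sub_le _ _).trans (add_le_add hAA hb1))
    have i3 : 0 ≤ 4 * S.L * (C₁ * Δ) * (k * Δ) := by positivity
    linarith

/-- A function which is compatible with the reflection, up to first order. -/
def IsReflecting (S : BilliardSystem) (G : Phase → ℝ) (G' : Phase → Phase →L[ℝ] ℝ) : Prop :=
  ∀ z, S.ψ z.1 = 0 → 0 < S.p z → G z = G (S.R z) ∧ G' z = (G' (S.R z)).comp (S.A z)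

/-- Expansion of a reflecting function when only one of two neighbouring trajectories has
bounced. -/
theorem IsScale.exists_reflecting_taylor {ρ c τ : ℝ} (h : S.IsScale ρ c τ) {G : Phase → ℝ}
    {G' : Phase → Phase →L[ℝ] ℝ} {C : ℝ} (hG : IsTaylor S.D S.lam C G G')
    (hR : S.IsReflecting G G') : ∃ C' r, 0 ≤ C' ∧ 0 < r ∧
    ∀ t σ z y, σ ∈ Icc 0 τ → ‖z‖ ≤ ρ → ‖y‖ ≤ ρ → ‖y - z‖ ≤ r → S.ψ z.1 = 0 → c ≤ S.p z →
    S.Φ t σ y ∈ S.D →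
    |G (S.Φ t σ y) - G (S.Φ t σ (S.R z)) - G' z (y - z)| ≤ C' * ‖y - z‖ ^ (1 + S.lam) ∧
    ‖(G' (S.Φ t σ (S.R z))).comp ((S.J t (S.R z) σ).comp (S.A z)) - G' z‖ ≤
      C' * ‖y - z‖ ^ S.lam ∧
    ‖G' (S.Φ t σ y) - G' z‖ ≤ C' * ‖y - z‖ ^ S.lam ∧ σ ≤ C' * ‖y - z‖ := by
  obtain ⟨C₁, hC₁, htime⟩ := h.exists_time_le
  obtain ⟨C₂, hC₂, hdisp⟩ := h.exists_A_displacement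
  obtain ⟨N, hN0, hN, -⟩ := S.isBddLip_A ρ h.c_pos
  obtain ⟨r₀, d₀, hFat⟩ := S.exists_isFat_D
  have hM := S.M_pos
  have hL := S.L_pos
  have hC := hG.nonneg
  set H := (12 * (d₀ + r₀) / r₀ + 4) * C with hH
  have hH0 : 0 ≤ H := by
    have := hFat.r_pos
    have := hFat.one_le
    positivity
  have hhol : ∀ x ∈ S.D, ∀ y ∈ S.D, ‖G' x - G' y‖ ≤ H * ‖x - y‖ ^ S.lam := fun x hx y hy =>
    hG.holder S.lam_pos S.lam_lt_one hFat hx hy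
  set k := 2 + S.M * C₁ with hk
  have hk1 : 1 ≤ k := by have : 0 ≤ S.M * C₁ := by positivity
                         linarith
  set K₁ := C * k ^ 2 + C * k ^ 2 + C * N * (2 * (2 * S.L * C₁)) + C * (C₂ * C₁ ^ 2 * 2) with hK₁
  set K₂ := (H * k * 2 + C * (2 * S.L * C₁)) * N with hK₂
  have hK₁0 : 0 ≤ K₁ := by positivity
  have hK₂0 : 0 ≤ K₂ := by positivity
  refine ⟨K₁ + K₂ + H * k + C₁, 1 / k, by positivity, by positivity,
    fun t σ z y hσ hz hy hr h0 hp hD => ?_⟩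
  have hσb : σ ∈ Icc 0 S.b := ⟨hσ.1, hσ.2.trans h.τ_le⟩
  have hσ1 := htime t z y σ hσ hz hy h0 hp hD
  have hdz := hdisp t z σ hσ hz h0 hp
  have hzD : z ∈ S.D := mem_D.2 h0.le
  have hRD : S.R z ∈ S.D := R_mem_D hzD
  have hUD := h.reflected_mem_D (t := t) hz h0 hp hσ
  have hAz := hN z ⟨hz, h0, hp⟩
  obtain ⟨hR1, hR2⟩ := hR z h0 (h.c_pos.trans_le hp)
  set Y := S.Φ t σ y
  set U := S.Φ t σ (S.R z)
  set Δ := ‖y - z‖ with hΔ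
  have hΔ0 : 0 ≤ Δ := norm_nonneg _
  have hkΔ : k * Δ ≤ 1 := by rw [le_div_iff₀ (by positivity)] at hr; linarith
  have hΔ1 : Δ ≤ 1 := by nlinarith
  have hΔ2 := S.sq_le_two_mul_rpow hΔ0 (by linarith)
  have hpow0 : 0 ≤ Δ ^ (1 + S.lam) := Real.rpow_nonneg hΔ0 _
  have hlam0 : 0 ≤ Δ ^ S.lam := Real.rpow_nonneg hΔ0 _
  have hMσ : S.M * σ ≤ S.M * (C₁ * Δ) := by gcongr
  have hYz : ‖Y - z‖ ≤ k * Δ := by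
    have e : Y - z = (Y - S.Φ t σ z) + (S.Φ t σ z - z) := by abel
    rw [e]
    refine (norm_add_le _ _).trans ((add_le_add (S.norm_Φ_sub_le t z y hσb)
      (S.norm_Φ_sub_self_le t z hσb)).trans ?_)
    rw [hk]; linarith
  have hUz : ‖U - S.R z‖ ≤ k * Δ := by
    refine (S.norm_Φ_sub_self_le t (S.R z) hσb).trans ?_
    rw [hk]; linarith
  have hl := S.lam_pos
  have p1 : ‖Y - z‖ ^ (1 + S.lam) ≤ k ^ 2 * Δ ^ (1 + S.lam) :=
    (Real.rpow_le_rpow (norm_nonneg _) hYz (by linarith)).trans (S.mul_rpow_le hk1 hΔ0)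
  have p2 : ‖U - S.R z‖ ^ (1 + S.lam) ≤ k ^ 2 * Δ ^ (1 + S.lam) :=
    (Real.rpow_le_rpow (norm_nonneg _) hUz (by linarith)).trans (S.mul_rpow_le hk1 hΔ0)
  have p3 : ‖Y - z‖ ^ S.lam ≤ k * Δ ^ S.lam :=
    (Real.rpow_le_rpow (norm_nonneg _) hYz hl.le).trans (S.mul_rpow_lam_le hk1 hΔ0)
  have p4 : ‖U - S.R z‖ ^ S.lam ≤ k * Δ ^ S.lam :=
    (Real.rpow_le_rpow (norm_nonneg _) hUz hl.le).trans (S.mul_rpow_lam_le hk1 hΔ0)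
  have q3 : ‖G' Y - G' z‖ ≤ H * (k * Δ ^ S.lam) :=
    (hhol Y hD z hzD).trans (by gcongr)
  have q4 : ‖G' U - G' (S.R z)‖ ≤ H * (k * Δ ^ S.lam) :=
    (hhol U hUD _ hRD).trans (by gcongr)
  have hGR := hG.bound _ hRD
  refine ⟨?_, ?_, ?_, ?_⟩
  · have t1 := hG.taylor z hzD Y hD (hYz.trans hkΔ)
    have t2 := hG.taylor _ hRD U hUD (hUz.trans hkΔ)
    rw [Real.norm_eq_abs] at t1 t2
    have t3 := S.norm_Φ_sub_sub_le t z y hσb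
    have e : G Y - G U - G' z (y - z) = (G Y - G z - G' z (Y - z)) -
        (G U - G (S.R z) - G' (S.R z) (U - S.R z)) +
        G' (S.R z) (S.A z ((Y - y) - (S.Φ t σ z - z))) +
        G' (S.R z) (S.A z (S.Φ t σ z - z) - (U - S.R z)) := by
      rw [hR1, hR2]
      simp only [ContinuousLinearMap.comp_apply, map_sub]
      ring
    rw [e]
    have t4 : |G' (S.R z) (S.A z ((Y - y) - (S.Φ t σ z - z)))| ≤
        C * (N * (2 * S.L * Δ * (C₁ * Δ))) := by
      refine (G' (S.R z)).le_of_opNorm_le_of_le hGR ((S.A z).le_of_opNorm_le_of_le hAz ?_)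
      exact t3.trans (by gcongr)
    have t5 : |G' (S.R z) (S.A z (S.Φ t σ z - z) - (U - S.R z))| ≤ C * (C₂ * (C₁ * Δ) ^ 2) := by
      refine (G' (S.R z)).le_of_opNorm_le_of_le hGR (hdz.trans ?_)
      gcongr
      exact hσ.1
    refine (abs_add_le _ _).trans ((add_le_add ((abs_add_le _ _).trans
      (add_le_add (abs_sub _ _) le_rfl)) le_rfl).trans ?_)
    have t6 : C * ‖Y - z‖ ^ (1 + S.lam) ≤ C * (k ^ 2 * Δ ^ (1 + S.lam)) := by gcongr
    have t7 : C * ‖U - S.R z‖ ^ (1 + S.lam) ≤ C * (k ^ 2 * Δ ^ (1 + S.lam)) := by gcongr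
    have t8 : (C * N * (2 * S.L * C₁) + C * (C₂ * C₁ ^ 2)) * Δ ^ 2 ≤
        (C * N * (2 * S.L * C₁) + C * (C₂ * C₁ ^ 2)) * (2 * Δ ^ (1 + S.lam)) := by gcongr
    have t9 : K₁ * Δ ^ (1 + S.lam) ≤ (K₁ + K₂ + H * k + C₁) * Δ ^ (1 + S.lam) := by
      gcongr
      have : 0 ≤ H * k := by positivity
      linarith
    refine le_trans ?_ t9
    rw [hK₁]
    linarith
  · have hle : K₂ * Δ ^ S.lam ≤ (K₁ + K₂ + H * k + C₁) * Δ ^ S.lam := by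
      gcongr
      have : 0 ≤ H * k := by positivity
      linarith
    refine le_trans ?_ hle
    have e : (G' U).comp ((S.J t (S.R z) σ).comp (S.A z)) - G' z =
        ((G' U - G' (S.R z)).comp (S.J t (S.R z) σ) +
          (G' (S.R z)).comp (S.J t (S.R z) σ - ContinuousLinearMap.id ℝ Phase)).comp (S.A z) := by
      rw [hR2]
      ext ξ <;> simp
    rw [e, hK₂]
    have hJ := S.norm_J_sub_id_le t (S.R z) hσb
    have hΔl : Δ ≤ Δ ^ S.lam := by
      have := Real.rpow_le_rpow_of_exponent_ge_of_imp hΔ0 hΔ1 S.lam_lt_one.le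
        (fun _ h => absurd h one_ne_zero)
      rwa [Real.rpow_one] at this
    refine (ContinuousLinearMap.opNorm_comp_le _ _).trans ?_
    have i1 : ‖(G' U - G' (S.R z)).comp (S.J t (S.R z) σ)‖ ≤ H * (k * Δ ^ S.lam) * 2 :=
      (ContinuousLinearMap.opNorm_comp_le _ _).trans
        (mul_le_mul q4 (S.norm_J_le _ _ hσb) (norm_nonneg _) (by positivity))
    have i2 : ‖(G' (S.R z)).comp (S.J t (S.R z) σ - ContinuousLinearMap.id ℝ Phase)‖ ≤
        C * (2 * S.L * (C₁ * Δ ^ S.lam)) := by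
      refine (ContinuousLinearMap.opNorm_comp_le _ _).trans
        (mul_le_mul hGR (hJ.trans ?_) (norm_nonneg _) hC)
      have : C₁ * Δ ≤ C₁ * Δ ^ S.lam := by gcongr
      gcongr
      exact hσ1.trans this
    calc _ ≤ (H * (k * Δ ^ S.lam) * 2 + C * (2 * S.L * (C₁ * Δ ^ S.lam))) * N :=
          mul_le_mul ((norm_add_le _ _).trans (add_le_add i1 i2)) hAz (norm_nonneg _)
            (by positivity)
      _ = _ := by ring
  · refine q3.trans ?_
    rw [← mul_assoc]
    gcongr
    linarith
  · refine hσ1.trans ?_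
    gcongr
    have : 0 ≤ H * k := by positivity
    linarith

/-- `Path c t σ z w B`: the backward trajectory of duration `σ` that leaves `z` at time `t`, with at
most one bounce, ends in `w`, and `B` is its linearization. -/
inductive Path (S : BilliardSystem) (c t σ : ℝ) (z : Phase) : Phase → (Phase →L[ℝ] Phase) → Prop
  | free (h : ∀ r ∈ Icc 0 σ, S.Φ t r z ∈ S.D) : Path S c t σ z (S.Φ t σ z) (S.J t z σ)
  | bounce (e : ℝ) (he : e ∈ Ico 0 σ) (h : ∀ r ∈ Icc 0 e, S.Φ t r z ∈ S.D)
      (h0 : S.ψ (S.Φ t e z).1 = 0) (hp : c ≤ S.p (S.Φ t e z)) :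
      Path S c t σ z (S.Φ (t - e) (σ - e) (S.R (S.Φ t e z)))
        ((S.J (t - e) (S.R (S.Φ t e z)) (σ - e)).comp ((S.A (S.Φ t e z)).comp (S.J t z e)))

/-- The infimum of the times at which `g` is positive: the last time up to which `g` is
nonpositive. -/
theorem exists_first_exit {g : ℝ → ℝ} {σ : ℝ} (hg : ContinuousOn g (Icc 0 σ))
    (h0 : g 0 ≤ 0) (h1 : ∃ r ∈ Icc 0 σ, 0 < g r) :
    ∃ e ∈ Ico 0 σ, (∀ r ∈ Icc 0 e, g r ≤ 0) ∧ g e = 0 ∧ ∃ r ∈ Ioc e σ, 0 < g r := by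
  set B := {r | r ∈ Icc 0 σ ∧ 0 < g r} with hB
  obtain ⟨r₁, hr₁, hgr₁⟩ := h1
  have hne : B.Nonempty := ⟨r₁, hr₁, hgr₁⟩
  have hbd : BddBelow B := ⟨0, fun r hr => hr.1.1⟩
  set e := sInf B with he
  have he0 : 0 ≤ e := le_csInf hne fun r hr => hr.1.1
  have heσ : e ≤ σ := (csInf_le hbd (show r₁ ∈ B from ⟨hr₁, hgr₁⟩)).trans hr₁.2
  have hlt : ∀ r, 0 ≤ r → r < e → g r ≤ 0 := fun r hr hre => by
    by_contra hpos
    exact absurd (csInf_le hbd (show r ∈ B from ⟨⟨hr, hre.le.trans heσ⟩, not_le.1 hpos⟩))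
      (not_le.2 hre)
  have hec : ContinuousWithinAt g (Icc 0 σ) e := hg e ⟨he0, heσ⟩
  have hle : g e ≤ 0 := by
    rcases he0.eq_or_lt with h | h
    · rw [← h]; exact h0
    · have hev : ∀ᶠ r in 𝓝[<] e, g r ≤ 0 := by
        filter_upwards [Ioo_mem_nhdsLT h] with r hr using hlt r hr.1.le hr.2
      have : Tendsto g (𝓝[<] e) (𝓝 (g e)) :=
        hec.mono_left (nhdsWithin_le_of_mem (by
          filter_upwards [Ioo_mem_nhdsLT h] with r hr using ⟨hr.1.le, hr.2.le.trans heσ⟩))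
      exact le_of_tendsto this hev
  have hr₁e : e < r₁ := by
    refine lt_of_le_of_ne (csInf_le hbd ⟨hr₁, hgr₁⟩) fun h => ?_
    rw [h] at hle
    exact absurd hgr₁ (not_lt.2 hle)
  have hge : 0 ≤ g e := by
    by_contra hneg
    have hev := hec.eventually (gt_mem_nhds (not_le.1 hneg))
    obtain ⟨s, hs, hss⟩ := mem_nhdsWithin.1 hev
    obtain ⟨ε, hε, hball⟩ := Metric.mem_nhds_iff.1 (hs.mem_nhds hss.1)
    obtain ⟨r, hr, hre⟩ := exists_lt_of_csInf_lt hne (lt_add_of_pos_right e hε)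
    have her : e ≤ r := csInf_le hbd hr
    have : g r < 0 := hss.2 ⟨hball (by
      rw [Metric.mem_ball, Real.dist_eq, abs_of_nonneg (by linarith)]; linarith), hr.1⟩
    exact absurd hr.2 (not_lt.2 this.le)
  refine ⟨e, ⟨he0, hr₁e.trans_le hr₁.2⟩, fun r hr => ?_, le_antisymm hle hge,
    r₁, ⟨hr₁e, hr₁.2⟩, hgr₁⟩
  rcases hr.2.eq_or_lt with h | h
  · rw [h]; exact hle
  · exact hlt r hr.1 h

/-- Backward trajectories exist and bounce at most once in the time `τ`, provided that they do not
meet the boundary at a grazing angle. -/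
theorem IsScale.exists_path {ρ c τ : ℝ} (h : S.IsScale ρ c τ) {t σ : ℝ} {z : Phase}
    (hσ : σ ∈ Icc 0 τ) (hz : ‖z‖ + S.M ≤ ρ) (hD : z ∈ S.D)
    (hng : ∀ e ∈ Icc 0 σ, (∀ r ∈ Icc 0 e, S.Φ t r z ∈ S.D) → S.ψ (S.Φ t e z).1 = 0 →
      c ≤ |S.p (S.Φ t e z)|) : ∃ w B, S.Path c t σ z w B := by
  by_cases hall : ∀ r ∈ Icc 0 σ, S.Φ t r z ∈ S.D
  · exact ⟨_, _, Path.free hall⟩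
  push Not at hall
  obtain ⟨r, hr, hrD⟩ := hall
  have hσb : σ ≤ S.b := hσ.2.trans h.τ_le
  have hcont : ContinuousOn (fun s => S.ψ (S.Φ t s z).1) (Icc 0 σ) :=
    (S.continuous_ψ.comp continuous_fst).comp_continuousOn
      ((S.continuousOn_Φ t z).mono (Icc_subset_Icc_right hσb))
  obtain ⟨e, he, hle, he0, s, hs, hspos⟩ := exists_first_exit hcont
    (by rw [Φ_zero]; exact mem_D.1 hD) ⟨r, hr, not_le.1 fun hh => hrD (mem_D.2 hh)⟩
  have heb : e ∈ Icc 0 S.b := ⟨he.1, he.2.le.trans hσb⟩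
  have hin : ∀ r ∈ Icc 0 e, S.Φ t r z ∈ S.D := fun r hr => mem_D.2 (hle r hr)
  have hp : c ≤ S.p (S.Φ t e z) := by
    rcases le_abs.1 (hng e ⟨he.1, he.2.le⟩ hin he0) with hp | hp
    · exact hp
    exfalso
    have h1 := h.inward (t - e) (S.Φ t e z) ((S.norm_Φ_le le_rfl heb).trans hz) he0 (by linarith)
      (s - e) ⟨by linarith [hs.1], by linarith [hs.2, hσ.2, he.1]⟩
    rw [← S.Φ_add t z he.1 (by linarith [hs.1]) (by linarith [hs.2]), add_sub_cancel] at h1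
    have h2 : 0 ≤ c / 2 * (s - e) := mul_nonneg (by linarith [h.c_pos]) (by linarith [hs.1])
    linarith
  exact ⟨_, _, Path.bounce e he hin he0 hp⟩

theorem Path.mem_D {ρ c τ t σ : ℝ} {z w : Phase} {B : Phase →L[ℝ] Phase}
    (hP : S.Path c t σ z w B) (h : S.IsScale ρ c τ) (hσ : σ ∈ Icc 0 τ) (hz : ‖z‖ + S.M ≤ ρ) :
    w ∈ S.D := by
  cases hP with
  | free hin => exact hin σ (right_mem_Icc.2 hσ.1)
  | bounce e he hin h0 hp =>
    exact h.reflected_mem_D ((S.norm_Φ_le le_rfl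
      ⟨he.1, he.2.le.trans (hσ.2.trans h.τ_le)⟩).trans hz) h0 hp
      ⟨by linarith [he.2], by linarith [he.1, hσ.2]⟩

theorem IsScale.exists_path_bound {ρ c τ : ℝ} (h : S.IsScale ρ c τ) : ∃ C, 1 ≤ C ∧
    ∀ t σ z w B, σ ∈ Icc 0 τ → ‖z‖ + S.M ≤ ρ → S.Path c t σ z w B → ‖B‖ ≤ C := by
  obtain ⟨N, hN0, hN, -⟩ := S.isBddLip_A ρ h.c_pos
  refine ⟨2 + 2 * (N * 2), by linarith, fun t σ z w B hσ hz hP => ?_⟩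
  have hσb : σ ≤ S.b := hσ.2.trans h.τ_le
  cases hP with
  | free hin => exact (S.norm_J_le _ _ ⟨hσ.1, hσb⟩).trans (by linarith)
  | bounce e he hin h0 hp =>
    have heb : e ∈ Icc 0 S.b := ⟨he.1, he.2.le.trans hσb⟩
    have h1 := hN _ ⟨(S.norm_Φ_le le_rfl heb).trans hz, h0, hp⟩
    have h2 : ‖(S.A (S.Φ t e z)).comp (S.J t z e)‖ ≤ N * 2 :=
      (ContinuousLinearMap.opNorm_comp_le _ _).trans
        (mul_le_mul h1 (S.norm_J_le _ _ heb) (norm_nonneg _) hN0)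
    refine (ContinuousLinearMap.opNorm_comp_le _ _).trans ((mul_le_mul (S.norm_J_le _ _
      ⟨by linarith [he.2], by linarith [he.1]⟩) h2 (norm_nonneg _) zero_le_two).trans ?_)
    linarith

end BilliardSystem

namespace BilliardSystem

variable {S : BilliardSystem}

/-! ### First-order expansion of transported functions -/

/-- The chain rule for first-order expansions. -/
theorem abs_sub_sub_le_of_taylor {G : Phase → ℝ} {G' : Phase → Phase →L[ℝ] ℝ} {C C₁ C₂ : ℝ}
    (hG : IsTaylor S.D S.lam C G G') (h1 : 0 ≤ C₁) (h2 : 0 ≤ C₂) {w w' ξ : Phase}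
    {B : Phase →L[ℝ] Phase} (hw : w ∈ S.D) (hw' : w' ∈ S.D) (hξ : (C₁ + C₂ + 1) * ‖ξ‖ ≤ 1)
    (hB : ‖B‖ ≤ C₂) (hd : ‖w' - w - B ξ‖ ≤ C₁ * ‖ξ‖ ^ (1 + S.lam)) :
    |G w' - G w - G' w (B ξ)| ≤ C * ((C₁ + C₂ + 1) ^ 2 + C₁) * ‖ξ‖ ^ (1 + S.lam) := by
  have h0 := norm_nonneg ξ
  have hC := hG.nonneg
  have hξ1 : ‖ξ‖ ≤ 1 := by nlinarith
  have hww : ‖w' - w‖ ≤ (C₁ + C₂ + 1) * ‖ξ‖ := by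
    have e : w' - w = (w' - w - B ξ) + B ξ := by abel
    rw [e]
    refine (norm_add_le _ _).trans ((add_le_add hd (B.le_of_opNorm_le hB ξ)).trans ?_)
    have := mul_le_mul_of_nonneg_left (S.rpow_le_self h0 hξ1) h1
    nlinarith
  have t1 := hG.taylor w hw w' hw' (hww.trans hξ)
  rw [Real.norm_eq_abs] at t1
  have t2 : ‖w' - w‖ ^ (1 + S.lam) ≤ (C₁ + C₂ + 1) ^ 2 * ‖ξ‖ ^ (1 + S.lam) :=
    (Real.rpow_le_rpow (norm_nonneg _) hww (by linarith [S.lam_pos])).trans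
      (S.mul_rpow_le (by linarith) h0)
  have t3 : |G' w (w' - w - B ξ)| ≤ C * (C₁ * ‖ξ‖ ^ (1 + S.lam)) :=
    (G' w).le_of_opNorm_le_of_le (hG.bound w hw) hd
  have e : G w' - G w - G' w (B ξ) = (G w' - G w - G' w (w' - w)) + G' w (w' - w - B ξ) := by
    rw [map_sub (G' w) (w' - w)]; ring
  rw [e]
  refine (abs_add_le _ _).trans ?_
  have t4 : C * ‖w' - w‖ ^ (1 + S.lam) ≤ C * ((C₁ + C₂ + 1) ^ 2 * ‖ξ‖ ^ (1 + S.lam)) := by gcongr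
  linarith

/-- The expansion, in both directions, for one trajectory with and one without a bounce. -/
theorem IsScale.exists_mixed_taylor {ρ c τ : ℝ} (h : S.IsScale ρ c τ) {G : Phase → ℝ}
    {G' : Phase → Phase →L[ℝ] ℝ} {C : ℝ} (hG : IsTaylor S.D S.lam C G G')
    (hR : S.IsReflecting G G') : ∃ C' r, 0 ≤ C' ∧ 0 < r ∧ ∀ t σ z y e, σ ∈ Icc 0 τ →
    ‖z‖ + S.M ≤ ρ → ‖y‖ + S.M ≤ ρ → ‖y - z‖ ≤ r → (∀ s ∈ Icc 0 σ, S.Φ t s y ∈ S.D) →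
    e ∈ Ico 0 σ → (∀ s ∈ Icc 0 e, S.Φ t s z ∈ S.D) → S.ψ (S.Φ t e z).1 = 0 →
    c ≤ S.p (S.Φ t e z) →
    |G (S.Φ t σ y) - G (S.Φ (t - e) (σ - e) (S.R (S.Φ t e z))) -
      G' (S.Φ (t - e) (σ - e) (S.R (S.Φ t e z)))
        (S.J (t - e) (S.R (S.Φ t e z)) (σ - e) (S.A (S.Φ t e z) (S.J t z e (y - z))))| ≤
      C' * ‖y - z‖ ^ (1 + S.lam) ∧
    |G (S.Φ (t - e) (σ - e) (S.R (S.Φ t e z))) - G (S.Φ t σ y) -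
      G' (S.Φ t σ y) (S.J t y σ (z - y))| ≤ C' * ‖y - z‖ ^ (1 + S.lam) := by
  obtain ⟨C₁, r, hC₁, hr, hmain⟩ := h.exists_reflecting_taylor hG hR
  obtain ⟨Cf, hCf, hflow⟩ := S.exists_Φ_taylor ρ
  have hC := hG.nonneg
  have hL := S.L_pos
  refine ⟨4 * C₁ + C * Cf + 4 * C₁ + 4 * (C * (2 * S.L * C₁)), min (r / 2) (1 / 2),
    by positivity, by positivity,
    fun t σ z y e hσ hz hy hyz hyin he hzin h0 hp => ?_⟩
  have hM := S.M_pos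
  have hl := S.lam_pos
  have hσb : σ ≤ S.b := hσ.2.trans h.τ_le
  have heb : e ∈ Icc 0 S.b := ⟨he.1, he.2.le.trans hσb⟩
  have hσ' : σ - e ∈ Icc 0 τ := ⟨by linarith [he.2], by linarith [he.1, hσ.2]⟩
  set Δ := ‖y - z‖ with hΔ
  have hΔ0 : 0 ≤ Δ := norm_nonneg _
  have hΔr : 2 * Δ ≤ r := by linarith [hyz.trans (min_le_left _ _)]
  have hΔ1 : Δ ≤ 1 := by linarith [hyz.trans (min_le_right _ _)]
  have hw : S.Φ t σ y = S.Φ (t - e) (σ - e) (S.Φ t e y) := by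
    rw [← S.Φ_add t y he.1 hσ'.1 (by linarith), add_sub_cancel]
  have hyn := S.norm_Φ_sub_le t z y heb
  obtain ⟨m1, m2, m3, m4⟩ := hmain (t - e) (σ - e) (S.Φ t e z) (S.Φ t e y) hσ'
    ((S.norm_Φ_le le_rfl heb).trans hz) ((S.norm_Φ_le le_rfl heb).trans hy) (hyn.trans hΔr) h0 hp
    (by rw [← hw]; exact hyin σ (right_mem_Icc.2 hσ.1))
  rw [← hw] at m1 m3
  have f1 := hflow t z y e heb (by linarith) (by linarith) hΔ1 (fun s hs => (hzin s hs).1)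
    (fun s hs => (hyin s ⟨hs.1, hs.2.trans he.2.le⟩).1)
  have f2 := hflow t y z e heb (by linarith) (by linarith) (by rw [norm_sub_rev]; exact hΔ1)
    (fun s hs => (hyin s ⟨hs.1, hs.2.trans he.2.le⟩).1) (fun s hs => (hzin s hs).1)
  rw [norm_sub_rev z] at f2
  have hza : S.Φ t e z ∈ S.D := hzin e (right_mem_Icc.2 he.1)
  have hwy : S.Φ t σ y ∈ S.D := hyin σ (right_mem_Icc.2 hσ.1)
  set a := S.Φ t e z
  set a' := S.Φ t e y
  set w := S.Φ (t - e) (σ - e) (S.R a)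
  set w' := S.Φ t σ y
  have hd0 : 0 ≤ ‖a' - a‖ := norm_nonneg _
  have p1 : ‖a' - a‖ ^ (1 + S.lam) ≤ 4 * Δ ^ (1 + S.lam) :=
    (Real.rpow_le_rpow hd0 hyn (by linarith)).trans (S.two_mul_rpow_le hΔ0)
  have p2 : ‖a' - a‖ ^ S.lam ≤ 2 * Δ ^ S.lam :=
    (Real.rpow_le_rpow hd0 hyn hl.le).trans (S.mul_rpow_lam_le one_le_two hΔ0)
  have hself := S.rpow_mul_self hΔ0
  have hpow0 : 0 ≤ Δ ^ (1 + S.lam) := Real.rpow_nonneg hΔ0 _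
  have hsq := S.sq_le_two_mul_rpow hΔ0 (by linarith)
  have q1 : C₁ * ‖a' - a‖ ^ (1 + S.lam) ≤ C₁ * (4 * Δ ^ (1 + S.lam)) := by gcongr
  have q2 : C₁ * ‖a' - a‖ ^ S.lam ≤ C₁ * (2 * Δ ^ S.lam) := by gcongr
  have hGa := hG.bound a hza
  have hJz := S.norm_J_le t z heb
  have hJy := S.norm_J_le t y heb
  constructor
  · have e1 : G w' - G w - G' w (S.J (t - e) (S.R a) (σ - e) (S.A a (S.J t z e (y - z)))) =
        (G w' - G w - G' a (a' - a)) + G' a (a' - a - S.J t z e (y - z)) -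
        ((G' w).comp ((S.J (t - e) (S.R a) (σ - e)).comp (S.A a)) - G' a) (S.J t z e (y - z)) := by
      simp only [_root_.sub_apply, ContinuousLinearMap.comp_apply, map_sub]
      ring
    rw [e1]
    have i1 : |G' a (a' - a - S.J t z e (y - z))| ≤ C * (Cf * Δ ^ (1 + S.lam)) :=
      (G' a).le_of_opNorm_le_of_le hGa f1
    have i2 : |((G' w).comp ((S.J (t - e) (S.R a) (σ - e)).comp (S.A a)) - G' a)
        (S.J t z e (y - z))| ≤ C₁ * (2 * Δ ^ S.lam) * (2 * Δ) :=
      ContinuousLinearMap.le_of_opNorm_le_of_le _ (m2.trans q2)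
        ((S.J t z e).le_of_opNorm_le hJz _)
    refine (abs_sub _ _).trans ((add_le_add (abs_add_le _ _) le_rfl).trans ?_)
    have i3 : C₁ * (2 * Δ ^ S.lam) * (2 * Δ) = 4 * C₁ * Δ ^ (1 + S.lam) := by
      rw [← hself]; ring
    have i4 : 0 ≤ 4 * (C * (2 * S.L * C₁)) * Δ ^ (1 + S.lam) := by positivity
    have := m1.trans q1
    linarith
  · have e1 : G w - G w' - G' w' (S.J t y σ (z - y)) =
        -(G w' - G w - G' a (a' - a)) + G' a (a - a' - S.J t y e (z - y)) -
        (G' w' - G' a) (S.J t y e (z - y)) - G' w' ((S.J t y σ - S.J t y e) (z - y)) := by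
      simp only [_root_.sub_apply, map_sub]
      ring
    rw [e1]
    have i1 : |G' a (a - a' - S.J t y e (z - y))| ≤ C * (Cf * Δ ^ (1 + S.lam)) :=
      (G' a).le_of_opNorm_le_of_le hGa f2
    have hzy : ‖z - y‖ ≤ Δ := by rw [norm_sub_rev]
    have i2 : |(G' w' - G' a) (S.J t y e (z - y))| ≤ C₁ * (2 * Δ ^ S.lam) * (2 * Δ) :=
      ContinuousLinearMap.le_of_opNorm_le_of_le _ (m3.trans q2)
        ((S.J t y e).le_of_opNorm_le_of_le hJy hzy)
    have hσe : σ - e ≤ C₁ * (2 * Δ) := m4.trans (by gcongr)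
    have hJJ : ‖S.J t y σ - S.J t y e‖ ≤ 2 * S.L * (C₁ * (2 * Δ)) := by
      refine (S.norm_J_sub_le t y heb ⟨hσ.1, hσb⟩).trans ?_
      rw [abs_of_nonneg hσ'.1]
      gcongr
    have i5 : |G' w' ((S.J t y σ - S.J t y e) (z - y))| ≤ C * (2 * S.L * (C₁ * (2 * Δ)) * Δ) :=
      (G' w').le_of_opNorm_le_of_le (hG.bound w' hwy)
        (ContinuousLinearMap.le_of_opNorm_le_of_le _ hJJ hzy)
    refine (abs_sub _ _).trans ((add_le_add ((abs_sub _ _).trans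
      (add_le_add (abs_add_le _ _) le_rfl)) le_rfl).trans ?_)
    rw [abs_neg]
    have i3 : C₁ * (2 * Δ ^ S.lam) * (2 * Δ) = 4 * C₁ * Δ ^ (1 + S.lam) := by
      rw [← hself]; ring
    have i6 : C * (2 * S.L * C₁) * (2 * Δ ^ 2) ≤
        C * (2 * S.L * C₁) * (2 * (2 * Δ ^ (1 + S.lam))) := by
      gcongr
    have := m1.trans q1
    linarith

/-- The expansion, in both directions, for two bouncing trajectories. -/
theorem IsScale.exists_two_bounce_taylor {ρ c τ : ℝ} (h : S.IsScale ρ c τ) :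
    ∃ C' r, 0 ≤ C' ∧ 0 < r ∧ ∀ t σ z y e e', σ ∈ Icc 0 τ →
    ‖z‖ + S.M ≤ ρ → ‖y‖ + S.M ≤ ρ → ‖y - z‖ ≤ r → e ∈ Ico 0 σ → e' ∈ Ico 0 σ → e ≤ e' →
    (∀ s ∈ Icc 0 e, S.Φ t s z ∈ S.D) → S.ψ (S.Φ t e z).1 = 0 → c ≤ S.p (S.Φ t e z) →
    (∀ s ∈ Icc 0 e', S.Φ t s y ∈ S.D) → S.ψ (S.Φ t e' y).1 = 0 → c ≤ S.p (S.Φ t e' y) →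
    ‖S.Φ (t - e') (σ - e') (S.R (S.Φ t e' y)) - S.Φ (t - e) (σ - e) (S.R (S.Φ t e z)) -
      S.J (t - e) (S.R (S.Φ t e z)) (σ - e) (S.A (S.Φ t e z) (S.J t z e (y - z)))‖ ≤
      C' * ‖y - z‖ ^ (1 + S.lam) ∧
    ‖S.Φ (t - e) (σ - e) (S.R (S.Φ t e z)) - S.Φ (t - e') (σ - e') (S.R (S.Φ t e' y)) -
      S.J (t - e') (S.R (S.Φ t e' y)) (σ - e') (S.A (S.Φ t e' y) (S.J t y e' (z - y)))‖ ≤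
      C' * ‖y - z‖ ^ (1 + S.lam) := by
  obtain ⟨C₁, r, hC₁, hr, hmain⟩ := h.exists_bounce_taylor
  obtain ⟨C₂, hC₂, htime⟩ := h.exists_time_le
  obtain ⟨Cf, hCf, hflow⟩ := S.exists_Φ_taylor ρ
  obtain ⟨N, hN0, hN, -⟩ := S.isBddLip_A ρ h.c_pos
  have hL := S.L_pos
  refine ⟨4 * C₁ + 2 * (N * Cf) + 2 * (N * (2 * S.L * (C₂ * 2) * 2)), min (r / 2) (1 / 2),
    by positivity, by positivity,
    fun t σ z y e e' hσ hz hy hyz he he' hee hzin h0 hp hyin h0' hp' => ?_⟩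
  have hM := S.M_pos
  have hl := S.lam_pos
  have hσb : σ ≤ S.b := hσ.2.trans h.τ_le
  have heb : e ∈ Icc 0 S.b := ⟨he.1, he.2.le.trans hσb⟩
  have heb' : e' ∈ Icc 0 S.b := ⟨he'.1, he'.2.le.trans hσb⟩
  have hσ' : σ - e ∈ Icc 0 τ := ⟨by linarith [he.2], by linarith [he.1, hσ.2]⟩
  have hδ : e' - e ∈ Icc 0 (σ - e) := ⟨by linarith, by linarith [he'.2]⟩
  set Δ := ‖y - z‖ with hΔ
  have hΔ0 : 0 ≤ Δ := norm_nonneg _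
  have hΔr : 2 * Δ ≤ r := by linarith [hyz.trans (min_le_left _ _)]
  have hΔ1 : Δ ≤ 1 := by linarith [hyz.trans (min_le_right _ _)]
  have hw : S.Φ (t - e) (e' - e) (S.Φ t e y) = S.Φ t e' y := by
    rw [← S.Φ_add t y he.1 hδ.1 (by linarith [heb'.2]), add_sub_cancel]
  have hyn := S.norm_Φ_sub_le t z y heb
  have hzn : ‖S.Φ t e z‖ ≤ ρ := (S.norm_Φ_le le_rfl heb).trans hz
  have hyn1 : ‖S.Φ t e y‖ ≤ ρ := (S.norm_Φ_le le_rfl heb).trans hy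
  have hyn2 : ‖S.Φ t e' y‖ ≤ ρ := (S.norm_Φ_le le_rfl heb').trans hy
  have hm := hmain (t - e) (σ - e) (S.Φ t e z) (S.Φ t e y) (e' - e) hσ' hδ hzn hyn1
    (hyn.trans hΔr) h0 hp
  rw [hw, sub_sub t e, sub_sub σ e, add_sub_cancel] at hm
  obtain ⟨m1, m2⟩ := hm hyn2 h0' hp'
  have hti := htime (t - e) (S.Φ t e z) (S.Φ t e y) (e' - e) ⟨hδ.1, hδ.2.trans hσ'.2⟩ hzn hyn1 h0 hp
    (by rw [hw]; exact hyin e' (right_mem_Icc.2 he'.1))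
  have f1 := hflow t z y e heb (by linarith) (by linarith) hΔ1 (fun s hs => (hzin s hs).1)
    (fun s hs => (hyin s ⟨hs.1, hs.2.trans hee⟩).1)
  have f2 := hflow t y z e heb (by linarith) (by linarith) (by rw [norm_sub_rev]; exact hΔ1)
    (fun s hs => (hyin s ⟨hs.1, hs.2.trans hee⟩).1) (fun s hs => (hzin s hs).1)
  rw [norm_sub_rev z] at f2
  have hA := hN _ ⟨hzn, h0, hp⟩
  have hA' := hN _ ⟨hyn2, h0', hp'⟩
  set a := S.Φ t e z
  set a' := S.Φ t e y
  set b := S.Φ t e' y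
  set w := S.Φ (t - e) (σ - e) (S.R a)
  set w' := S.Φ (t - e') (σ - e') (S.R b)
  have p1 : ‖a' - a‖ ^ (1 + S.lam) ≤ 4 * Δ ^ (1 + S.lam) :=
    (Real.rpow_le_rpow (norm_nonneg _) hyn (by linarith)).trans (S.two_mul_rpow_le hΔ0)
  have hsq := S.sq_le_two_mul_rpow hΔ0 (by linarith)
  have q1 : C₁ * ‖a' - a‖ ^ (1 + S.lam) ≤ C₁ * (4 * Δ ^ (1 + S.lam)) := by gcongr
  have hpow0 : 0 ≤ Δ ^ (1 + S.lam) := Real.rpow_nonneg hΔ0 _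
  have hJ1 := S.norm_J_le (t - e) (S.R a) (s := σ - e) ⟨hσ'.1, hσ'.2.trans h.τ_le⟩
  have hJ2 := S.norm_J_le (t - e') (S.R b) (s := σ - e')
    ⟨by linarith [he'.2], by linarith [he'.1]⟩
  constructor
  · have e1 : w' - w - S.J (t - e) (S.R a) (σ - e) (S.A a (S.J t z e (y - z))) =
        (w' - w - S.J (t - e) (S.R a) (σ - e) (S.A a (a' - a))) +
        S.J (t - e) (S.R a) (σ - e) (S.A a (a' - a - S.J t z e (y - z))) := by
      simp only [map_sub]; abel
    rw [e1]
    have i1 := (S.J (t - e) (S.R a) (σ - e)).le_of_opNorm_le_of_le hJ1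
      ((S.A a).le_of_opNorm_le_of_le hA f1)
    have i4 : 0 ≤ 2 * (N * (2 * S.L * (C₂ * 2) * 2)) * Δ ^ (1 + S.lam) := by positivity
    refine (norm_add_le _ _).trans ((add_le_add (m1.trans q1) i1).trans ?_)
    linarith
  · have e1 : w - w' - S.J (t - e') (S.R b) (σ - e') (S.A b (S.J t y e' (z - y))) =
        (w - w' - S.J (t - e') (S.R b) (σ - e') (S.A b (a - a'))) +
        S.J (t - e') (S.R b) (σ - e') (S.A b ((a - a' - S.J t y e (z - y)) -
          (S.J t y e' - S.J t y e) (z - y))) := by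
      simp only [_root_.sub_apply, map_sub]; abel
    rw [e1]
    have hzy : ‖z - y‖ ≤ Δ := by rw [norm_sub_rev]
    have hJJ : ‖S.J t y e' - S.J t y e‖ ≤ 2 * S.L * (C₂ * (2 * Δ)) := by
      refine (S.norm_J_sub_le t y heb heb').trans ?_
      rw [abs_of_nonneg hδ.1]
      gcongr
      exact hti.trans (by gcongr)
    have i1 := (S.J (t - e') (S.R b) (σ - e')).le_of_opNorm_le_of_le hJ2
      ((S.A b).le_of_opNorm_le_of_le hA' ((norm_sub_le _ _).trans (add_le_add f2
        (ContinuousLinearMap.le_of_opNorm_le_of_le _ hJJ hzy))))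
    refine (norm_add_le _ _).trans ((add_le_add (m2.trans q1) i1).trans ?_)
    have i6 : 2 * (N * (2 * S.L * (C₂ * 2))) * Δ ^ 2 ≤
        2 * (N * (2 * S.L * (C₂ * 2))) * (2 * Δ ^ (1 + S.lam)) := by gcongr
    linarith

/-- Transport along trajectories with at most one bounce preserves `C^{1,lam}` regularity up to
the boundary of reflecting functions. -/
theorem IsScale.exists_path_taylor {ρ c τ : ℝ} (h : S.IsScale ρ c τ) {G : Phase → ℝ}
    {G' : Phase → Phase →L[ℝ] ℝ} {C : ℝ} (hG : IsTaylor S.D S.lam C G G')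
    (hR : S.IsReflecting G G') : ∃ C' r, 0 ≤ C' ∧ 0 < r ∧ r ≤ 1 ∧ ∀ t σ z z' w w' B B',
    σ ∈ Icc 0 τ → ‖z‖ + S.M ≤ ρ → ‖z'‖ + S.M ≤ ρ → ‖z' - z‖ ≤ r →
    S.Path c t σ z w B → S.Path c t σ z' w' B' →
    |G w' - G w - G' w (B (z' - z))| ≤ C' * ‖z' - z‖ ^ (1 + S.lam) := by
  obtain ⟨C₁, r₁, hC₁, hr₁, h1⟩ := h.exists_mixed_taylor hG hR
  obtain ⟨C₂, r₂, hC₂, hr₂, h2⟩ := h.exists_two_bounce_taylor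
  obtain ⟨Cf, hCf, hflow⟩ := S.exists_Φ_taylor ρ
  obtain ⟨N, hN1, hN⟩ := h.exists_path_bound
  have hC := hG.nonneg
  have hM := S.M_pos
  set K := Cf + C₂ with hK
  refine ⟨C₁ + C * ((K + N + 1) ^ 2 + K), min (min r₁ r₂) (1 / (K + N + 1)),
    by positivity, by positivity, ?_, fun t σ z z' w w' B B' hσ hz hz' hzz hP hP' => ?_⟩
  · refine (min_le_right _ _).trans ?_
    rw [div_le_one (by positivity)]
    linarith [add_nonneg hCf hC₂]
  have hwD := hP.mem_D h hσ hz
  have hwD' := hP'.mem_D h hσ hz'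
  have hB := hN t σ z w B hσ hz hP
  have hz1 := hzz.trans ((min_le_left _ _).trans (min_le_left _ _))
  have hz2 := hzz.trans ((min_le_left _ _).trans (min_le_right _ _))
  have hz3 := hzz.trans (min_le_right _ _)
  rw [le_div_iff₀ (by positivity), mul_comm] at hz3
  have hpow0 : 0 ≤ ‖z' - z‖ ^ (1 + S.lam) := Real.rpow_nonneg (norm_nonneg _) _
  have hsm : ‖z' - z‖ ≤ 1 := by
    have : 1 ≤ K + N + 1 := by linarith [add_nonneg hCf hC₂]
    nlinarith [norm_nonneg (z' - z)]
  have hσb : σ ∈ Icc 0 S.b := ⟨hσ.1, hσ.2.trans h.τ_le⟩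
  have fin1 : ∀ x : ℝ, x ≤ C₁ * ‖z' - z‖ ^ (1 + S.lam) →
      x ≤ (C₁ + C * ((K + N + 1) ^ 2 + K)) * ‖z' - z‖ ^ (1 + S.lam) := fun x hx => by
    have : 0 ≤ C * ((K + N + 1) ^ 2 + K) * ‖z' - z‖ ^ (1 + S.lam) := by positivity
    linarith
  have fin2 : ‖w' - w - B (z' - z)‖ ≤ K * ‖z' - z‖ ^ (1 + S.lam) →
      |G w' - G w - G' w (B (z' - z))| ≤
      (C₁ + C * ((K + N + 1) ^ 2 + K)) * ‖z' - z‖ ^ (1 + S.lam) := fun hx => by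
    have := abs_sub_sub_le_of_taylor hG (by positivity) (by linarith) hwD hwD' hz3 hB hx
    have h0 : 0 ≤ C₁ * ‖z' - z‖ ^ (1 + S.lam) := by positivity
    linarith
  have hK1 : Cf * ‖z' - z‖ ^ (1 + S.lam) ≤ K * ‖z' - z‖ ^ (1 + S.lam) := by gcongr; linarith
  have hK2 : C₂ * ‖z' - z‖ ^ (1 + S.lam) ≤ K * ‖z' - z‖ ^ (1 + S.lam) := by gcongr; linarith
  cases hP with
  | free hin =>
    cases hP' with
    | free hin' =>
      exact fin2 ((hflow t z z' σ hσb (by linarith) (by linarith) hsm (fun s hs => (hin s hs).1)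
        (fun s hs => (hin' s hs).1)).trans hK1)
    | bounce e' he' hin' h0' hp' =>
      have := (h1 t σ z' z e' hσ hz' hz (by rw [norm_sub_rev]; exact hz1) hin he' hin' h0' hp').2
      rw [norm_sub_rev z] at this
      exact fin1 _ this
  | bounce e he hin h0 hp =>
    cases hP' with
    | free hin' =>
      exact fin1 _ (h1 t σ z z' e hσ hz hz' hz1 hin' he hin h0 hp).1
    | bounce e' he' hin' h0' hp' =>
      rcases le_total e e' with hee | hee
      · exact fin2 ((h2 t σ z z' e e' hσ hz hz' hz2 he he' hee hin h0 hp hin' h0' hp').1.trans hK2)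
      · have := (h2 t σ z' z e' e hσ hz' hz (by rw [norm_sub_rev]; exact hz2) he' he hee hin' h0'
          hp' hin h0 hp).2
        rw [norm_sub_rev z] at this
        exact fin2 (this.trans hK2)

end BilliardSystem

namespace BilliardSystem

variable {S : BilliardSystem}

/-! ### One time step of the transport -/

theorem Path.of_zero {c t : ℝ} {z w : Phase} {B : Phase →L[ℝ] Phase} (h : S.Path c t 0 z w B) :
    w = z ∧ B = ContinuousLinearMap.id ℝ Phase := by
  cases h with
  | free hin => exact ⟨S.Φ_zero t z, S.J_zero t z⟩
  | bounce e he => exact absurd (he.1.trans_lt he.2) (lt_irrefl _)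

/-- At an outgoing boundary state the bounce is instantaneous. -/
theorem Path.of_outgoing {ρ c τ t σ : ℝ} {z w : Phase} {B : Phase →L[ℝ] Phase}
    (hP : S.Path c t σ z w B) (h : S.IsScale ρ c τ) (hσ : σ ∈ Ioc 0 τ) (hz : ‖z‖ ≤ ρ)
    (h0 : S.ψ z.1 = 0) (hp : c ≤ S.p z) :
    w = S.Φ t σ (S.R z) ∧ B = (S.J t (S.R z) σ).comp (S.A z) := by
  have key : ∀ s ∈ Icc 0 τ, S.Φ t s z ∈ S.D → s = 0 := fun s hs hD => by
    have h1 := h.outward t z hz h0 hp s hs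
    have h2 := BilliardSystem.mem_D.1 hD
    have h3 : c / 2 * s ≤ 0 := h1.trans h2
    have := h.c_pos
    exact le_antisymm (by nlinarith) hs.1
  cases hP with
  | free hin =>
    exact absurd (key σ ⟨hσ.1.le, hσ.2⟩ (hin σ (right_mem_Icc.2 hσ.1.le))) hσ.1.ne'
  | bounce e he hin h0' hp' =>
    obtain rfl := key e ⟨he.1, he.2.le.trans hσ.2⟩ (hin e (right_mem_Icc.2 he.1))
    rw [sub_zero, sub_zero, S.Φ_zero, S.J_zero]
    exact ⟨rfl, by rw [ContinuousLinearMap.comp_id]⟩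

/-- At an incoming boundary state there is no bounce. -/
theorem Path.of_incoming {ρ c τ t σ : ℝ} {z w : Phase} {B : Phase →L[ℝ] Phase}
    (hP : S.Path c t σ z w B) (h : S.IsScale ρ c τ) (hσ : σ ∈ Icc 0 τ) (hz : ‖z‖ ≤ ρ)
    (h0 : S.ψ z.1 = 0) (hp : S.p z ≤ -c) : w = S.Φ t σ z ∧ B = S.J t z σ := by
  cases hP with
  | free hin => exact ⟨rfl, rfl⟩
  | bounce e he hin h0' hp' =>
    exfalso
    have hc := h.c_pos
    have h1 := h.inward t z hz h0 hp e ⟨he.1, he.2.le.trans hσ.2⟩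
    rw [h0'] at h1
    have he0 : e = 0 := le_antisymm (by nlinarith) he.1
    subst he0
    rw [S.Φ_zero] at hp'
    linarith

/-- Prolongation of a path by a free piece at its beginning. -/
theorem Path.prepend {c t σ δ : ℝ} {z w : Phase} {B : Phase →L[ℝ] Phase}
    (hP : S.Path c t σ (S.Φ (t + δ) δ z) w B) (hδ : 0 ≤ δ) (hσ : 0 ≤ σ) (hb : δ + σ ≤ S.b)
    (hin : ∀ s ∈ Icc 0 δ, S.Φ (t + δ) s z ∈ S.D) : ∃ B', S.Path c (t + δ) (δ + σ) z w B' := by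
  have hadd : ∀ s, 0 ≤ s → s ≤ σ → S.Φ (t + δ) (δ + s) z = S.Φ t s (S.Φ (t + δ) δ z) :=
    fun s hs hsσ => by
      rw [S.Φ_add (t + δ) z hδ hs (by linarith), add_sub_cancel_right]
  have hin' : ∀ e ≤ σ, (∀ s ∈ Icc 0 e, S.Φ t s (S.Φ (t + δ) δ z) ∈ S.D) →
      ∀ s ∈ Icc 0 (δ + e), S.Φ (t + δ) s z ∈ S.D := by
    intro e he h s hs
    rcases le_total s δ with h1 | h1
    · exact hin s ⟨hs.1, h1⟩
    · have := hadd (s - δ) (by linarith) (by linarith [hs.2])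
      rw [add_sub_cancel] at this
      rw [this]
      exact h _ ⟨by linarith, by linarith [hs.2]⟩
  cases hP with
  | free h =>
    refine ⟨S.J (t + δ) z (δ + σ), ?_⟩
    rw [← hadd σ hσ le_rfl]
    exact Path.free (hin' σ le_rfl h)
  | bounce e he h h0 hp =>
    have h1 := hadd e he.1 he.2.le
    have h2 : t + δ - (δ + e) = t - e := by ring
    have h3 : δ + σ - (δ + e) = σ - e := by ring
    rw [← h1] at h0 hp ⊢
    have := Path.bounce (σ := δ + σ) (δ + e) ⟨by linarith [he.1], by linarith [he.2]⟩
      (hin' e he.2.le h) h0 hp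
    rw [h2, h3] at this
    exact ⟨_, this⟩

variable (S) in
/-- The velocity lemma in the form in which it is used: for states of size at most `ρ` the energy
controls the distance to the boundary and changes at most by the factor `exp (C * T)`. -/
def EnergyBounds (ρ K C : ℝ) : Prop :=
  ∀ t T Z, 0 ≤ T → S.IsTraj t T Z → (∀ s ∈ Icc 0 T, Z s ∈ S.D ∧ ‖Z s‖ ≤ ρ) →
    Real.exp (-(C * T)) * S.energy K (Z 0) ≤ S.energy K (Z T) ∧
    S.energy K (Z T) ≤ Real.exp (C * T) * S.energy K (Z 0)

theorem EnergyBounds.of_flow {ρ K C : ℝ} (h : S.EnergyBounds ρ K C) {t s : ℝ} {z : Phase}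
    (hs : s ∈ Icc 0 S.b) (hz : ‖z‖ + S.M ≤ ρ) (hin : ∀ r ∈ Icc 0 s, S.Φ t r z ∈ S.D) :
    Real.exp (-(C * s)) * S.energy K z ≤ S.energy K (S.Φ t s z) ∧
    S.energy K (S.Φ t s z) ≤ Real.exp (C * s) * S.energy K z := by
  have := h t s (fun r => S.Φ t r z) hs.1 ((S.isTraj_Φ t z).mono hs.2) (fun r hr => ⟨hin r hr,
    (S.norm_Φ_le le_rfl ⟨hr.1, hr.2.trans hs.2⟩).trans hz⟩)
  simpa only [Φ_zero] using this

/-- The velocity lemma along a path: the reflection preserves the kinetic distance and the size of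
the momentum. -/
theorem Path.energy_le {ρ c τ K C t σ : ℝ} {z w : Phase} {B : Phase →L[ℝ] Phase}
    (hP : S.Path c t σ z w B) (h : S.IsScale ρ c τ) (hE : S.EnergyBounds ρ K C)
    (hσ : σ ∈ Icc 0 τ) (hz : ‖z‖ + 2 * S.M ≤ ρ) :
    S.energy K w ≤ Real.exp (C * σ) * S.energy K z ∧ ‖z.2‖ ≤ ‖w.2‖ + S.M * σ := by
  have hM := S.M_pos
  have hσb : σ ≤ S.b := hσ.2.trans h.τ_le
  have hflow : ∀ t s z, s ∈ Icc 0 S.b → ‖z.2‖ ≤ ‖(S.Φ t s z).2‖ + S.M * s := fun t s z hs => by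
    have h1 := S.norm_Φ_sub_self_le t z hs
    have h2 : ‖(S.Φ t s z).2 - z.2‖ ≤ S.M * s := (norm_snd_le (S.Φ t s z - z)).trans h1
    have h3 := norm_sub_norm_le z.2 (S.Φ t s z).2
    rw [norm_sub_rev] at h3
    linarith
  cases hP with
  | free hin => exact ⟨(hE.of_flow ⟨hσ.1, hσb⟩ (by linarith) hin).2, hflow t σ z ⟨hσ.1, hσb⟩⟩
  | bounce e he hin h0 hp =>
    have heb : e ∈ Icc 0 S.b := ⟨he.1, he.2.le.trans hσb⟩
    have heb' : σ - e ∈ Icc 0 S.b := ⟨by linarith [he.2], by linarith [he.1]⟩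
    have hY : ‖S.Φ t e z‖ ≤ ‖z‖ + S.M := S.norm_Φ_le le_rfl heb
    have h1 := (hE.of_flow heb (by linarith) hin).2
    have h2 := (hE.of_flow (t := t - e) (z := S.R (S.Φ t e z)) heb'
      (by rw [norm_R_le h0]; linarith) (fun r hr => h.reflected_mem_D (by linarith) h0 hp
        ⟨hr.1, by linarith [hr.2, he.1, hσ.2]⟩)).2
    rw [energy_R h0] at h2
    constructor
    · refine h2.trans ?_
      have e1 : C * σ = C * (σ - e) + C * e := by ring
      rw [e1, Real.exp_add, mul_assoc]
      gcongr
    · have h3 := hflow t e z heb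
      have h4 := hflow (t - e) (σ - e) (S.R (S.Φ t e z)) heb'
      rw [norm_R h0] at h4
      linarith

/-- A lower bound on the kinetic distance keeps the normal velocity at the boundary away from `0`.
-/
theorem exists_speed (S : BilliardSystem) {ρ κ : ℝ} (hρ : 0 ≤ ρ) (hκ : 0 < κ) :
    ∃ c, 0 < c ∧ ∀ K z, ‖z‖ ≤ ρ → S.ψ z.1 = 0 → κ ≤ S.energy K z → c ≤ |S.p z| := by
  refine ⟨Real.sqrt (2 * κ) / (1 + ρ), by positivity, fun K z hz h0 hen => ?_⟩
  rw [energy_eq h0] at hen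
  have h1 : ⟪S.n z.1, z.2⟫ = lorentz z.2 * S.p z := by
    rw [p_eq, mul_inv_cancel_left₀ (lorentz_pos _).ne']
  have h2 : lorentz z.2 ≤ 1 + ρ := by
    have h3 := lorentz_sq z.2
    have h4 : ‖z.2‖ ≤ ρ := (norm_snd_le z).trans hz
    have h5 := norm_nonneg z.2
    have h6 := lorentz_pos z.2
    by_contra hlt
    push Not at hlt
    nlinarith
  rw [div_le_iff₀ (by positivity), Real.sqrt_le_left (by positivity), mul_pow, sq_abs]
  have h3 : lorentz z.2 ^ 2 ≤ (1 + ρ) ^ 2 := pow_le_pow_left₀ (lorentz_pos _).le h2 2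
  have h4 : S.p z ^ 2 * lorentz z.2 ^ 2 ≤ S.p z ^ 2 * (1 + ρ) ^ 2 := by gcongr
  rw [h1] at hen
  nlinarith

variable (S) in
/-- The class of data that is preserved by the transport: nonnegative bounded functions on the
closed phase space, `C^{1,lam}` up to the boundary, reflecting, and vanishing near the grazing
set and for large momenta. -/
structure IsAdmissible (K κ P C : ℝ) (G : Phase → ℝ) (G' : Phase → Phase →L[ℝ] ℝ) : Prop where
  taylor : IsTaylor S.D S.lam C G G'
  bound : ∀ z ∈ S.D, |G z| ≤ C
  nonneg : ∀ z ∈ S.D, 0 ≤ G z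
  reflecting : S.IsReflecting G G'
  vanish : ∀ z ∈ S.D, S.energy K z < κ ∨ P < ‖z.2‖ → G z = 0 ∧ G' z = 0

variable (S) in
/-- `F`, with spatial derivative `F'`, solves the backward transport equation on `[a, b]`. -/
structure IsEvolution (K κ P C a b : ℝ) (F : ℝ → Phase → ℝ) (F' : ℝ → Phase → Phase →L[ℝ] ℝ) :
    Prop where
  admissible : ∀ t ∈ Icc a b, S.IsAdmissible K κ P C (F t) (F' t)
  continuousOn : ∀ z ∈ S.D, ContinuousOn (fun t => F t z) (Icc a b)
  hasDerivWithinAt : ∀ z ∈ S.D, ∀ t ∈ Ico a b,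
    HasDerivWithinAt (fun t => F t z) (F' t z (S.W t z)) (Ici t) t

/-- The end points of free trajectories with a fixed starting time in the past have the expected
derivative with respect to the length of the time interval. -/
theorem hasDerivWithinAt_Φ_diag (t : ℝ) (z : Phase) {h₀ : ℝ} (hh₀ : h₀ ≤ S.b) :
    HasDerivWithinAt (fun h => S.Φ (t + h) h z) (S.W t z) (Icc 0 h₀) 0 := by
  rw [hasDerivWithinAt_iff_isLittleO, Asymptotics.isLittleO_iff]
  intro ε hε
  obtain ⟨d, hd, hW⟩ := Metric.continuousAt_iff.1 (S.continuous_W.continuousAt (x := (t, z))) ε hε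
  have hM := S.M_pos
  have hnear : ∀ᶠ h in 𝓝[Icc 0 h₀] (0 : ℝ), h < d / (S.M + 1) :=
    nhdsWithin_le_nhds (gt_mem_nhds (by positivity))
  filter_upwards [hnear, self_mem_nhdsWithin] with h hh hmem
  rw [lt_div_iff₀ (by positivity)] at hh
  have hsub : Icc 0 h ⊆ Icc 0 S.b := Icc_subset_Icc_right (hmem.2.trans hh₀)
  have hder : ∀ s ∈ Icc 0 h, HasDerivWithinAt (fun s => S.Φ (t + h) s z - s • S.W t z)
      (S.W (t + h - s) (S.Φ (t + h) s z) - (1 : ℝ) • S.W t z) (Icc 0 h) s := fun s hs =>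
    ((S.isTraj_Φ (t + h) z s (hsub hs)).mono hsub).sub
      ((hasDerivAt_id s).smul_const (S.W t z)).hasDerivWithinAt
  have := norm_image_sub_le_of_norm_deriv_le_segment' hder (C := ε) (fun s hs => by
    rw [one_smul, ← dist_eq_norm]
    refine (hW (x := (t + h - s, S.Φ (t + h) s z)) ?_).le
    have h1 := S.norm_Φ_sub_self_le (t + h) z (hsub (Ico_subset_Icc_self hs))
    rw [Prod.dist_eq, max_lt_iff, Real.dist_eq, dist_eq_norm]
    constructor
    · simp only
      rw [abs_of_nonneg (by linarith [hs.2])]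
      nlinarith [hs.1, hs.2]
    · simp only
      nlinarith [hs.1, hs.2]) h (right_mem_Icc.2 hmem.1)
  simp only [Φ_zero, zero_smul, sub_zero, add_zero] at this ⊢
  rw [Real.norm_of_nonneg hmem.1]
  convert this using 2
  abel

end BilliardSystem

namespace BilliardSystem

variable {S : BilliardSystem}

theorem IsScale.mono {ρ c τ τ' : ℝ} (h : S.IsScale ρ c τ) (h0 : 0 < τ') (hτ : τ' ≤ τ) :
    S.IsScale ρ c τ' :=
  ⟨h.ρ_nonneg, h.c_pos, h0, hτ.trans h.τ_le,
    fun t z hz hψ hp s hs => h.outward t z hz hψ hp s ⟨hs.1, hs.2.trans hτ⟩,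
    fun t z hz hψ hp s hs => h.inward t z hz hψ hp s ⟨hs.1, hs.2.trans hτ⟩⟩

variable (S) in
/-- The constants for a time step of length `τ`: states of energy at least `κ` and momentum at
most `P` have size at most `ρ` (with room for one step), and they meet the boundary with
normal velocity at least `c`. -/
structure IsStep (ρ c τ K C κ P : ℝ) : Prop where
  scale : S.IsScale ρ c τ
  energy : S.EnergyBounds ρ K C
  C_nonneg : 0 ≤ C
  κ_pos : 0 < κ
  C_mul_le : C * τ ≤ 1 / 2
  size : ∀ z ∈ S.D, ‖z.2‖ ≤ P → ‖z‖ + 2 * S.M ≤ ρ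
  speed : ∀ z, ‖z‖ ≤ ρ → S.ψ z.1 = 0 → κ * Real.exp (-C) ≤ S.energy K z → c ≤ |S.p z|

theorem EnergyBounds.exists_isStep {ρ K C κ P : ℝ} (hE : S.EnergyBounds ρ K C) (hρ : 0 ≤ ρ)
    (hC : 0 ≤ C) (hκ : 0 < κ) (hsize : ∀ z ∈ S.D, ‖z.2‖ ≤ P → ‖z‖ + 2 * S.M ≤ ρ) :
    ∃ c τ, S.IsStep ρ c τ K C κ P := by
  obtain ⟨c, hc, hspeed⟩ := S.exists_speed hρ (κ := κ * Real.exp (-C)) (by positivity)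
  obtain ⟨τ, hτ⟩ := S.exists_isScale hρ hc
  have hτ0 := hτ.τ_pos
  refine ⟨c, min τ (1 / (2 * (C + 1))), hτ.mono (by positivity) (min_le_left _ _), hE, hC, hκ,
    ?_, hsize, hspeed K⟩
  have h := min_le_right τ (1 / (2 * (C + 1)))
  rw [le_div_iff₀ (by positivity)] at h
  have h0 : 0 < min τ (1 / (2 * (C + 1))) := by positivity
  linarith

variable (S) in
/-- The states on which the transport is nontrivial. -/
def Relevant (K κ P : ℝ) (z : Phase) : Prop := z ∈ S.D ∧ κ ≤ S.energy K z ∧ ‖z.2‖ ≤ P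

/-- Trajectories of relevant states are not grazing, by the velocity lemma. -/
theorem IsStep.exists_path {ρ c τ K C κ P t σ : ℝ} {z : Phase} (h : S.IsStep ρ c τ K C κ P)
    (hz : S.Relevant K κ P z) (hσ : σ ∈ Icc 0 τ) : ∃ w B, S.Path c t σ z w B := by
  have hs := h.size z hz.1 hz.2.2
  have hM := S.M_pos
  refine h.scale.exists_path hσ (by linarith) hz.1 fun e he hin h0 => ?_
  have heb : e ∈ Icc 0 S.b := ⟨he.1, he.2.trans (hσ.2.trans h.scale.τ_le)⟩
  refine h.speed _ ((S.norm_Φ_le le_rfl heb).trans (by linarith)) h0 ?_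
  refine le_trans ?_ (h.energy.of_flow heb (by linarith) hin).1
  rw [mul_comm]
  have : -C ≤ -(C * e) := by nlinarith [h.C_nonneg, heb.2, S.b_le_one]
  exact mul_le_mul (Real.exp_le_exp.2 this) hz.2.1 h.κ_pos.le (Real.exp_pos _).le

variable (S) in
/-- The end point and the linearization of a path. -/
noncomputable def pathEnd (c t σ : ℝ) (z : Phase) : Phase × (Phase →L[ℝ] Phase) :=
  Classical.epsilon fun q => S.Path c t σ z q.1 q.2

open Classical in
variable (S) in
/-- The transport of `G`, given at time `a`, to the time `t`. -/
noncomputable def transport (c K κ P a : ℝ) (G : Phase → ℝ) (t : ℝ) (z : Phase) : ℝ :=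
  if S.Relevant K κ P z then G (S.pathEnd c t (t - a) z).1 else 0

open Classical in
variable (S) in
/-- The spatial derivative of the transport. -/
noncomputable def transportDeriv (c K κ P a : ℝ) (G' : Phase → Phase →L[ℝ] ℝ) (t : ℝ)
    (z : Phase) : Phase →L[ℝ] ℝ :=
  if S.Relevant K κ P z then (G' (S.pathEnd c t (t - a) z).1).comp (S.pathEnd c t (t - a) z).2
  else 0

section Step

variable {ρ c τ K C κ P κ₀ P₀ C₀ a : ℝ} {G : Phase → ℝ} {G' : Phase → Phase →L[ℝ] ℝ}

theorem IsStep.path_pathEnd (h : S.IsStep ρ c τ K C κ P) {t σ : ℝ} {z : Phase}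
    (hz : S.Relevant K κ P z) (hσ : σ ∈ Icc 0 τ) :
    S.Path c t σ z (S.pathEnd c t σ z).1 (S.pathEnd c t σ z).2 := by
  obtain ⟨w, B, hP⟩ := h.exists_path (t := t) hz hσ
  exact Classical.epsilon_spec (p := fun q : Phase × (Phase →L[ℝ] Phase) =>
    S.Path c t σ z q.1 q.2) ⟨(w, B), hP⟩

/-- The transported function vanishes near the grazing set and for large momenta, with constants
that worsen by the velocity lemma and by the bound of the field. -/
theorem IsStep.transport_vanish (h : S.IsStep ρ c τ K C κ P) (hG : S.IsAdmissible K κ₀ P₀ C₀ G G')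
    {t : ℝ} (ht : t ∈ Icc a (a + τ)) {z : Phase}
    (hz : S.energy K z < κ₀ * Real.exp (-(C * τ)) ∨ P₀ + S.M * τ < ‖z.2‖) :
    S.transport c K κ P a G t z = 0 ∧ S.transportDeriv c K κ P a G' t z = 0 := by
  by_cases hrel : S.Relevant K κ P z
  · have hσ : t - a ∈ Icc 0 τ := ⟨by linarith [ht.1], by linarith [ht.2]⟩
    have hsz := h.size z hrel.1 hrel.2.2
    have hM := S.M_pos
    have hP := h.path_pathEnd (t := t) hrel hσ
    rw [transport, transportDeriv, if_pos hrel, if_pos hrel]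
    set w := (S.pathEnd c t (t - a) z).1
    have hw := hP.mem_D h.scale hσ (by linarith)
    obtain ⟨h1, h2⟩ := hP.energy_le h.scale h.energy hσ hsz
    have hMσ : S.M * (t - a) ≤ S.M * τ := by gcongr; exact hσ.2
    have hCσ : C * (t - a) ≤ C * τ := mul_le_mul_of_nonneg_left hσ.2 h.C_nonneg
    obtain ⟨h3, h4⟩ := hG.vanish w hw (by
      rcases hz with hz | hz
      · left
        have h5 : 0 < S.energy K z := h.κ_pos.trans_le hrel.2.1
        calc S.energy K w ≤ Real.exp (C * (t - a)) * S.energy K z := h1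
          _ ≤ Real.exp (C * τ) * S.energy K z := by gcongr
          _ < Real.exp (C * τ) * (κ₀ * Real.exp (-(C * τ))) := by gcongr
          _ = κ₀ * (Real.exp (C * τ) * Real.exp (-(C * τ))) := by ring
          _ = κ₀ := by rw [← Real.exp_add, add_neg_cancel, Real.exp_zero, mul_one]
      · right; linarith)
    exact ⟨h3, by rw [h4, ContinuousLinearMap.zero_comp]⟩
  · rw [transport, transportDeriv, if_neg hrel, if_neg hrel]
    exact ⟨rfl, rfl⟩

theorem IsStep.transport_start (h : S.IsStep ρ c τ K C κ P) (hG : S.IsAdmissible K κ₀ P₀ C₀ G G')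
    (hκ : κ ≤ κ₀) (hP : P₀ ≤ P) {z : Phase} (hz : z ∈ S.D) :
    S.transport c K κ P a G a z = G z ∧ S.transportDeriv c K κ P a G' a z = G' z := by
  by_cases hrel : S.Relevant K κ P z
  · have hpath := h.path_pathEnd (t := a) hrel (left_mem_Icc.2 h.scale.τ_pos.le)
    obtain ⟨h1, h2⟩ := hpath.of_zero
    rw [transport, transportDeriv, if_pos hrel, if_pos hrel, sub_self, h1, h2]
    exact ⟨rfl, by rw [ContinuousLinearMap.comp_id]⟩
  · rw [transport, transportDeriv, if_neg hrel, if_neg hrel]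
    have := hG.vanish z hz (by
      by_contra hcon
      push Not at hcon
      exact hrel ⟨hz, hκ.trans hcon.1, hcon.2.trans hP⟩)
    exact ⟨this.1.symm, this.2.symm⟩

/-- The transport does not depend on the choice of the path. At an outgoing end point both a path
with and one without a bounce exist, and a reflecting function takes the same value at both. -/
theorem IsStep.transport_eq (h : S.IsStep ρ c τ K C κ P) (hG : S.IsAdmissible K κ₀ P₀ C₀ G G')
    {t : ℝ} (ht : t ∈ Icc a (a + τ)) {z w : Phase} {B : Phase →L[ℝ] Phase}
    (hz : S.Relevant K κ P z) (hP : S.Path c t (t - a) z w B) :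
    S.transport c K κ P a G t z = G w := by
  have hσ : t - a ∈ Icc 0 τ := ⟨by linarith [ht.1], by linarith [ht.2]⟩
  have hsz := h.size z hz.1 hz.2.2
  have hM := S.M_pos
  obtain ⟨C', r, hC', hr, hr1, hT⟩ := h.scale.exists_path_taylor hG.taylor hG.reflecting
  have := hT t (t - a) z z _ _ _ _ hσ (by linarith) (by linarith)
    (by rw [sub_self, norm_zero]; exact hr.le)
    hP (h.path_pathEnd hz hσ)
  rw [sub_self, norm_zero, Real.zero_rpow (by linarith [S.lam_pos]), mul_zero, map_zero, map_zero,
    sub_zero] at this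
  rw [transport, if_pos hz]
  exact sub_eq_zero.1 (abs_nonpos_iff.1 this)

theorem IsStep.transport_bound (h : S.IsStep ρ c τ K C κ P)
    (hG : S.IsAdmissible K κ₀ P₀ C₀ G G') {t : ℝ} (ht : t ∈ Icc a (a + τ)) (z : Phase) :
    |S.transport c K κ P a G t z| ≤ C₀ ∧ 0 ≤ S.transport c K κ P a G t z := by
  by_cases hrel : S.Relevant K κ P z
  · have hσ : t - a ∈ Icc 0 τ := ⟨by linarith [ht.1], by linarith [ht.2]⟩
    have hsz := h.size z hrel.1 hrel.2.2
    have hw := (h.path_pathEnd (t := t) hrel hσ).mem_D h.scale hσ (by linarith [S.M_pos])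
    rw [transport, if_pos hrel]
    exact ⟨hG.bound _ hw, hG.nonneg _ hw⟩
  · rw [transport, if_neg hrel, abs_zero]
    exact ⟨hG.taylor.nonneg, le_rfl⟩

/-- The transported function is again `C^{1,lam}`: by the comparison of paths where both states are
relevant, and because it vanishes otherwise. -/
theorem IsStep.exists_transport_taylor (h : S.IsStep ρ c τ K C κ P)
    (hG : S.IsAdmissible K κ₀ P₀ C₀ G G') (hκ : 2 * κ ≤ κ₀ * Real.exp (-(C * τ)))
    (hP : P₀ + S.M * τ + 1 ≤ P) : ∃ C', C₀ ≤ C' ∧ ∀ t ∈ Icc a (a + τ), IsTaylor S.D S.lam C'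
      (S.transport c K κ P a G t) (S.transportDeriv c K κ P a G' t) := by
  obtain ⟨C₁, r, hC₁, hr, hr1, hT⟩ := h.scale.exists_path_taylor hG.taylor hG.reflecting
  obtain ⟨N, hN1, hN⟩ := h.scale.exists_path_bound
  have hC₀ := hG.taylor.nonneg
  have hM := S.M_pos
  have hκ0 := h.κ_pos
  -- a radius on which the energy varies by less than `κ`
  obtain ⟨d, hd, huc⟩ := Metric.uniformContinuousOn_iff.1
    ((isCompact_closedBall (0 : Phase) (ρ + 1)).uniformContinuousOn_of_continuous
      (S.continuous_energy K).continuousOn) κ hκ0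
  set r' := min r (d / 2) with hr'
  have hr'0 : 0 < r' := by positivity
  have hr'1 : r' ≤ 1 := (min_le_left _ _).trans hr1
  have hnear : ∀ t ∈ Icc a (a + τ), ∀ x ∈ S.D, ∀ y ∈ S.D, ‖y - x‖ ≤ r' → S.Relevant K κ P x →
      ¬ S.Relevant K κ P y →
      S.transport c K κ P a G t x = 0 ∧ S.transportDeriv c K κ P a G' t x = 0 := by
    intro t ht x hx y hy hxy hrx hry
    have hsx := h.size x hx hrx.2.2
    refine h.transport_vanish hG ht ?_
    by_contra hcon
    push Not at hcon
    refine hry ⟨hy, ?_, ?_⟩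
    · have h1 := huc x (by rw [mem_closedBall_zero_iff]; linarith) y (by
        rw [mem_closedBall_zero_iff]
        have := norm_le_norm_add_norm_sub' y x
        linarith) (by
        rw [dist_comm, dist_eq_norm]
        exact (hxy.trans (min_le_right _ _)).trans_lt (by linarith))
      rw [Real.dist_eq] at h1
      have := (abs_lt.1 h1).2
      linarith [hcon.1]
    · have h1 : ‖y.2 - x.2‖ ≤ 1 := (norm_snd_le (y - x)).trans (hxy.trans hr'1)
      have h2 := norm_le_norm_add_norm_sub' y.2 x.2
      linarith [hcon.2]
  set C' := C₀ + C₀ * N + C₁ with hC'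
  have hC'0 : 0 ≤ C' := by positivity
  have hC₀N : 0 ≤ C₀ * N := by positivity
  refine ⟨3 * C' / r' ^ 2, ?_, fun t ht => ?_⟩
  · rw [le_div_iff₀ (by positivity)]
    have : r' ^ 2 ≤ 1 := pow_le_one₀ hr'0.le hr'1
    nlinarith
  have hσ : t - a ∈ Icc 0 τ := ⟨by linarith [ht.1], by linarith [ht.2]⟩
  refine IsTaylor.of_local hr'0 hr'1 S.lam_pos S.lam_lt_one hC'0 (fun x hx => ?_)
    (fun x hx => ?_) (fun x hx y hy hxy => ?_)
  · exact (h.transport_bound hG ht x).1.trans (by linarith)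
  · by_cases hrel : S.Relevant K κ P x
    · have hsz := h.size x hrel.1 hrel.2.2
      have hpath := h.path_pathEnd (t := t) hrel hσ
      have hw := hpath.mem_D h.scale hσ (by linarith)
      rw [transportDeriv, if_pos hrel]
      refine (ContinuousLinearMap.opNorm_comp_le _ _).trans ((mul_le_mul (hG.taylor.bound _ hw)
        (hN t (t - a) x _ _ hσ (by linarith) hpath) (norm_nonneg _) hC₀).trans ?_)
      linarith
    · rw [transportDeriv, if_neg hrel, norm_zero]
      exact hC'0
  · have hpow0 : 0 ≤ C' * ‖y - x‖ ^ (1 + S.lam) :=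
      mul_nonneg hC'0 (Real.rpow_nonneg (norm_nonneg _) _)
    rw [Real.norm_eq_abs]
    by_cases hrx : S.Relevant K κ P x
    · by_cases hry : S.Relevant K κ P y
      · have hsx := h.size x hrx.1 hrx.2.2
        have hsy := h.size y hry.1 hry.2.2
        have := hT t (t - a) x y _ _ _ _ hσ (by linarith) (by linarith)
          (hxy.trans (min_le_left _ _)) (h.path_pathEnd hrx hσ) (h.path_pathEnd hry hσ)
        rw [transport, transport, transportDeriv, if_pos hrx, if_pos hry, if_pos hrx]
        refine this.trans ?_
        gcongr
        linarith
      · obtain ⟨h1, h2⟩ := hnear t ht x hx y hy hxy hrx hry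
        rw [h1, h2]
        rw [transport, if_neg hry]
        simpa using hpow0
    · have h1 : S.transport c K κ P a G t x = 0 := by rw [transport, if_neg hrx]
      have h2 : S.transportDeriv c K κ P a G' t x = 0 := by rw [transportDeriv, if_neg hrx]
      have h3 : S.transport c K κ P a G t y = 0 := by
        by_cases hry : S.Relevant K κ P y
        · exact (hnear t ht y hy x hx (by rw [norm_sub_rev]; exact hxy) hry hrx).1
        · rw [transport, if_neg hry]
      rw [h1, h2, h3]
      simpa using hpow0

theorem relevant_R {z : Phase} (h0 : S.ψ z.1 = 0) :
    S.Relevant K κ P (S.R z) ↔ S.Relevant K κ P z := by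
  rw [Relevant, Relevant, energy_R h0, norm_R h0, mem_D, mem_D, R_fst]

theorem IsStep.le_abs_p (h : S.IsStep ρ c τ K C κ P) {z : Phase} (hz : S.Relevant K κ P z)
    (h0 : S.ψ z.1 = 0) : c ≤ |S.p z| := by
  have hsz := h.size z hz.1 hz.2.2
  refine h.speed z (by linarith [S.M_pos]) h0 ?_
  have h1 : Real.exp (-C) ≤ 1 := Real.exp_le_one_iff.2 (by linarith [h.C_nonneg])
  have h2 : κ * Real.exp (-C) ≤ κ * 1 := mul_le_mul_of_nonneg_left h1 h.κ_pos.le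
  linarith [hz.2.1]

/-- The transported function is again compatible with the reflection, since `z` and `R z` have the
same path after the bounce. -/
theorem IsStep.transport_reflecting (h : S.IsStep ρ c τ K C κ P)
    (hG : S.IsAdmissible K κ₀ P₀ C₀ G G') {t : ℝ} (ht : t ∈ Icc a (a + τ)) :
    S.IsReflecting (S.transport c K κ P a G t) (S.transportDeriv c K κ P a G' t) := by
  intro z h0 hp
  by_cases hrel : S.Relevant K κ P z
  · have hrelR := (relevant_R h0).2 hrel
    have hpc : c ≤ S.p z := by
      have := h.le_abs_p hrel h0
      rwa [abs_of_pos hp] at this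
    have hsz := h.size z hrel.1 hrel.2.2
    have hzρ : ‖z‖ ≤ ρ := by linarith [S.M_pos]
    have hσ : t - a ∈ Icc 0 τ := ⟨by linarith [ht.1], by linarith [ht.2]⟩
    have p1 := h.path_pathEnd (t := t) hrel hσ
    have p2 := h.path_pathEnd (t := t) hrelR hσ
    rw [transport, transport, transportDeriv, transportDeriv, if_pos hrel, if_pos hrel,
      if_pos hrelR, if_pos hrelR]
    rcases hσ.1.eq_or_lt with h1 | h1
    · rw [← h1] at p1 p2 ⊢
      obtain ⟨e1, e2⟩ := p1.of_zero
      obtain ⟨e3, e4⟩ := p2.of_zero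
      rw [e1, e2, e3, e4, ContinuousLinearMap.comp_id, ContinuousLinearMap.comp_id]
      exact hG.reflecting z h0 hp
    · obtain ⟨e1, e2⟩ := p1.of_outgoing h.scale ⟨h1, hσ.2⟩ hzρ h0 hpc
      obtain ⟨e3, e4⟩ := p2.of_incoming h.scale hσ ((norm_R_le h0).trans_le hzρ) h0
        (by rw [p_R h0]; linarith)
      rw [e1, e2, e3, e4]
      exact ⟨rfl, rfl⟩
  · have hrelR : ¬ S.Relevant K κ P (S.R z) := fun hh => hrel ((relevant_R h0).1 hh)
    rw [transport, transport, transportDeriv, transportDeriv, if_neg hrel, if_neg hrel,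
      if_neg hrelR, if_neg hrelR, ContinuousLinearMap.zero_comp]
    exact ⟨rfl, rfl⟩

/-- Transport is constant along free pieces of trajectories. -/
theorem IsStep.transport_add (h : S.IsStep ρ c τ K C κ P) (hG : S.IsAdmissible K κ₀ P₀ C₀ G G')
    (hκ : 2 * κ ≤ κ₀ * Real.exp (-(C * τ))) (hP : P₀ + S.M * τ + 1 ≤ P) {t δ : ℝ}
    (ht : a ≤ t) (hδ : 0 ≤ δ) (htδ : t + δ ≤ a + τ) {z : Phase} (hz : S.Relevant K κ P z)
    (hin : ∀ s ∈ Icc 0 δ, S.Φ (t + δ) s z ∈ S.D) :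
    S.transport c K κ P a G (t + δ) z = S.transport c K κ P a G t (S.Φ (t + δ) δ z) := by
  have hM := S.M_pos
  have hτb := h.scale.τ_le
  have hδb : δ ∈ Icc 0 S.b := ⟨hδ, by linarith⟩
  have hsz := h.size z hz.1 hz.2.2
  have ht1 : t ∈ Icc a (a + τ) := ⟨ht, by linarith⟩
  have ht2 : t + δ ∈ Icc a (a + τ) := ⟨by linarith, htδ⟩
  by_cases hrel : S.Relevant K κ P (S.Φ (t + δ) δ z)
  · have hp := h.path_pathEnd (t := t) hrel (σ := t - a) ⟨by linarith, by linarith⟩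
    obtain ⟨B', hB'⟩ := hp.prepend hδ (by linarith) (by linarith) hin
    have e : δ + (t - a) = t + δ - a := by ring
    rw [e] at hB'
    rw [h.transport_eq hG ht2 hz hB', h.transport_eq hG ht1 hrel hp]
  · have h1 : S.transport c K κ P a G t (S.Φ (t + δ) δ z) = 0 := by rw [transport, if_neg hrel]
    rw [h1]
    refine (h.transport_vanish hG ht2 ?_).1
    by_contra hcon
    push Not at hcon
    refine hrel ⟨hin δ (right_mem_Icc.2 hδ), ?_, ?_⟩
    · refine le_trans ?_ (h.energy.of_flow hδb (by linarith) hin).1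
      have h2 : 1 / 2 ≤ Real.exp (-(C * δ)) := by
        have h3 := Real.add_one_le_exp (-(C * δ))
        have h4 : C * δ ≤ C * τ := mul_le_mul_of_nonneg_left (by linarith) h.C_nonneg
        linarith [h.C_mul_le]
      have h5 : 0 ≤ S.energy K z := h.κ_pos.le.trans hz.2.1
      have h6 : 1 / 2 * S.energy K z ≤ Real.exp (-(C * δ)) * S.energy K z := by gcongr
      linarith [hcon.1]
    · have h2 : ‖(S.Φ (t + δ) δ z).2 - z.2‖ ≤ S.M * δ :=
        (norm_snd_le (S.Φ (t + δ) δ z - z)).trans (S.norm_Φ_sub_self_le _ z hδb)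
      have h3 := norm_le_norm_add_norm_sub' (S.Φ (t + δ) δ z).2 z.2
      have h4 : S.M * δ ≤ 1 := by
        have h5 : S.M * δ ≤ S.L * S.b :=
          mul_le_mul (by unfold L; linarith) hδb.2 hδ S.L_pos.le
        linarith [S.L_mul_b]
      linarith [hcon.2]

/-- The function `ψ` grows at most linearly along a trajectory. -/
theorem exists_ψ_flow_le (z : Phase) : ∃ N, 0 ≤ N ∧ ∀ t, ∀ s ∈ Icc 0 S.b,
    S.ψ (S.Φ t s z).1 ≤ S.ψ z.1 + N * s := by
  obtain ⟨N, hN⟩ := (isCompact_closedBall (0 : Phase) (‖z‖ + S.M)).exists_bound_of_continuousOn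
    S.contDiff_p.continuous.continuousOn
  have hN0 : 0 ≤ N := (norm_nonneg _).trans (hN 0 (by
    rw [mem_closedBall_zero_iff, norm_zero]; linarith [norm_nonneg z, S.M_pos]))
  refine ⟨N, hN0, fun t s hs => ?_⟩
  have := norm_image_sub_le_of_norm_deriv_le_segment'
    (fun r hr => S.hasDerivWithinAt_ψ (S.isTraj_Φ t z) (s := r) hr) (C := N)
    (fun r hr => hN _ (by
      rw [mem_closedBall_zero_iff]
      exact S.norm_Φ_le le_rfl (Ico_subset_Icc_self hr))) s hs
  simp only [Φ_zero, sub_zero, Real.norm_eq_abs] at this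
  linarith [(abs_le.1 this).2]

/-- A trajectory that starts in the interior, or at the boundary with incoming velocity, is free
for some time, uniformly with respect to the starting time. -/
theorem IsStep.exists_free (h : S.IsStep ρ c τ K C κ P) {z : Phase} (hz : S.Relevant K κ P z)
    (hp : S.ψ z.1 = 0 → S.p z < 0) : ∃ h₀, 0 < h₀ ∧ h₀ ≤ τ ∧
    ∀ t, ∀ s ∈ Icc 0 h₀, S.Φ t s z ∈ S.D := by
  have hτ := h.scale.τ_pos
  rcases (mem_D.1 hz.1).eq_or_lt with h0 | h0
  · refine ⟨τ, hτ, le_rfl, fun t s hs => mem_D.2 ?_⟩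
    have hsz := h.size z hz.1 hz.2.2
    have h1 := h.le_abs_p hz h0
    rw [abs_of_neg (hp h0)] at h1
    have h2 := h.scale.inward t z (by linarith [S.M_pos]) h0 (by linarith) s hs
    have h3 := mul_nonneg (half_pos h.scale.c_pos).le hs.1
    linarith
  · obtain ⟨N, hN0, hN⟩ := S.exists_ψ_flow_le z
    refine ⟨min τ (-S.ψ z.1 / (N + 1)), lt_min hτ (div_pos (by linarith) (by linarith)),
      min_le_left _ _, fun t s hs => mem_D.2 ?_⟩
    have h1 := hs.2.trans (min_le_right _ _)
    rw [le_div_iff₀ (by linarith)] at h1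
    have h2 := hN t s ⟨hs.1, (hs.2.trans (min_le_left _ _)).trans h.scale.τ_le⟩
    nlinarith [hs.1]

/-- The transported function is continuous in time and satisfies the transport equation with right
time derivatives. For a small time increment the new trajectory first runs freely to a state at
which the old function is evaluated, so the derivative is that of the old function along the
field. -/
theorem IsStep.transport_time (h : S.IsStep ρ c τ K C κ P) (hG : S.IsAdmissible K κ₀ P₀ C₀ G G')
    (hκ : 2 * κ ≤ κ₀ * Real.exp (-(C * τ))) (hP : P₀ + S.M * τ + 1 ≤ P) {z : Phase}
    (hz : z ∈ S.D) :
    ContinuousOn (fun t => S.transport c K κ P a G t z) (Icc a (a + τ)) ∧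
    ∀ t ∈ Ico a (a + τ), HasDerivWithinAt (fun t => S.transport c K κ P a G t z)
      (S.transportDeriv c K κ P a G' t z (S.W t z)) (Ici t) t := by
  obtain ⟨C', hC₀', hTay⟩ := h.exists_transport_taylor (a := a) hG hκ hP
  -- first the states that are not on the point of leaving the domain
  have key : ∀ z ∈ S.D, (S.ψ z.1 = 0 → S.p z < 0) →
      ContinuousOn (fun t => S.transport c K κ P a G t z) (Icc a (a + τ)) ∧
      ∀ t ∈ Ico a (a + τ), HasDerivWithinAt (fun t => S.transport c K κ P a G t z)
        (S.transportDeriv c K κ P a G' t z (S.W t z)) (Ici t) t := by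
    intro z hz hin
    by_cases hrel : S.Relevant K κ P z
    · obtain ⟨h₀, hh₀, hh₀τ, hfree⟩ := h.exists_free hrel hin
      have hh₀b := hh₀τ.trans h.scale.τ_le
      have hadd : ∀ t, a ≤ t → ∀ δ ∈ Icc 0 h₀, t + δ ≤ a + τ →
          S.transport c K κ P a G (t + δ) z = S.transport c K κ P a G t (S.Φ (t + δ) δ z) :=
        fun t ht δ hδ htδ => h.transport_add hG hκ hP ht hδ.1 htδ hrel
          (fun s hs => hfree _ s ⟨hs.1, hs.2.trans hδ.2⟩)
      constructor
      · have hlip : ∀ t ∈ Icc a (a + τ), ∀ t' ∈ Icc a (a + τ), t ≤ t' → t' - t ≤ h₀ →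
            |S.transport c K κ P a G t' z - S.transport c K κ P a G t z| ≤ C' * S.M * (t' - t) := by
          intro t ht t' ht' htt hle
          have hmem : t' - t ∈ Icc 0 h₀ := ⟨by linarith, hle⟩
          have e := hadd t ht.1 (t' - t) hmem (by linarith [ht'.2])
          rw [add_sub_cancel] at e
          rw [e, mul_assoc]
          refine ((hTay t ht).lipschitz S.lam_pos S.convex_D hz
            (hfree t' _ hmem)).trans ?_
          exact mul_le_mul_of_nonneg_left (S.norm_Φ_sub_self_le _ _ ⟨hmem.1, hle.trans hh₀b⟩)
            (hTay t ht).nonneg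
        rw [Metric.continuousOn_iff]
        intro t ht ε hε
        have hC'0 := (hTay t ht).nonneg
        have hM := S.M_pos
        refine ⟨min h₀ (ε / (C' * S.M + 1)), by positivity, fun t' ht' hd => ?_⟩
        have hd1 := hd.trans_le (min_le_left _ _)
        have hd2 := hd.trans_le (min_le_right _ _)
        rw [lt_div_iff₀ (by positivity)] at hd2
        rw [Real.dist_eq] at hd1 hd2 ⊢
        have hb : |S.transport c K κ P a G t' z - S.transport c K κ P a G t z| ≤
            C' * S.M * |t' - t| := by
          rcases le_total t t' with htt | htt
          · rw [abs_of_nonneg (sub_nonneg.2 htt)] at hd1 ⊢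
            exact hlip t ht t' ht' htt hd1.le
          · rw [abs_sub_comm t'] at hd1 ⊢
            rw [abs_of_nonneg (sub_nonneg.2 htt)] at hd1 ⊢
            rw [abs_sub_comm]
            exact hlip t' ht' t ht htt hd1.le
        refine hb.trans_lt ?_
        nlinarith [abs_nonneg (t' - t)]
      · intro t ht
        have ht' : t ∈ Icc a (a + τ) := Ico_subset_Icc_self ht
        set h₁ := min h₀ (a + τ - t) with hh₁
        have hh₁0 : 0 < h₁ := lt_min hh₀ (by linarith [ht.2])
        have h1 := hasDerivWithinAt_Φ_diag (S := S) t z (h₀ := h₁)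
          ((min_le_left _ _).trans hh₀b)
        have h2 : HasFDerivWithinAt (S.transport c K κ P a G t)
            (S.transportDeriv c K κ P a G' t z) S.D (S.Φ (t + 0) 0 z) := by
          rw [Φ_zero]; exact (hTay t ht').hasFDerivWithinAt S.lam_pos hz
        have h3 := h2.comp_hasDerivWithinAt (f := fun δ => S.Φ (t + δ) δ z) (0 : ℝ) h1
          (fun δ hδ => hfree (t + δ) δ ⟨hδ.1, hδ.2.trans (min_le_left _ _)⟩)
        have h4 : HasDerivWithinAt (fun δ => S.transport c K κ P a G (t + δ) z)
            (S.transportDeriv c K κ P a G' t z (S.W t z)) (Icc 0 h₁) 0 :=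
          h3.congr (fun δ hδ => hadd t ht.1 δ ⟨hδ.1, hδ.2.trans (min_le_left _ _)⟩
            (by linarith [hδ.2.trans (min_le_right h₀ (a + τ - t))]))
            (by simp [Φ_zero])
        have h5 : HasDerivWithinAt (fun t' => t' - t) 1 (Icc t (t + h₁)) t :=
          ((hasDerivAt_id t).sub_const t).hasDerivWithinAt
        have h4' : HasDerivWithinAt (fun δ => S.transport c K κ P a G (t + δ) z)
            (S.transportDeriv c K κ P a G' t z (S.W t z)) (Icc 0 h₁) (t - t) := by
          rwa [sub_self]
        have h6 := HasDerivWithinAt.scomp (h := fun t' => t' - t) t h4' h5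
          (fun s hs => ⟨by linarith [hs.1], by linarith [hs.2]⟩)
        rw [one_smul] at h6
        have h7 : HasDerivWithinAt (fun t => S.transport c K κ P a G t z)
            (S.transportDeriv c K κ P a G' t z (S.W t z)) (Icc t (t + h₁)) t := by
          refine h6.congr (fun s _ => ?_) ?_ <;> simp [Function.comp]
        exact h7.mono_of_mem_nhdsWithin (Icc_mem_nhdsGE (by linarith))
    · have e : (fun t => S.transport c K κ P a G t z) = fun _ => 0 := by
        funext t; rw [transport, if_neg hrel]
      refine ⟨by rw [e]; exact continuousOn_const, fun t ht => ?_⟩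
      rw [e, transportDeriv, if_neg hrel]
      exact hasDerivWithinAt_const _ _ _
  -- at an outgoing boundary state the reflected state is of this kind
  by_cases hgood : S.ψ z.1 = 0 → S.p z < 0
  · exact key z hz hgood
  push Not at hgood
  obtain ⟨h0, hp⟩ := hgood
  by_cases hrel : S.Relevant K κ P z
  · have hp0 : 0 < S.p z := lt_of_le_of_ne hp fun he => by
      have := h.le_abs_p hrel h0
      rw [← he, abs_zero] at this
      exact absurd h.scale.c_pos (not_lt.2 this)
    obtain ⟨k1, k2⟩ := key (S.R z) (R_mem_D hz) (fun _ => by rw [p_R h0]; linarith)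
    have heq : ∀ t ∈ Icc a (a + τ), S.transport c K κ P a G t z =
        S.transport c K κ P a G t (S.R z) := fun t ht =>
      (h.transport_reflecting hG ht z h0 hp0).1
    refine ⟨k1.congr heq, fun t ht => ?_⟩
    rw [(h.transport_reflecting hG (Ico_subset_Icc_self ht) z h0 hp0).2,
      ContinuousLinearMap.comp_apply, A_W h0 hp0.ne']
    refine (((k2 t ht).mono Icc_subset_Ici_self).congr (s := Icc t (a + τ))
      (fun s hs => heq s ⟨ht.1.trans hs.1, hs.2⟩)
      (heq t (Ico_subset_Icc_self ht))).mono_of_mem_nhdsWithin (Icc_mem_nhdsGE ht.2)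
  · have e : (fun t => S.transport c K κ P a G t z) = fun _ => 0 := by
      funext t; rw [transport, if_neg hrel]
    refine ⟨by rw [e]; exact continuousOn_const, fun t ht => ?_⟩
    rw [e, transportDeriv, if_neg hrel]
    exact hasDerivWithinAt_const _ _ _

/-- One time step. -/
theorem IsStep.exists_evolution (h : S.IsStep ρ c τ K C κ P)
    (hG : S.IsAdmissible K κ₀ P₀ C₀ G G') (hκ : 2 * κ ≤ κ₀ * Real.exp (-(C * τ)))
    (hP : P₀ + S.M * τ + 1 ≤ P) (a : ℝ) : ∃ C₁ F F',
      S.IsEvolution K (κ₀ * Real.exp (-(C * τ))) (P₀ + S.M * τ) C₁ a (a + τ) F F' ∧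
      ∀ z ∈ S.D, F a z = G z ∧ F' a z = G' z := by
  obtain ⟨C', hC₀', hTay⟩ := h.exists_transport_taylor (a := a) hG hκ hP
  have hMτ := mul_pos S.M_pos h.scale.τ_pos
  have hκ₀ : κ ≤ κ₀ := by
    have h1 : Real.exp (-(C * τ)) ≤ 1 := Real.exp_le_one_iff.2
      (by linarith [mul_nonneg h.C_nonneg h.scale.τ_pos.le])
    have h2 := h.κ_pos
    have h3 := Real.exp_pos (-(C * τ))
    by_contra hlt
    push Not at hlt
    have h4 : κ₀ * Real.exp (-(C * τ)) ≤ κ * Real.exp (-(C * τ)) := by gcongr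
    have h5 : κ * Real.exp (-(C * τ)) ≤ κ * 1 := by gcongr
    linarith
  refine ⟨C', S.transport c K κ P a G, S.transportDeriv c K κ P a G', ⟨fun t ht => ?_,
    fun z hz => (h.transport_time hG hκ hP hz).1,
    fun z hz => (h.transport_time hG hκ hP hz).2⟩,
    fun z hz => h.transport_start hG hκ₀ (by linarith) hz⟩
  exact ⟨hTay t ht, fun z _ => (h.transport_bound hG ht z).1.trans hC₀',
    fun z _ => (h.transport_bound hG ht z).2, h.transport_reflecting hG ht,
    fun z _ hz => h.transport_vanish hG ht hz⟩

end Step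

/-! ### The global evolution -/

theorem IsAdmissible.mono {K κ P C κ' P' C' : ℝ} {G : Phase → ℝ} {G' : Phase → Phase →L[ℝ] ℝ}
    (h : S.IsAdmissible K κ P C G G') (hκ : κ' ≤ κ) (hP : P ≤ P') (hC : C ≤ C') :
    S.IsAdmissible K κ' P' C' G G' :=
  ⟨h.taylor.mono hC, fun z hz => (h.bound z hz).trans hC, h.nonneg, h.reflecting,
    fun z hz hor => h.vanish z hz (hor.imp (fun h1 => h1.trans_le hκ) (fun h1 => hP.trans_lt h1))⟩

/-- Concatenation of two evolutions. -/
theorem IsEvolution.glue {K κ₁ P₁ C₁ κ₂ P₂ C₂ a b d : ℝ} {F₁ F₂ : ℝ → Phase → ℝ}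
    {F₁' F₂' : ℝ → Phase → Phase →L[ℝ] ℝ} (h₁ : S.IsEvolution K κ₁ P₁ C₁ a b F₁ F₁')
    (h₂ : S.IsEvolution K κ₂ P₂ C₂ b d F₂ F₂') (hab : a ≤ b) (hbd : b ≤ d) (hκ : κ₂ ≤ κ₁)
    (hP : P₁ ≤ P₂) (heq : ∀ z ∈ S.D, F₂ b z = F₁ b z ∧ F₂' b z = F₁' b z) :
    S.IsEvolution K κ₂ P₂ (max C₁ C₂) a d (fun t => if t < b then F₁ t else F₂ t)
      (fun t => if t < b then F₁' t else F₂' t) := by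
  refine ⟨fun t ht => ?_, fun z hz => ?_, fun z hz t ht => ?_⟩
  · by_cases htb : t < b
    · simp only [if_pos htb]
      exact (h₁.admissible t ⟨ht.1, htb.le⟩).mono hκ hP (le_max_left _ _)
    · simp only [if_neg htb]
      exact (h₂.admissible t ⟨not_lt.1 htb, ht.2⟩).mono le_rfl le_rfl (le_max_right _ _)
  · have e1 : ∀ t ∈ Icc a b, (if t < b then F₁ t else F₂ t) z = F₁ t z := fun t ht => by
      by_cases htb : t < b
      · rw [if_pos htb]
      · rw [if_neg htb, le_antisymm ht.2 (not_lt.1 htb)]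
        exact (heq z hz).1
    have e2 : ∀ t ∈ Icc b d, (if t < b then F₁ t else F₂ t) z = F₂ t z := fun t ht => by
      rw [if_neg (not_lt.2 ht.1)]
    rw [← Icc_union_Icc_eq_Icc hab hbd]
    exact ((h₁.continuousOn z hz).congr e1).union_of_isClosed
      ((h₂.continuousOn z hz).congr e2) isClosed_Icc isClosed_Icc
  · by_cases htb : t < b
    · simp only [if_pos htb]
      have h3 := (h₁.hasDerivWithinAt z hz t ⟨ht.1, htb⟩).mono (s := Ico t b) Ico_subset_Ici_self
      refine (h3.congr (fun s hs => by rw [if_pos hs.2])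
        (by rw [if_pos htb])).mono_of_mem_nhdsWithin
        (Ico_mem_nhdsGE htb)
    · simp only [if_neg htb]
      have htb' := not_lt.1 htb
      exact (h₂.hasDerivWithinAt z hz t ⟨htb', ht.2⟩).congr
        (fun s hs => by rw [if_neg (not_lt.2 (htb'.trans hs))]) (by rw [if_neg htb])

theorem IsEvolution.mono {K κ P C a b b' : ℝ} {F : ℝ → Phase → ℝ}
    {F' : ℝ → Phase → Phase →L[ℝ] ℝ} (h : S.IsEvolution K κ P C a b F F') (hb : b' ≤ b) :
    S.IsEvolution K κ P C a b' F F' :=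
  ⟨fun t ht => h.admissible t ⟨ht.1, ht.2.trans hb⟩,
    fun z hz => (h.continuousOn z hz).mono (Icc_subset_Icc_right hb),
    fun z hz t ht => h.hasDerivWithinAt z hz t ⟨ht.1, ht.2.trans_le hb⟩⟩

/-- Several time steps. The constants of admissibility depend on the total time only, so the length
of the step never has to shrink. -/
theorem IsStep.exists_long_evolution {ρ c τ K C κ P κ₀ P₀ C₀ : ℝ} (h : S.IsStep ρ c τ K C κ P)
    {G : Phase → ℝ} {G' : Phase → Phase →L[ℝ] ℝ} (hG : S.IsAdmissible K κ₀ P₀ C₀ G G') (N : ℕ)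
    (hκ : 2 * κ ≤ κ₀ * Real.exp (-(C * (N * τ)))) (hP : P₀ + S.M * (N * τ) + 1 ≤ P)
    (hκ₀ : 0 ≤ κ₀) : ∃ C₁ F F',
      S.IsEvolution K (κ₀ * Real.exp (-(C * (N * τ)))) (P₀ + S.M * (N * τ)) C₁ 0 (N * τ) F F' ∧
      ∀ z ∈ S.D, F 0 z = G z ∧ F' 0 z = G' z := by
  have hτ := h.scale.τ_pos
  have hMτ := mul_pos S.M_pos hτ
  have hCτ := mul_nonneg h.C_nonneg hτ.le
  induction N with
  | zero =>
    refine ⟨C₀, fun _ => G, fun _ => G', ⟨fun t _ => ?_, fun z _ => continuousOn_const,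
      fun z _ t ht => ?_⟩, fun z _ => ⟨rfl, rfl⟩⟩
    · refine hG.mono ?_ ?_ le_rfl <;> simp
    · have := ht.1.trans_lt ht.2
      simp at this
  | succ N ih =>
    push_cast at hκ hP ⊢
    have hexp : κ₀ * Real.exp (-(C * ((N + 1) * τ))) =
        κ₀ * Real.exp (-(C * (N * τ))) * Real.exp (-(C * τ)) := by
      rw [mul_assoc, ← Real.exp_add]; congr 2; ring
    have hle : κ₀ * Real.exp (-(C * ((N + 1) * τ))) ≤ κ₀ * Real.exp (-(C * (N * τ))) := by
      rw [hexp]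
      exact mul_le_of_le_one_right (by positivity) (Real.exp_le_one_iff.2 (by linarith))
    have hPeq : P₀ + S.M * ((N + 1) * τ) = P₀ + S.M * (N * τ) + S.M * τ := by ring
    have hNeq : ((N : ℝ) + 1) * τ = N * τ + τ := by ring
    obtain ⟨C₁, F₁, F₁', hF₁, h01⟩ := ih (hκ.trans hle) (by linarith)
    have hN0 : (0 : ℝ) ≤ N * τ := by positivity
    obtain ⟨C₂, F₂, F₂', hF₂, h02⟩ := h.exists_evolution
      (hF₁.admissible _ (right_mem_Icc.2 hN0)) (by rw [← hexp]; exact hκ) (by linarith) (N * τ)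
    rw [← hexp, ← hPeq, ← hNeq] at hF₂
    refine ⟨_, _, _, hF₁.glue hF₂ hN0 (by linarith) hle (by linarith) h02, fun z hz => ?_⟩
    by_cases h0 : (0 : ℝ) < N * τ
    · simp only [if_pos h0]
      exact h01 z hz
    · simp only [if_neg h0]
      have h0' : (N : ℝ) * τ = 0 := le_antisymm (not_lt.1 h0) hN0
      have h3 := h02 z hz
      rw [h0'] at h3
      exact ⟨h3.1.trans (h01 z hz).1, h3.2.trans (h01 z hz).2⟩

/-- Existence of the evolution on a given time interval for data of momentum at most `P₀`. The
parameter `K` of the energy depends on the size of the momenta only. -/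
theorem exists_evolution (S : BilliardSystem) {T P₀ : ℝ} (hT : 0 ≤ T) (hP₀ : 0 ≤ P₀) :
    ∃ K c, 0 < c ∧ (∀ z ∈ S.D, ‖z.2‖ ≤ P₀ → c * |S.ψ z.1| ≤ S.energy K z) ∧
    ∀ κ₀ C₀ G G', 0 < κ₀ → S.IsAdmissible K κ₀ P₀ C₀ G G' → ∃ κ P C F F',
      S.IsEvolution K κ P C 0 T F F' ∧ ∀ z ∈ S.D, F 0 z = G z ∧ F' 0 z = G' z := by
  obtain ⟨ρ₀, hρ₀, hb⟩ := S.exists_norm_le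
  have hM := S.M_pos
  set P := P₀ + S.M * (T + 1) + 1 with hP
  have hMT : 0 ≤ S.M * (T + 1) := by positivity
  set ρ := ρ₀ + P + 2 * S.M with hρ
  have hsize : ∀ z ∈ S.D, ‖z.2‖ ≤ P → ‖z‖ + 2 * S.M ≤ ρ := fun z hz hz2 => by
    have h1 := hb z.1 hz.1
    have h2 : ‖z‖ ≤ ρ₀ + P := (Prod.norm_def z).trans_le
      (max_le (by linarith [(norm_nonneg z.2).trans hz2]) (by linarith))
    linarith
  obtain ⟨K, c, C, hc, hC, hcoer, hE⟩ := S.exists_energy_bounds ρ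
  refine ⟨K, c, hc, fun z hz hz2 => hcoer z hz (by linarith [hsize z hz (by linarith)]),
    fun κ₀ C₀ G G' hκ₀ hG => ?_⟩
  have hE' : S.EnergyBounds ρ K C := hE
  obtain ⟨c', τ, hstep⟩ := hE'.exists_isStep (κ := κ₀ * Real.exp (-(C * (T + 1))) / 2) (P := P)
    (by linarith) hC (by positivity) hsize
  have hτ := hstep.scale.τ_pos
  have hτ1 : τ ≤ 1 := hstep.scale.τ_le.trans S.b_le_one
  obtain ⟨N, hN⟩ : ∃ N : ℕ, T ≤ N * τ ∧ N * τ ≤ T + 1 := by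
    refine ⟨⌈T / τ⌉₊, ?_, ?_⟩
    · have := Nat.le_ceil (T / τ)
      rwa [div_le_iff₀ hτ] at this
    · have h1 := (Nat.ceil_lt_add_one (div_nonneg hT hτ.le)).le
      have h2 : (⌈T / τ⌉₊ : ℝ) * τ ≤ (T / τ + 1) * τ := by gcongr
      have h3 : (T / τ + 1) * τ = T + τ := by field_simp
      linarith
  obtain ⟨C₁, F, F', hF, h0⟩ := hstep.exists_long_evolution hG N (by
      have : Real.exp (-(C * (T + 1))) ≤ Real.exp (-(C * (N * τ))) := by
        rw [Real.exp_le_exp]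
        have := mul_le_mul_of_nonneg_left hN.2 hC
        linarith
      have := mul_le_mul_of_nonneg_left this hκ₀.le
      linarith) (by
      have := mul_le_mul_of_nonneg_left hN.2 hM.le
      linarith) hκ₀.le
  exact ⟨_, _, _, F, F', hF.mono hN.1, h0⟩

end BilliardSystem

/-! ### The billiard system of the theorem -/

/-- The nearest-point projection onto a closed convex set. -/
theorem exists_projection {s : Set Plane} (hc : IsClosed s) (hs : Convex ℝ s) (hn : s.Nonempty) :
    ∃ π : Plane → Plane, (∀ x, π x ∈ s) ∧ (∀ x ∈ s, π x = x) ∧ ∀ x y, ‖π y - π x‖ ≤ ‖y - x‖ := by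
  have h : ∀ x, ∃ v ∈ s, ∀ w ∈ s, ⟪x - v, w - v⟫ ≤ 0 := fun x => by
    obtain ⟨v, hv, he⟩ := exists_norm_eq_iInf_of_complete_convex hn hc.isComplete hs x
    exact ⟨v, hv, (norm_eq_iInf_iff_real_inner_le_zero hs hv).1 he⟩
  choose π hπ hπ' using h
  refine ⟨π, hπ, fun x hx => ?_, fun x y => ?_⟩
  · have := hπ' x x hx
    rw [real_inner_self_eq_norm_sq] at this
    have h0 : ‖x - π x‖ = 0 := pow_eq_zero_iff two_ne_zero |>.1 (le_antisymm this (sq_nonneg _))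
    exact (sub_eq_zero.1 (norm_eq_zero.1 h0)).symm
  · have h1 := hπ' x (π y) (hπ y)
    have h2 := hπ' y (π x) (hπ x)
    have h3 : ‖π y - π x‖ ^ 2 ≤ ⟪y - x, π y - π x⟫ := by
      rw [← real_inner_self_eq_norm_sq]
      simp only [inner_sub_left, inner_sub_right] at *
      linarith
    have h4 := real_inner_le_norm (y - x) (π y - π x)
    rcases (norm_nonneg (π y - π x)).eq_or_lt with h5 | h5
    · rw [← h5]; exact norm_nonneg _
    · exact le_of_mul_le_mul_right (by linarith [sq ‖π y - π x‖]) h5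

theorem isFat_closure {Ω : Set Plane} (hΩ : IsC5ConvexDomain Ω) : ∃ r d, IsFat (closure Ω) r d := by
  obtain ⟨c, r, hr, hball⟩ := hΩ.exists_closedBall_subset
  obtain ⟨B, hB⟩ := hΩ.isBounded.closure.exists_norm_le
  exact ⟨r, ‖c‖ + |B| + 1, hΩ.convex.closure, hr, by linarith [norm_nonneg c, abs_nonneg B],
    fun x hx => ⟨c, (norm_sub_le _ _).trans (by linarith [hB x hx, le_abs_self B]),
      hball.trans subset_closure⟩⟩

/-- Hölder continuity at unit distance with exponent `μ` implies the same with a smaller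
exponent. -/
theorem rpow_le_rpow_half {μ x : ℝ} (hμ : 0 < μ) (hx : 0 ≤ x) (hx1 : x ≤ 1) :
    x ^ μ ≤ x ^ (μ / 2) :=
  Real.rpow_le_rpow_of_exponent_ge_of_imp hx hx1 (by linarith) (fun _ h => by linarith)

/-- The domain and the field of the theorem form a billiard system. The exponent is halved, because
`x ^ μ ≤ x ^ (μ / 2)` near `0` and any exponent below `μ` serves the purpose. -/
theorem exists_billiardSystem {Ω : Set Plane} (hΩ : IsC5ConvexDomain Ω) {T : ℝ} (hT : 0 < T)
    {μ : ℝ} (hμ : μ ∈ Ioo (0 : ℝ) 1) {E : ℝ → Plane → Plane} (hE : MemC01Holder T Ω μ E)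
    {h : Plane → ℝ} (hpos : ∀ x ∈ frontier Ω, 0 < h x)
    (hEn : ∀ t ∈ Icc 0 T, ∀ x ∈ frontier Ω, ⟪E t x, outerNormal Ω x⟫ = h x) :
    ∃ S : BilliardSystem, S.Ω = Ω ∧ S.lam = μ / 2 ∧
      (∀ t ∈ Icc 0 T, ∀ x ∈ closure Ω, S.E t x = E t x) ∧
      ∀ x ∈ frontier Ω, S.n x = outerNormal Ω x := by
  obtain ⟨ψ, n, hn3, hψn, hΩψ, hfψ, hn⟩ := hΩ.exists_definingFunction
  obtain ⟨r, d, hFat⟩ := isFat_closure hΩ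
  obtain ⟨π, hπ, hπs, hπl⟩ := exists_projection isClosed_closure hΩ.convex.closure
    hΩ.nonempty.closure
  have hπc : Continuous π := (LipschitzWith.of_dist_le_mul (K := 1) fun x y => by
    rw [dist_eq_norm, dist_eq_norm, NNReal.coe_one, one_mul]; exact hπl y x).continuous
  obtain ⟨C₁, hC₁⟩ := hE.holder
  obtain ⟨B, hB⟩ := hE.bddCont.2
  have hμ2 : 0 < μ / 2 := by linarith [hμ.1]
  set E' : ℝ → Plane → Plane →L[ℝ] Plane := fun t => fderivWithin ℝ (E t) (closure Ω) with hE'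
  have hTay : ∃ C, ∀ t ∈ Icc 0 T, IsTaylor (closure Ω) (μ / 2) C (E t) (E' t) :=
    ⟨_, fun t ht => hFat.isTaylor_of_holder (C := |C₁|) hμ2 (abs_nonneg _) (hB t ht)
      (fun x hx => (hE.differentiableOn t ht x hx).hasFDerivWithinAt) fun x hx y hy hxy => by
        refine (hC₁ t ht x hx y hy).trans ?_
        rw [norm_sub_rev] at hxy
        exact mul_le_mul (le_abs_self _) (rpow_le_rpow_half hμ.1 (norm_nonneg _) hxy)
          (Real.rpow_nonneg (norm_nonneg _) _) (abs_nonneg _)⟩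
  obtain ⟨C, hTay⟩ := hTay
  have h0T : (0 : ℝ) ∈ Icc 0 T := ⟨le_rfl, hT.le⟩
  have hC : 0 ≤ C := (hTay 0 h0T).nonneg
  -- the field is extended constantly in time and by the projection in space
  let κ : ℝ → ℝ := fun t => projIcc 0 T hT.le t
  have hκm : ∀ t, κ t ∈ Icc 0 T := fun t => (projIcc 0 T hT.le t).2
  have hκ : ∀ t ∈ Icc 0 T, κ t = t := fun t ht => by
    simp only [κ]; rw [projIcc_of_mem _ ht]
  have hκc : Continuous κ := continuous_subtype_val.comp continuous_projIcc
  have hpc : Continuous fun p : ℝ × Plane => (κ p.1, π p.2) :=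
    (hκc.comp continuous_fst).prodMk (hπc.comp continuous_snd)
  have hpm : ∀ p : ℝ × Plane, (κ p.1, π p.2) ∈ Icc 0 T ×ˢ closure Ω := fun p => ⟨hκm _, hπ _⟩
  have hE'c : ContinuousOn (fun z : ℝ × Plane => E' z.1 z.2) (Icc 0 T ×ˢ closure Ω) := by
    refine continuousOn_prod_of_holder hμ2 (C := (12 * (d + r) / r + 4) * C)
      (fun t ht x hx y hy => (hTay t ht).holder hμ2 (by linarith [hμ.2]) hFat hx hy) fun x hx =>
      hFat.continuousOn_deriv hμ2 hTay (fun x hx => ?_) hx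
    exact hE.bddCont.1.comp (f := fun t : ℝ => (t, x)) (by fun_prop) (fun t ht => ⟨ht, hx⟩)
  have hcl : ∀ x, x ∈ closure Ω ↔ ψ x ≤ 0 := fun x => by
    rw [closure_eq_self_union_frontier, mem_union, hΩψ, hfψ, le_iff_lt_or_eq]
  set M := max 1 (C + 2 * |B|) with hM
  have hMC : C ≤ M := le_trans (by linarith [abs_nonneg B]) (le_max_right _ _)
  have hMB : |B| ≤ M := le_trans (by linarith [abs_nonneg B]) (le_max_right _ _)
  have hEt : ∀ t ∈ Icc 0 T, ∀ x ∈ closure Ω, ∀ y ∈ closure Ω,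
      ‖E t y - E t x - E' t x (y - x)‖ ≤ M * ‖y - x‖ ^ (1 + μ / 2) := by
    intro t ht x hx y hy
    rcases le_or_gt ‖y - x‖ 1 with hle | hgt
    · exact ((hTay t ht).taylor x hx y hy hle).trans (by gcongr)
    · have h1 : ‖y - x‖ ≤ ‖y - x‖ ^ (1 + μ / 2) := by
        conv_lhs => rw [← Real.rpow_one ‖y - x‖]
        exact Real.rpow_le_rpow_of_exponent_le hgt.le (by linarith)
      have h2 : ‖E t y - E t x - E' t x (y - x)‖ ≤ (|B| + |B|) + C * ‖y - x‖ :=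
        (norm_sub_le _ _).trans (add_le_add ((norm_sub_le _ _).trans
          (add_le_add ((hB t ht y hy).trans (le_abs_self _))
            ((hB t ht x hx).trans (le_abs_self _))))
          ((E' t x).le_of_opNorm_le ((hTay t ht).bound x hx) _))
      have h3 : (C + 2 * |B|) * ‖y - x‖ ≤ M * ‖y - x‖ ^ (1 + μ / 2) := by
        gcongr
        exact le_max_right _ _
      have h4 : |B| * 1 ≤ |B| * ‖y - x‖ := by gcongr
      linarith
  refine ⟨{
    Ω := Ω
    ψ := ψ
    n := n
    E := fun t x => E (κ t) (π x)
    E' := fun t x => E' (κ t) (π x)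
    lam := μ / 2
    M := M
    lam_pos := hμ2
    lam_lt_one := by linarith [hμ.2]
    one_le_M := le_max_left _ _
    nonempty := hΩ.nonempty
    convex := hΩ.convex
    bounded := hΩ.isBounded
    hasFDerivAt_ψ := hψn
    n_contDiff := hn3
    mem_iff := hΩψ
    mem_closure_iff := hcl
    norm_n := fun x hx => (hn x ((hfψ x).2 hx)).2.1
    hess := fun x hx => (hn x ((hfψ x).2 hx)).2.2
    E_cont := hE.bddCont.1.comp_continuous hpc hpm
    E_bdd := fun t x => ((hB _ (hκm t) _ (hπ x)).trans (le_abs_self B)).trans hMB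
    E_lip := fun t x y => ((hTay _ (hκm t)).lipschitz hμ2 hΩ.convex.closure (hπ x) (hπ y)).trans
      (mul_le_mul hMC (hπl x y) (norm_nonneg _) (hC.trans hMC))
    E'_cont := hE'c.comp_continuous hpc hpm
    E'_bdd := fun t x => ((hTay _ (hκm t)).bound _ (hπ x)).trans hMC
    E_taylor := fun t x hx y hy => by
      rw [hπs x hx, hπs y hy]; exact hEt _ (hκm t) x hx y hy
    E_normal := fun t x hx => by
      have hxf := (hfψ x).2 hx
      rw [hπs x (frontier_subset_closure hxf), (hn x hxf).1, hEn _ (hκm t) x hxf,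
        hEn _ (hκm 0) x hxf]
    E_normal_pos := fun x hx => by
      have hxf := (hfψ x).2 hx
      rw [hπs x (frontier_subset_closure hxf), (hn x hxf).1, hEn _ (hκm 0) x hxf]
      exact hpos x hxf }, rfl, rfl, fun t ht x hx => ?_, fun x hx => (hn x hx).1⟩
  simp only
  rw [hκ t ht, hπs x hx]

namespace BilliardSystem

variable (S : BilliardSystem)

theorem isOpen_Ω : IsOpen S.Ω := by
  have : S.Ω = {x | S.ψ x < 0} := by ext x; exact S.mem_iff x
  rw [this]
  exact isOpen_lt S.continuous_ψ continuous_const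

theorem mem_frontier_iff (x : Plane) : x ∈ frontier S.Ω ↔ S.ψ x = 0 := by
  rw [S.isOpen_Ω.frontier_eq, Set.mem_sdiff, S.mem_closure_iff, S.mem_iff, not_lt, le_antisymm_iff]

/-- Every tangent vector at a boundary point is the velocity of a curve in the boundary. -/
theorem exists_boundary_curve {x ξ : Plane} (hx : S.ψ x = 0) (hξ : ⟪S.n x, ξ⟫ = 0) :
    ∃ γ : ℝ → Plane, ∃ s₀ > 0, γ 0 = x ∧ (∀ s ∈ Icc 0 s₀, S.ψ (γ s) = 0) ∧
      HasDerivWithinAt γ ξ (Icc 0 s₀) 0 := by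
  obtain ⟨C, hC, hd⟩ := S.exists_dist_le
  set ρ := ‖x‖ + ‖ξ‖ + 1 with hρ
  have hρ0 : 0 < ρ := by positivity
  obtain ⟨C₁, hC₁, hT⟩ := exists_taylor_of_contDiff S.contDiff_ψ
    (isCompact_closedBall (0 : Plane) ρ) (convex_closedBall 0 ρ)
  -- a point of `closure Ω` at distance `O(s ^ 2)` from the tangent line
  set K := C₁ * (‖ξ‖ + 1) ^ 2 with hK
  have hK0 : 0 ≤ K := by positivity
  set s₀ := 1 / (K + 1) with hs₀
  have hs₀0 : 0 < s₀ := by positivity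
  have hn1 := S.norm_n x hx
  have key : ∀ s ∈ Icc 0 s₀, ∃ y, S.ψ y = 0 ∧ ‖y - x - s • ξ‖ ≤ (2 * C * K + K) * s ^ 2 := by
    intro s hs
    have hsK : (K + 1) * s ≤ 1 := by
      have := hs.2
      rw [hs₀, le_div_iff₀ (by positivity)] at this
      linarith
    have hs1 : s ≤ 1 := by nlinarith [hs.1]
    have hKs : K * s ≤ 1 := by linarith [hs.1]
    set w := x + (s • ξ - (K * s ^ 2) • S.n x) with hw
    have hwx : ‖w - x‖ ≤ s * (‖ξ‖ + 1) := by
      rw [hw, add_sub_cancel_left]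
      refine (norm_sub_le _ _).trans ?_
      rw [norm_smul, norm_smul, hn1, Real.norm_of_nonneg hs.1,
        Real.norm_of_nonneg (by positivity), mul_one, mul_add, mul_one]
      have : K * s * s ≤ 1 * s := by gcongr; exact hs.1
      linarith
    have hxm : x ∈ Metric.closedBall (0 : Plane) ρ := by
      rw [mem_closedBall_zero_iff]; linarith [norm_nonneg ξ]
    have hwm : w ∈ Metric.closedBall (0 : Plane) ρ := by
      rw [mem_closedBall_zero_iff]
      have h1 := norm_le_norm_add_norm_sub' w x
      have h2 : s * (‖ξ‖ + 1) ≤ 1 * (‖ξ‖ + 1) := by gcongr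
      linarith
    have h1 := hT x hxm w hwm
    have h2 : fderiv ℝ S.ψ x (w - x) = -(K * s ^ 2) := by
      rw [fderiv_ψ, innerSL_apply_apply, hw, add_sub_cancel_left, inner_sub_right,
        real_inner_smul_right, real_inner_smul_right, hξ, real_inner_self_eq_norm_sq, hn1]
      ring
    rw [h2, hx, sub_zero, Real.norm_eq_abs] at h1
    have h3 : C₁ * ‖w - x‖ ^ 2 ≤ K * s ^ 2 := by
      have : ‖w - x‖ ^ 2 ≤ (s * (‖ξ‖ + 1)) ^ 2 := pow_le_pow_left₀ (norm_nonneg _) hwx 2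
      calc C₁ * ‖w - x‖ ^ 2 ≤ C₁ * (s * (‖ξ‖ + 1)) ^ 2 := by gcongr
        _ = K * s ^ 2 := by rw [hK]; ring
    have h4 := abs_le.1 (h1.trans h3)
    have h5 : S.ψ w ≤ 0 := by linarith [h4.2]
    have h6 : |S.ψ w| ≤ 2 * K * s ^ 2 := by rw [abs_of_nonpos h5]; linarith [h4.1]
    obtain ⟨y, hy, hyw⟩ := hd w ((S.mem_closure_iff w).2 h5)
    refine ⟨y, hy, ?_⟩
    have e : y - x - s • ξ = -(w - y) - (K * s ^ 2) • S.n x := by rw [hw]; abel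
    rw [e]
    refine (norm_sub_le _ _).trans ?_
    rw [norm_neg, norm_smul, hn1, Real.norm_of_nonneg (by positivity), mul_one]
    have : C * |S.ψ w| ≤ C * (2 * K * s ^ 2) := by gcongr
    linarith
  choose! γ hγ0 hγ using key
  have h0 : γ 0 = x := by
    have := hγ 0 ⟨le_rfl, hs₀0.le⟩
    rw [zero_smul, sub_zero, zero_pow two_ne_zero, mul_zero] at this
    exact sub_eq_zero.1 (norm_le_zero_iff.1 this)
  refine ⟨γ, s₀, hs₀0, h0, hγ0, ?_⟩
  rw [hasDerivWithinAt_iff_isLittleO, Asymptotics.isLittleO_iff]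
  intro ε hε
  have hev : ∀ᶠ s in 𝓝[Icc 0 s₀] (0 : ℝ), s < ε / (2 * C * K + K + 1) :=
    nhdsWithin_le_nhds (gt_mem_nhds (by positivity))
  filter_upwards [hev, self_mem_nhdsWithin] with s hs hmem
  rw [lt_div_iff₀ (by positivity)] at hs
  rw [h0, sub_zero, Real.norm_of_nonneg hmem.1]
  refine (hγ s hmem).trans ?_
  have h1 : 0 ≤ 2 * C * K + K := by positivity
  nlinarith [hmem.1]

/-- A function which is invariant under the reflection, and whose transport derivative is
invariant as well, is reflecting: the compatibility of the full derivative follows by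
differentiation along the boundary and in the momentum. -/
theorem isReflecting_of_compat {C : ℝ} {G : Phase → ℝ} {G' : Phase → Phase →L[ℝ] ℝ}
    (hG : IsTaylor S.D S.lam C G G') (h0 : ∀ z, S.ψ z.1 = 0 → G z = G (S.R z))
    (h1 : ∀ z, S.ψ z.1 = 0 → G' z (S.W 0 z) = G' (S.R z) (S.W 0 (S.R z))) :
    S.IsReflecting G G' := by
  intro z hz hp
  refine ⟨h0 z hz, ?_⟩
  have hzD : z ∈ S.D := mem_D.2 hz.le
  have hd := hG.hasFDerivWithinAt S.lam_pos hzD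
  have hdR := hG.hasFDerivWithinAt S.lam_pos (R_mem_D hzD)
  -- curves in the boundary
  have hcurve : ∀ (γ : ℝ → Phase) (ξ : Phase) (s₀ : ℝ), 0 < s₀ → γ 0 = z →
      (∀ s ∈ Icc 0 s₀, S.ψ (γ s).1 = 0) → HasDerivWithinAt γ ξ (Icc 0 s₀) 0 →
      G' z ξ = G' (S.R z) (fderiv ℝ S.R z ξ) := by
    intro γ ξ s₀ hs₀ hγ0 hγ hγd
    have hd' : HasFDerivWithinAt G (G' z) S.D (γ 0) := by rw [hγ0]; exact hd
    have d1 := hd'.comp_hasDerivWithinAt (f := γ) (0 : ℝ) hγd (fun s hs => mem_D.2 (hγ s hs).le)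
    have dR : HasFDerivAt S.R (fderiv ℝ S.R z) (γ 0) := by rw [hγ0]; exact S.hasFDerivAt_R z
    have d2 := dR.comp_hasDerivWithinAt (f := γ) (0 : ℝ) hγd
    have hdR' : HasFDerivWithinAt G (G' (S.R z)) S.D ((S.R ∘ γ) 0) := by
      rw [Function.comp_apply, hγ0]; exact hdR
    have d3 := hdR'.comp_hasDerivWithinAt (f := S.R ∘ γ) (0 : ℝ) d2
      (fun s hs => R_mem_D (mem_D.2 (hγ s hs).le))
    have d4 : HasDerivWithinAt (G ∘ γ) (G' (S.R z) (fderiv ℝ S.R z ξ)) (Icc 0 s₀) 0 :=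
      d3.congr (fun s hs => h0 _ (hγ s hs)) (h0 _ (hγ 0 ⟨le_rfl, hs₀.le⟩))
    exact (uniqueDiffOn_Icc hs₀ 0 ⟨le_rfl, hs₀.le⟩).eq_deriv _ d1 d4
  refine ContinuousLinearMap.ext fun ξ => ?_
  rw [ContinuousLinearMap.comp_apply]
  -- decompose `ξ` along the flow, the boundary and the momenta
  set q := (S.p z)⁻¹ * ⟪S.n z.1, ξ.1⟫ with hq
  have hpq : q * S.p z = ⟪S.n z.1, ξ.1⟫ := by rw [hq]; field_simp
  set ξ₁ : Plane := ξ.1 - q • relVelocity z.2 with hξ₁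
  set η : Plane := ξ.2 - q • S.E 0 z.1 with hη
  have hdec : ξ = q • S.W 0 z + (ξ₁, 0) + (0, η) := by
    refine Prod.ext ?_ ?_ <;> simp [W, hξ₁, hη]
  have ht : ⟪S.n z.1, ξ₁⟫ = 0 := by
    rw [hξ₁, inner_sub_right, real_inner_smul_right, ← p, hpq, sub_self]
  have hA1 : S.A z (ξ₁, 0) = fderiv ℝ S.R z (ξ₁, 0) := by
    rw [A_apply, ht, mul_zero, zero_smul, add_zero]
  have hA2 : S.A z (0, η) = fderiv ℝ S.R z (0, η) := by
    rw [A_apply, inner_zero_right, mul_zero, zero_smul, add_zero]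
  have e1 : G' z (ξ₁, 0) = G' (S.R z) (S.A z (ξ₁, 0)) := by
    obtain ⟨γ, s₀, hs₀, hγ0, hγ, hγd⟩ := S.exists_boundary_curve hz ht
    rw [hA1]
    exact hcurve (fun s => (γ s, z.2)) _ s₀ hs₀ (by rw [hγ0]) hγ
      (hγd.prodMk (hasDerivWithinAt_const _ _ _))
  have e2 : G' z (0, η) = G' (S.R z) (S.A z (0, η)) := by
    rw [hA2]
    refine hcurve (fun s => z + s • ((0, η) : Phase)) _ 1 one_pos (by simp) (fun s _ => ?_) ?_
    · simpa using hz
    · have := (((hasDerivAt_id (0 : ℝ)).smul_const ((0, η) : Phase)).const_add z).hasDerivWithinAt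
        (s := Icc 0 1)
      rw [one_smul] at this
      exact this
  have e3 : G' z (S.W 0 z) = G' (S.R z) (S.A z (S.W 0 z)) := by
    rw [A_W hz hp.ne', h1 z hz]
  rw [hdec]
  simp only [map_add, map_smul, e1, e2, e3]

end BilliardSystem

namespace BilliardSystem

variable (S : BilliardSystem)

/-! ### The initial datum -/

/-- Reversal of momenta, as a linear map. -/
noncomputable def rev : Phase →L[ℝ] Phase :=
  (ContinuousLinearMap.fst ℝ Plane Plane).prod (-ContinuousLinearMap.snd ℝ Plane Plane)

theorem rev_apply (z : Phase) : rev z = (z.1, -z.2) := rfl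

theorem rev_rev (z : Phase) : rev (rev z) = z := by simp [rev_apply]

theorem norm_rev (z : Phase) : ‖rev z‖ = ‖z‖ := by
  rw [rev_apply, Prod.norm_def, Prod.norm_def, norm_neg]

theorem norm_rev_le : ‖rev‖ ≤ 1 :=
  ContinuousLinearMap.opNorm_le_bound _ zero_le_one fun z => by rw [norm_rev, one_mul]

variable {S} in
theorem rev_mem_D {z : Phase} (hz : z ∈ S.D) : rev z ∈ S.D := mem_D.2 (mem_D.1 hz)

variable {S} in
theorem isTaylor_rev {C : ℝ} {f : Phase → ℝ} {f' : Phase → Phase →L[ℝ] ℝ}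
    (h : IsTaylor S.D S.lam C f f') :
    IsTaylor S.D S.lam C (fun z => f (rev z)) (fun z => (f' (rev z)).comp rev) := by
  refine ⟨h.nonneg, fun x hx y hy hxy => ?_, fun x hx => ?_⟩
  · have e : ‖rev y - rev x‖ = ‖y - x‖ := by rw [← map_sub, norm_rev]
    have := h.taylor (rev x) (rev_mem_D hx) (rev y) (rev_mem_D hy) (by rwa [e])
    rwa [e, ← map_sub] at this
  · refine (ContinuousLinearMap.opNorm_comp_le _ _).trans ?_
    have h1 := h.bound (rev x) (rev_mem_D hx)
    nlinarith [norm_nonneg (f' (rev x)), norm_nonneg rev, norm_rev_le]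

theorem exists_tangent (n : Plane) : ∃ w : Plane, ‖w‖ = ‖n‖ ∧ ⟪n, w⟫ = 0 := by
  refine ⟨!₂[-(n 1), n 0], ?_, ?_⟩
  · rw [EuclideanSpace.norm_eq, EuclideanSpace.norm_eq]
    simp [Fin.sum_univ_two, add_comm]
  · simp [PiLp.inner_apply, Fin.sum_univ_two]
    ring

variable {S}

/-- The value of a flat datum near the grazing set is `0`, because the support is compact while
the grazing set is unbounded. -/
theorem flat_value {f₀ : Phase → ℝ} {B : ℝ} (hB : ∀ z ∈ S.D, B < ‖z‖ → f₀ z = 0)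
    (hn : ∀ x ∈ frontier S.Ω, S.n x = outerNormal S.Ω x) {δ c : ℝ} (hδ : 0 < δ)
    (h : ∀ z ∈ S.D, Metric.infDist z (singularSet S.Ω) ≤ δ → f₀ z = c) : c = 0 := by
  obtain ⟨x, hx⟩ := S.exists_ψ_eq_zero
  obtain ⟨w, hw, hnw⟩ := exists_tangent (S.n x)
  rw [S.norm_n x hx] at hw
  have hxf := (S.mem_frontier_iff x).2 hx
  set z : Phase := (x, (|B| + 1) • w) with hz
  have hzD : z ∈ S.D := mem_D.2 hx.le
  have hzs : z ∈ singularSet S.Ω :=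
    ⟨hxf, by rw [← hn x hxf]; simp [hz, real_inner_smul_right, hnw]⟩
  have h1 := h z hzD (by rw [Metric.infDist_zero_of_mem hzs]; exact hδ.le)
  rw [← h1]
  refine hB z hzD ?_
  have h2 : ‖z.2‖ = |B| + 1 := by
    rw [hz, norm_smul, hw, mul_one, Real.norm_of_nonneg (by positivity)]
  have h3 := norm_snd_le z
  linarith [le_abs_self B]

theorem deriv_eq_zero_of_eventually {C : ℝ} {G : Phase → ℝ} {G' : Phase → Phase →L[ℝ] ℝ}
    (hG : IsTaylor S.D S.lam C G G') {z : Phase} (hz : z ∈ S.D) {U : Set Phase} (hU : IsOpen U)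
    (hzU : z ∈ U) (h : ∀ y ∈ S.D, y ∈ U → G y = 0) : G' z = 0 := by
  obtain ⟨r, d, hFat⟩ := S.exists_isFat_D
  have h1 := hG.hasFDerivWithinAt S.lam_pos hz
  have h2 : HasFDerivWithinAt G (0 : Phase →L[ℝ] ℝ) S.D z := by
    refine (hasFDerivWithinAt_const (0 : ℝ) z S.D).congr_of_eventuallyEq ?_ (h z hz hzU)
    filter_upwards [self_mem_nhdsWithin, nhdsWithin_le_nhds (hU.mem_nhds hzU)] with y h1 h2
      using h y h1 h2
  exact hFat.uniqueDiffOn.eq (mem_inter hz hz).1 h1 h2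

variable (S)

/-- The initial datum, in reversed momenta, is admissible. -/
theorem exists_isAdmissible {μ : ℝ} (hμ : 0 < μ) (hlam : S.lam = μ / 2)
    (hn : ∀ x ∈ frontier S.Ω, S.n x = outerNormal S.Ω x) {E : ℝ → Plane → Plane}
    (hE : ∀ x ∈ closure S.Ω, S.E 0 x = E 0 x) {f₀ : Phase → ℝ} (hf₀ : MemC1Holder0 S.Ω μ f₀)
    (hpos : ∀ p ∈ phaseSpace S.Ω, 0 ≤ f₀ p) (hcompat : IsCompatible S.Ω E f₀)
    (hflat : IsFlat S.Ω f₀) : ∃ P₀ C G', 0 ≤ P₀ ∧ ∀ K c, 0 < c →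
      (∀ z ∈ S.D, ‖z.2‖ ≤ P₀ → c * |S.ψ z.1| ≤ S.energy K z) →
      ∃ κ₀, 0 < κ₀ ∧ S.IsAdmissible K κ₀ P₀ C (fun z => f₀ (rev z)) G' := by
  obtain ⟨r, d, hFat⟩ := S.exists_isFat_D
  obtain ⟨B, hB⟩ := hf₀.bounded
  obtain ⟨H, hH⟩ := hf₀.holder
  obtain ⟨Kc, hKc, hsupp⟩ := hf₀.compactSupport
  obtain ⟨P₀, hP₀⟩ := hKc.isBounded.exists_norm_le
  set f' := fderivWithin ℝ f₀ (phaseSpace S.Ω) with hf'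
  have hl := S.lam_pos
  have hTay : ∃ C, |B| ≤ C ∧ IsTaylor S.D S.lam C f₀ f' := by
    have := hFat.isTaylor_of_holder (f := f₀) (f' := f') (B := B) (C := 2 * |H|) hl (by positivity)
      hB (fun x hx => (hf₀.differentiableOn x hx).hasFDerivWithinAt) (fun x hx y hy hxy => by
        refine (hH x hx y hy).trans ?_
        rw [norm_sub_rev] at hxy
        have h1 : ‖x.1 - y.1‖ ^ μ ≤ ‖x - y‖ ^ μ :=
          Real.rpow_le_rpow (norm_nonneg _) (norm_fst_le (x - y)) hμ.le
        have h2 : ‖x.2 - y.2‖ ^ μ ≤ ‖x - y‖ ^ μ :=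
          Real.rpow_le_rpow (norm_nonneg _) (norm_snd_le (x - y)) hμ.le
        have h3 := rpow_le_rpow_half hμ (norm_nonneg (x - y)) hxy
        rw [hlam]
        calc _ ≤ |H| * (‖x - y‖ ^ (μ / 2) + ‖x - y‖ ^ (μ / 2)) := by
              refine mul_le_mul (le_abs_self _) (add_le_add (h1.trans h3) (h2.trans h3)) ?_
                (abs_nonneg _)
              exact add_nonneg (Real.rpow_nonneg (norm_nonneg _) _)
                (Real.rpow_nonneg (norm_nonneg _) _)
          _ = _ := by ring)
    refine ⟨_, le_max_right _ _, this.mono (le_max_left _ |B|)⟩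
  obtain ⟨C, hBC, hTay⟩ := hTay
  have hG := isTaylor_rev hTay
  have hlarge : ∀ z ∈ S.D, |P₀| < ‖z.2‖ → f₀ (rev z) = 0 := fun z hz h =>
    hsupp _ (rev_mem_D hz) fun hmem => by
      have h1 := hP₀ _ hmem
      rw [norm_rev] at h1
      linarith [norm_snd_le z, le_abs_self P₀]
  obtain ⟨δ, hδ, c₀, hc₀⟩ := hflat
  obtain rfl : c₀ = 0 := flat_value (B := P₀) (fun z hz h => hsupp z hz fun hmem =>
    absurd (hP₀ z hmem) (not_le.2 h)) hn hδ hc₀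
  have hinf : Continuous fun z : Phase => Metric.infDist (rev z) (singularSet S.Ω) :=
    (Metric.continuous_infDist_pt _).comp rev.continuous
  refine ⟨|P₀|, C, fun z => (f' (rev z)).comp rev, abs_nonneg _, fun K c hc hcoer => ?_⟩
  -- the energy is bounded below away from the grazing set
  obtain ⟨ρ₀, hρ₀, hb⟩ := S.exists_norm_le
  obtain ⟨κ₀, hκ₀, hmax⟩ := exists_pos_le_max (K := {z | z ∈ S.D ∧ ‖z.2‖ ≤ |P₀|})
    (f := fun z => δ - Metric.infDist (rev z) (singularSet S.Ω)) (g := S.energy K)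
    ((S.isCompact_D_inter (ρ₀ + |P₀|)).of_isClosed_subset
      (S.isClosed_D.inter (isClosed_le continuous_snd.norm continuous_const)) (fun z hz => ⟨hz.1, by
        rw [mem_closedBall_zero_iff]
        exact (Prod.norm_def z).trans_le (max_le (by linarith [hb z.1 hz.1.1, abs_nonneg P₀])
          (hz.2.trans (by linarith)))⟩))
    (continuous_const.sub hinf).continuousOn (S.continuous_energy K).continuousOn
    (fun z hz hle => by
      have h1 := hcoer z hz.1 hz.2
      have h2 : 0 ≤ c * |S.ψ z.1| := by positivity
      by_contra hcon
      have h3 : S.ψ z.1 = 0 := by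
        have : c * |S.ψ z.1| ≤ 0 := h1.trans (not_lt.1 hcon)
        exact abs_nonpos_iff.1 (nonpos_of_mul_nonpos_right this hc)
      rw [energy_eq h3] at hcon
      have h4 : ⟪S.n z.1, z.2⟫ = 0 := by
        have : ⟪S.n z.1, z.2⟫ ^ 2 ≤ 0 := by linarith [not_lt.1 hcon]
        exact pow_eq_zero_iff two_ne_zero |>.1 (le_antisymm this (sq_nonneg _))
      have hxf := (S.mem_frontier_iff z.1).2 h3
      have h5 : rev z ∈ singularSet S.Ω :=
        ⟨hxf, by rw [rev_apply, inner_neg_right]; simp only; rw [← hn _ hxf, h4, neg_zero]⟩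
      have hle' : δ - Metric.infDist (rev z) (singularSet S.Ω) ≤ 0 := hle
      rw [Metric.infDist_zero_of_mem h5] at hle'
      linarith)
  refine ⟨κ₀, hκ₀, hG, fun z hz => (hB _ (rev_mem_D hz)).trans ((le_abs_self B).trans hBC),
    fun z hz => hpos _ (rev_mem_D hz), S.isReflecting_of_compat hG (fun z hz => ?_)
    (fun z hz => ?_), fun z hz hor => ?_⟩
  · have hxf := (S.mem_frontier_iff z.1).2 hz
    have := hcompat.zeroth z.1 hxf (-z.2)
    rw [rev_apply, this, reflect, ← hn z.1 hxf, rev_apply, R]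
    congr 2
    rw [inner_neg_right]
    module
  · have hxf := (S.mem_frontier_iff z.1).2 hz
    have := hcompat.first z.1 hxf (-z.2)
    have e1 : reflect S.Ω z.1 (-z.2) = -(S.R z).2 := by
      rw [reflect, ← hn z.1 hxf, R, inner_neg_right]
      module
    rw [e1, relVelocity_neg, relVelocity_neg] at this
    have e2 : ∀ u : Plane, rev (relVelocity u, S.E 0 z.1) =
        -(-relVelocity u, E 0 z.1) := fun u => by
      rw [rev_apply, hE _ (frontier_subset_closure hxf)]; simp
    simp only [ContinuousLinearMap.comp_apply, W, R_fst, e2, map_neg]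
    rw [rev_apply, rev_apply, R_fst]
    exact congrArg Neg.neg this
  · by_cases hP : ‖z.2‖ ≤ |P₀|
    · have hen := hor.resolve_right (not_lt.2 hP)
      have hlt : Metric.infDist (rev z) (singularSet S.Ω) < δ := by
        rcases le_max_iff.1 (hmax z ⟨hz, hP⟩) with h | h
        · linarith
        · exact absurd hen (not_lt.2 h)
      have hzero : ∀ y ∈ S.D, y ∈ {y : Phase | Metric.infDist (rev y) (singularSet S.Ω) < δ} →
          f₀ (rev y) = 0 := fun y hy hyd => hc₀ _ (rev_mem_D hy) (le_of_lt hyd)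
      exact ⟨hzero z hz hlt, deriv_eq_zero_of_eventually hG hz
        (isOpen_lt hinf continuous_const) hlt hzero⟩
    · have hlt := not_le.1 hP
      exact ⟨hlarge z hz hlt, deriv_eq_zero_of_eventually hG hz
        (isOpen_lt continuous_const continuous_snd.norm) hlt hlarge⟩

end BilliardSystem

/-! ### From the evolution to the solution -/

/-- A continuous right derivative is a derivative. -/
theorem hasDerivWithinAt_Icc_of_right {a b : ℝ} (hab : a ≤ b) {g g' : ℝ → ℝ}
    (hg : ContinuousOn g (Icc a b)) (hg' : ContinuousOn g' (Icc a b))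
    (h : ∀ t ∈ Ico a b, HasDerivWithinAt g (g' t) (Ici t) t) {t : ℝ} (ht : t ∈ Icc a b) :
    HasDerivWithinAt g (g' t) (Icc a b) t := by
  set e : ℝ → ℝ := IccExtend hab (domRestrict (Icc a b) g') with he
  have hec : Continuous e := hg'.domRestrict.Icc_extend'
  have hee : ∀ s ∈ Icc a b, e s = g' s := fun s hs => IccExtend_of_mem hab _ hs
  have hd : ∀ s, HasDerivAt (fun s => ∫ r in a..s, e r) (e s) s := fun s =>
    (hec.integral_hasStrictDerivAt a s).hasDerivAt
  have hconst := constant_of_has_deriv_right_zero (f := fun s => g s - ∫ r in a..s, e r)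
    (hg.sub fun s _ => (hd s).continuousAt.continuousWithinAt) (fun s hs => by
      have := (h s hs).sub (hd s).hasDerivWithinAt
      rwa [hee s (Ico_subset_Icc_self hs), sub_self] at this)
  have hd' : HasDerivWithinAt (fun s => g a + ∫ r in a..s, e r) (g' t) (Icc a b) t := by
    rw [← hee t ht]
    exact ((hd t).const_add (g a)).hasDerivWithinAt
  refine hd'.congr_of_mem (fun s hs => ?_) ht
  have := hconst s hs
  simp only [intervalIntegral.integral_same, sub_zero] at this
  linarith

namespace BilliardSystem

variable {S : BilliardSystem}

/-- Invariance under the reflection at all boundary states, the grazing and incoming ones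
included. -/
theorem IsReflecting.apply_R {G : Phase → ℝ} {G' : Phase → Phase →L[ℝ] ℝ}
    (h : S.IsReflecting G G') {z : Phase} (hz : S.ψ z.1 = 0) : G (S.R z) = G z := by
  rcases lt_trichotomy (S.p z) 0 with hp | hp | hp
  · rw [(h (S.R z) hz (by rw [p_R hz]; linarith)).1, R_R hz]
  · have : ⟪S.n z.1, z.2⟫ = 0 := by
      rw [p_eq] at hp
      exact (mul_eq_zero.1 hp).resolve_left (inv_ne_zero (lorentz_pos _).ne')
    rw [R, this]
    simp
  · exact (h z hz hp).1.symm

section Evolution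

variable {K κ P C T : ℝ} {F : ℝ → Phase → ℝ} {F' : ℝ → Phase → Phase →L[ℝ] ℝ}

theorem IsEvolution.continuousOn_deriv (h : S.IsEvolution K κ P C 0 T F F') {z : Phase}
    (hz : z ∈ S.D) : ContinuousOn (fun t => F' t z) (Icc 0 T) := by
  obtain ⟨r, d, hFat⟩ := S.exists_isFat_D
  exact hFat.continuousOn_deriv S.lam_pos (fun t ht => (h.admissible t ht).taylor) h.continuousOn hz

theorem IsEvolution.continuousOn_timeDeriv (h : S.IsEvolution K κ P C 0 T F F') {z : Phase}
    (hz : z ∈ S.D) : ContinuousOn (fun t => F' t z (S.W t z)) (Icc 0 T) :=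
  (h.continuousOn_deriv hz).clm_apply (by
    have := S.continuous_W
    fun_prop)

theorem IsEvolution.hasDerivWithinAt_Icc (hT : 0 ≤ T) (h : S.IsEvolution K κ P C 0 T F F')
    {z : Phase} (hz : z ∈ S.D) {t : ℝ} (ht : t ∈ Icc 0 T) :
    HasDerivWithinAt (fun t => F t z) (F' t z (S.W t z)) (Icc 0 T) t :=
  hasDerivWithinAt_Icc_of_right hT (h.continuousOn z hz) (h.continuousOn_timeDeriv hz)
    (h.hasDerivWithinAt z hz) ht

/-- The solution, in the original momenta. -/
theorem IsEvolution.memC11Holder (hT : 0 < T) (h : S.IsEvolution K κ P C 0 T F F') :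
    MemC11Holder T S.Ω S.lam fun t z => F t (rev z) := by
  obtain ⟨r, d, hFat⟩ := S.exists_isFat_D
  have hl := S.lam_pos
  have hTay : ∀ t ∈ Icc 0 T, IsTaylor S.D S.lam C (fun z => F t (rev z))
      (fun z => (F' t (rev z)).comp rev) := fun t ht => isTaylor_rev (h.admissible t ht).taylor
  have hC : 0 ≤ C := (h.admissible 0 ⟨le_rfl, hT.le⟩).taylor.nonneg
  have hder : ∀ t ∈ Icc 0 T, ∀ z ∈ S.D, derivWithin (fun s => F s (rev z)) (Icc 0 T) t =
      F' t (rev z) (S.W t (rev z)) := fun t ht z hz =>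
    (h.hasDerivWithinAt_Icc hT.le (rev_mem_D hz) ht).derivWithin (uniqueDiffOn_Icc hT t ht)
  have hfd : ∀ t ∈ Icc 0 T, ∀ z ∈ S.D, fderivWithin ℝ (fun z => F t (rev z)) S.D z =
      (F' t (rev z)).comp rev := fun t ht z hz =>
    ((hTay t ht).hasFDerivWithinAt hl hz).fderivWithin (hFat.uniqueDiffOn z hz)
  set H := (12 * (d + r) / r + 4) * C with hH
  have hhol : ∀ t ∈ Icc 0 T, ∀ z ∈ S.D, ∀ y ∈ S.D, ‖F' t z - F' t y‖ ≤ H * ‖z - y‖ ^ S.lam :=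
    fun t ht z hz y hy => (h.admissible t ht).taylor.holder hl S.lam_lt_one hFat hz hy
  have hH0 : 0 ≤ H := by
    have := hFat.r_pos
    have := hFat.one_le
    positivity
  refine ⟨⟨?_, C, fun t ht z hz => (h.admissible t ht).bound _ (rev_mem_D hz)⟩,
    fun z hz t ht => (h.hasDerivWithinAt_Icc hT.le (rev_mem_D hz) ht).differentiableWithinAt,
    ⟨?_, C * S.M, fun t ht z hz => ?_⟩,
    fun t ht z hz => ((hTay t ht).hasFDerivWithinAt hl hz).differentiableWithinAt,
    H, fun t ht z hz y hy => ?_⟩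
  · refine continuousOn_prod_of_holder (S := S.D) (C := C) one_pos (fun t ht z hz y hy => ?_)
      fun z hz => h.continuousOn _ (rev_mem_D hz)
    rw [Real.rpow_one]
    exact (hTay t ht).lipschitz hl S.convex_D hy hz
  · have hc : ContinuousOn (fun q : ℝ × Phase => F' q.1 q.2) (Icc 0 T ×ˢ S.D) :=
      continuousOn_prod_of_holder hl hhol fun z hz => h.continuousOn_deriv hz
    have hr : Continuous fun q : ℝ × Phase => (q.1, rev q.2) := by fun_prop
    have hm : MapsTo (fun q : ℝ × Phase => (q.1, rev q.2)) (Icc 0 T ×ˢ S.D) (Icc 0 T ×ˢ S.D) :=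
      fun q hq => ⟨hq.1, rev_mem_D hq.2⟩
    refine ContinuousOn.congr (f := fun q : ℝ × Phase => F' q.1 (rev q.2) (S.W q.1 (rev q.2)))
      ?_ fun q hq => hder q.1 hq.1 q.2 hq.2
    exact (hc.comp hr.continuousOn hm).clm_apply (S.continuous_W.comp hr).continuousOn
  · beta_reduce
    rw [hder t ht z hz]
    refine (ContinuousLinearMap.le_opNorm _ _).trans ?_
    exact mul_le_mul ((h.admissible t ht).taylor.bound _ (rev_mem_D hz)) (S.norm_W_le _ _)
      (norm_nonneg _) hC
  · change ‖fderivWithin ℝ _ S.D z - fderivWithin ℝ _ S.D y‖ ≤ _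
    rw [hfd t ht z hz, hfd t ht y hy, ← ContinuousLinearMap.sub_comp]
    have h1 := hhol t ht _ (rev_mem_D hz) _ (rev_mem_D hy)
    rw [← map_sub, norm_rev] at h1
    have h2 : ‖(F' t (rev z) - F' t (rev y)).comp rev‖ ≤ H * ‖z - y‖ ^ S.lam := by
      refine (ContinuousLinearMap.opNorm_comp_le _ _).trans (le_trans ?_ h1)
      exact mul_le_of_le_one_right (norm_nonneg _) norm_rev_le
    refine h2.trans (mul_le_mul_of_nonneg_left ?_ hH0)
    rw [Prod.norm_def]
    rcases max_cases ‖(z - y).1‖ ‖(z - y).2‖ with hm | hm <;> rw [hm.1]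
    · exact le_add_of_nonneg_right (Real.rpow_nonneg (norm_nonneg _) _)
    · exact le_add_of_nonneg_left (Real.rpow_nonneg (norm_nonneg _) _)

theorem IsEvolution.isSolution (hT : 0 < T) (h : S.IsEvolution K κ P C 0 T F F')
    (hn : ∀ x ∈ frontier S.Ω, S.n x = outerNormal S.Ω x) {E : ℝ → Plane → Plane}
    (hE : ∀ t ∈ Icc 0 T, ∀ x ∈ closure S.Ω, S.E t x = E t x) {f₀ : Phase → ℝ}
    (h0 : ∀ z ∈ S.D, F 0 z = f₀ (rev z)) :
    IsSolution T S.Ω E f₀ fun t z => F t (rev z) := by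
  refine ⟨fun t ht x hx v => ?_, fun t ht x hx v => ?_, fun x hx v => ?_⟩
  · have ht' := Ioc_subset_Icc_self ht
    have hz : (x, v) ∈ S.D := ⟨subset_closure hx, mem_univ v⟩
    have h1 :=
      ((isTaylor_rev (h.admissible t ht').taylor).hasFDerivWithinAt S.lam_pos hz).hasFDerivAt
      (mem_of_superset ((S.isOpen_Ω.prod isOpen_univ).mem_nhds (show (x, v) ∈ S.Ω ×ˢ univ from
        ⟨hx, mem_univ v⟩)) (prod_mono_left subset_closure))
    rw [h1.fderiv, (h.hasDerivWithinAt_Icc hT.le (rev_mem_D hz) ht').derivWithin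
      (uniqueDiffOn_Icc hT t ht'), ContinuousLinearMap.comp_apply, ← map_add]
    have : S.W t (rev (x, v)) + rev (relVelocity v, E t x) = 0 := by
      rw [W, rev_apply, rev_apply, relVelocity_neg, hE t ht' x (subset_closure hx)]
      simp
    rw [this, map_zero]
  · have hz := (S.mem_frontier_iff x).1 hx
    have := (h.admissible t (Ioc_subset_Icc_self ht)).reflecting.apply_R (z := rev (x, v)) hz
    rw [← this]
    congr 1
    rw [rev_apply, rev_apply, R, reflect, ← hn x hx]
    refine Prod.ext rfl ?_
    simp only [inner_neg_right]
    module
  · have hz : (x, v) ∈ S.D := ⟨subset_closure hx, mem_univ v⟩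
    change F 0 (rev (x, v)) = _
    rw [h0 _ (rev_mem_D hz), rev_rev]

end Evolution

end BilliardSystem

namespace BilliardSystem

variable {S : BilliardSystem}

/-! ### Uniqueness -/

/-- A direction that points strictly inwards at boundary points stays in the closed domain for a
short time. -/
theorem exists_inward_step {x d : Plane} (hx : S.ψ x ≤ 0) (hd : S.ψ x = 0 → ⟪S.n x, d⟫ < 0) :
    ∃ s : ℝ, 0 < s ∧ S.ψ (x + s • d) ≤ 0 := by
  have hline : HasDerivAt (fun s : ℝ => x + s • d) d 0 := by
    simpa using ((hasDerivAt_id (0 : ℝ)).smul_const d).const_add x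
  have hder : HasDerivAt (fun s : ℝ => S.ψ (x + s • d)) ⟪S.n x, d⟫ 0 := by
    have h2 : HasFDerivAt S.ψ (innerSL ℝ (S.n x)) (x + (0 : ℝ) • d) := by
      simpa using S.hasFDerivAt_ψ x
    exact h2.comp_hasDerivAt (0 : ℝ) hline
  have hpos : ∀ᶠ s : ℝ in 𝓝[>] 0, 0 < s := self_mem_nhdsWithin
  suffices H : ∀ᶠ s : ℝ in 𝓝[>] 0, S.ψ (x + s • d) ≤ 0 by
    obtain ⟨s, h1, h2⟩ := (hpos.and H).exists
    exact ⟨s, h1, h2⟩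
  rcases hx.lt_or_eq with hlt | h0
  · have h1 := hder.continuousAt.tendsto
    simp only [zero_smul, add_zero] at h1
    exact ((h1.mono_left nhdsWithin_le_nhds).eventually (gt_mem_nhds hlt)).mono fun s hs => hs.le
  · have hle : 𝓝[>] (0 : ℝ) ≤ 𝓝[≠] 0 := nhdsWithin_mono _ fun y hy => ne_of_gt hy
    filter_upwards [((hasDerivAt_iff_tendsto_slope.1 hder).mono_left hle).eventually
      (gt_mem_nhds (hd h0)), hpos] with s hs h
    simp only [slope_def_field, zero_smul, add_zero, sub_zero, h0] at hs
    by_contra hh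
    exact absurd hs (not_lt.2 (div_nonneg (not_le.1 hh).le h.le))

section Solution

variable {T lam lam' : ℝ} {E : ℝ → Plane → Plane} {f₀ : Phase → ℝ} {f g : ℝ → Phase → ℝ}

theorem D_subset_closure : S.D ⊆ closure (S.Ω ×ˢ univ) := by
  rw [closure_prod_eq, closure_univ]; exact subset_rfl

theorem _root_.VlasovLinear.MemC11Holder.hasFDerivWithinAt (hf : MemC11Holder T S.Ω lam f) {t : ℝ}
    (ht : t ∈ Icc 0 T) {z : Phase} (hz : z ∈ S.D) :
    HasFDerivWithinAt (f t) (fderivWithin ℝ (f t) S.D z) S.D z :=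
  (hf.differentiableOn t ht z hz).hasFDerivWithinAt

theorem _root_.VlasovLinear.MemC11Holder.continuousOn_fderivWithin (hlam : 0 < lam)
    (hf : MemC11Holder T S.Ω lam f) {t : ℝ} (ht : t ∈ Icc 0 T) :
    ContinuousOn (fderivWithin ℝ (f t) S.D) S.D := by
  obtain ⟨C, hC⟩ := hf.holder
  intro z hz
  rw [ContinuousWithinAt, tendsto_iff_norm_sub_tendsto_zero]
  have h1 : ContinuousAt (fun y : Phase => C * (‖y.1 - z.1‖ ^ lam + ‖y.2 - z.2‖ ^ lam)) z := by
    refine continuousAt_const.mul (ContinuousAt.add ?_ ?_) <;>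
    exact ContinuousAt.rpow_const (by fun_prop) (Or.inr hlam.le)
  have h2 := h1.tendsto
  simp only [sub_self, norm_zero, Real.zero_rpow hlam.ne', add_zero, mul_zero] at h2
  refine squeeze_zero' (Eventually.of_forall fun _ => norm_nonneg _) ?_
    (h2.mono_left nhdsWithin_le_nhds)
  filter_upwards [self_mem_nhdsWithin] with y hy using hC t ht y hy z hz

theorem _root_.VlasovLinear.MemC11Holder.continuousOn_time (hf : MemC11Holder T S.Ω lam f) {t : ℝ}
    (ht : t ∈ Icc 0 T) : ContinuousOn (f t) S.D :=
  hf.bddCont.1.comp (f := fun z : Phase => (t, z)) (by fun_prop) fun _ hz => ⟨ht, hz⟩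

/-- The transport equation extends to the boundary by continuity. -/
theorem _root_.VlasovLinear.IsSolution.transport_D (hlam : 0 < lam) (hf : MemC11Holder T S.Ω lam f)
    (hE : ∀ t ∈ Icc 0 T, ∀ x ∈ closure S.Ω, S.E t x = E t x) (hs : IsSolution T S.Ω E f₀ f)
    {t : ℝ} (ht : t ∈ Ioc 0 T) {z : Phase} (hz : z ∈ S.D) :
    derivWithin (fun s => f s z) (Icc 0 T) t
      + fderivWithin ℝ (f t) S.D z (relVelocity z.2, S.E t z.1) = 0 := by
  have ht' := Ioc_subset_Icc_self ht
  have hW : Continuous fun z : Phase => ((relVelocity z.2, S.E t z.1) : Phase) :=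
    S.continuous_W.comp (f := fun z : Phase => (t, z)) (by fun_prop)
  have hc : ContinuousOn (fun z : Phase => derivWithin (fun s => f s z) (Icc 0 T) t
      + fderivWithin ℝ (f t) S.D z (relVelocity z.2, S.E t z.1)) S.D :=
    (hf.timeDeriv.1.comp (f := fun z : Phase => (t, z)) (by fun_prop) fun _ hz => ⟨ht', hz⟩).add
      ((hf.continuousOn_fderivWithin hlam ht').clm_apply hW.continuousOn)
  refine EqOn.of_subset_closure (s := S.Ω ×ˢ univ) (t := S.D) (g := fun _ => 0) (fun z hz => ?_) hc
    continuousOn_const (prod_mono_left subset_closure) D_subset_closure hz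
  have hnhds : S.D ∈ 𝓝 z :=
    mem_of_superset ((S.isOpen_Ω.prod isOpen_univ).mem_nhds hz) (prod_mono_left subset_closure)
  have := hs.transport t ht z.1 hz.1 z.2
  rw [← hE t ht' z.1 (subset_closure hz.1)] at this
  simp only
  rw [fderivWithin_of_mem_nhds hnhds]
  exact this

theorem _root_.VlasovLinear.IsSolution.apply_R
    (hn : ∀ x ∈ frontier S.Ω, S.n x = outerNormal S.Ω x) (hs : IsSolution T S.Ω E f₀ f)
    {t : ℝ} (ht : t ∈ Ioc 0 T) {z : Phase} (hz : S.ψ z.1 = 0) : f t (S.R z) = f t z := by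
  have hx := (S.mem_frontier_iff _).2 hz
  have := hs.specular t ht z.1 hx z.2
  rw [reflect, ← hn _ hx] at this
  exact this.symm

/-- The maximum principle. Subtracting a small multiple of `(M + 1) * t + √(1 + |v|²)` makes the
difference of two solutions attain its maximum; there the transport equation is violated, at a
boundary point after a reflection that makes the momentum outgoing. -/
theorem _root_.VlasovLinear.IsSolution.le (hlam : 0 < lam) (hlam' : 0 < lam')
    (hn : ∀ x ∈ frontier S.Ω, S.n x = outerNormal S.Ω x)
    (hE : ∀ t ∈ Icc 0 T, ∀ x ∈ closure S.Ω, S.E t x = E t x)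
    (hf : MemC11Holder T S.Ω lam f) (hfs : IsSolution T S.Ω E f₀ f)
    (hg : MemC11Holder T S.Ω lam' g) (hgs : IsSolution T S.Ω E f₀ g)
    {t : ℝ} (ht : t ∈ Icc 0 T) {z : Phase} (hz : z ∈ S.D) : g t z ≤ f t z := by
  by_contra hlt
  push Not at hlt
  have hM := S.M_pos
  have hT : 0 ≤ T := ht.1.trans ht.2
  set q : ℝ := (S.M + 1) * t + lorentz z.2 with hq
  have hq0 : 0 < q := add_pos_of_nonneg_of_pos (mul_nonneg (by linarith) ht.1) (lorentz_pos _)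
  obtain ⟨ε, hε, hεq⟩ : ∃ ε, 0 < ε ∧ ε * q < g t z - f t z :=
    ⟨(g t z - f t z) / (2 * q), div_pos (by linarith) (by linarith), by
      rw [div_mul_eq_mul_div, div_lt_iff₀ (by positivity)]; nlinarith⟩
  set m : ℝ → Phase → ℝ := fun s y => g s y - f s y - ε * ((S.M + 1) * s + lorentz y.2) with hm
  have hm1 : 0 < m t z := by simp only [hm, ← hq]; linarith
  obtain ⟨B₁, hB₁⟩ := hf.bddCont.2
  obtain ⟨B₂, hB₂⟩ := hg.bddCont.2
  obtain ⟨ρ₀, hρ₀, hb⟩ := S.exists_norm_le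
  -- the maximum is attained
  set ρ := ρ₀ + ‖z‖ + |B₁ + B₂| / ε with hρ
  have hfar : ∀ s ∈ Icc 0 T, ∀ y ∈ S.D, y ∉ Metric.closedBall (0 : Phase) ρ → m s y ≤ 0 := by
    intro s hs y hy hyρ
    rw [mem_closedBall_zero_iff, not_le] at hyρ
    have h1 := abs_le.1 (hB₁ s hs y hy)
    have h2 := abs_le.1 (hB₂ s hs y hy)
    have h3 : |B₁ + B₂| / ε ≤ ‖y.2‖ := by
      by_contra hcon
      have hx := hb y.1 hy.1
      have h4 : ‖y‖ ≤ ρ := (Prod.norm_def y).trans_le (max_le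
        (by have : 0 ≤ |B₁ + B₂| / ε := by positivity
            linarith [norm_nonneg z]) (by linarith [norm_nonneg z]))
      linarith
    rw [div_le_iff₀ hε] at h3
    have h5 := norm_le_lorentz y.2
    have h6 : 0 ≤ (S.M + 1) * s := mul_nonneg (by linarith) hs.1
    have h7 := le_abs_self (B₁ + B₂)
    simp only [hm]
    nlinarith
  have hcont : ContinuousOn (fun p : ℝ × Phase => m p.1 p.2) (Icc 0 T ×ˢ S.D) := by
    refine (hg.bddCont.1.sub hf.bddCont.1).sub ?_
    have := (contDiff_lorentz (k := 0)).continuous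
    exact Continuous.continuousOn (by fun_prop)
  obtain ⟨⟨τ, y⟩, ⟨hτ, hyD, -⟩, hmax⟩ := (isCompact_Icc.prod (S.isCompact_D_inter ρ)).exists_isMaxOn
    ⟨(t, z), ht, hz, by
      rw [mem_closedBall_zero_iff]
      have : 0 ≤ |B₁ + B₂| / ε := by positivity
      linarith⟩ (hcont.mono (prod_mono_right inter_subset_left))
  have hzb : z ∈ Metric.closedBall (0 : Phase) ρ := by
    rw [mem_closedBall_zero_iff]
    have : 0 ≤ |B₁ + B₂| / ε := by positivity
    linarith
  have hmy : 0 < m τ y := hm1.trans_le (hmax (a := (t, z)) ⟨ht, hz, hzb⟩)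
  have hmax' : ∀ s ∈ Icc 0 T, ∀ w ∈ S.D, m s w ≤ m τ y := fun s hs w hw => by
    by_cases hwρ : w ∈ Metric.closedBall (0 : Phase) ρ
    · exact hmax (a := (s, w)) ⟨hs, hw, hwρ⟩
    · exact (hfar s hs w hw hwρ).trans hmy.le
  clear_value m
  have h0 : ∀ w ∈ S.D, g 0 w = f 0 w := by
    have h0T : (0 : ℝ) ∈ Icc 0 T := ⟨le_rfl, hT⟩
    exact EqOn.of_subset_closure (s := S.Ω ×ˢ univ) (fun w hw =>
      (hgs.initial w.1 hw.1 w.2).trans (hfs.initial w.1 hw.1 w.2).symm)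
      (hg.continuousOn_time h0T) (hf.continuousOn_time h0T) (prod_mono_left subset_closure)
      D_subset_closure
  have hτ0 : 0 < τ := by
    rcases hτ.1.eq_or_lt with h | h
    · subst h
      have := mul_pos hε (lorentz_pos y.2)
      simp only [hm, h0 y hyD] at hmy
      linarith
    · exact h
  have hτ' : τ ∈ Ioc 0 T := ⟨hτ0, hτ.2⟩
  -- a maximum point with outgoing momentum
  obtain ⟨w, hwD, hw, hout⟩ : ∃ w ∈ S.D, m τ w = m τ y ∧ (S.ψ w.1 = 0 → 0 ≤ S.p w) := by
    by_cases hcase : S.ψ y.1 = 0 ∧ S.p y < 0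
    · refine ⟨S.R y, R_mem_D hyD, ?_, fun _ => by rw [p_R hcase.1]; linarith [hcase.2]⟩
      simp only [hm, hgs.apply_R hn hτ' hcase.1, hfs.apply_R hn hτ' hcase.1,
        lorentz_eq_of_norm_eq (norm_R hcase.1)]
    · exact ⟨y, hyD, rfl, fun h => not_lt.1 fun h' => hcase ⟨h, h'⟩⟩
  rw [← hw] at hmax'
  set f' := fderivWithin ℝ (f τ) S.D w
  set g' := fderivWithin ℝ (g τ) S.D w
  set ft := derivWithin (fun s => f s w) (Icc 0 T) τ
  set gt := derivWithin (fun s => g s w) (Icc 0 T) τ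
  have hft := hfs.transport_D hlam hf hE hτ' hwD
  have hgt := hgs.transport_D hlam' hg hE hτ' hwD
  -- the time derivative at the maximum
  have htime : 0 ≤ gt - ft - ε * (S.M + 1) := by
    have hd : HasDerivWithinAt (fun s => m s w) (gt - ft - ε * (S.M + 1)) (Icc 0 T) τ := by
      have h1 := (hg.timeDifferentiableOn w hwD τ hτ).hasDerivWithinAt
      have h2 := (hf.timeDifferentiableOn w hwD τ hτ).hasDerivWithinAt
      have h3 := (((hasDerivAt_id τ).const_mul (S.M + 1)).add_const (lorentz w.2)).const_mul ε
      have := (h1.sub h2).sub h3.hasDerivWithinAt (s := Icc 0 T)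
      simp only [hm]
      rw [mul_one] at this
      exact this
    have h4 : IsMaxOn (fun s => m s w) (Icc 0 T) τ := fun s hs => hmax' s hs w hwD
    have h5 := h4.localize.hasFDerivWithinAt_nonpos hd.hasFDerivWithinAt (y := -τ)
      (mem_posTangentConeAt_of_segment_subset ((convex_Icc 0 T).segment_subset hτ (by
        rw [add_neg_cancel]; exact ⟨le_rfl, hT⟩)))
    simp only [ContinuousLinearMap.toSpanSingleton_apply, smul_eq_mul] at h5
    nlinarith
  -- the derivative in an inward direction close to the backward characteristic
  set l := fderiv ℝ lorentz w.2
  have hl : HasFDerivAt lorentz l w.2 :=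
    ((contDiff_lorentz (k := 1)).differentiable (by norm_num) w.2).hasFDerivAt
  have hl1 : |l (S.E τ w.1)| ≤ S.M := by
    have h1 : ‖l‖ ≤ 1 := norm_fderiv_le_of_lipschitz ℝ (C := 1) (LipschitzWith.of_dist_le_mul
      fun u v => by
        rw [NNReal.coe_one, one_mul, Real.dist_eq, dist_eq_norm, norm_sub_rev]
        exact abs_lorentz_sub_le v u)
    have h2 := l.le_opNorm (S.E τ w.1)
    have h3 := S.E_bdd τ w.1
    rw [Real.norm_eq_abs] at h2
    nlinarith [norm_nonneg (S.E τ w.1), norm_nonneg l]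
  have hspace : ∀ δ, 0 < δ → gt - ft + ε * l (S.E τ w.1) ≤
      δ * (g' (S.n w.1, 0) - f' (S.n w.1, 0)) := by
    intro δ hδ
    set d : Plane := -relVelocity w.2 - δ • S.n w.1 with hd
    obtain ⟨s, hs, hsψ⟩ := exists_inward_step (S := S) (x := w.1) (d := d) (mem_D.1 hwD)
      fun hψ => by
      have h1 := hout hψ
      rw [p] at h1
      rw [hd, inner_sub_right, inner_neg_right, real_inner_smul_right, real_inner_self_eq_norm_sq,
        S.norm_n _ hψ]
      linarith
    have hder : HasFDerivWithinAt (fun u => m τ u)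
        (g' - f' - ε • l.comp (ContinuousLinearMap.snd ℝ Plane Plane)) S.D w := by
      have h1 : HasFDerivAt (fun u : Phase => lorentz u.2)
          (l.comp (ContinuousLinearMap.snd ℝ Plane Plane)) w := hl.comp w hasFDerivAt_snd
      have h2 := (h1.const_add ((S.M + 1) * τ)).const_mul ε
      simp only [hm]
      exact ((hg.hasFDerivWithinAt hτ hwD).sub (hf.hasFDerivWithinAt hτ hwD)).sub
        h2.hasFDerivWithinAt
    have h4 : IsMaxOn (fun u => m τ u) S.D w := fun u hu => hmax' τ hτ u hu
    have h5 := h4.localize.hasFDerivWithinAt_nonpos hder (y := s • (d, -S.E τ w.1))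
      (mem_posTangentConeAt_of_segment_subset (S.convex_D.segment_subset hwD (mem_D.2 hsψ)))
    rw [map_smul, smul_eq_mul] at h5
    have h6 := nonpos_of_mul_nonpos_right h5 hs
    have e : ((d, -S.E τ w.1) : Phase) =
        -(relVelocity w.2, S.E τ w.1) - δ • (S.n w.1, (0 : Plane)) := by
      rw [hd]; simp
    have e1 : g' (d, -S.E τ w.1) = gt - δ * g' (S.n w.1, 0) := by
      rw [e, map_sub, map_neg, map_smul, smul_eq_mul]; linarith
    have e2 : f' (d, -S.E τ w.1) = ft - δ * f' (S.n w.1, 0) := by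
      rw [e, map_sub, map_neg, map_smul, smul_eq_mul]; linarith
    simp only [_root_.sub_apply, _root_.smul_apply, ContinuousLinearMap.comp_apply,
      ContinuousLinearMap.coe_snd', map_neg, smul_eq_mul, e1, e2] at h6
    linarith
  have hA := abs_nonneg (g' (S.n w.1, 0) - f' (S.n w.1, 0))
  set A := g' (S.n w.1, 0) - f' (S.n w.1, 0)
  have h1 := hspace (ε / (2 * (|A| + 1))) (by positivity)
  have h2 : ε / (2 * (|A| + 1)) * A < ε := by
    rw [div_mul_eq_mul_div, div_lt_iff₀ (by positivity)]
    nlinarith [le_abs_self A]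
  nlinarith [abs_le.1 hl1]

end Solution

end BilliardSystem

/-! ### Conservation of mass -/

theorem integral_fderiv_apply_eq_zero {u : Plane → ℝ} {u' : Plane → Plane →L[ℝ] ℝ}
    (hu : ∀ x, HasFDerivAt u (u' x) x) (hc : Continuous u') (hs : HasCompactSupport u) (e : Plane) :
    ∫ x, u' x e = 0 := by
  obtain rfl : u' = fderiv ℝ u := funext fun x => (hu x).fderiv.symm
  have hd : Differentiable ℝ u := fun x => (hu x).differentiableAt
  have hs' : HasCompactSupport fun x => fderiv ℝ u x e :=
    hs.fderiv_apply ℝ (v := e)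
  have hi : Integrable fun x => fderiv ℝ u x e :=
    (hc.clm_apply continuous_const).integrable_of_hasCompactSupport hs'
  have := integral_mul_fderiv_eq_neg_fderiv_mul_of_integrable (μ := (volume : Measure Plane))
    (f := fun _ => (1 : ℝ)) (g := u) (v := e) (by simp) (by simpa using hi)
    (by simpa using hd.continuous.integrable_of_hasCompactSupport hs)
    (fun x _ => differentiableAt_const _) (fun x _ => hd x)
  simpa using this

/-- The field `(a v, b x)` is divergence free. -/
theorem integral_transport_eq_zero {G : Phase → ℝ} {G' : Phase → Phase →L[ℝ] ℝ}
    (hG : ∀ z, HasFDerivAt G (G' z) z) (hc : Continuous G') (hs : HasCompactSupport G)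
    {a b : Plane → Plane} (ha : Continuous a) (hb : Continuous b) :
    ∫ z : Phase, G' z (a z.2, b z.1) = 0 := by
  have hs' : HasCompactSupport G' := by
    obtain rfl : G' = fderiv ℝ G := funext fun z => (hG z).fderiv.symm
    exact hs.fderiv ℝ
  have hint : ∀ e : Phase → Phase, Continuous e → Integrable fun z => G' z (e z) := fun e he =>
    (hc.clm_apply he).integrable_of_hasCompactSupport (hs'.mono fun z hz h0 => hz (by simp [h0]))
  have h1 := hint (fun z => (a z.2, 0)) (by fun_prop)
  have h2 := hint (fun z => (0, b z.1)) (by fun_prop)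
  have e : ∀ z : Phase, G' z (a z.2, b z.1) = G' z (a z.2, 0) + G' z (0, b z.1) := fun z => by
    rw [← map_add]; simp
  simp_rw [e]
  rw [integral_add h1 h2, Measure.volume_eq_prod, integral_prod_symm _ h1, integral_prod _ h2]
  have z1 : ∀ v, ∫ x, G' (x, v) (a v, 0) = 0 := fun v => by
    refine integral_fderiv_apply_eq_zero (u := fun x => G (x, v))
      (u' := fun x => (G' (x, v)).comp (ContinuousLinearMap.inl ℝ Plane Plane))
      (fun x => (hG (x, v)).comp x (hasFDerivAt_prodMk_left x v)) (by fun_prop)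
      (HasCompactSupport.intro (hs.isCompact.image continuous_fst) fun x hx => ?_) (a v)
    by_contra hne
    exact hx ⟨(x, v), subset_tsupport G hne, rfl⟩
  have z2 : ∀ x, ∫ v, G' (x, v) (0, b x) = 0 := fun x => by
    refine integral_fderiv_apply_eq_zero (u := fun v => G (x, v))
      (u' := fun v => (G' (x, v)).comp (ContinuousLinearMap.inr ℝ Plane Plane))
      (fun v => (hG (x, v)).comp v (hasFDerivAt_prodMk_right x v)) (by fun_prop)
      (HasCompactSupport.intro (hs.isCompact.image continuous_snd) fun v hv => ?_) (b x)
    by_contra hne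
    exact hv ⟨(x, v), subset_tsupport G hne, rfl⟩
  simp [z1, z2]

namespace BilliardSystem

variable {S : BilliardSystem} {K κ P C T : ℝ}

theorem continuous_of_continuousOn_D {H : Type*} [TopologicalSpace H] [Zero H] {h : Phase → H}
    {ε : ℝ} (hε : 0 < ε) (hc : ContinuousOn h S.D) (h0 : ∀ z : Phase, -ε < S.ψ z.1 → h z = 0) :
    Continuous h := by
  have hψ : Continuous fun z : Phase => S.ψ z.1 := S.continuous_ψ.comp continuous_fst
  refine continuous_iff_continuousAt.2 fun z => ?_
  rcases lt_or_ge (S.ψ z.1) 0 with hz | hz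
  · exact hc.continuousAt (mem_of_superset ((isOpen_lt hψ continuous_const).mem_nhds hz)
      fun y hy => mem_D.2 (le_of_lt hy))
  · have : h =ᶠ[𝓝 z] fun _ => 0 := by
      filter_upwards [(isOpen_lt continuous_const hψ).mem_nhds (show -ε < S.ψ z.1 by linarith)]
        with y hy using h0 y hy
    exact continuousAt_const.congr this.symm

theorem exists_phase_bound (S : BilliardSystem) (P : ℝ) :
    ∃ ρ, ∀ z ∈ S.D, z ∉ Metric.closedBall (0 : Phase) ρ → P < ‖z.2‖ := by
  obtain ⟨ρ₀, hρ₀, hb⟩ := S.exists_norm_le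
  refine ⟨max ρ₀ P, fun z hz hzρ => ?_⟩
  by_contra hcon
  refine hzρ (mem_closedBall_zero_iff.2 ((Prod.norm_def z).trans_le (max_le ?_ ?_)))
  · exact (hb z.1 hz.1).trans (le_max_left _ _)
  · exact (not_lt.1 hcon).trans (le_max_right _ _)

theorem hasCompactSupport_of_vanish {H : Type*} [Zero H] {h : Phase → H}
    (h0 : ∀ z, z ∉ S.D → h z = 0) (h1 : ∀ z ∈ S.D, P < ‖z.2‖ → h z = 0) : HasCompactSupport h := by
  obtain ⟨ρ, hρ⟩ := S.exists_phase_bound P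
  refine HasCompactSupport.intro (S.isCompact_D_inter ρ) fun z hz => ?_
  by_cases hzD : z ∈ S.D
  · exact h1 z hzD (hρ z hzD fun h => hz ⟨hzD, h⟩)
  · exact h0 z hzD

/-- The boundary flux of a reflecting density vanishes, so the flux through the level sets of
`ψ` is of the order of `ψ`. -/
theorem exists_flux_le (S : BilliardSystem) (K κ P C : ℝ) :
    ∃ A, 0 ≤ A ∧ ∀ G G', S.IsAdmissible K κ P C G G' → ∀ x ∈ closure S.Ω,
      |∫ v, G (x, v) * S.p (x, v)| ≤ A * |S.ψ x| := by
  obtain ⟨N, hN0, hN, hNl⟩ := isBddLip_of_contDiff (S.n_contDiff.of_le (by norm_num))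
    S.isCompact_closure S.convex.closure
  obtain ⟨L, hL0, hL⟩ := S.exists_dist_le
  set V := (volume : Measure Plane).real (Metric.closedBall 0 P) with hV
  have hV0 : 0 ≤ V := measureReal_nonneg
  refine ⟨2 * |C| * N * V * L, by positivity, fun G G' hG x hx => ?_⟩
  obtain ⟨y, hy, hxy⟩ := hL x hx
  have hyc : y ∈ closure S.Ω := (S.mem_closure_iff y).2 hy.le
  have hrestr : ∀ x ∈ closure S.Ω, ∫ v, G (x, v) * S.p (x, v) =
      ∫ v in Metric.closedBall 0 P, G (x, v) * S.p (x, v) := fun x hx =>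
    (setIntegral_eq_integral_of_forall_compl_eq_zero fun v hv => by
      rw [mem_closedBall_zero_iff, not_le] at hv
      rw [(hG.vanish (x, v) ⟨hx, mem_univ _⟩ (Or.inr hv)).1, zero_mul]).symm
  have hint : ∀ x ∈ closure S.Ω,
      IntegrableOn (fun v => G (x, v) * S.p (x, v)) (Metric.closedBall 0 P) := fun x hx => by
    refine ContinuousOn.integrableOn_compact (isCompact_closedBall _ _) (Continuous.continuousOn ?_)
    have h1 : Continuous fun v => G (x, v) := by
      refine continuousOn_univ.1 (ContinuousOn.comp (t := S.D) (g := G) (fun z hz =>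
        (hG.taylor.hasFDerivWithinAt S.lam_pos hz).continuousWithinAt) (by fun_prop)
        fun v _ => ⟨hx, mem_univ _⟩)
    exact h1.mul (S.contDiff_p.continuous.comp (by fun_prop))
  -- the flux through the boundary is odd under the reflection of the momenta
  have hzero : ∫ v, G (y, v) * S.p (y, v) = 0 := by
    have hR : ∀ v, (ℝ ∙ S.n y)ᗮ.reflection v = (S.R (y, v)).2 := fun v => by
      rw [Submodule.reflection_orthogonal_apply, Submodule.reflection_singleton_apply, R]
      simp only [S.norm_n y hy]
      norm_num
      module
    have h1 := ((ℝ ∙ S.n y)ᗮ.reflection.measurePreserving).integral_comp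
      (ℝ ∙ S.n y)ᗮ.reflection.toHomeomorph.measurableEmbedding (fun v => G (y, v) * S.p (y, v))
    have h2 : ∀ v, G (y, (S.R (y, v)).2) * S.p (y, (S.R (y, v)).2) =
        -(G (y, v) * S.p (y, v)) := fun v => by
      have e1 : G (y, (S.R (y, v)).2) = G (y, v) := hG.reflecting.apply_R (z := (y, v)) hy
      have e2 : S.p (y, (S.R (y, v)).2) = -S.p (y, v) := p_R (z := (y, v)) hy
      rw [e1, e2]; ring
    simp_rw [hR, h2, integral_neg] at h1
    linarith
  have hdiff : ∀ v, ‖G (x, v) * S.p (x, v) - G (y, v) * S.p (y, v)‖ ≤ 2 * |C| * N * ‖x - y‖ := by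
    intro v
    have hxv : (x, v) ∈ S.D := ⟨hx, mem_univ _⟩
    have hyv : (y, v) ∈ S.D := ⟨hyc, mem_univ _⟩
    have h1 := hG.taylor.lipschitz S.lam_pos S.convex_D hyv hxv
    have h2 : ‖((x, v) : Phase) - (y, v)‖ = ‖x - y‖ := by simp [Prod.norm_def]
    rw [h2, Real.norm_eq_abs] at h1
    have h3 := hG.bound _ hyv
    have hC := hG.taylor.nonneg
    have hr := norm_relVelocity_le v
    have h4 : |S.p (x, v)| ≤ N := by
      rw [p]
      refine (abs_real_inner_le_norm _ _).trans ?_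
      have := hN x hx
      exact (mul_le_mul this hr (norm_nonneg _) hN0).trans_eq (mul_one N)
    have h5 : |S.p (x, v) - S.p (y, v)| ≤ N * ‖x - y‖ := by
      rw [p, p, ← inner_sub_left]
      refine (abs_real_inner_le_norm _ _).trans ?_
      exact (mul_le_mul (hNl y hyc x hx) hr (norm_nonneg _) (by positivity)).trans_eq (mul_one _)
    have e : G (x, v) * S.p (x, v) - G (y, v) * S.p (y, v) =
        (G (x, v) - G (y, v)) * S.p (x, v) + G (y, v) * (S.p (x, v) - S.p (y, v)) := by ring
    rw [e, Real.norm_eq_abs, abs_of_nonneg hC]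
    refine (abs_add_le _ _).trans ?_
    rw [abs_mul, abs_mul]
    have h6 := mul_le_mul h1 h4 (abs_nonneg _) (by positivity)
    have h7 := mul_le_mul h3 h5 (abs_nonneg _) hC
    linarith
  have h8 : ∫ v, G (x, v) * S.p (x, v) = ∫ v in Metric.closedBall 0 P,
      (G (x, v) * S.p (x, v) - G (y, v) * S.p (y, v)) := by
    rw [integral_sub (hint x hx) (hint y hyc), ← hrestr x hx, ← hrestr y hyc, hzero, sub_zero]
  rw [h8]
  have h9 := norm_setIntegral_le_of_norm_le_const
    (measure_closedBall_lt_top (μ := (volume : Measure Plane)) (x := 0) (r := P))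
    (fun v _ => hdiff v)
  rw [Real.norm_eq_abs] at h9
  calc _ ≤ 2 * |C| * N * ‖x - y‖ * V := h9
    _ ≤ 2 * |C| * N * (L * |S.ψ x|) * V := by gcongr
    _ = _ := by ring

/-- The mass away from the boundary changes by the flux through the support of the derivative of
the cutoff. -/
theorem IsEvolution.hasDerivAt_integral_mul {F : ℝ → Phase → ℝ} {F' : ℝ → Phase → Phase →L[ℝ] ℝ}
    (hF : S.IsEvolution K κ P C 0 T F F') {c : Plane → ℝ} (hc : ContDiff ℝ 1 c) {ε : ℝ}
    (hε : 0 < ε) (hc0 : ∀ x, -ε < S.ψ x → c x = 0) {t : ℝ} (ht : t ∈ Ioo 0 T) :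
    HasDerivAt (fun t => ∫ z : Phase, c z.1 * F t z)
      (-∫ z : Phase, F t z * fderiv ℝ c z.1 (relVelocity z.2)) t := by
  obtain ⟨r, d, hFat⟩ := S.exists_isFat_D
  have hT : 0 ≤ T := ht.1.le.trans ht.2.le
  have hIcc : ∀ {s}, s ∈ Ioo 0 T → s ∈ Icc 0 T := fun hs => Ioo_subset_Icc_self hs
  have hcD : ∀ z : Phase, z ∉ S.D → -ε < S.ψ z.1 := fun z hz => by
    rw [mem_D, not_le] at hz; linarith
  have hc'0 : ∀ x, -ε < S.ψ x → fderiv ℝ c x = 0 := fun x hx => by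
    have : c =ᶠ[𝓝 x] fun _ => 0 := by
      filter_upwards [(isOpen_lt continuous_const S.continuous_ψ).mem_nhds hx] with y hy
        using hc0 y hy
    rw [this.fderiv_eq, fderiv_const_apply]
  have hc'c : Continuous (fderiv ℝ c) := hc.continuous_fderiv one_ne_zero
  have hcont : ∀ s ∈ Icc 0 T, ContinuousOn (F s) S.D := fun s hs z hz =>
    ((hF.admissible s hs).taylor.hasFDerivWithinAt S.lam_pos hz).continuousWithinAt
  have hcont' : ∀ s ∈ Icc 0 T, ContinuousOn (F' s) S.D := fun s hs => by
    have := continuousOn_prod_of_holder (A := (univ : Set Unit)) (g := fun _ => F' s) (S := S.D)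
      S.lam_pos (fun _ _ x hx y hy =>
        (hF.admissible s hs).taylor.holder S.lam_pos S.lam_lt_one hFat hx hy)
      (fun _ _ => continuousOn_const)
    exact this.comp (f := fun z : Phase => ((), z)) (by fun_prop) fun z hz => ⟨mem_univ _, hz⟩
  set g : ℝ → Phase → ℝ := fun s z => c z.1 * F s z with hg
  set g' : ℝ → Phase → Phase →L[ℝ] ℝ := fun s z => c z.1 • F' s z +
    F s z • (fderiv ℝ c z.1).comp (ContinuousLinearMap.fst ℝ Plane Plane) with hg'
  have hgc : ∀ s ∈ Icc 0 T, Continuous (g s) := fun s hs =>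
    continuous_of_continuousOn_D (S := S) hε ((hc.continuous.comp continuous_fst).continuousOn.mul
      (hcont s hs)) fun z hz => by simp [hg, hc0 _ hz]
  have hgs : ∀ s ∈ Icc 0 T, HasCompactSupport (g s) := fun s hs =>
    hasCompactSupport_of_vanish (S := S) (P := P) (fun z hz => by simp [hg, hc0 _ (hcD z hz)])
      fun z hz hP => by simp [hg, ((hF.admissible s hs).vanish z hz (Or.inr hP)).1]
  have hA := hIcc ht
  -- the spatial derivative of the truncated density
  have hgd : ∀ z, HasFDerivAt (g t) (g' t z) z := fun z => by
    have hψ : Continuous fun z : Phase => S.ψ z.1 := S.continuous_ψ.comp continuous_fst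
    rcases lt_or_ge (S.ψ z.1) 0 with hz | hz
    · have h1 := ((hF.admissible t hA).taylor.hasFDerivWithinAt S.lam_pos
        (mem_D.2 hz.le)).hasFDerivAt (mem_of_superset
          ((isOpen_lt hψ continuous_const).mem_nhds hz) fun y hy => mem_D.2 (le_of_lt hy))
      have h2 : HasFDerivAt (fun z : Phase => c z.1)
          ((fderiv ℝ c z.1).comp (ContinuousLinearMap.fst ℝ Plane Plane)) z :=
        ((hc.differentiable one_ne_zero z.1).hasFDerivAt).comp z hasFDerivAt_fst
      exact h2.mul h1
    · have hz' : -ε < S.ψ z.1 := by linarith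
      have h1 : g t =ᶠ[𝓝 z] fun _ => 0 := by
        filter_upwards [(isOpen_lt continuous_const hψ).mem_nhds hz'] with y hy
        simp [hg, hc0 _ hy]
      have h2 : g' t z = 0 := by simp [hg', hc0 _ hz', hc'0 _ hz']
      rw [h2]
      exact (hasFDerivAt_const (0 : ℝ) z).congr_of_eventuallyEq h1
  have hflux : Continuous fun z : Phase => F t z • (fderiv ℝ c z.1).comp
      (ContinuousLinearMap.fst ℝ Plane Plane) := by
    refine continuous_of_continuousOn_D (S := S) hε ((hcont t hA).smul (Continuous.continuousOn ?_))
      fun z hz => by simp [hc'0 _ hz]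
    fun_prop
  have hvol : Continuous fun z : Phase => c z.1 • F' t z :=
    continuous_of_continuousOn_D (S := S) hε ((hc.continuous.comp continuous_fst).continuousOn.smul
      (hcont' t hA)) fun z hz => by simp [hc0 _ hz]
  have hWc : Continuous (S.W t) := S.continuous_W.comp (f := fun z : Phase => (t, z)) (by fun_prop)
  have hi1 : Integrable fun z : Phase => c z.1 * F' t z (S.W t z) := by
    refine (hvol.clm_apply hWc).integrable_of_hasCompactSupport (hasCompactSupport_of_vanish
      (S := S) (P := P) (fun z hz => ?_) fun z hz hP => ?_)
    · simp [hc0 _ (hcD z hz)]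
    · simp [((hF.admissible t hA).vanish z hz (Or.inr hP)).2]
  have hi2 : Integrable fun z : Phase => F t z * fderiv ℝ c z.1 (relVelocity z.2) := by
    refine (hflux.clm_apply hWc).integrable_of_hasCompactSupport (hasCompactSupport_of_vanish
      (S := S) (P := P) (fun z hz => ?_) fun z hz hP => ?_)
    · simp [hc'0 _ (hcD z hz)]
    · simp [((hF.admissible t hA).vanish z hz (Or.inr hP)).1]
  have hdiv : ∫ z : Phase, c z.1 * F' t z (S.W t z) =
      -∫ z : Phase, F t z * fderiv ℝ c z.1 (relVelocity z.2) := by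
    have h1 := integral_transport_eq_zero hgd (hvol.add hflux) (hgs t hA)
      (contDiff_relVelocity (k := 0)).continuous
      (S.E_cont.comp (f := fun x : Plane => (t, x)) (by fun_prop))
    have h2 : ∀ z : Phase, g' t z (relVelocity z.2, S.E t z.1) =
        c z.1 * F' t z (S.W t z) + F t z * fderiv ℝ c z.1 (relVelocity z.2) := fun z => rfl
    simp only [Function.comp_def] at h1
    simp_rw [h2] at h1
    rw [integral_add hi1 hi2] at h1
    linarith
  rw [← hdiv]
  -- a common integrable bound for the time derivatives
  obtain ⟨ρ, hρ⟩ := S.exists_phase_bound P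
  obtain ⟨B, hB⟩ := S.isCompact_closure.exists_bound_of_continuousOn hc.continuous.continuousOn
  have hC := (hF.admissible t hA).taylor.nonneg
  refine (hasDerivAt_integral_of_dominated_loc_of_deriv_le (Ioo_mem_nhds ht.1 ht.2)
    (F := g) (F' := fun s z => c z.1 * F' s z (S.W s z))
    (bound := (S.D ∩ Metric.closedBall 0 ρ).indicator fun _ => |B| * (C * S.M)) ?_ ?_ ?_ ?_ ?_ ?_).2
  · filter_upwards [Ioo_mem_nhds ht.1 ht.2] with s hs
    exact (hgc s (hIcc hs)).aestronglyMeasurable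
  · exact (hgc t hA).integrable_of_hasCompactSupport (hgs t hA)
  · exact hi1.aestronglyMeasurable
  · refine Eventually.of_forall fun z s hs => ?_
    by_cases hzD : z ∈ S.D
    · by_cases hzρ : z ∈ Metric.closedBall (0 : Phase) ρ
      · rw [indicator_of_mem (mem_inter hzD hzρ), norm_mul]
        refine mul_le_mul ((hB _ hzD.1).trans (le_abs_self _)) ?_ (norm_nonneg _) (abs_nonneg _)
        exact (ContinuousLinearMap.le_opNorm _ _).trans (mul_le_mul
          ((hF.admissible s (hIcc hs)).taylor.bound _ hzD) (S.norm_W_le _ _) (norm_nonneg _) hC)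
      · rw [((hF.admissible s (hIcc hs)).vanish z hzD (Or.inr (hρ z hzD hzρ))).2,
          indicator_of_notMem fun h => hzρ h.2]
        simp
    · rw [hc0 _ (hcD z hzD), indicator_of_notMem fun h => hzD h.1]
      simp
  · have hK := S.isCompact_D_inter ρ
    exact (integrable_indicator_iff hK.measurableSet).2 (integrableOn_const hK.measure_lt_top.ne)
  · refine Eventually.of_forall fun z s hs => ?_
    by_cases hzD : z ∈ S.D
    · exact ((hF.hasDerivWithinAt_Icc hT hzD (hIcc hs)).hasDerivAt
        (Icc_mem_nhds hs.1 hs.2)).const_mul (c z.1)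
    · simp only [hg, hc0 _ (hcD z hzD), zero_mul]
      exact hasDerivAt_const _ _

end BilliardSystem

namespace BilliardSystem

variable {S : BilliardSystem} {K κ P C T : ℝ}

/-- The points of the domain at distance of order `ε` from the boundary. -/
def strip (S : BilliardSystem) (ε : ℝ) : Set Plane := {x | -(2 * ε) ≤ S.ψ x ∧ S.ψ x ≤ -ε}

theorem isClosed_strip (S : BilliardSystem) (ε : ℝ) : IsClosed (S.strip ε) :=
  (isClosed_le continuous_const S.continuous_ψ).inter (isClosed_le S.continuous_ψ continuous_const)

theorem strip_subset {ε : ℝ} (hε : 0 < ε) : S.strip ε ⊆ closure S.Ω := fun x hx =>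
  (S.mem_closure_iff x).2 (by linarith [hx.2])

/-- Cutoffs near the boundary, whose gradients are normal to the level sets of `ψ` and of order
`1 / ε`. -/
theorem exists_cutoff (S : BilliardSystem) : ∃ A, 0 ≤ A ∧ ∀ ε, 0 < ε → ∃ c a : Plane → ℝ,
    ContDiff ℝ 1 c ∧ (∀ x, 0 ≤ c x ∧ c x ≤ 1) ∧ (∀ x, -ε < S.ψ x → c x = 0) ∧
    (∀ x, S.ψ x ≤ -(2 * ε) → c x = 1) ∧ (∀ x, fderiv ℝ c x = a x • innerSL ℝ (S.n x)) ∧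
    ∀ x, |a x| * |S.ψ x| ≤ (S.strip ε).indicator (fun _ => A) x := by
  have hs : ContDiff ℝ 1 Real.smoothTransition := Real.smoothTransition.contDiff
  obtain ⟨B, hB⟩ := isCompact_Icc (a := (0 : ℝ)) (b := 1) |>.exists_bound_of_continuousOn
    (hs.continuous_deriv le_rfl).continuousOn
  refine ⟨2 * |B|, by positivity, fun ε hε => ⟨fun x => Real.smoothTransition (-(S.ψ x / ε) - 1),
    fun x => deriv Real.smoothTransition (-(S.ψ x / ε) - 1) * -(1 / ε), ?_,
    fun x => ⟨Real.smoothTransition.nonneg _, Real.smoothTransition.le_one _⟩, fun x hx => ?_,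
    fun x hx => ?_, fun x => ?_, fun x => ?_⟩⟩
  · exact hs.comp (((S.contDiff_ψ.of_le (by norm_num)).div_const ε).neg.sub contDiff_const)
  · refine Real.smoothTransition.zero_of_nonpos ?_
    have : -1 < S.ψ x / ε := by rw [lt_div_iff₀ hε]; linarith
    linarith
  · refine Real.smoothTransition.one_of_one_le ?_
    have : S.ψ x / ε ≤ -2 := by rw [div_le_iff₀ hε]; linarith
    linarith
  · have h1 : HasFDerivAt (fun x => -(S.ψ x / ε) - 1) (-((1 / ε) • innerSL ℝ (S.n x))) x := by
      have := (((S.hasFDerivAt_ψ x).const_mul (1 / ε)).neg).sub_const 1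
      simp only [one_div, inv_mul_eq_div] at this ⊢
      exact this
    have h2 : HasFDerivAt (fun x => Real.smoothTransition (-(S.ψ x / ε) - 1)) _ x :=
      ((hs.differentiable one_ne_zero _).hasDerivAt).comp_hasFDerivAt x h1
    rw [h2.fderiv]
    module
  · by_cases hx : x ∈ S.strip ε
    · rw [indicator_of_mem hx]
      have h1 : -(S.ψ x / ε) - 1 ∈ Icc (0 : ℝ) 1 := by
        have h2 : S.ψ x / ε ≤ -1 := by rw [div_le_iff₀ hε]; linarith [hx.2]
        have h3 : -2 ≤ S.ψ x / ε := by rw [le_div_iff₀ hε]; linarith [hx.1]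
        constructor <;> linarith
      have h4 := (hB _ h1).trans (le_abs_self B)
      rw [Real.norm_eq_abs] at h4
      have h5 : |S.ψ x| ≤ 2 * ε := abs_le.2 ⟨hx.1, by linarith [hx.2]⟩
      rw [abs_mul, abs_neg, abs_of_pos (one_div_pos.2 hε)]
      calc _ ≤ |B| * (1 / ε) * (2 * ε) := by gcongr
        _ = 2 * |B| := by field_simp
    · rw [indicator_of_notMem hx]
      suffices H : deriv Real.smoothTransition (-(S.ψ x / ε) - 1) = 0 by simp [H]
      rcases lt_or_ge (-ε) (S.ψ x) with h | h
      · have h1 : -(S.ψ x / ε) - 1 < 0 := by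
          have : -1 < S.ψ x / ε := by rw [lt_div_iff₀ hε]; linarith
          linarith
        have : Real.smoothTransition =ᶠ[𝓝 (-(S.ψ x / ε) - 1)] fun _ => 0 := by
          filter_upwards [gt_mem_nhds h1] with y hy
            using Real.smoothTransition.zero_of_nonpos (le_of_lt hy)
        rw [this.deriv_eq, deriv_const]
      · have h1 : 1 < -(S.ψ x / ε) - 1 := by
          have h2 : S.ψ x < -(2 * ε) := not_le.1 fun h' => hx ⟨h', h⟩
          have : S.ψ x / ε < -2 := by rw [div_lt_iff₀ hε]; linarith
          linarith
        have : Real.smoothTransition =ᶠ[𝓝 (-(S.ψ x / ε) - 1)] fun _ => 1 := by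
          filter_upwards [lt_mem_nhds h1] with y hy
            using Real.smoothTransition.one_of_one_le (le_of_lt hy)
        rw [this.deriv_eq, deriv_const]

/-- One integrable bound for all functions that are admissible with the same constants. -/
theorem exists_integrable_bound (S : BilliardSystem) (K κ P C : ℝ) : ∃ b : Phase → ℝ,
    Integrable b ∧ (∀ z, 0 ≤ b z) ∧
    ∀ G G', S.IsAdmissible K κ P C G G' → ∀ z ∈ S.D, |G z| ≤ b z := by
  obtain ⟨ρ, hρ⟩ := S.exists_phase_bound P
  have hK := S.isCompact_D_inter ρ
  refine ⟨(S.D ∩ Metric.closedBall 0 ρ).indicator fun _ => |C|,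
    (integrable_indicator_iff hK.measurableSet).2 (integrableOn_const hK.measure_lt_top.ne),
    fun z => indicator_nonneg (fun _ _ => abs_nonneg C) z, fun G G' hG z hz => ?_⟩
  by_cases hzρ : z ∈ Metric.closedBall (0 : Phase) ρ
  · rw [indicator_of_mem (mem_inter hz hzρ)]
    exact (hG.bound z hz).trans (le_abs_self C)
  · rw [(hG.vanish z hz (Or.inr (hρ z hz hzρ))).1, indicator_of_notMem fun h => hzρ h.2, abs_zero]

section Evolution

variable {F : ℝ → Phase → ℝ} {F' : ℝ → Phase → Phase →L[ℝ] ℝ}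

theorem IsAdmissible.continuousOn {G : Phase → ℝ} {G' : Phase → Phase →L[ℝ] ℝ}
    (hG : S.IsAdmissible K κ P C G G') : ContinuousOn G S.D := fun _ hz =>
  (hG.taylor.hasFDerivWithinAt S.lam_pos hz).continuousWithinAt

theorem IsAdmissible.continuous_mul {G : Phase → ℝ} {G' : Phase → Phase →L[ℝ] ℝ}
    (hG : S.IsAdmissible K κ P C G G') {c : Plane → ℝ} (hc : Continuous c) {ε : ℝ} (hε : 0 < ε)
    (hc0 : ∀ x, -ε < S.ψ x → c x = 0) : Continuous fun z : Phase => c z.1 * G z :=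
  continuous_of_continuousOn_D (S := S) hε
    ((hc.comp continuous_fst).continuousOn.mul hG.continuousOn) fun z hz => by simp [hc0 _ hz]

theorem norm_cutoff_mul_le {c : Plane → ℝ} (hc1 : ∀ x, 0 ≤ c x ∧ c x ≤ 1) {ε : ℝ} (hε : 0 < ε)
    (hc0 : ∀ x, -ε < S.ψ x → c x = 0) {G b : Phase → ℝ} (hb : ∀ z, 0 ≤ b z)
    (h : ∀ z ∈ S.D, |G z| ≤ b z) (z : Phase) : ‖c z.1 * G z‖ ≤ b z := by
  by_cases hz : z ∈ S.D
  · rw [norm_mul, Real.norm_of_nonneg (hc1 _).1]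
    exact (mul_le_of_le_one_left (norm_nonneg _) (hc1 _).2).trans (h z hz)
  · rw [mem_D, not_le] at hz
    rw [hc0 _ (by linarith), zero_mul, norm_zero]
    exact hb z

/-- The flux through the strip is of the order of its area. -/
theorem IsEvolution.exists_mass_sub_le (hT : 0 < T) (hF : S.IsEvolution K κ P C 0 T F F') :
    ∃ A, 0 ≤ A ∧ ∀ ε, 0 < ε → ∃ c : Plane → ℝ, Continuous c ∧ (∀ x, 0 ≤ c x ∧ c x ≤ 1) ∧
      (∀ x, -ε < S.ψ x → c x = 0) ∧ (∀ x, S.ψ x ≤ -(2 * ε) → c x = 1) ∧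
      ∀ t ∈ Icc 0 T, |(∫ z : Phase, c z.1 * F t z) - ∫ z : Phase, c z.1 * F 0 z| ≤
        T * ∫ x, (S.strip ε).indicator (fun _ => A) x := by
  obtain ⟨A, hA0, hA⟩ := S.exists_cutoff
  obtain ⟨Q, hQ0, hQ⟩ := S.exists_flux_le K κ P C
  obtain ⟨b, hbi, hb0, hb⟩ := S.exists_integrable_bound K κ P C
  refine ⟨Q * A, by positivity, fun ε hε => ?_⟩
  obtain ⟨c, a, hc, hc1, hc0, hc2, hca, ha⟩ := hA ε hε
  refine ⟨c, hc.continuous, hc1, hc0, hc2, fun t ht => ?_⟩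
  have hKs : IsCompact (S.strip ε) :=
    S.isCompact_closure.of_isClosed_subset (S.isClosed_strip ε) (strip_subset hε)
  have hint : Integrable ((S.strip ε).indicator fun _ => Q * A) :=
    (integrable_indicator_iff hKs.measurableSet).2 (integrableOn_const hKs.measure_lt_top.ne)
  set I := ∫ x, (S.strip ε).indicator (fun _ => Q * A) x with hI
  have hI0 : 0 ≤ I := integral_nonneg fun x => indicator_nonneg (fun _ _ => by positivity) x
  have hflux : ∀ s ∈ Icc 0 T, |∫ z : Phase, F s z * fderiv ℝ c z.1 (relVelocity z.2)| ≤ I := by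
    intro s hs
    by_cases hi : Integrable fun z : Phase => F s z * fderiv ℝ c z.1 (relVelocity z.2)
    · rw [Measure.volume_eq_prod, integral_prod _ hi, ← Real.norm_eq_abs]
      refine norm_integral_le_of_norm_le hint (Eventually.of_forall fun x => ?_)
      have e : ∫ v, F s (x, v) * fderiv ℝ c x (relVelocity v) =
          a x * ∫ v, F s (x, v) * S.p (x, v) := by
        rw [← integral_const_mul]
        congr 1
        ext v
        rw [hca, p]
        simp only [_root_.smul_apply, innerSL_apply_apply, smul_eq_mul]
        ring
      simp only
      rw [e, norm_mul, Real.norm_eq_abs, Real.norm_eq_abs]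
      have hax := ha x
      rw [indicator_const_mul]
      by_cases hx : x ∈ closure S.Ω
      · calc |a x| * |∫ v, F s (x, v) * S.p (x, v)| ≤ |a x| * (Q * |S.ψ x|) := by
              gcongr
              exact hQ _ _ (hF.admissible s hs) x hx
          _ = Q * (|a x| * |S.ψ x|) := by ring
          _ ≤ _ := by gcongr
      · have hψ : 0 < S.ψ x := by rwa [S.mem_closure_iff, not_le] at hx
        rw [indicator_of_notMem fun h => hx (strip_subset hε h)] at hax ⊢
        have : |a x| = 0 := by
          have := abs_pos.2 hψ.ne'
          nlinarith [abs_nonneg (a x)]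
        rw [this, zero_mul, mul_zero]
    · rw [integral_undef hi, abs_zero]
      exact hI0
  rcases ht.1.eq_or_lt with rfl | ht0
  · rw [sub_self, abs_zero]
    positivity
  have hcont : ContinuousOn (fun t => ∫ z : Phase, c z.1 * F t z) (Icc 0 T) := by
    refine continuousOn_of_dominated (bound := b) (fun s hs =>
      ((hF.admissible s hs).continuous_mul hc.continuous hε hc0).aestronglyMeasurable)
      (fun s hs => Eventually.of_forall (norm_cutoff_mul_le hc1 hε hc0 hb0
        (hb _ _ (hF.admissible s hs)))) hbi (Eventually.of_forall fun z => ?_)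
    by_cases hz : z ∈ S.D
    · exact continuousOn_const.mul (hF.continuousOn z hz)
    · rw [mem_D, not_le] at hz
      simp only [hc0 z.1 (by linarith), zero_mul]
      exact continuousOn_const
  obtain ⟨s, hs, hslope⟩ := exists_hasDerivAt_eq_slope (fun t => ∫ z : Phase, c z.1 * F t z)
    (fun t => -∫ z : Phase, F t z * fderiv ℝ c z.1 (relVelocity z.2)) ht0
    (hcont.mono (Icc_subset_Icc_right ht.2)) fun s hs =>
      hF.hasDerivAt_integral_mul hc hε hc0 ⟨hs.1, hs.2.trans_le ht.2⟩
  have h1 := hflux s ⟨hs.1.le, hs.2.le.trans ht.2⟩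
  rw [sub_zero, eq_div_iff ht0.ne'] at hslope
  rw [← hslope, abs_mul, abs_neg, abs_of_pos ht0, mul_comm]
  exact mul_le_mul ht.2 h1 (abs_nonneg _) hT.le

theorem IsAdmissible.integrableOn {G : Phase → ℝ} {G' : Phase → Phase →L[ℝ] ℝ}
    (hG : S.IsAdmissible K κ P C G G') : IntegrableOn G (S.Ω ×ˢ univ) := by
  obtain ⟨b, hbi, -, hb⟩ := S.exists_integrable_bound K κ P C
  have hm : MeasurableSet (S.Ω ×ˢ (univ : Set Plane)) := (S.isOpen_Ω.prod isOpen_univ).measurableSet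
  refine hbi.integrableOn.mono' ((hG.continuousOn.mono
    (prod_mono_left subset_closure)).aestronglyMeasurable hm) ?_
  filter_upwards [ae_restrict_mem hm] with z hz using hb _ _ hG z ⟨subset_closure hz.1, mem_univ _⟩

/-- Conservation of mass: the cutoffs exhaust the domain, while the flux is bounded by the area of a
shrinking strip. -/
theorem IsEvolution.integral_eq (hT : 0 < T) (hF : S.IsEvolution K κ P C 0 T F F') {t : ℝ}
    (ht : t ∈ Icc 0 T) : ∫ z in S.Ω ×ˢ univ, F t z = ∫ z in S.Ω ×ˢ univ, F 0 z := by
  obtain ⟨A, hA0, hA⟩ := hF.exists_mass_sub_le hT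
  obtain ⟨b, hbi, hb0, hb⟩ := S.exists_integrable_bound K κ P C
  have hε : ∀ k : ℕ, (0 : ℝ) < 1 / ((k : ℝ) + 1) := fun k => by positivity
  have hε0 : Tendsto (fun k : ℕ => 1 / ((k : ℝ) + 1)) atTop (𝓝 0) :=
    tendsto_one_div_add_atTop_nhds_zero_nat
  choose c hc hc1 hc0 hc2 hcm using fun k : ℕ => hA _ (hε k)
  have hm : MeasurableSet (S.Ω ×ˢ (univ : Set Plane)) := (S.isOpen_Ω.prod isOpen_univ).measurableSet
  have hsmall : ∀ x ∈ S.Ω, ∀ᶠ k : ℕ in atTop, S.ψ x < -(2 * (1 / ((k : ℝ) + 1))) := fun x hx => by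
    have h1 := (hε0.const_mul 2).neg
    rw [mul_zero, neg_zero] at h1
    exact h1.eventually (lt_mem_nhds ((S.mem_iff x).1 hx))
  -- the cutoffs exhaust the domain
  have hlim : ∀ s ∈ Icc 0 T, Tendsto (fun k => ∫ z : Phase, c k z.1 * F s z) atTop
      (𝓝 (∫ z in S.Ω ×ˢ univ, F s z)) := fun s hs => by
    rw [← integral_indicator hm]
    refine tendsto_integral_of_dominated_convergence b (fun k =>
      ((hF.admissible s hs).continuous_mul (hc k) (hε k) (hc0 k)).aestronglyMeasurable) hbi
      (fun k => Eventually.of_forall (norm_cutoff_mul_le (hc1 k) (hε k) (hc0 k) hb0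
        (hb _ _ (hF.admissible s hs)))) (Eventually.of_forall fun z => ?_)
    by_cases hz : z.1 ∈ S.Ω
    · rw [indicator_of_mem (show z ∈ S.Ω ×ˢ (univ : Set Plane) from ⟨hz, mem_univ _⟩)]
      refine tendsto_const_nhds.congr' ?_
      filter_upwards [hsmall _ hz] with k hk
      rw [hc2 k _ hk.le, one_mul]
    · rw [indicator_of_notMem fun h : z ∈ S.Ω ×ˢ (univ : Set Plane) => hz h.1]
      refine tendsto_const_nhds.congr fun k => ?_
      rw [S.mem_iff, not_lt] at hz
      rw [hc0 k _ (by linarith [hε k]), zero_mul]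
  -- the strips shrink to the empty set
  have hstrip : Tendsto (fun k : ℕ => T * ∫ x,
      (S.strip (1 / ((k : ℝ) + 1))).indicator (fun _ => A) x) atTop (𝓝 0) := by
    have hK := S.isCompact_closure
    have := tendsto_integral_of_dominated_convergence (f := fun _ : Plane => (0 : ℝ))
      (F := fun k : ℕ => (S.strip (1 / ((k : ℝ) + 1))).indicator fun _ => A) (μ := volume)
      ((closure S.Ω).indicator fun _ => A)
      (fun k => (stronglyMeasurable_const.indicator
        (S.isClosed_strip _).measurableSet).aestronglyMeasurable)
      ((integrable_indicator_iff hK.measurableSet).2 (integrableOn_const hK.measure_lt_top.ne))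
      (fun k => Eventually.of_forall fun x => by
        rw [Real.norm_of_nonneg (indicator_nonneg (fun _ _ => hA0) x)]
        exact indicator_le_indicator_of_subset (strip_subset (hε k)) (fun _ => hA0) x)
      (Eventually.of_forall fun x => by
        refine tendsto_const_nhds.congr' ?_
        by_cases hx : x ∈ S.Ω
        · filter_upwards [hsmall x hx] with k hk
          rw [indicator_of_notMem fun h : x ∈ S.strip _ => absurd h.1 (not_le.2 hk)]
        · refine Eventually.of_forall fun k => ?_
          rw [S.mem_iff, not_lt] at hx
          exact (indicator_of_notMem (fun h : x ∈ S.strip (1 / ((k : ℝ) + 1)) => by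
            linarith [h.2, hε k]) _).symm)
    simpa using this.const_mul T
  have h0 : (0 : ℝ) ∈ Icc 0 T := ⟨le_rfl, hT.le⟩
  have h1 := ((hlim t ht).sub (hlim 0 h0)).abs
  have h2 := le_of_tendsto_of_tendsto' h1 hstrip fun k => hcm k t ht
  exact sub_eq_zero.1 (abs_nonpos_iff.1 h2)

end Evolution

theorem measurePreserving_rev : MeasurePreserving rev :=
  (MeasurePreserving.id _).prod (Measure.measurePreserving_neg volume)

theorem measurableEmbedding_rev : MeasurableEmbedding rev :=
  (Homeomorph.mk ⟨rev, rev, rev_rev, rev_rev⟩ rev.continuous rev.continuous).measurableEmbedding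

theorem rev_preimage (Ω : Set Plane) : rev ⁻¹' (Ω ×ˢ univ) = Ω ×ˢ univ := by
  ext z; simp [rev_apply]

end BilliardSystem

end VlasovLinear

open VlasovLinear BilliardSystem in
theorem theorem3 (Ω : Set Plane) (hΩ : VlasovLinear.IsC5ConvexDomain Ω)
    (T : ℝ) (hT : 0 < T) (μ : ℝ) (hμ : μ ∈ Set.Ioo (0 : ℝ) 1)
    (E : ℝ → Plane → Plane) (hE : VlasovLinear.MemC01Holder T Ω μ E)
    (h : Plane → ℝ) (hpos : ∀ x ∈ frontier Ω, 0 < h x)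
    (hEn : ∀ t ∈ Set.Icc 0 T, ∀ x ∈ frontier Ω,
      inner ℝ (E t x) (VlasovLinear.outerNormal Ω x) = h x)
    (f₀ : Plane × Plane → ℝ) (hf₀ : VlasovLinear.MemC1Holder0 Ω μ f₀)
    (hf₀_nonneg : ∀ p ∈ VlasovLinear.phaseSpace Ω, 0 ≤ f₀ p)
    (hcompat : VlasovLinear.IsCompatible Ω E f₀) (hflat : VlasovLinear.IsFlat Ω f₀) :
    ∃ lam ∈ Set.Ioo 0 μ, ∃ f : ℝ → Plane × Plane → ℝ,
      (VlasovLinear.MemC11Holder T Ω lam f ∧ VlasovLinear.IsSolution T Ω E f₀ f) ∧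
      (∀ t ∈ Set.Icc 0 T, ∀ p ∈ VlasovLinear.phaseSpace Ω, 0 ≤ f t p) ∧
      (∀ t ∈ Set.Icc 0 T,
        MeasureTheory.IntegrableOn (f t) (Ω ×ˢ Set.univ) ∧
        ∫ p in Ω ×ˢ Set.univ, f t p = ∫ p in Ω ×ˢ Set.univ, f₀ p) ∧
      (∀ lam' ∈ Set.Ioo 0 μ, ∀ g : ℝ → Plane × Plane → ℝ,
        VlasovLinear.MemC11Holder T Ω lam' g → VlasovLinear.IsSolution T Ω E f₀ g →
        ∀ t ∈ Set.Icc 0 T, ∀ p ∈ VlasovLinear.phaseSpace Ω, g t p = f t p) := by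
  obtain ⟨S, rfl, hlam, hSE, hn⟩ := exists_billiardSystem hΩ hT hμ hE hpos hEn
  have h0T : (0 : ℝ) ∈ Icc 0 T := ⟨le_rfl, hT.le⟩
  obtain ⟨P₀, C₀, G', hP₀, hG⟩ := S.exists_isAdmissible hμ.1 hlam hn (hSE 0 h0T) hf₀ hf₀_nonneg
    hcompat hflat
  obtain ⟨K, c, hc, hcoer, hev⟩ := exists_evolution S hT.le hP₀
  obtain ⟨κ₀, hκ₀, hadm⟩ := hG K c hc hcoer
  obtain ⟨κ, P, C, F, F', hF, h0⟩ := hev κ₀ C₀ _ G' hκ₀ hadm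
  have hmem := hF.memC11Holder hT
  have hsol := hF.isSolution hT hn hSE (f₀ := f₀) fun z hz => (h0 z hz).1
  have hrev : ∀ s, ∫ p in S.Ω ×ˢ univ, F s (rev p) = ∫ p in S.Ω ×ˢ univ, F s p := fun s => by
    have := measurePreserving_rev.setIntegral_preimage_emb measurableEmbedding_rev (F s)
      (S.Ω ×ˢ univ)
    rwa [rev_preimage] at this
  refine ⟨S.lam, ⟨S.lam_pos, by rw [hlam]; linarith [hμ.1]⟩, fun t z => F t (rev z), ⟨hmem, hsol⟩,
    fun t ht p hp => (hF.admissible t ht).nonneg _ (rev_mem_D hp), fun t ht => ⟨?_, ?_⟩,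
    fun lam' hlam' g hg hgs t ht p hp => le_antisymm ?_ ?_⟩
  · have := (measurePreserving_rev.integrableOn_comp_preimage measurableEmbedding_rev
      (f := F t) (s := S.Ω ×ˢ univ)).2 (hF.admissible t ht).integrableOn
    rwa [rev_preimage] at this
  · rw [hrev t, hF.integral_eq hT ht, ← hrev 0]
    refine setIntegral_congr_fun (S.isOpen_Ω.prod isOpen_univ).measurableSet fun p hp => ?_
    have hpD : p ∈ S.D := ⟨subset_closure hp.1, mem_univ _⟩
    beta_reduce
    rw [(h0 _ (rev_mem_D hpD)).1, rev_rev]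
  · exact hsol.le S.lam_pos hlam'.1 hn hSE hmem hg hgs ht hp
  · exact hgs.le hlam'.1 S.lam_pos hn hSE hg hmem hsol ht hp
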